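/- **Universality of the 2D Quon language.** *Diagrams.* A 2D Quon diagram is a planar diagram of Majorana strings drawn on a background surface, read from top to bottom along a global time direction, times a complex factor. A time slice is a row of intervals (components), each crossed by an even number of strings. The diagram is a finite sequence of the following events: birth/death of a component without strings, splitting a component into two (with even numbers of strings), merging two neighbouring components, a cap or a cup of neighbouring strings, a pair of simultaneous dots on two strings of one component, a positive or negative braid of neighbouring strings, and a scattering element of angle $\theta\in\mathbb C$ of neighbouring strings, with arrow along or across time. With the Jordan–Wigner operators $\gamma_{2k-1}=Z\cdots Z X_k$, $\gamma_{2k}=iZ\cdots ZZ_kX_k$ on one qubit per pair of strings, a cap at an odd string is $|\dots\rangle\mapsto 2^{1/4}|\dots0\dots\rangle$, a cap at an even string is $|\dots a\dots\rangle\mapsto2^{-1/4}\sum_p|\dots p,p{+}a\dots\rangle$ (sum modulo 2), cups are the adjoints, a pair of dots on strings $s<t$ is $i\gamma_s\gamma_t$, the positive braid is $e^{-i\pi/8}e^{\frac{i\pi}{4}(i\gamma_s\gamma_{s+1})}$ and the negative braid is its inverse, a scattering element along time is $\frac{1+e^{i\theta}}2+\frac{1-e^{i\theta}}2\,i\gamma_s\gamma_{s+1}$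 and one across time is $\frac{1+e^{i\theta}}2\,C+\frac{1-e^{i\theta}}2\,\gamma_{s+1}C\gamma_{s+1}$, where $C$ is the cup followed by the cap. A splitting projects both resulting components onto even fermion parity; births, deaths and mergings act as the identity. Tensor legs are open boundary intervals with four strings with a basis encoder glued to them: two nested caps (or cups) for the index $0$, the same with a pair of dots on the two rightmost strings for the index $1$. A diagram with $n$ legs, labelled $0,\dots,n-1$, thus defines a tensor with $n$ qubit indices. *Efficiency.* An algorithm is a program over finite lists and trees of complex numbers whose instructions are constants, pairing and projections, the field operations, tests for zero or for the empty list, composition, branching and loops along a list; an instruction costs the size of what it writes, a number having size 1. Diagrams are written as the list of their events, a scattering element carrying $e^{i\theta}$. The tensors of a network may be given in any of three ways: by the table of all components; as a Clifford tensor $x\mapsto c\,i^{\sum_j l_jx_j}(-1)^{\sum_{j<k}q_{jk}x_jx_k}$ supported on the solutions of a system of affine equations over $\mathbb F_2$ ($l_j\in\{0,1,2,3\}$, $q_{jk}\in\{0,1\}$); or as a matchgate tensor $x\mapsto c\,\mathrm{Pf}(A_{x\oplus s})$, where $A_{x\oplus s}$ is the submatrix of an antisymmetric matrix $A$ on the legs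 where $x$ differs from a reference $s$. **Theorem.** 1. *(Generators.)* The tensors $|0\rangle$, $I$, $X$, $e^{i\pi/4}e^{-i\frac\pi4X}$, $e^{-i\pi/4}e^{i\frac\pi4X}$, $e^{i\theta/2}e^{-i\frac\theta2Z}=\mathrm{diag}(1,e^{i\theta})$ ($\theta\in\mathbb C$) and the 3-leg parity tensor $P$ are represented by the following diagrams: $\frac12$ times two nested caps; $\frac12$ times four parallel strings; $\frac12$ times four strings with dots on strings 3, 4; $\frac12e^{i\pi/8}$ times four strings with a negative braid of strings 1, 2; $\frac12e^{-i\pi/8}$ times four strings with a positive braid of strings 1, 2; $\frac12$ times four strings with a scattering element of angle $\theta$ along time on strings 2, 3; $\frac12$ times the surface in which a component with four strings entering on a leg from above is given two more strings by a cap between strings 2 and 3 and two more by a second cap inside the first, and then splits into two components with four strings each, ending at two legs below. 2. *(Generation.)* Every tensor with $n$ qubit legs is the value of a tensor network all of whose tensors are among those in 1, with $\theta\in[0,2\pi)$. 3. *(Gluing.)* (a) Bending the first leg of a diagram with all legs on the lower side around the diagram by bent four-string strips gives a diagram in which this leg has become the last one and the tensor is otherwise unchanged. (b) A leg pointing up may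 be replaced by a bent strip and a leg pointing down on either side of it, and conversely, without changing the tensor. (c) Braiding the four strings of one leg through the four strings of a neighbouring leg (merge, 16 negative braids, split) exchanges the two legs. (d) Drawing a diagram beside the components of a slice of another one gives a diagram for the product of the two tensors. (e) The contraction of two legs, facing each other or neighbouring (below or above), is twice the diagram glued along the two open intervals, directly or by a bent strip. 4. *(Universality.)* There is a polynomial-time algorithm which, given a tensor network (planar or not) with qubit legs whose tensors are each given in one of the three ways above, outputs a single 2D Quon diagram, with the open legs in order on its lower side, whose tensor is exactly the value of the network. 5. *(Converse.)* There is a polynomial-time algorithm which, given any 2D Quon diagram with legs $0,\dots,n-1$, outputs a tensor network consisting of tables of tensors with at most four legs whose value is exactly the tensor of the diagram. -/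

import Mathlib

namespace Quon

/-! ### Evaluation of Majorana strings on a background manifold

A diagram is read from top to bottom. A horizontal slice of the background manifold is a row of
intervals; the entry `e` of a `Slice` is an interval crossed by `2 * e` Majorana strings. -/

/-- The components of a time slice, from left to right, with half their numbers of strings. -/
abbrev Slice := List ℕ

/-- The state carried by a slice: an amplitude for every assignment of a bit to each pair of
neighbouring strings (the Jordan–Wigner qubits, from left to right over all components). -/
abbrev Amp := List Bool → ℂ

/-- Elementary events. `c` is the number of a component of the slice, counted from the left and
from `0`; `s`, `t` are positions of strings inside that component, counted from `0`. -/
inductive Elem where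
  /-- a new component without strings appears at place `c` -/
  | birth (c : ℕ)
  /-- the component `c`, without strings, disappears -/
  | death (c : ℕ)
  /-- the component `c` is split in two, with `2 * m` strings going to the left -/
  | split (c m : ℕ)
  /-- the components `c` and `c + 1` are merged -/
  | merge (c : ℕ)
  /-- two strings are created, at the places `s` and `s + 1` -/
  | cap (c s : ℕ)
  /-- the strings `s` and `s + 1` are joined -/
  | cup (c s : ℕ)
  /-- a pair of simultaneous dots on the strings `s < t` -/
  | dots (c s t : ℕ)
  /-- positive braid of the strings `s` and `s + 1` -/
  | braidPos (c s : ℕ)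
  /-- negative braid of the strings `s` and `s + 1` -/
  | braidNeg (c s : ℕ)
  /-- scattering element of angle `θ` with the arrow along the time direction -/
  | scatter (θ : ℂ) (c s : ℕ)
  /-- scattering element of angle `θ` with the arrow across the time direction -/
  | scatterH (θ : ℂ) (c s : ℕ)

/-- The slice below an elementary event, if the event fits the slice above it. -/
def Elem.step : Elem → Slice → Option Slice
  | .birth c, s => if c ≤ s.length then some (s.take c ++ 0 :: s.drop c) else none
  | .death c, s => if s[c]? = some 0 then some (s.eraseIdx c) else none
  | .split c m, s =>
      match s[c]? with
      | some e => if m ≤ e then some (s.take c ++ m :: (e - m) :: s.drop (c + 1)) else none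
      | none => none
  | .merge c, s =>
      match s[c]?, s[c + 1]? with
      | some e, some e' => some (s.take c ++ (e + e') :: s.drop (c + 2))
      | _, _ => none
  | .cap c i, s =>
      match s[c]? with
      | some e => if i ≤ 2 * e then some (s.set c (e + 1)) else none
      | none => none
  | .cup c i, s =>
      match s[c]? with
      | some e => if i + 1 < 2 * e then some (s.set c (e - 1)) else none
      | none => none
  | .dots c i j, s =>
      match s[c]? with
      | some e => if i < j ∧ j < 2 * e then some s else none
      | none => none
  | .braidPos c i, s | .braidNeg c i, s | .scatter _ c i, s | .scatterH _ c i, s =>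
      match s[c]? with
      | some e => if i + 1 < 2 * e then some s else none
      | none => none

/-- The bit `k` of a string of bits. -/
def bit (b : List Bool) (k : ℕ) : Bool := b.getD k false

/-- The Majorana operator of the string `g`:
`γ_{2k} = Z ⋯ Z X_k` and `γ_{2k+1} = i Z ⋯ Z Z_k X_k`, for `k = 0, 1, …`. -/
noncomputable def majorana (g : ℕ) (ψ : Amp) : Amp := fun b =>
  let k := g / 2
  (-1) ^ ((b.take k).count true)
    * (if g % 2 = 0 then 1 else Complex.I * (if bit b k then -1 else 1))
    * ψ (b.set k (!bit b k))

/-- The operator `i γ_g γ_h`. -/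
noncomputable def parity (g h : ℕ) (ψ : Amp) : Amp := fun b =>
  Complex.I * majorana g (majorana h ψ) b

/-- `2 ^ (1 / 4)`. -/
noncomputable def fourthRootTwo : ℂ := ((2 : ℝ) ^ (1 / 4 : ℝ) : ℝ)

/-- The cap creating the strings `g`, `g + 1`. For even `g` it is
`|…⟩ ↦ 2^{1/4} |… 0 …⟩`; for odd `g` it is `|… a …⟩ ↦ 2^{-1/4} ∑ₚ |… p (p + a) …⟩`. -/
noncomputable def capAt (g : ℕ) (ψ : Amp) : Amp := fun b =>
  let k := g / 2
  if g % 2 = 0 then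
    (if bit b k then 0 else fourthRootTwo * ψ (b.eraseIdx k))
  else fourthRootTwo⁻¹ * ψ (b.take k ++ (bit b k ^^ bit b (k + 1)) :: b.drop (k + 2))

/-- The cup joining the strings `g`, `g + 1`: the adjoint of the cap. -/
noncomputable def cupAt (g : ℕ) (ψ : Amp) : Amp := fun b =>
  let k := g / 2
  if g % 2 = 0 then fourthRootTwo * ψ (b.take k ++ false :: b.drop k)
  else fourthRootTwo⁻¹ *
    (ψ (b.take k ++ false :: bit b k :: b.drop (k + 1))
      + ψ (b.take k ++ true :: (!bit b k) :: b.drop (k + 1)))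

/-- The positive braid `e^{-iπ/8} / √2 · (1 + i (i γ_g γ_{g+1}))`
`= e^{-iπ/8} exp (i π / 4 · i γ_g γ_{g+1})`. -/
noncomputable def braidPosAt (g : ℕ) (ψ : Amp) : Amp := fun b =>
  Complex.exp (-(Complex.I * Real.pi / 8)) / (Real.sqrt 2 : ℝ)
    * (ψ b + Complex.I * parity g (g + 1) ψ b)

/-- The negative braid, inverse of the positive one. -/
noncomputable def braidNegAt (g : ℕ) (ψ : Amp) : Amp := fun b =>
  Complex.exp (Complex.I * Real.pi / 8) / (Real.sqrt 2 : ℝ)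
    * (ψ b - Complex.I * parity g (g + 1) ψ b)

/-- The scattering element along time,
`(1 + e^{iθ}) / 2 + (1 - e^{iθ}) / 2 · i γ_g γ_{g+1}`. -/
noncomputable def scatterAt (θ : ℂ) (g : ℕ) (ψ : Amp) : Amp := fun b =>
  (1 + Complex.exp (Complex.I * θ)) / 2 * ψ b
    + (1 - Complex.exp (Complex.I * θ)) / 2 * parity g (g + 1) ψ b

/-- The scattering element across time: `(1 + e^{iθ}) / 2` times the pair cup–cap plus
`(1 - e^{iθ}) / 2` times the pair cup–cap with a dot on either. -/
noncomputable def scatterHAt (θ : ℂ) (g : ℕ) (ψ : Amp) : Amp := fun b =>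
  (1 + Complex.exp (Complex.I * θ)) / 2 * capAt g (cupAt g ψ) b
    + (1 - Complex.exp (Complex.I * θ)) / 2
      * majorana (g + 1) (capAt g (cupAt g (majorana (g + 1) ψ))) b

/-- The projection onto even parity of the `m` pairs that start with pair `o`. -/
def projectEven (o m : ℕ) (ψ : Amp) : Amp := fun b =>
  if (((b.drop o).take m).count true) % 2 = 0 then ψ b else 0

/-- The number of pairs of strings to the left of component `c`. -/
def Slice.offset (s : Slice) (c : ℕ) : ℕ := (s.take c).sum

/-- The linear map of an elementary event, from the states of the slice `s` above it to those of
the slice below. The background manifold projects every component onto even parity; all events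
but the splitting preserve the property of being even on every component, so that the projection
has to be written there only. -/
noncomputable def Elem.act (s : Slice) : Elem → Amp → Amp
  | .birth _, ψ | .death _, ψ | .merge _, ψ => ψ
  | .split c m, ψ =>
      projectEven (s.offset c) m (projectEven (s.offset c + m) (s.getD c 0 - m) ψ)
  | .cap c i, ψ => capAt (2 * s.offset c + i) ψ
  | .cup c i, ψ => cupAt (2 * s.offset c + i) ψ
  | .dots c i j, ψ => parity (2 * s.offset c + i) (2 * s.offset c + j) ψ
  | .braidPos c i, ψ => braidPosAt (2 * s.offset c + i) ψ
  | .braidNeg c i, ψ => braidNegAt (2 * s.offset c + i) ψ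
  | .scatter θ c i, ψ => scatterAt θ (2 * s.offset c + i) ψ
  | .scatterH θ c i, ψ => scatterHAt θ (2 * s.offset c + i) ψ

/-- The amplitude of a closed sequence of events started in the state `ψ` of the slice `s`
(and `0` if the events do not fit together). -/
noncomputable def evalElems : List Elem → Slice → Amp → ℂ
  | [], _, ψ => ψ []
  | a :: l, s, ψ =>
      match a.step s with
      | some s' => evalElems l s' (a.act s ψ)
      | none => 0

/-! ### Tensor legs and Quon diagrams -/

/-- A layer of a diagram: an elementary event, or an open interval of the boundary with four
strings and the basis encoder glued to it, which is a tensor leg with a label `ℓ`. -/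
inductive Layer where
  | ev (a : Elem)
  /-- a leg pointing up: the component `c` starts at an open interval -/
  | legIn (c ℓ : ℕ)
  /-- a leg pointing down: the component `c`, with four strings, ends at an open interval -/
  | legOut (c ℓ : ℕ)

/-- The basis encoder. The bit `0` is encoded by two nested caps (cups), the bit `1` by the same
with dots on the last two strings. -/
def Layer.toElems (x : ℕ → Bool) : Layer → List Elem
  | .ev a => [a]
  | .legIn c ℓ => [.birth c, .cap c 0, .cap c 1] ++ (if x ℓ then [.dots c 2 3] else [])
  | .legOut c ℓ => (if x ℓ then [.dots c 2 3] else []) ++ [.cup c 1, .cup c 0, .death c]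

/-- The slice below a layer, if the layer fits the slice above it. -/
def Layer.step : Layer → Slice → Option Slice
  | .ev a, s => a.step s
  | .legIn c _, s => if c ≤ s.length then some (s.take c ++ 2 :: s.drop c) else none
  | .legOut c _, s => if s[c]? = some 2 then some (s.eraseIdx c) else none

/-- The slice below a sequence of layers, if they fit together. -/
def run : List Layer → Slice → Option Slice
  | [], s => some s
  | a :: l, s => (a.step s).bind (run l)

/-- The layers fit together, from the empty slice to the empty slice. -/
def Closed (L : List Layer) : Prop := run L [] = some []

/-- The labels of the legs. -/
def legs : List Layer → List ℕ
  | [] => []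
  | .ev _ :: l => legs l
  | .legIn _ ℓ :: l => ℓ :: legs l
  | .legOut _ ℓ :: l => ℓ :: legs l

/-- The amplitude of the layers when the leg with label `ℓ` has index `x ℓ`. -/
noncomputable def eval (L : List Layer) (x : ℕ → Bool) : ℂ :=
  evalElems (L.flatMap (Layer.toElems x)) [] (fun b => if b = [] then 1 else 0)

/-- A 2D Quon diagram with a scalar factor. -/
structure Diagram where
  coeff : ℂ
  layers : List Layer

/-- `D` is a well-formed diagram with the `n` legs `0, …, n - 1`. -/
def IsDiagram (D : Diagram) (n : ℕ) : Prop :=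
  Closed D.layers ∧ (legs D.layers).Perm (List.range n)

/-- An assignment of bits to `n` legs, as a function of all labels. -/
def extend {n : ℕ} (x : Fin n → Bool) (i : ℕ) : Bool := if h : i < n then x ⟨i, h⟩ else false

/-- The tensor with `n` qubit legs that a diagram represents. -/
noncomputable def Diagram.tensor (D : Diagram) (n : ℕ) (x : Fin n → Bool) : ℂ :=
  D.coeff * eval D.layers (extend x)

/-- The legs `0, …, n - 1` in this order on the lower side of the diagram. -/
def outs (n : ℕ) : List Layer := (List.range n).map fun i => Layer.legOut 0 i

/-- All legs are on the lower side of the diagram, in their order. -/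
def Diagram.HasOrderedLegs (D : Diagram) (n : ℕ) : Prop :=
  ∃ es : List Elem, D.layers = es.map Layer.ev ++ outs n

/-! ### The generating tensors and their diagrams -/

/-- The tensor `|0⟩`. -/
def ketZero (x : Fin 1 → Bool) : ℂ := if x 0 then 0 else 1

/-- The identity. -/
def idTensor (x : Fin 2 → Bool) : ℂ := if x 0 = x 1 then 1 else 0

/-- Pauli `X`. -/
def pauliX (x : Fin 2 → Bool) : ℂ := if x 0 = x 1 then 0 else 1

/-- `e^{iα} e^{-iαX} = e^{iα} (cos α - i sin α X)`. -/
noncomputable def rotX (α : ℝ) (x : Fin 2 → Bool) : ℂ :=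
  Complex.exp (Complex.I * α) *
    (if x 0 = x 1 then Complex.cos α else -(Complex.I * Complex.sin α))

/-- `e^{iθ/2} e^{-iθZ/2} = diag (1, e^{iθ})`. -/
noncomputable def rotZ (θ : ℂ) (x : Fin 2 → Bool) : ℂ :=
  if x 0 = x 1 then (if x 0 then Complex.exp (Complex.I * θ) else 1) else 0

/-- The parity tensor with three legs. -/
def parityTensor (x : Fin 3 → Bool) : ℂ := if (x 0 ^^ x 1 ^^ x 2) then 0 else 1

/-- The generating set. -/
inductive IsGenerator : (k : ℕ) → ((Fin k → Bool) → ℂ) → Prop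
  | ketZero : IsGenerator 1 ketZero
  | idTensor : IsGenerator 2 idTensor
  | pauliX : IsGenerator 2 pauliX
  | rotXPos : IsGenerator 2 (rotX (Real.pi / 4))
  | rotXNeg : IsGenerator 2 (rotX (-(Real.pi / 4)))
  | rotZ (θ : ℝ) (h₀ : 0 ≤ θ) (h₁ : θ < 2 * Real.pi) : IsGenerator 2 (rotZ θ)
  | parityTensor : IsGenerator 3 parityTensor

noncomputable def ketZeroDiagram : Diagram :=
  ⟨1 / 2, [.ev (.birth 0), .ev (.cap 0 0), .ev (.cap 0 1), .legOut 0 0]⟩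

noncomputable def idDiagram : Diagram := ⟨1 / 2, [.legIn 0 0, .legOut 0 1]⟩

noncomputable def pauliXDiagram : Diagram :=
  ⟨1 / 2, [.legIn 0 0, .ev (.dots 0 2 3), .legOut 0 1]⟩

noncomputable def rotXPosDiagram : Diagram :=
  ⟨Complex.exp (Complex.I * Real.pi / 8) / 2,
    [.legIn 0 0, .ev (.braidNeg 0 0), .legOut 0 1]⟩

noncomputable def rotXNegDiagram : Diagram :=
  ⟨Complex.exp (-(Complex.I * Real.pi / 8)) / 2,
    [.legIn 0 0, .ev (.braidPos 0 0), .legOut 0 1]⟩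

noncomputable def rotZDiagram (θ : ℂ) : Diagram :=
  ⟨1 / 2, [.legIn 0 0, .ev (.scatter θ 0 1), .legOut 0 1]⟩

noncomputable def parityTensorDiagram : Diagram :=
  ⟨1 / 2, [.legIn 0 0, .ev (.cap 0 2), .ev (.cap 0 3), .ev (.split 0 2),
    .legOut 0 1, .legOut 0 2]⟩

/-- `D` is a diagram with `k` legs for the tensor `T`. -/
def Represents (D : Diagram) (k : ℕ) (T : (Fin k → Bool) → ℂ) : Prop :=
  IsDiagram D k ∧ D.tensor k = T

/-! ### Gluing -/

/-- The event moved to the right by `d` components. -/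
def Elem.shift (d : ℕ) : Elem → Elem
  | .birth c => .birth (d + c)
  | .death c => .death (d + c)
  | .split c m => .split (d + c) m
  | .merge c => .merge (d + c)
  | .cap c i => .cap (d + c) i
  | .cup c i => .cup (d + c) i
  | .dots c i j => .dots (d + c) i j
  | .braidPos c i => .braidPos (d + c) i
  | .braidNeg c i => .braidNeg (d + c) i
  | .scatter θ c i => .scatter θ (d + c) i
  | .scatterH θ c i => .scatterH θ (d + c) i

/-- The layer moved to the right by `d` components. -/
def Layer.shift (d : ℕ) : Layer → Layer
  | .ev a => .ev (a.shift d)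
  | .legIn c ℓ => .legIn (d + c) ℓ
  | .legOut c ℓ => .legOut (d + c) ℓ

/-- A new strip of the manifold bent like a cap, with four parallel strings; it becomes the
components `c` and `c + 1`. -/
def bendTop (c : ℕ) : List Layer :=
  [.ev (.birth c), .ev (.cap c 0), .ev (.cap c 1), .ev (.cap c 2), .ev (.cap c 3),
    .ev (.split c 2)]

/-- The components `c` and `c + 1`, with four strings each, joined by a strip bent like a cup. -/
def bendBot (c : ℕ) : List Layer :=
  [.ev (.merge c), .ev (.cup c 3), .ev (.cup c 2), .ev (.cup c 1), .ev (.cup c 0),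
    .ev (.death c)]

/-- The four strings of component `c` braided through the four strings of component `c + 1`. -/
def crossing (c : ℕ) : List Layer :=
  [.ev (.merge c)]
    ++ (List.range 4).flatMap (fun i => (List.range 4).map fun j =>
        Layer.ev (.braidNeg c (3 - i + j)))
    ++ [.ev (.split c 2)]

/-- Rotating a diagram moves its first leg to the last place. -/
def LegRotation : Prop :=
  ∀ (n : ℕ) (es : List Elem),
    run (es.map Layer.ev) [] = some (List.replicate (n + 1) 2) →
    Closed (bendTop 0 ++ (es.map Layer.ev).map (Layer.shift 1) ++ bendBot 0 ++ outs (n + 1)) ∧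
    ∀ x : ℕ → Bool,
      eval (bendTop 0 ++ (es.map Layer.ev).map (Layer.shift 1) ++ bendBot 0 ++ outs (n + 1)) x
        = eval (es.map Layer.ev ++ outs (n + 1)) (fun i => if i = 0 then x n else x (i - 1))

/-- Bending a leg reverses its direction and changes nothing else: a leg pointing up can be
replaced by a leg pointing down on either side of it, and conversely. -/
def LegBending : Prop :=
  ∀ (A B : List Layer) (c ℓ : ℕ),
    (Closed (A ++ [.legIn c ℓ] ++ B) →
      Closed (A ++ bendTop c ++ [.legOut c ℓ] ++ B) ∧
      Closed (A ++ bendTop c ++ [.legOut (c + 1) ℓ] ++ B) ∧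
      ∀ x : ℕ → Bool,
        eval (A ++ bendTop c ++ [.legOut c ℓ] ++ B) x = eval (A ++ [.legIn c ℓ] ++ B) x ∧
        eval (A ++ bendTop c ++ [.legOut (c + 1) ℓ] ++ B) x = eval (A ++ [.legIn c ℓ] ++ B) x) ∧
    (Closed (A ++ [.legOut c ℓ] ++ B) →
      Closed (A ++ [.legIn c ℓ] ++ bendBot c ++ B) ∧
      Closed (A ++ [.legIn (c + 1) ℓ] ++ bendBot c ++ B) ∧
      ∀ x : ℕ → Bool,
        eval (A ++ [.legIn c ℓ] ++ bendBot c ++ B) x = eval (A ++ [.legOut c ℓ] ++ B) x ∧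
        eval (A ++ [.legIn (c + 1) ℓ] ++ bendBot c ++ B) x = eval (A ++ [.legOut c ℓ] ++ B) x)

/-- Braiding two neighbouring legs through each other exchanges them. -/
def LegCrossing : Prop :=
  ∀ (A B : List Layer) (c ℓ ℓ' : ℕ),
    Closed (A ++ [.legOut c ℓ', .legOut c ℓ] ++ B) →
    Closed (A ++ crossing c ++ [.legOut c ℓ, .legOut c ℓ'] ++ B) ∧
    ∀ x : ℕ → Bool,
      eval (A ++ crossing c ++ [.legOut c ℓ, .legOut c ℓ'] ++ B) x
        = eval (A ++ [.legOut c ℓ', .legOut c ℓ] ++ B) x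

/-- A diagram drawn beside the components of a slice of another diagram represents, with the
latter, the product of the two tensors. -/
def Merging : Prop :=
  ∀ (A B L : List Layer) (s : Slice) (c : ℕ),
    Closed (A ++ B) → run A [] = some s → c ≤ s.length → Closed L →
    Closed (A ++ L.map (Layer.shift c) ++ B) ∧
    ∀ x : ℕ → Bool,
      eval (A ++ L.map (Layer.shift c) ++ B) x = eval (A ++ B) x * eval L x

/-- The sum over the common index of the legs `ℓ` and `ℓ'`. -/
noncomputable def contract (L : List Layer) (ℓ ℓ' : ℕ) (x : ℕ → Bool) : ℂ :=
  ∑ k : Bool, eval L (Function.update (Function.update x ℓ k) ℓ' k)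

/-- Contracting two legs amounts to gluing the diagram along their open intervals, directly or
by means of a bent strip, with a factor `2`. -/
def Contraction : Prop :=
  ∀ (A B : List Layer) (c ℓ ℓ' : ℕ),
    (Closed (A ++ [.legOut c ℓ, .legIn c ℓ'] ++ B) →
      (legs (A ++ [.legOut c ℓ, .legIn c ℓ'] ++ B)).Nodup →
      Closed (A ++ B) ∧ ∀ x : ℕ → Bool,
        contract (A ++ [.legOut c ℓ, .legIn c ℓ'] ++ B) ℓ ℓ' x = 2 * eval (A ++ B) x) ∧
    (Closed (A ++ [.legOut c ℓ, .legOut c ℓ'] ++ B) →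
      (legs (A ++ [.legOut c ℓ, .legOut c ℓ'] ++ B)).Nodup →
      Closed (A ++ bendBot c ++ B) ∧ ∀ x : ℕ → Bool,
        contract (A ++ [.legOut c ℓ, .legOut c ℓ'] ++ B) ℓ ℓ' x
          = 2 * eval (A ++ bendBot c ++ B) x) ∧
    (Closed (A ++ [.legIn c ℓ, .legIn (c + 1) ℓ'] ++ B) →
      (legs (A ++ [.legIn c ℓ, .legIn (c + 1) ℓ'] ++ B)).Nodup →
      Closed (A ++ bendTop c ++ B) ∧ ∀ x : ℕ → Bool,
        contract (A ++ [.legIn c ℓ, .legIn (c + 1) ℓ'] ++ B) ℓ ℓ' x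
          = 2 * eval (A ++ bendTop c ++ B) x)

/-! ### Tensor networks -/

/-- The Pfaffian of the antisymmetric matrix whose entries above the diagonal are those of `A`,
restricted to the rows and columns in an increasing list, by expansion along the first row
(`fuel` bounds the length of the list). -/
def pfAux {k : ℕ} (A : Fin k → Fin k → ℂ) : ℕ → List (Fin k) → ℂ
  | _, [] => 1
  | 0, _ :: _ => 0
  | fuel + 1, i :: l =>
      ∑ p : Fin l.length, (-1) ^ (p : ℕ) * A i (l.get p) * pfAux A fuel (l.eraseIdx p)

/-- The Pfaffian of the rows and columns of `A` in an increasing list. -/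
def pf {k : ℕ} (A : Fin k → Fin k → ℂ) (l : List (Fin k)) : ℂ := pfAux A l.length l

/-- An efficient description of a tensor with `k` legs. -/
inductive NodeTensor (k : ℕ) where
  /-- all components, given explicitly -/
  | table (T : (Fin k → Bool) → ℂ)
  /-- a Clifford tensor: on the solutions `x` of the affine equations `∑ aᵢ xᵢ = b` modulo `2`,
  for `(a, b)` in `rows`, the component is `c · i^{∑ lin i xᵢ} · (-1)^{∑_{i<j} quad i j xᵢ xⱼ}`;
  elsewhere it is `0` -/
  | clifford (c : ℂ) (rows : List ((Fin k → Bool) × Bool)) (lin : Fin k → Fin 4)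
      (quad : Fin k → Fin k → Bool)
  /-- a matchgate tensor: the component at `x` is `c` times the Pfaffian of the submatrix of `A`
  on the legs where `x` differs from `ref` -/
  | matchgate (c : ℂ) (ref : Fin k → Bool) (A : Fin k → Fin k → ℂ)

/-- The components of the tensor. -/
noncomputable def NodeTensor.component {k : ℕ} : NodeTensor k → (Fin k → Bool) → ℂ
  | .table T, x => T x
  | .clifford c rows lin quad, x =>
      if ∀ r ∈ rows, (∑ i, if r.1 i && x i then 1 else 0 : ZMod 2) = (if r.2 then 1 else 0) then
        c * Complex.I ^ (∑ i, if x i then (lin i : ℕ) else 0)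
          * (-1) ^ (∑ i, ∑ j, if i < j ∧ quad i j ∧ x i ∧ x j then 1 else 0)
      else 0
  | .matchgate c ref A, x => c * pf A ((List.finRange k).filter fun i => x i != ref i)

/-- A node of a network with `n` open legs and `m` inner edges: a tensor, with each of its legs
attached to an open leg or to an inner edge. -/
structure Node (n m : ℕ) where
  rank : ℕ
  tensor : NodeTensor rank
  leg : Fin rank → Fin n ⊕ Fin m

/-- The data of a tensor network with `n` open legs and `m` inner edges. -/
abbrev Network (n m : ℕ) := List (Node n m)

/-- All leg ends of the network. -/
def Network.ends {n m : ℕ} (N : Network n m) : List (Fin n ⊕ Fin m) :=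
  N.flatMap fun v => List.ofFn v.leg

/-- Every open leg belongs to one leg of one node and every inner edge joins two legs. -/
def IsNetwork {n m : ℕ} (N : Network n m) : Prop :=
  (∀ i : Fin n, (Network.ends N).count (Sum.inl i) = 1) ∧
  (∀ j : Fin m, (Network.ends N).count (Sum.inr j) = 2)

/-- The tensor obtained by contracting the network: the sum over the indices of all inner
edges of the product of the components. -/
noncomputable def Network.value {n m : ℕ} (N : Network n m) (x : Fin n → Bool) : ℂ :=
  ∑ y : Fin m → Bool,
    (N.map fun v => v.tensor.component fun i => Sum.elim x y (v.leg i)).prod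

/-- The node is one of the generating tensors. -/
def Node.IsGen {n m : ℕ} (v : Node n m) : Prop :=
  ∃ T, v.tensor = .table T ∧ IsGenerator v.rank T

/-- The node has at most four legs and is given by its components. -/
def Node.IsSmall {n m : ℕ} (v : Node n m) : Prop :=
  v.rank ≤ 4 ∧ ∃ T, v.tensor = .table T

/-! ### Algebraic programs with a step count

Programs in the manner of Blum, Shub and Smale over `ℂ`: they work on finite lists and trees of
complex numbers by the field operations and tests for zero, and their only loop is the traversal
of a list. -/

/-- Finite binary trees of complex numbers. -/
inductive Data where
  | nil
  | atom (z : ℂ)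
  | cons (a b : Data)

/-- The size of a tree; every number has size `1`. -/
def Data.size : Data → ℕ
  | .nil => 1
  | .atom _ => 1
  | .cons a b => a.size + b.size + 1

/-- Programs. -/
inductive Prog where
  | id
  | nil
  | const (z : ℂ)
  /-- the arithmetic operations, on pairs of numbers or numbers -/
  | add
  | mul
  | neg
  | inv
  /-- `nil` on the number `0`, the number `1` on everything else -/
  | isZero
  | fst
  | snd
  | pair (p q : Prog)
  /-- first `p`, then `q` -/
  | comp (p q : Prog)
  /-- `p` if `t` gives `nil`, otherwise `q` -/
  | branch (t p q : Prog)
  /-- on a pair of a list `a₁, a₂, …` and a state `s`: apply `p` to the pair of `a₁` and `s` to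
  get a new state, then to the pair of `a₂` and this state, and so on -/
  | fold (p : Prog)

/-- The value `d` at the cost of writing it. -/
def ret (d : Data) : Data × ℕ := (d, d.size)

/-- The loop over a list, with its cost. -/
def foldRun (f : Data → Data × ℕ) : Data → Data → Data × ℕ
  | .cons a l, s =>
      let r := f (.cons a s)
      let t := foldRun f l r.1
      (t.1, (Data.cons a s).size + r.2 + t.2)
  | _, s => ret s

open Classical in
/-- The value of a program on an input and the number of steps, where every instruction costs
the size of what it writes. -/
noncomputable def Prog.run : Prog → Data → Data × ℕ
  | .id, d => ret d
  | .nil, _ => ret .nil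
  | .const z, _ => ret (.atom z)
  | .add, d => match d with
      | .cons (.atom a) (.atom b) => ret (.atom (a + b))
      | _ => ret .nil
  | .mul, d => match d with
      | .cons (.atom a) (.atom b) => ret (.atom (a * b))
      | _ => ret .nil
  | .neg, d => match d with
      | .atom a => ret (.atom (-a))
      | _ => ret .nil
  | .inv, d => match d with
      | .atom a => ret (.atom a⁻¹)
      | _ => ret .nil
  | .isZero, d => if d = .atom 0 then ret .nil else ret (.atom 1)
  | .fst, d => match d with
      | .cons a _ => ret a
      | _ => ret .nil
  | .snd, d => match d with
      | .cons _ b => ret b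
      | _ => ret .nil
  | .pair p q, d => (.cons (p.run d).1 (q.run d).1,
      (p.run d).2 + (q.run d).2 + (Data.cons (p.run d).1 (q.run d).1).size)
  | .comp p q, d => ((q.run (p.run d).1).1, (p.run d).2 + (q.run (p.run d).1).2 + 1)
  | .branch t p q, d =>
      if (t.run d).1 = .nil then ((p.run d).1, (t.run d).2 + (p.run d).2 + 1)
      else ((q.run d).1, (t.run d).2 + (q.run d).2 + 1)
  | .fold p, d => match d with
      | .cons l s => ((foldRun p.run l s).1, (foldRun p.run l s).2 + 1)
      | _ => ret .nil

/-- Lists as trees. -/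
def Data.list : List Data → Data
  | [] => .nil
  | a :: l => .cons a (Data.list l)

/-- Natural numbers as complex numbers. -/
def Data.nat (n : ℕ) : Data := .atom n

/-- Bits as complex numbers. -/
def Data.bool (b : Bool) : Data := .atom (if b then 1 else 0)

/-- An event is encoded by its kind and its data; a scattering element by the number `e^{iθ}`,
on which alone it depends. -/
noncomputable def Elem.encode : Elem → Data
  | .birth c => .list [.nat 0, .nat c]
  | .death c => .list [.nat 1, .nat c]
  | .split c m => .list [.nat 2, .nat c, .nat m]
  | .merge c => .list [.nat 3, .nat c]
  | .cap c i => .list [.nat 4, .nat c, .nat i]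
  | .cup c i => .list [.nat 5, .nat c, .nat i]
  | .dots c i j => .list [.nat 6, .nat c, .nat i, .nat j]
  | .braidPos c i => .list [.nat 7, .nat c, .nat i]
  | .braidNeg c i => .list [.nat 8, .nat c, .nat i]
  | .scatter θ c i => .list [.nat 9, .nat c, .nat i, .atom (Complex.exp (Complex.I * θ))]
  | .scatterH θ c i => .list [.nat 10, .nat c, .nat i, .atom (Complex.exp (Complex.I * θ))]

noncomputable def Layer.encode : Layer → Data
  | .ev a => a.encode
  | .legIn c ℓ => .list [.nat 11, .nat c, .nat ℓ]
  | .legOut c ℓ => .list [.nat 12, .nat c, .nat ℓ]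

noncomputable def Diagram.encode (D : Diagram) : Data :=
  .cons (.atom D.coeff) (.list (D.layers.map Layer.encode))

/-- Tables of functions on `Fin k`. -/
def Data.vec {k : ℕ} (f : Fin k → Data) : Data := .list (List.ofFn f)

/-- The components of an explicit tensor are listed in the order of the numbers whose binary
digits, from the least significant one, are the indices. -/
def NodeTensor.encode {k : ℕ} : NodeTensor k → Data
  | .table T => .cons (.nat 0)
      (.vec fun j : Fin (2 ^ k) => .atom (T fun i => (j : ℕ).testBit i))
  | .clifford c rows lin quad => .list [.nat 1, .atom c,
      .list (rows.map fun r => .cons (.bool r.2) (.vec fun i => .bool (r.1 i))),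
      .vec fun i => .nat (lin i),
      .vec fun i => .vec fun j => .bool (quad i j)]
  | .matchgate c ref A => .list [.nat 2, .atom c,
      .vec fun i => .bool (ref i),
      .vec fun i => .vec fun j => .atom (A i j)]

def encodeEnd {n m : ℕ} : Fin n ⊕ Fin m → Data
  | .inl i => .cons (.nat 0) (.nat i)
  | .inr j => .cons (.nat 1) (.nat j)

def Node.encode {n m : ℕ} (v : Node n m) : Data :=
  .cons (.vec fun i => encodeEnd (v.leg i)) v.tensor.encode

def Network.encode {n m : ℕ} (N : Network n m) : Data :=
  .cons (.nat n) (.cons (.nat m) (.list (N.map Node.encode)))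

/-- On the input `d` the program gives `d'` within `q (size of d)` steps. -/
def Computes (p : Prog) (q : Polynomial ℕ) (d d' : Data) : Prop :=
  (p.run d).1 = d' ∧ (p.run d).2 ≤ q.eval d.size

end Quon

namespace Quon

/-! ### Locality of events -/

/-- The slice below a sequence of events. -/
def runE : List Elem → Slice → Option Slice
  | [], s => some s
  | a :: l, s => (a.step s).bind (runE l)

/-- The state below a sequence of events. -/
noncomputable def exec : List Elem → Slice → Amp → Amp
  | [], _, ψ => ψ
  | a :: l, s, ψ => exec l ((a.step s).getD []) (a.act s ψ)

theorem runE_append (l l' : List Elem) (s : Slice) :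
    runE (l ++ l') s = (runE l s).bind (runE l') := by
  induction l generalizing s with
  | nil => simp [runE]
  | cons a l ih => cases h : a.step s <;> simp [runE, h, ih]

theorem exec_append {l l' : List Elem} {s s' : Slice} (h : runE l s = some s') (ψ : Amp) :
    exec (l ++ l') s ψ = exec l' s' (exec l s ψ) := by
  induction l generalizing s ψ with
  | nil => simp_all [runE, exec]
  | cons a l ih =>
    cases h' : a.step s with
    | none => simp [runE, h'] at h
    | some t => simp [runE, h'] at h; simp [exec, h', ih h]

theorem evalElems_eq {l : List Elem} {s s' : Slice} (h : runE l s = some s') (ψ : Amp) :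
    evalElems l s ψ = exec l s ψ [] := by
  induction l generalizing s ψ with
  | nil => simp [evalElems, exec]
  | cons a l ih =>
    cases h' : a.step s with
    | none => simp [runE, h'] at h
    | some t => simp [runE, h'] at h; simp [evalElems, exec, h', ih h]

theorem take_frame {α : Type*} (b₁ m b₃ : List α) {k : ℕ} (h : k ≤ m.length) :
    (b₁ ++ m ++ b₃).take (b₁.length + k) = b₁ ++ m.take k := by
  rw [List.append_assoc, List.take_length_add_append, List.take_append_of_le_length h]

theorem drop_frame {α : Type*} (b₁ m b₃ : List α) {k : ℕ} (h : k ≤ m.length) :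
    (b₁ ++ m ++ b₃).drop (b₁.length + k) = m.drop k ++ b₃ := by
  rw [List.append_assoc, List.drop_length_add_append, List.drop_append_of_le_length h]

theorem bit_frame (b₁ m b₃ : List Bool) {k : ℕ} (h : k < m.length) :
    bit (b₁ ++ m ++ b₃) (b₁.length + k) = bit m k := by
  simp [bit, List.getD, List.append_assoc, List.getElem?_append_right, List.getElem?_append_left h]

theorem set_frame {α : Type*} (b₁ m b₃ : List α) {k : ℕ} (h : k < m.length) (v : α) :
    (b₁ ++ m ++ b₃).set (b₁.length + k) v = b₁ ++ m.set k v ++ b₃ := by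
  rw [List.append_assoc, List.set_append_right _ _ (by omega), List.append_assoc,
    Nat.add_sub_cancel_left, List.set_append_left _ _ h]

theorem eraseIdx_frame {α : Type*} (b₁ m b₃ : List α) {k : ℕ} (h : k < m.length) :
    (b₁ ++ m ++ b₃).eraseIdx (b₁.length + k) = b₁ ++ m.eraseIdx k ++ b₃ := by
  rw [List.append_assoc, List.eraseIdx_append_of_length_le (by omega), List.append_assoc,
    Nat.add_sub_cancel_left, List.eraseIdx_append_of_lt_length h]

/-- Between the bits `b₁` and `b₃`, the state `Ψ` is `ε` times `ψ` on `n` bits. -/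
def Loc (b₁ b₃ : List Bool) (n : ℕ) (ε : ℂ) (Ψ ψ : Amp) : Prop :=
  ∀ m : List Bool, m.length = n → Ψ (b₁ ++ m ++ b₃) = ε * ψ m

section
variable {b₁ b₃ : List Bool} {n : ℕ} {ε : ℂ} {Ψ ψ : Amp}

/-- The Jordan–Wigner string of the operator also runs over the bits `b₁`, which gives the sign.
Since every event contains an even number of Majorana operators, the sign disappears in all the
lemmas on events below. -/
theorem Loc.majorana (h : Loc b₁ b₃ n ε Ψ ψ) {g : ℕ} (hg : g / 2 < n) :
    Loc b₁ b₃ n ((-1) ^ (b₁.count true) * ε) (majorana (2 * b₁.length + g) Ψ)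
      (majorana g ψ) := by
  intro m hm
  have e1 : (2 * b₁.length + g) / 2 = b₁.length + g / 2 := by omega
  have e2 : (2 * b₁.length + g) % 2 = g % 2 := by omega
  simp only [Quon.majorana, e1, e2]
  rw [take_frame _ _ _ (by omega), bit_frame _ _ _ (by omega), set_frame _ _ _ (by omega),
    h _ (by simpa using hm), List.count_append, pow_add]
  ring

theorem Loc.parity (h : Loc b₁ b₃ n ε Ψ ψ) {g g' : ℕ} (hg : g / 2 < n) (hg' : g' / 2 < n) :
    Loc b₁ b₃ n ε (parity (2 * b₁.length + g) (2 * b₁.length + g') Ψ) (parity g g' ψ) := by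
  intro m hm
  simp only [Quon.parity]
  rw [(h.majorana hg').majorana hg m hm]
  have : ((-1 : ℂ) ^ (b₁.count true)) * (-1) ^ (b₁.count true) = 1 := by
    rw [← mul_pow]; simp
  linear_combination (Complex.I * ε * Quon.majorana g (Quon.majorana g' ψ) m) * this

theorem Loc.capAt (h : Loc b₁ b₃ n ε Ψ ψ) {g : ℕ} (hg : g ≤ 2 * n) :
    Loc b₁ b₃ (n + 1) ε (capAt (2 * b₁.length + g) Ψ) (capAt g ψ) := by
  intro m hm
  have e1 : (2 * b₁.length + g) / 2 = b₁.length + g / 2 := by omega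
  have e2 : (2 * b₁.length + g) % 2 = g % 2 := by omega
  simp only [Quon.capAt, e1, e2]
  rw [bit_frame _ _ _ (by omega)]
  split_ifs with h1 h2
  · simp
  · rw [eraseIdx_frame _ _ _ (by omega), h _ (by rw [List.length_eraseIdx_of_lt] <;> omega)]; ring
  · have hk : g / 2 + 1 < m.length := by omega
    rw [take_frame _ _ _ (by omega), add_assoc, add_assoc, bit_frame _ _ _ hk,
      drop_frame _ _ _ (by omega), ← List.cons_append, ← List.append_assoc, List.append_assoc b₁,
      h _ (by simp; omega)]
    ring

theorem Loc.cupAt (h : Loc b₁ b₃ (n + 1) ε Ψ ψ) {g : ℕ} (hg : g < 2 * n + 1) :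
    Loc b₁ b₃ n ε (cupAt (2 * b₁.length + g) Ψ) (cupAt g ψ) := by
  intro m hm
  have e1 : (2 * b₁.length + g) / 2 = b₁.length + g / 2 := by omega
  have e2 : (2 * b₁.length + g) % 2 = g % 2 := by omega
  simp only [Quon.cupAt, e1, e2]
  rw [take_frame _ _ _ (by omega)]
  split_ifs with h1
  · rw [drop_frame _ _ _ (by omega), ← List.cons_append, ← List.append_assoc,
      List.append_assoc b₁, h _ (by simp; omega)]
    ring
  · rw [bit_frame _ _ _ (by omega), add_assoc, drop_frame _ _ _ (by omega)]
    have key : ∀ x y, b₁ ++ m.take (g / 2) ++ x :: y :: (m.drop (g / 2 + 1) ++ b₃)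
        = b₁ ++ (m.take (g / 2) ++ x :: y :: m.drop (g / 2 + 1)) ++ b₃ := by simp
    rw [key, key, h _ (by simp; omega), h _ (by simp; omega)]
    ring

theorem Loc.braidPosAt (h : Loc b₁ b₃ n ε Ψ ψ) {g : ℕ} (hg : g + 1 < 2 * n) :
    Loc b₁ b₃ n ε (braidPosAt (2 * b₁.length + g) Ψ) (braidPosAt g ψ) := by
  intro m hm
  simp only [Quon.braidPosAt]
  rw [add_assoc, h.parity (by omega) (by omega) m hm, h m hm]; ring

theorem Loc.braidNegAt (h : Loc b₁ b₃ n ε Ψ ψ) {g : ℕ} (hg : g + 1 < 2 * n) :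
    Loc b₁ b₃ n ε (braidNegAt (2 * b₁.length + g) Ψ) (braidNegAt g ψ) := by
  intro m hm
  simp only [Quon.braidNegAt]
  rw [add_assoc, h.parity (by omega) (by omega) m hm, h m hm]; ring

theorem Loc.scatterAt (h : Loc b₁ b₃ n ε Ψ ψ) {g : ℕ} (hg : g + 1 < 2 * n) (θ : ℂ) :
    Loc b₁ b₃ n ε (scatterAt θ (2 * b₁.length + g) Ψ) (scatterAt θ g ψ) := by
  intro m hm
  simp only [Quon.scatterAt]
  rw [add_assoc, h.parity (by omega) (by omega) m hm, h m hm]; ring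

theorem Loc.scatterHAt (h : Loc b₁ b₃ n ε Ψ ψ) {g : ℕ} (hg : g + 1 < 2 * n) (θ : ℂ) :
    Loc b₁ b₃ n ε (scatterHAt θ (2 * b₁.length + g) Ψ) (scatterHAt θ g ψ) := by
  -- Between the cup and the cap the block has one pair less, so its size must be a successor.
  obtain ⟨n, rfl⟩ : ∃ k, n = k + 1 := ⟨n - 1, by omega⟩
  intro m hm
  simp only [Quon.scatterHAt]
  rw [add_assoc, (h.cupAt (by omega)).capAt (by omega) m hm,
    (((h.majorana (by omega)).cupAt (by omega)).capAt (by omega)).majorana (by omega) m hm]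
  have : ((-1 : ℂ) ^ (b₁.count true)) * (-1) ^ (b₁.count true) = 1 := by
    rw [← mul_pow]; simp
  linear_combination ((1 - Complex.exp (Complex.I * θ)) / 2 * ε * Quon.majorana (g + 1)
    (Quon.capAt g (Quon.cupAt g (Quon.majorana (g + 1) ψ))) m) * this

theorem Loc.projectEven (h : Loc b₁ b₃ n ε Ψ ψ) {o k : ℕ} (ho : o + k ≤ n) :
    Loc b₁ b₃ n ε (projectEven (b₁.length + o) k Ψ) (projectEven o k ψ) := by
  intro m hm
  simp only [Quon.projectEven]
  rw [drop_frame _ _ _ (by omega), List.take_append_of_le_length (by simp; omega), h m hm]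
  split_ifs <;> simp

end

theorem sum_take_add_drop (s : List ℕ) (c : ℕ) : (s.take c).sum + (s.drop c).sum = s.sum := by
  rw [← List.sum_append, List.take_append_drop]

theorem split_at {s : Slice} {c e : ℕ} (h : s[c]? = some e) :
    s = s.take c ++ e :: s.drop (c + 1) ∧ (s.take c).length = c ∧ c < s.length := by
  obtain ⟨hc, rfl⟩ := List.getElem?_eq_some_iff.1 h
  exact ⟨by simp, by simp [hc.le], hc⟩

theorem sum_split {s : Slice} {c e : ℕ} (h : s[c]? = some e) :
    s.sum = s.offset c + e + (s.drop (c + 1)).sum := by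
  conv_lhs => rw [(split_at h).1]
  simp [Slice.offset, add_assoc]

theorem sum_set {s : Slice} {c e e' : ℕ} (h : s[c]? = some e) :
    (s.set c e').sum = s.offset c + e' + (s.drop (c + 1)).sum := by
  have := (split_at h).2.2
  rw [List.set_eq_take_append_cons_drop]
  simp [this, Slice.offset, add_assoc]

theorem getElem?_frame {α : Type*} (s₁ s₂ s₃ : List α) {c : ℕ} {e : α} (h : s₂[c]? = some e) :
    (s₁ ++ s₂ ++ s₃)[s₁.length + c]? = some e := by
  obtain ⟨hc, _⟩ := List.getElem?_eq_some_iff.1 h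
  rw [List.append_assoc, List.getElem?_append_right (by omega), Nat.add_sub_cancel_left,
    List.getElem?_append_left hc, h]

theorem offset_frame (s₁ s₂ s₃ : Slice) {c : ℕ} (h : c ≤ s₂.length) :
    Slice.offset (s₁ ++ s₂ ++ s₃) (s₁.length + c) = s₁.sum + s₂.offset c := by
  simp only [Slice.offset]; rw [take_frame _ _ _ h]; simp

theorem lt_of_getElem?_eq_some {α : Type*} {s : List α} {c : ℕ} {e : α} (h : s[c]? = some e) :
    c < s.length := (List.getElem?_eq_some_iff.1 h).1

/-- What it means for an event to fit a slice. -/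
theorem step_frame (a : Elem) {s₂ s₂' : Slice} (h : a.step s₂ = some s₂') (s₁ s₃ : Slice) :
    (a.shift s₁.length).step (s₁ ++ s₂ ++ s₃) = some (s₁ ++ s₂' ++ s₃) := by
  cases a with
  | birth c =>
    simp only [Elem.step, Elem.shift, Option.ite_none_right_eq_some] at h ⊢
    obtain ⟨h, h'⟩ := h
    refine ⟨by simp; omega, ?_⟩
    rw [take_frame _ _ _ h, drop_frame _ _ _ h, ← Option.some.inj h']; simp
  | death c =>
    simp only [Elem.step, Elem.shift, Option.ite_none_right_eq_some] at h ⊢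
    obtain ⟨h, h'⟩ := h
    refine ⟨getElem?_frame _ _ _ h, ?_⟩
    rw [eraseIdx_frame _ _ _ (lt_of_getElem?_eq_some h), ← Option.some.inj h']
  | split c m =>
    simp only [Elem.step, Elem.shift] at h ⊢
    cases hc : s₂[c]? with
    | none => simp [hc] at h
    | some e =>
      have := lt_of_getElem?_eq_some hc
      simp only [hc, Option.ite_none_right_eq_some] at h
      rw [getElem?_frame _ _ _ hc]
      simp only [h.1, if_true, Option.some.injEq]
      rw [take_frame _ _ _ (by omega), add_assoc, drop_frame _ _ _ (by omega),
        ← Option.some.inj h.2]; simp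
  | merge c =>
    simp only [Elem.step, Elem.shift] at h ⊢
    cases hc : s₂[c]? with
    | none => simp [hc] at h
    | some e =>
      cases hc' : s₂[c + 1]? with
      | none => simp [hc, hc'] at h
      | some e' =>
        have := lt_of_getElem?_eq_some hc'
        simp only [hc, hc'] at h
        rw [getElem?_frame _ _ _ hc, add_assoc, getElem?_frame _ _ _ hc']
        simp only [Option.some.injEq]
        rw [take_frame _ _ _ (by omega), add_assoc, drop_frame _ _ _ (by omega),
          ← Option.some.inj h]; simp
  | cap c i | cup c i | dots c i j | braidPos c i | braidNeg c i | scatter θ c i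
  | scatterH θ c i =>
    simp only [Elem.step, Elem.shift] at h ⊢
    cases hc : s₂[c]? with
    | none => simp [hc] at h
    | some e =>
      have := lt_of_getElem?_eq_some hc
      simp only [hc, Option.ite_none_right_eq_some] at h
      rw [getElem?_frame _ _ _ hc]
      simp only [h.1, and_self, if_true, Option.some.injEq]
      try rw [set_frame _ _ _ (by omega)]
      rw [← Option.some.inj h.2]

/-- An event acts on its component alone. -/
theorem act_frame (a : Elem) {s₁ s₂ s₂' s₃ : Slice} (h : a.step s₂ = some s₂') {Ψ ψ : Amp}
    {b₁ b₃ : List Bool} {ε : ℂ} (h₁ : b₁.length = s₁.sum) (hΨ : Loc b₁ b₃ s₂.sum ε Ψ ψ) :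
    Loc b₁ b₃ s₂'.sum ε ((a.shift s₁.length).act (s₁ ++ s₂ ++ s₃) Ψ) (a.act s₂ ψ) := by
  cases a with
  | birth c =>
    simp only [Elem.step, Option.ite_none_right_eq_some] at h
    have e : s₂'.sum = s₂.sum := by
      rw [← Option.some.inj h.2, ← sum_take_add_drop s₂ c]; simp
    rw [e]; exact hΨ
  | death c =>
    simp only [Elem.step, Option.ite_none_right_eq_some] at h
    have e : s₂'.sum = s₂.sum := by
      rw [← Option.some.inj h.2, sum_split h.1, List.eraseIdx_eq_take_drop_succ]
      simp [Slice.offset]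
    rw [e]; exact hΨ
  | split c m =>
    simp only [Elem.step] at h
    cases hc : s₂[c]? with
    | none => simp [hc] at h
    | some e =>
      have := lt_of_getElem?_eq_some hc
      simp only [hc, Option.ite_none_right_eq_some] at h
      have e1 : s₂'.sum = s₂.sum := by
        rw [← Option.some.inj h.2, sum_split hc]; simp [Slice.offset]; omega
      have e2 : (s₁ ++ s₂ ++ s₃).getD (s₁.length + c) 0 = e := by
        rw [List.getD, getElem?_frame _ _ _ hc]; rfl
      have e3 : s₂.getD c 0 = e := by rw [List.getD, hc]; rfl
      have e4 := sum_split hc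
      simp only [Elem.shift, Elem.act]
      rw [e1, e2, e3, offset_frame _ _ _ (by omega), ← h₁, add_assoc]
      exact (hΨ.projectEven (by omega)).projectEven (by omega)
  | merge c =>
    simp only [Elem.step] at h
    cases hc : s₂[c]? with
    | none => simp [hc] at h
    | some e =>
      cases hc' : s₂[c + 1]? with
      | none => simp [hc, hc'] at h
      | some e' =>
        simp only [hc, hc'] at h
        have e1 : s₂'.sum = s₂.sum := by
          have := lt_of_getElem?_eq_some hc'
          rw [← Option.some.inj h, sum_split hc', Slice.offset, List.take_add_one, hc]
          simp [add_assoc]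
        rw [e1]; exact hΨ
  | cap c i | cup c i | dots c i j | braidPos c i | braidNeg c i | scatter θ c i
  | scatterH θ c i =>
    simp only [Elem.step] at h
    cases hc : s₂[c]? with
    | none => simp [hc] at h
    | some e =>
      have := lt_of_getElem?_eq_some hc
      simp only [hc, Option.ite_none_right_eq_some] at h
      have e4 := sum_split hc
      have e5 : ∀ e', (s₂.set c e').sum = _ := fun e' => sum_set hc
      simp only [Elem.shift, Elem.act]
      rw [offset_frame _ _ _ (by omega), ← h₁, ← Option.some.inj h.2, mul_add, add_assoc]
      first
      | rw [e5, show s₂.offset c + (e + 1) + (s₂.drop (c + 1)).sum = s₂.sum + 1 by omega]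
        exact hΨ.capAt (by omega)
      | rw [e5]
        rw [show s₂.sum = s₂.offset c + (e - 1) + (s₂.drop (c + 1)).sum + 1 by omega] at hΨ
        exact hΨ.cupAt (by omega)
      | exact hΨ.braidPosAt (by omega)
      | exact hΨ.braidNegAt (by omega)
      | exact hΨ.scatterAt (by omega) _
      | exact hΨ.scatterHAt (by omega) _
      | rw [add_assoc]; exact hΨ.parity (by omega) (by omega)

theorem runE_frame {l : List Elem} {s₂ s₂' : Slice} (h : runE l s₂ = some s₂') (s₁ s₃ : Slice) :
    runE (l.map (Elem.shift s₁.length)) (s₁ ++ s₂ ++ s₃) = some (s₁ ++ s₂' ++ s₃) := by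
  induction l generalizing s₂ with
  | nil => simp_all [runE]
  | cons a l ih =>
    simp only [runE, Option.bind_eq_some_iff] at h
    obtain ⟨t, ht, h⟩ := h
    simp only [List.map_cons, runE, step_frame a ht, Option.bind_some]
    exact ih h

/-- A sequence of events acts on its components alone. -/
theorem exec_frame {l : List Elem} {s₁ s₂ s₂' s₃ : Slice} (h : runE l s₂ = some s₂') {Ψ ψ : Amp}
    {b₁ b₃ : List Bool} {ε : ℂ} (h₁ : b₁.length = s₁.sum) (hΨ : Loc b₁ b₃ s₂.sum ε Ψ ψ) :
    Loc b₁ b₃ s₂'.sum ε (exec (l.map (Elem.shift s₁.length)) (s₁ ++ s₂ ++ s₃) Ψ)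
      (exec l s₂ ψ) := by
  induction l generalizing s₂ Ψ ψ with
  | nil => simp_all [runE, exec]
  | cons a l ih =>
    simp only [runE, Option.bind_eq_some_iff] at h
    obtain ⟨t, ht, h⟩ := h
    simp only [List.map_cons, exec, step_frame a ht, ht, Option.getD_some]
    exact ih h (act_frame a ht h₁ hΨ)

theorem Elem.shift_zero (a : Elem) : a.shift 0 = a := by cases a <;> simp [Elem.shift]

/-- Only the amplitudes of the right length matter, and linearly. -/
theorem exec_congr {l : List Elem} {s s' : Slice} (h : runE l s = some s') {Ψ ψ : Amp} {ε : ℂ}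
    (hΨ : ∀ m : List Bool, m.length = s.sum → Ψ m = ε * ψ m) {b : List Bool}
    (hb : b.length = s'.sum) : exec l s Ψ b = ε * exec l s ψ b := by
  -- With nothing on either side, locality is a statement about the whole state, and `ε` expresses
  -- homogeneity.
  have := exec_frame (s₁ := []) (s₃ := []) (b₁ := []) (b₃ := []) (ε := ε) h rfl
    (show Loc [] [] s.sum ε Ψ ψ from fun m hm => by simpa using hΨ m hm) b hb
  have e : l.map (Elem.shift 0) = l := by simp [funext Elem.shift_zero]
  simpa [e] using this

end Quon

namespace Quon

/-! ### Linearity and parity -/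

theorem act_add (a : Elem) (s : Slice) (ψ φ : Amp) (b : List Bool) :
    a.act s (fun b => ψ b + φ b) b = a.act s ψ b + a.act s φ b := by
  cases a <;>
    simp only [Elem.act, projectEven, capAt, cupAt, parity, majorana, braidPosAt, braidNegAt,
      scatterAt, scatterHAt] <;>
    (try split_ifs) <;> ring

theorem exec_add (l : List Elem) (s : Slice) (ψ φ : Amp) (b : List Bool) :
    exec l s (fun b => ψ b + φ b) b = exec l s ψ b + exec l s φ b := by
  induction l generalizing s ψ φ with
  | nil => rfl
  | cons a l ih => simp only [exec]; rw [← ih]; congr 1; funext b; exact act_add ..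

/-- The assignment `b` has even parity on every component of the slice. -/
def EvenAt : Slice → List Bool → Prop
  | [], _ => True
  | e :: s, b => (b.take e).count true % 2 = 0 ∧ EvenAt s (b.drop e)

theorem evenAt_append {s₁ : Slice} {b₁ : List Bool} (h : b₁.length = s₁.sum) (s₂ : Slice)
    (b₂ : List Bool) : EvenAt (s₁ ++ s₂) (b₁ ++ b₂) ↔ EvenAt s₁ b₁ ∧ EvenAt s₂ b₂ := by
  induction s₁ generalizing b₁ with
  | nil => simp at h; simp [EvenAt, h]
  | cons e s ih =>
    simp only [List.sum_cons] at h
    simp only [List.cons_append, EvenAt]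
    rw [List.take_append_of_le_length (by omega), List.drop_append_of_le_length (by omega),
      ih (by simp; omega), and_assoc]

/-- The state is even on every component of the slice. -/
def EvenOn (s : Slice) (ψ : Amp) : Prop :=
  ∀ b : List Bool, b.length = s.sum → ¬ EvenAt s b → ψ b = 0

/-- The state on `n` bits has parity `p`. -/
def HasPar (n p : ℕ) (ψ : Amp) : Prop :=
  ∀ b : List Bool, b.length = n → b.count true % 2 ≠ p → ψ b = 0

theorem evenOn_singleton {e : ℕ} {ψ : Amp} : EvenOn [e] ψ ↔ HasPar e 0 ψ := by
  refine forall₂_congr fun b hb => ?_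
  simp at hb
  rw [EvenAt, List.take_of_length_le (by omega)]
  simp [EvenAt]

theorem count_eq_take_drop {b : List Bool} {k : ℕ} (h : k < b.length) :
    b.count true = (b.take k).count true + (if bit b k then 1 else 0)
      + (b.drop (k + 1)).count true := by
  have e : b = b.take k ++ b[k] :: b.drop (k + 1) := by simp
  have : bit b k = b[k] := by simp [bit, h]
  conv_lhs => rw [e]
  rw [List.count_append, List.count_cons, this]
  cases b[k] <;> simp; omega

/-- Exactly one bit is flipped. This is why dots have to come in pairs. -/
theorem HasPar.majorana {n p : ℕ} {ψ : Amp} (h : HasPar n p ψ) {g : ℕ} (hg : g / 2 < n)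
    (hp : p < 2) : HasPar n (1 - p) (majorana g ψ) := by
  intro b hb hc
  have := count_eq_take_drop (b := b) (k := g / 2) (by omega)
  simp only [Quon.majorana]
  rw [h, mul_zero]
  · simpa
  · rw [List.set_eq_take_append_cons_drop, if_pos (by omega), List.count_append, List.count_cons]
    cases h' : bit b (g / 2) <;> rw [h'] at this <;> simp at this ⊢ <;> omega

theorem HasPar.parity {n p : ℕ} {ψ : Amp} (h : HasPar n p ψ) {g g' : ℕ} (hg : g / 2 < n)
    (hg' : g' / 2 < n) (hp : p < 2) : HasPar n p (parity g g' ψ) := by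
  intro b hb hc
  simp only [Quon.parity]
  rw [(h.majorana hg' hp).majorana hg (by omega) b hb (by omega), mul_zero]

/-- A cap at an even string inserts the bit `0`; one at an odd string replaces `a` by `p, p + a`,
which has the same sum modulo `2`. -/
theorem HasPar.capAt {n p : ℕ} {ψ : Amp} (h : HasPar n p ψ) {g : ℕ} (hg : g ≤ 2 * n) :
    HasPar (n + 1) p (capAt g ψ) := by
  intro b hb hc
  have h0 := count_eq_take_drop (b := b) (k := g / 2) (by omega)
  simp only [Quon.capAt]
  split_ifs with h1 h2
  · rfl
  · rw [h, mul_zero]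
    · rw [List.length_eraseIdx_of_lt] <;> omega
    · rw [List.eraseIdx_eq_take_drop_succ, List.count_append]
      simp [h2] at h0; omega
  · have h3 : b.count true = _ + _ + (b.drop (g / 2 + 2)).count true :=
      count_eq_take_drop (b := b) (k := g / 2 + 1) (by omega)
    have h4 : (b.take (g / 2 + 1)).count true
        = (b.take (g / 2)).count true + (if bit b (g / 2) then 1 else 0) := by
      rw [List.take_add_one, List.count_append, bit, List.getD]
      cases b[g / 2]? with
      | none => simp
      | some v => cases v <;> simp
    rw [h, mul_zero]
    · simp; omega
    · rw [List.count_append, List.count_cons]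
      cases h5 : bit b (g / 2) <;> cases h6 : bit b (g / 2 + 1) <;> rw [h5] at h4 <;>
        rw [h6] at h3 <;> simp at h3 h4 ⊢ <;> omega

theorem HasPar.cupAt {n p : ℕ} {ψ : Amp} (h : HasPar (n + 1) p ψ) {g : ℕ}
    (hg : g < 2 * n + 1) : HasPar n p (cupAt g ψ) := by
  intro b hb hc
  simp only [Quon.cupAt]
  split_ifs with h1
  · rw [h, mul_zero]
    · simp; omega
    · have h5 : b.count true = (b.take (g / 2)).count true + (b.drop (g / 2)).count true := by
        rw [← List.count_append, List.take_append_drop]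
      rw [List.count_append, List.count_cons]; simp; omega
  · have h0 := count_eq_take_drop (b := b) (k := g / 2) (by omega)
    rw [h, h, add_zero, mul_zero]
    · simp; omega
    · rw [List.count_append, List.count_cons, List.count_cons]
      cases h5 : bit b (g / 2) <;> rw [h5] at h0 <;> simp at h0 ⊢ <;> omega
    · simp; omega
    · rw [List.count_append, List.count_cons, List.count_cons]
      cases h5 : bit b (g / 2) <;> rw [h5] at h0 <;> simp at h0 ⊢ <;> omega

/-- Serves the events that touch a single component and replace it by a single component. -/
theorem exists_local_of_getElem {a a₀ : Elem} {s s' : Slice} {c e e' : ℕ} (hc : s[c]? = some e)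
    (ha : a = a₀.shift c) (hs : a.step s = some s') (h₀ : a₀.step [e] = some [e']) :
    ∃ s₁ s₃ : Slice, a = a₀.shift s₁.length ∧ s = s₁ ++ [e] ++ s₃ ∧ s' = s₁ ++ [e'] ++ s₃ := by
  obtain ⟨h1, h2, h3⟩ := split_at hc
  have h1' : s = s.take c ++ [e] ++ s.drop (c + 1) := by simpa using h1
  refine ⟨s.take c, s.drop (c + 1), by rw [h2, ha], h1', ?_⟩
  rw [h1', ha] at hs
  have := step_frame a₀ h₀ (s.take c) (s.drop (c + 1))
  rw [h2] at this
  exact Option.some.inj (hs.symm.trans this)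

/-- Every event comes from an event at place `0` on the components that it touches, and it
preserves parities there. -/
theorem exists_local {a : Elem} {s s' : Slice} (h : a.step s = some s') :
    ∃ (a₀ : Elem) (s₁ s₂ s₂' s₃ : Slice), a = a₀.shift s₁.length ∧ s = s₁ ++ s₂ ++ s₃ ∧
      s' = s₁ ++ s₂' ++ s₃ ∧ a₀.step s₂ = some s₂' ∧
      ∀ ψ, EvenOn s₂ ψ → EvenOn s₂' (a₀.act s₂ ψ) := by
  cases a with
  | birth c =>
    simp only [Elem.step, Option.ite_none_right_eq_some] at h
    refine ⟨.birth 0, s.take c, [], [0], s.drop c, by simp [Elem.shift, h.1], by simp,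
      by simpa using (Option.some.inj h.2).symm, rfl, fun ψ _ b _ h => ?_⟩
    simp [EvenAt] at h
  | death c =>
    have h' := h
    simp only [Elem.step, Option.ite_none_right_eq_some] at h'
    obtain ⟨h1, h2, h3⟩ := split_at h'.1
    refine ⟨.death 0, s.take c, [0], [], s.drop (c + 1), by simp [Elem.shift, h3.le],
      by simpa using h1, ?_, rfl, fun ψ _ b _ h => by simp [EvenAt] at h⟩
    rw [← Option.some.inj h'.2, List.eraseIdx_eq_take_drop_succ]; simp
  | split c m =>
    simp only [Elem.step] at h
    cases hc : s[c]? with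
    | none => simp [hc] at h
    | some e =>
      simp only [hc, Option.ite_none_right_eq_some] at h
      obtain ⟨h1, h2, h3⟩ := split_at hc
      refine ⟨.split 0 m, s.take c, [e], [m, e - m], s.drop (c + 1), by simp [Elem.shift, h3.le],
        by simpa using h1, by simpa using (Option.some.inj h.2).symm, by simp [Elem.step, h.1],
        fun ψ _ b hb h' => ?_⟩
      simp at hb
      simp only [EvenAt, and_true, not_and_or] at h'
      -- The parity of `ψ` plays no role here: even parity of the whole does not make both halves
      -- even, so each projection has to kill the odd states of its own half.
      simp only [Elem.act, projectEven, Slice.offset]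
      rcases h' with h' | h'
      · simp [h']
      · simp [h']
  | merge c =>
    simp only [Elem.step] at h
    cases hc : s[c]? with
    | none => simp [hc] at h
    | some e =>
      cases hc' : s[c + 1]? with
      | none => simp [hc, hc'] at h
      | some e' =>
        simp only [hc, hc'] at h
        obtain ⟨h1, h2, h3⟩ := split_at hc
        obtain ⟨h4, h5, h6⟩ := split_at hc'
        refine ⟨.merge 0, s.take c, [e, e'], [e + e'], s.drop (c + 2),
          by simp [Elem.shift, h3.le], ?_, by simpa using (Option.some.inj h).symm,
          by simp [Elem.step], fun ψ hψ b hb h' => hψ b (by simpa using hb) ?_⟩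
        · conv_lhs => rw [h4, List.take_add_one, hc]
          simp
        · simp at hb
          simp only [EvenAt, and_true] at h' ⊢
          rw [List.take_of_length_le (by omega)] at h'
          rw [List.take_of_length_le (l := b.drop e) (by simp; omega)]
          rw [← List.take_append_drop e b, List.count_append] at h'
          omega
  | cap c i =>
    have h' := h
    simp only [Elem.step] at h'
    cases hc : s[c]? with
    | none => simp [hc] at h'
    | some e =>
      simp only [hc, Option.ite_none_right_eq_some] at h'
      obtain ⟨s₁, s₃, h1, h2, h3⟩ := exists_local_of_getElem (a₀ := .cap 0 i) (e' := e + 1) hc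
        (by simp [Elem.shift]) h (by simp [Elem.step, h'.1])
      refine ⟨_, s₁, _, _, s₃, h1, h2, h3, by simp [Elem.step, h'.1], fun ψ hψ => ?_⟩
      rw [evenOn_singleton] at hψ ⊢
      simpa [Elem.act, Slice.offset] using hψ.capAt h'.1
  | cup c i =>
    have h' := h
    simp only [Elem.step] at h'
    cases hc : s[c]? with
    | none => simp [hc] at h'
    | some e =>
      simp only [hc, Option.ite_none_right_eq_some] at h'
      obtain ⟨s₁, s₃, h1, h2, h3⟩ := exists_local_of_getElem (a₀ := .cup 0 i) (e' := e - 1) hc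
        (by simp [Elem.shift]) h (by simp [Elem.step, h'.1])
      refine ⟨_, s₁, _, _, s₃, h1, h2, h3, by simp [Elem.step, h'.1], fun ψ hψ => ?_⟩
      rw [evenOn_singleton] at hψ ⊢
      obtain ⟨e, rfl⟩ : ∃ k, e = k + 1 := ⟨e - 1, by omega⟩
      simpa [Elem.act, Slice.offset] using hψ.cupAt (g := i) (by omega)
  | dots c i j =>
    have h' := h
    simp only [Elem.step] at h'
    cases hc : s[c]? with
    | none => simp [hc] at h'
    | some e =>
      simp only [hc, Option.ite_none_right_eq_some] at h'
      obtain ⟨s₁, s₃, h1, h2, h3⟩ := exists_local_of_getElem (a₀ := .dots 0 i j) (e' := e) hc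
        (by simp [Elem.shift]) h (by simp [Elem.step, h'.1])
      refine ⟨_, s₁, _, _, s₃, h1, h2, h3, by simp [Elem.step, h'.1], fun ψ hψ => ?_⟩
      rw [evenOn_singleton] at hψ ⊢
      simpa [Elem.act, Slice.offset] using hψ.parity (g := i) (g' := j) (by omega) (by omega)
        (by omega)
  | braidPos c i | braidNeg c i | scatter θ c i =>
    have h' := h
    simp only [Elem.step] at h'
    cases hc : s[c]? with
    | none => simp [hc] at h'
    | some e =>
      simp only [hc, Option.ite_none_right_eq_some] at h'
      obtain ⟨s₁, s₃, h1, h2, h3⟩ := exists_local_of_getElem (e' := e) hc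
        (by first
          | exact (show Elem.braidPos c i = (Elem.braidPos 0 i).shift c by simp [Elem.shift])
          | exact (show Elem.braidNeg c i = (Elem.braidNeg 0 i).shift c by simp [Elem.shift])
          | exact (show Elem.scatter θ c i = (Elem.scatter θ 0 i).shift c by simp [Elem.shift]))
        h (by simp [Elem.step, h'.1])
      refine ⟨_, s₁, _, _, s₃, h1, h2, h3, by simp [Elem.step, h'.1], fun ψ hψ => ?_⟩
      rw [evenOn_singleton] at hψ ⊢
      intro b hb hb'
      have := hψ.parity (g := i) (g' := i + 1) (by omega) (by omega) (by omega) b hb hb'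
      simp [Elem.act, Slice.offset, braidPosAt, braidNegAt, scatterAt, this, hψ b hb hb']
  | scatterH θ c i =>
    have h' := h
    simp only [Elem.step] at h'
    cases hc : s[c]? with
    | none => simp [hc] at h'
    | some e =>
      simp only [hc, Option.ite_none_right_eq_some] at h'
      obtain ⟨s₁, s₃, h1, h2, h3⟩ := exists_local_of_getElem (a₀ := .scatterH θ 0 i) (e' := e) hc
        (by simp [Elem.shift]) h (by simp [Elem.step, h'.1])
      refine ⟨_, s₁, _, _, s₃, h1, h2, h3, by simp [Elem.step, h'.1], fun ψ hψ => ?_⟩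
      rw [evenOn_singleton] at hψ ⊢
      obtain ⟨e, rfl⟩ : ∃ k, e = k + 1 := ⟨e - 1, by omega⟩
      intro b hb hb'
      have h5 := (hψ.cupAt (g := i) (by omega)).capAt (g := i) (by omega) b hb hb'
      have h6 := (((hψ.majorana (g := i + 1) (by omega) (by omega)).cupAt (g := i)
        (by omega)).capAt (g := i) (by omega)).majorana (g := i + 1) (by omega) (by omega) b hb
        (by simpa using hb')
      simp [Elem.act, Slice.offset, scatterHAt, h5, h6]

theorem sum_append₃ (s₁ s₂ s₃ : Slice) : (s₁ ++ s₂ ++ s₃).sum = s₁.sum + s₂.sum + s₃.sum := by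
  simp [add_assoc]

theorem exists_bits₃ {b : List Bool} {n₁ n₂ n₃ : ℕ} (h : b.length = n₁ + n₂ + n₃) :
    ∃ b₁ b₂ b₃, b = b₁ ++ b₂ ++ b₃ ∧ b₁.length = n₁ ∧ b₂.length = n₂ ∧ b₃.length = n₃ :=
  ⟨b.take n₁, (b.drop n₁).take n₂, (b.drop n₁).drop n₂, by simp, by simp; omega,
    by simp; omega, by simp; omega⟩

theorem EvenOn.frame {s₁ s₂ s₃ : Slice} {Ψ : Amp} (h : EvenOn (s₁ ++ s₂ ++ s₃) Ψ)
    {b₁ b₃ : List Bool} (h₁ : b₁.length = s₁.sum) (h₃ : b₃.length = s₃.sum) :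
    EvenOn s₂ (fun m => Ψ (b₁ ++ m ++ b₃)) := fun b hb hb' =>
  h _ (by rw [sum_append₃]; simp; omega) (by
    rw [List.append_assoc, List.append_assoc, evenAt_append h₁, evenAt_append hb]; tauto)

/-- By locality the event acts on the block of the touched components, with the outer bits fixed. If
the outer bits are odd on some component, the whole block of `Ψ` vanishes, and this is locality with
`ε = 0`. -/
theorem EvenOn.act {a : Elem} {s s' : Slice} (h : a.step s = some s') {Ψ : Amp}
    (hΨ : EvenOn s Ψ) : EvenOn s' (a.act s Ψ) := by
  obtain ⟨a₀, s₁, s₂, s₂', s₃, rfl, rfl, rfl, h₀, hE⟩ := exists_local h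
  intro b hb hb'
  rw [sum_append₃] at hb
  obtain ⟨b₁, b₂, b₃, rfl, h₁, h₂, h₃⟩ := exists_bits₃ hb
  rw [List.append_assoc, List.append_assoc, evenAt_append h₁, evenAt_append h₂] at hb'
  by_cases h4 : EvenAt s₁ b₁ ∧ EvenAt s₃ b₃
  · rw [act_frame (ε := 1) (ψ := fun m => Ψ (b₁ ++ m ++ b₃)) a₀ h₀ h₁ (fun m _ => by simp) _ h₂,
      hE _ (hΨ.frame h₁ h₃) _ h₂ (by tauto), mul_zero]
  · rw [act_frame (ε := 0) (ψ := 0) a₀ h₀ h₁ (fun m hm => ?_) _ h₂, zero_mul]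
    rw [zero_mul]
    refine hΨ _ (by rw [sum_append₃]; simp; omega) ?_
    rw [List.append_assoc, List.append_assoc, evenAt_append h₁, evenAt_append hm]; tauto

theorem EvenOn.exec {l : List Elem} {s s' : Slice} (h : runE l s = some s') {Ψ : Amp}
    (hΨ : EvenOn s Ψ) : EvenOn s' (exec l s Ψ) := by
  induction l generalizing s Ψ with
  | nil => simp [runE] at h; subst h; exact hΨ
  | cons a l ih =>
    simp only [runE, Option.bind_eq_some_iff] at h
    obtain ⟨t, ht, h⟩ := h
    simp only [Quon.exec, ht, Option.getD_some]
    exact ih h (hΨ.act ht)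

/-- The state of the empty slice. -/
noncomputable def vac : Amp := fun b => if b = [] then 1 else 0

theorem evenOn_nil (ψ : Amp) : EvenOn [] ψ := fun b _ h => by simp [EvenAt] at h

/-- Events that are related on the components that they touch are related in a diagram. -/
theorem evalElems_local {A B M M' N : List Elem} {s₁ s₂ s₂' s₃ : Slice} {c : ℕ}
    (hA : runE A [] = some (s₁ ++ s₂ ++ s₃)) (hM : runE M s₂ = some s₂')
    (hM' : runE M' s₂ = some s₂') (hN : runE N s₂ = some s₂')
    (hB : runE B (s₁ ++ s₂' ++ s₃) = some []) (hc : c = s₁.length)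
    (hloc : ∀ ψ, EvenOn s₂ ψ → ∀ b : List Bool, b.length = s₂'.sum →
      exec M s₂ ψ b + exec M' s₂ ψ b = 2 * exec N s₂ ψ b) :
    evalElems (A ++ M.map (Elem.shift c) ++ B) [] vac
      + evalElems (A ++ M'.map (Elem.shift c) ++ B) [] vac
      = 2 * evalElems (A ++ N.map (Elem.shift c) ++ B) [] vac := by
  subst hc
  have key : ∀ {K : List Elem}, runE K s₂ = some s₂' →
      evalElems (A ++ K.map (Elem.shift s₁.length) ++ B) [] vac
        = exec B (s₁ ++ s₂' ++ s₃)
          (exec (K.map (Elem.shift s₁.length)) (s₁ ++ s₂ ++ s₃) (exec A [] vac)) [] := by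
    intro K hK
    have h1 : runE (A ++ K.map (Elem.shift s₁.length)) [] = some (s₁ ++ s₂' ++ s₃) := by
      rw [runE_append, hA, Option.bind_some, runE_frame hK]
    rw [evalElems_eq (by rw [runE_append, h1, Option.bind_some, hB]), exec_append h1,
      exec_append hA]
  -- The events of `B` act linearly, so it is enough to compare the states just above them.
  rw [key hM, key hM', key hN, ← exec_add]
  refine exec_congr hB (fun b hb => ?_) rfl
  rw [sum_append₃] at hb
  obtain ⟨b₁, b₂, b₃, rfl, h₁, h₂, h₃⟩ := exists_bits₃ hb
  -- The state above the piece descends from the vacuum; this is what allows `hloc` to assume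
  -- evenness.
  have hE : EvenOn _ (exec A [] vac) := EvenOn.exec hA (evenOn_nil _)
  have hl : Loc b₁ b₃ s₂.sum 1 (exec A [] vac) (fun m => exec A [] vac (b₁ ++ m ++ b₃)) :=
    fun m _ => by simp
  rw [exec_frame hM h₁ hl _ h₂, exec_frame hM' h₁ hl _ h₂, exec_frame hN h₁ hl _ h₂]
  simpa using hloc _ (hE.frame h₁ h₃) b₂ h₂

end Quon

namespace Quon

/-! ### Local identities -/

theorem fourthRootTwo_ne_zero : fourthRootTwo ≠ 0 := by
  rw [fourthRootTwo, Complex.ofReal_ne_zero]; positivity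

theorem fourthRootTwo_sq : fourthRootTwo ^ 2 = (Real.sqrt 2 : ℝ) := by
  rw [fourthRootTwo, ← Complex.ofReal_pow, ← Real.rpow_natCast, ← Real.rpow_mul (by norm_num),
    Real.sqrt_eq_rpow]
  norm_num

/-- The sign `(-1)^v`. -/
def sgn (v : Bool) : ℂ := if v then -1 else 1

section
attribute [local simp] exec Elem.step Elem.act Slice.offset cupAt capAt bit projectEven
  parity majorana sgn

/-- The basis encoder of a leg pointing up. -/
def encIn (v : Bool) : List Elem :=
  [.birth 0, .cap 0 0, .cap 0 1] ++ (if v then [.dots 0 2 3] else [])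

/-- The basis encoder of a leg pointing down. -/
def encOut (v : Bool) : List Elem :=
  (if v then [.dots 0 2 3] else []) ++ [.cup 0 1, .cup 0 0, .death 0]

/-- The events of a strip bent like a cap. -/
def bendTopE : List Elem := [.birth 0, .cap 0 0, .cap 0 1, .cap 0 2, .cap 0 3, .split 0 2]

/-- The events of a strip bent like a cup. -/
def bendBotE : List Elem := [.merge 0, .cup 0 3, .cup 0 2, .cup 0 1, .cup 0 0, .death 0]

/-- The outer cap creates a bit `0` with the factor `2^(1/4)`; the inner one spreads it to `|00⟩ +
|11⟩` with the inverse factor. The dots on the last two strings are `Z` on the second bit. The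
encoders thus form the Hadamard basis of the even states, and this is the origin of the signs `sgn
v` everywhere below. -/
theorem exec_encIn (v : Bool) (ψ : Amp) (p q : Bool) :
    exec (encIn v) [] ψ [p, q] = if p = q then (if p then sgn v else 1) * ψ [] else 0 := by
  have := fourthRootTwo_ne_zero
  cases v <;> cases p <;> cases q <;> simp [encIn, this, ← mul_assoc]

theorem exec_encOut (v : Bool) (ψ : Amp) :
    exec (encOut v) [2] ψ [] = ψ [false, false] + sgn v * ψ [true, true] := by
  have := fourthRootTwo_ne_zero
  cases v <;> simp [encOut, this, ← mul_assoc]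

/-- The four nested caps give `∑ₚ |p, q, q, p⟩` summed over both bits, and the splitting retains the
terms in which both halves are even. -/
theorem exec_bendTopE (ψ : Amp) (p q r s : Bool) :
    exec bendTopE [] ψ [p, q, r, s] = if p = q ∧ q = r ∧ r = s then ψ [] else 0 := by
  have := fourthRootTwo_ne_zero
  cases p <;> cases q <;> cases r <;> cases s <;> simp [bendTopE, this]

/-- No projection takes place at a merging. On states that are even on both components the two
middle terms vanish, which leaves the maximally entangled functional. -/
theorem exec_bendBotE (ψ : Amp) :
    exec bendBotE [2, 2] ψ [] = ψ [false, false, false, false] + ψ [false, true, true, false]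
      + ψ [true, false, false, true] + ψ [true, true, true, true] := by
  have := fourthRootTwo_ne_zero
  simp [bendBotE]
  field_simp
  ring

theorem exec_bendTop_encOut (v : Bool) (ψ : Amp) (p q : Bool) :
    exec (bendTopE ++ encOut v) [] ψ [p, q] = exec (encIn v) [] ψ [p, q] ∧
    exec (bendTopE ++ (encOut v).map (Elem.shift 1)) [] ψ [p, q] = exec (encIn v) [] ψ [p, q] := by
  have := fourthRootTwo_ne_zero
  rw [exec_encIn]
  constructor <;> cases v <;> cases p <;> cases q <;>
    simp [bendTopE, encOut, Elem.shift, this] <;> (try field_simp) <;> (try ring_nf) <;>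
    (try simp [Complex.I_sq])

theorem exec_encIn_bendBot (v : Bool) (ψ : Amp) (h : EvenOn [2] ψ) :
    exec (encIn v ++ bendBotE) [2] ψ [] = exec (encOut v) [2] ψ [] ∧
    exec ((encIn v).map (Elem.shift 1) ++ bendBotE) [2] ψ [] = exec (encOut v) [2] ψ [] := by
  have := fourthRootTwo_ne_zero
  have h1 : ψ [false, true] = 0 := h _ rfl (by simp [EvenAt])
  have h2 : ψ [true, false] = 0 := h _ rfl (by simp [EvenAt])
  rw [exec_encOut]
  constructor <;> cases v <;> simp [bendBotE, encIn, Elem.shift] <;> (try field_simp) <;> (try ring_nf) <;>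
    (try simp [Complex.I_sq]) <;> (try ring_nf)

/-- Completeness of the Hadamard basis, whose vectors `|00⟩ ± |11⟩` have squared norm `2`. It holds
on even states only, as the encoders span nothing else. -/
theorem exec_encOut_encIn (ψ : Amp) (h : EvenOn [2] ψ) (p q : Bool) :
    exec (encOut false ++ encIn false) [2] ψ [p, q]
      + exec (encOut true ++ encIn true) [2] ψ [p, q] = 2 * exec [] [2] ψ [p, q] := by
  have := fourthRootTwo_ne_zero
  have h1 : ψ [false, true] = 0 := h _ rfl (by simp [EvenAt])
  have h2 : ψ [true, false] = 0 := h _ rfl (by simp [EvenAt])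
  cases p <;> cases q <;> simp [encOut, encIn, h1, h2] <;> (try field_simp) <;> (try ring_nf) <;>
    (try simp [Complex.I_pow_four]) <;> (try ring_nf)

theorem exec_encOut_encOut (ψ : Amp) (h : EvenOn [2, 2] ψ) :
    exec (encOut false ++ encOut false) [2, 2] ψ []
      + exec (encOut true ++ encOut true) [2, 2] ψ [] = 2 * exec bendBotE [2, 2] ψ [] := by
  have := fourthRootTwo_ne_zero
  have h1 : ψ [false, true, true, false] = 0 := h _ rfl (by simp [EvenAt])
  have h2 : ψ [true, false, false, true] = 0 := h _ rfl (by simp [EvenAt])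
  rw [exec_bendBotE]
  simp [encOut, h1, h2] <;> (try field_simp) <;> (try ring_nf) <;>
    (try simp [Complex.I_pow_four]) <;> (try ring_nf)

theorem exec_encIn_encIn (ψ : Amp) (p q r s : Bool) :
    exec (encIn false ++ (encIn false).map (Elem.shift 1)) [] ψ [p, q, r, s]
      + exec (encIn true ++ (encIn true).map (Elem.shift 1)) [] ψ [p, q, r, s]
      = 2 * exec bendTopE [] ψ [p, q, r, s] := by
  have := fourthRootTwo_ne_zero
  rw [exec_bendTopE]
  cases p <;> cases q <;> cases r <;> cases s <;> simp [encIn, Elem.shift, this] <;> (try field_simp) <;> (try ring_nf) <;>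
    (try simp [Complex.I_pow_four]) <;> (try ring_nf)
end

/-! ### Layers -/

/-- The events of a sequence of layers. -/
def elems (x : ℕ → Bool) (L : List Layer) : List Elem := L.flatMap (Layer.toElems x)

theorem eval_eq (L : List Layer) (x : ℕ → Bool) : eval L x = evalElems (elems x L) [] vac := rfl

theorem elems_append (x : ℕ → Bool) (L L' : List Layer) :
    elems x (L ++ L') = elems x L ++ elems x L' := List.flatMap_append

theorem toElems_legIn (x : ℕ → Bool) (c ℓ : ℕ) :
    (Layer.legIn c ℓ).toElems x = (encIn (x ℓ)).map (Elem.shift c) := by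
  cases h : x ℓ <;> simp [Layer.toElems, encIn, Elem.shift, h]

theorem toElems_legOut (x : ℕ → Bool) (c ℓ : ℕ) :
    (Layer.legOut c ℓ).toElems x = (encOut (x ℓ)).map (Elem.shift c) := by
  cases h : x ℓ <;> simp [Layer.toElems, encOut, Elem.shift, h]

theorem elems_ev (x : ℕ → Bool) (l : List Elem) : elems x (l.map Layer.ev) = l := by
  simp [elems, List.flatMap_map, Layer.toElems]

theorem run_append (L L' : List Layer) (s : Slice) :
    run (L ++ L') s = (run L s).bind (run L') := by
  induction L generalizing s with
  | nil => simp [run]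
  | cons a l ih => cases h : a.step s <;> simp [run, h, ih]

theorem run_ev (l : List Elem) (s : Slice) : run (l.map Layer.ev) s = runE l s := by
  induction l generalizing s with
  | nil => rfl
  | cons a l ih => simp only [List.map_cons, run, runE, Layer.step]; congr 1; funext s; exact ih s

theorem runE_encIn (v : Bool) : runE (encIn v) [] = some [2] := by cases v <;> rfl

theorem runE_encOut (v : Bool) : runE (encOut v) [2] = some [] := by cases v <;> rfl

theorem step_legIn {c ℓ : ℕ} {s s' : Slice} (h : (Layer.legIn c ℓ).step s = some s') :
    ∃ s₁ s₃ : Slice, c = s₁.length ∧ s = s₁ ++ [] ++ s₃ ∧ s' = s₁ ++ [2] ++ s₃ := by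
  simp only [Layer.step, Option.ite_none_right_eq_some] at h
  exact ⟨s.take c, s.drop c, by simp [h.1], by simp, by simpa using (Option.some.inj h.2).symm⟩

theorem step_legOut {c ℓ : ℕ} {s s' : Slice} (h : (Layer.legOut c ℓ).step s = some s') :
    ∃ s₁ s₃ : Slice, c = s₁.length ∧ s = s₁ ++ [2] ++ s₃ ∧ s' = s₁ ++ [] ++ s₃ := by
  simp only [Layer.step, Option.ite_none_right_eq_some] at h
  obtain ⟨h1, h2, _⟩ := split_at h.1
  refine ⟨s.take c, s.drop (c + 1), h2.symm, by simpa using h1, ?_⟩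
  rw [← Option.some.inj h.2, List.eraseIdx_eq_take_drop_succ]; simp

theorem runE_toElems (x : ℕ → Bool) {l : Layer} {s s' : Slice} (h : l.step s = some s') :
    runE (l.toElems x) s = some s' := by
  cases l with
  | ev a => simpa [Layer.toElems, runE, Layer.step] using h
  | legIn c ℓ =>
    obtain ⟨s₁, s₃, rfl, rfl, rfl⟩ := step_legIn h
    rw [toElems_legIn]; exact runE_frame (runE_encIn _) _ _
  | legOut c ℓ =>
    obtain ⟨s₁, s₃, rfl, rfl, rfl⟩ := step_legOut h
    rw [toElems_legOut]; exact runE_frame (runE_encOut _) _ _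

theorem runE_elems (x : ℕ → Bool) {L : List Layer} {s s' : Slice} (h : run L s = some s') :
    runE (elems x L) s = some s' := by
  induction L generalizing s with
  | nil => exact h
  | cons a l ih =>
    simp only [run, Option.bind_eq_some_iff] at h
    obtain ⟨t, ht, h⟩ := h
    rw [elems, List.flatMap_cons, runE_append, runE_toElems x ht, Option.bind_some]
    exact ih h

theorem closed_append₃ {A K B : List Layer} (h : Closed (A ++ K ++ B)) :
    ∃ s s', run A [] = some s ∧ run K s = some s' ∧ run B s' = some [] := by
  rw [Closed, run_append, run_append] at h
  simp only [Option.bind_eq_some_iff] at h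
  obtain ⟨s', ⟨s, h1, h2⟩, h3⟩ := h
  exact ⟨s, s', h1, h2, h3⟩

theorem closed_of_run {A K B : List Layer} {s s' : Slice} (hA : run A [] = some s)
    (hK : run K s = some s') (hB : run B s' = some []) : Closed (A ++ K ++ B) := by
  rw [Closed, run_append, run_append, hA, Option.bind_some, hK, Option.bind_some, hB]

theorem bendTop_eq (c : ℕ) : bendTop c = (bendTopE.map (Elem.shift c)).map Layer.ev := rfl

theorem bendBot_eq (c : ℕ) : bendBot c = (bendBotE.map (Elem.shift c)).map Layer.ev := rfl

/-- Pieces of a diagram that are related on the components that they touch. -/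
theorem eval_local {A B K K' N : List Layer} {k k' n : List Elem} {s₁ s₂ s₂' s₃ : Slice}
    (x x₁ x₂ : ℕ → Bool) (hA : run A [] = some (s₁ ++ s₂ ++ s₃))
    (hB : run B (s₁ ++ s₂' ++ s₃) = some [])
    (hK : elems x₁ K = k.map (Elem.shift s₁.length))
    (hK' : elems x₂ K' = k'.map (Elem.shift s₁.length))
    (hN : elems x N = n.map (Elem.shift s₁.length))
    (rk : runE k s₂ = some s₂') (rk' : runE k' s₂ = some s₂') (rn : runE n s₂ = some s₂')
    (h₁ : ∀ L ∈ [A, B], elems x₁ L = elems x L) (h₂ : ∀ L ∈ [A, B], elems x₂ L = elems x L)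
    (hloc : ∀ ψ, EvenOn s₂ ψ → ∀ b : List Bool, b.length = s₂'.sum →
      exec k s₂ ψ b + exec k' s₂ ψ b = 2 * exec n s₂ ψ b) :
    eval (A ++ K ++ B) x₁ + eval (A ++ K' ++ B) x₂ = 2 * eval (A ++ N ++ B) x := by
  simp only [List.mem_cons, List.not_mem_nil, or_false, forall_eq_or_imp, forall_eq] at h₁ h₂
  have := evalElems_local (runE_elems x hA) rk rk' rn (runE_elems x hB) rfl hloc
  simpa only [eval_eq, elems_append, hK, hK', hN, h₁.1, h₁.2, h₂.1, h₂.2] using this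

theorem forall_length_two {P : List Bool → Prop} (h : ∀ p q, P [p, q]) (b : List Bool)
    (hb : b.length = 2) : P b := by
  match b, hb with
  | [p, q], _ => exact h p q

theorem forall_length_four {P : List Bool → Prop} (h : ∀ p q r s, P [p, q, r, s])
    (b : List Bool) (hb : b.length = 4) : P b := by
  match b, hb with
  | [p, q, r, s], _ => exact h p q r s

/-- A piece of a diagram may be replaced by one that agrees with it locally. -/
theorem replace_local {A B K N : List Layer} {s₁ s₂ s₂' s₃ : Slice} (k n : (ℕ → Bool) → List Elem)
    (hA : run A [] = some (s₁ ++ s₂ ++ s₃)) (hB : run B (s₁ ++ s₂' ++ s₃) = some [])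
    (hK' : run K (s₁ ++ s₂ ++ s₃) = some (s₁ ++ s₂' ++ s₃))
    (hK : ∀ x, elems x K = (k x).map (Elem.shift s₁.length))
    (hN : ∀ x, elems x N = (n x).map (Elem.shift s₁.length))
    (rk : ∀ x, runE (k x) s₂ = some s₂') (rn : ∀ x, runE (n x) s₂ = some s₂')
    (hloc : ∀ x ψ, EvenOn s₂ ψ → ∀ b : List Bool, b.length = s₂'.sum →
      exec (k x) s₂ ψ b = exec (n x) s₂ ψ b) :
    Closed (A ++ K ++ B) ∧ ∀ x, eval (A ++ K ++ B) x = eval (A ++ N ++ B) x := by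
  refine ⟨closed_of_run hA hK' hB, fun x => ?_⟩
  -- With both pieces equal, the relation for sums reads `2 K = 2 N`.
  have := eval_local (K := K) (K' := K) x x x hA hB (hK x) (hK x) (hN x) (rk x) (rk x) (rn x)
    (by simp) (by simp) (fun ψ h b hb => by rw [hloc x ψ h b hb]; ring)
  linear_combination this / 2

theorem run_of_elems {K : List Layer} {s₁ s₂ s₂' s₃ : Slice} {k : List Elem}
    (h : K = (k.map (Elem.shift s₁.length)).map Layer.ev) (hk : runE k s₂ = some s₂') :
    run K (s₁ ++ s₂ ++ s₃) = some (s₁ ++ s₂' ++ s₃) := by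
  rw [h, run_ev]; exact runE_frame hk _ _

theorem run_legOut (s₁ s₃ : Slice) (c ℓ : ℕ) (hc : c = s₁.length) :
    run [.legOut c ℓ] (s₁ ++ [2] ++ s₃) = some (s₁ ++ s₃) := by
  subst hc; simp [run, Layer.step, List.eraseIdx_append_of_length_le]

theorem run_legIn (s₁ s₃ : Slice) (c ℓ : ℕ) (hc : c = s₁.length) :
    run [.legIn c ℓ] (s₁ ++ s₃) = some (s₁ ++ [2] ++ s₃) := by
  subst hc; simp [run, Layer.step]

theorem map_shift_shift (l : List Elem) (d e : ℕ) :
    (l.map (Elem.shift e)).map (Elem.shift d) = l.map (Elem.shift (d + e)) := by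
  rw [List.map_map]; congr 1; funext a; cases a <;> simp [Elem.shift, add_assoc]

theorem elems_cons (x : ℕ → Bool) (a : Layer) (L : List Layer) :
    elems x (a :: L) = a.toElems x ++ elems x L := List.flatMap_cons

theorem elems_nil (x : ℕ → Bool) : elems x [] = [] := rfl

theorem elems_bendTop (x : ℕ → Bool) (c : ℕ) :
    elems x (bendTop c) = bendTopE.map (Elem.shift c) := by rw [bendTop_eq, elems_ev]

theorem elems_bendBot (x : ℕ → Bool) (c : ℕ) :
    elems x (bendBot c) = bendBotE.map (Elem.shift c) := by rw [bendBot_eq, elems_ev]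

theorem legBending : LegBending := by
  intro A B c ℓ
  constructor
  · intro h
    obtain ⟨s, s', hA, hK, hB⟩ := closed_append₃ h
    simp only [run, Option.bind_eq_some_iff, Option.some.injEq, exists_eq_right] at hK
    obtain ⟨s₁, s₃, hc, rfl, rfl⟩ := step_legIn hK
    have key := fun K k => replace_local (K := K) k (N := [Layer.legIn c ℓ])
      (fun x => encIn (x ℓ)) hA hB
    have r : run (bendTop c) (s₁ ++ [] ++ s₃) = some (s₁ ++ [2, 2] ++ s₃) :=
      run_of_elems (by rw [bendTop_eq, hc]) rfl
    have h1 := key (bendTop c ++ [.legOut c ℓ]) (fun x => bendTopE ++ encOut (x ℓ))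
      (by
        rw [run_append, r, Option.bind_some]
        simpa using run_legOut s₁ (2 :: s₃) c ℓ hc)
      (fun x => by
        simp [elems_append, elems_bendTop, elems_cons, elems_nil, toElems_legOut, hc])
      (fun x => by simp [elems_cons, elems_nil, toElems_legIn, hc])
      (fun x => by cases x ℓ <;> rfl) (fun x => runE_encIn _)
      (fun x ψ _ => forall_length_two fun p q => (exec_bendTop_encOut _ ψ p q).1)
    have h2 := key (bendTop c ++ [.legOut (c + 1) ℓ])
      (fun x => bendTopE ++ (encOut (x ℓ)).map (Elem.shift 1))
      (by
        rw [run_append, r, Option.bind_some]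
        rw [show s₁ ++ [2, 2] ++ s₃ = s₁ ++ [2] ++ [2] ++ s₃ by simp]
        exact run_legOut (s₁ ++ [2]) s₃ (c + 1) ℓ (by simp [hc]))
      (fun x => by
        simp [elems_append, elems_bendTop, elems_cons, elems_nil, toElems_legOut, hc,
          -List.map_map, map_shift_shift])
      (fun x => by simp [elems_cons, elems_nil, toElems_legIn, hc])
      (fun x => by cases x ℓ <;> rfl) (fun x => runE_encIn _)
      (fun x ψ _ => forall_length_two fun p q => (exec_bendTop_encOut _ ψ p q).2)
    simp only [List.append_assoc] at h1 h2 ⊢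
    exact ⟨h1.1, h2.1, fun x => ⟨h1.2 x, h2.2 x⟩⟩
  · intro h
    obtain ⟨s, s', hA, hK, hB⟩ := closed_append₃ h
    simp only [run, Option.bind_eq_some_iff, Option.some.injEq, exists_eq_right] at hK
    obtain ⟨s₁, s₃, hc, rfl, rfl⟩ := step_legOut hK
    have key := fun K k => replace_local (K := K) k (N := [Layer.legOut c ℓ])
      (fun x => encOut (x ℓ)) hA hB
    have r : run (bendBot c) (s₁ ++ [2, 2] ++ s₃) = some (s₁ ++ [] ++ s₃) :=
      run_of_elems (by rw [bendBot_eq, hc]) rfl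
    have h1 := key ([.legIn c ℓ] ++ bendBot c) (fun x => encIn (x ℓ) ++ bendBotE)
      (by
        rw [run_append, List.append_assoc, run_legIn s₁ _ c ℓ hc, Option.bind_some]
        simpa using r)
      (fun x => by
        simp [elems_bendBot, elems_cons, toElems_legIn, hc])
      (fun x => by simp [elems_cons, elems_nil, toElems_legOut, hc])
      (fun x => by cases x ℓ <;> rfl) (fun x => runE_encOut _)
      (fun x ψ hψ b hb => by
        rw [List.length_eq_zero_iff.1 hb]; exact (exec_encIn_bendBot _ ψ hψ).1)
    have h2 := key ([.legIn (c + 1) ℓ] ++ bendBot c)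
      (fun x => (encIn (x ℓ)).map (Elem.shift 1) ++ bendBotE)
      (by
        rw [run_append, run_legIn (s₁ ++ [2]) _ (c + 1) ℓ (by simp [hc]), Option.bind_some]
        simpa using r)
      (fun x => by
        simp [elems_bendBot, elems_cons, toElems_legIn, hc,
          -List.map_map, map_shift_shift])
      (fun x => by simp [elems_cons, elems_nil, toElems_legOut, hc])
      (fun x => by cases x ℓ <;> rfl) (fun x => runE_encOut _)
      (fun x ψ hψ b hb => by
        rw [List.length_eq_zero_iff.1 hb]; exact (exec_encIn_bendBot _ ψ hψ).2)
    simp only [List.append_assoc] at h1 h2 ⊢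
    exact ⟨h1.1, h2.1, fun x => ⟨h1.2 x, h2.2 x⟩⟩

end Quon

/-! ### Contraction of legs and products of diagrams -/

namespace Quon

theorem elems_congr {x y : ℕ → Bool} {L : List Layer} (h : ∀ ℓ ∈ legs L, x ℓ = y ℓ) :
    elems x L = elems y L := by
  induction L with
  | nil => rfl
  | cons a L ih =>
    rw [elems_cons, elems_cons]
    cases a with
    | ev a => rw [ih fun ℓ hℓ => h ℓ (by simpa [legs] using hℓ)]; rfl
    | legIn c ℓ =>
      rw [ih fun ℓ hℓ => h ℓ (by simp [legs, hℓ]), toElems_legIn, toElems_legIn,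
        h ℓ (by simp [legs])]
    | legOut c ℓ =>
      rw [ih fun ℓ hℓ => h ℓ (by simp [legs, hℓ]), toElems_legOut, toElems_legOut,
        h ℓ (by simp [legs])]

theorem legs_append (L L' : List Layer) : legs (L ++ L') = legs L ++ legs L' := by
  induction L with
  | nil => rfl
  | cons a L ih => cases a <;> simp [legs, ih]

/-- Contraction of two legs, from a local identity. -/
theorem contract_local {A B K N : List Layer} {ℓ ℓ' : ℕ} {s₁ s₂ s₂' s₃ : Slice}
    (k : Bool → List Elem) (n : List Elem) (hA : run A [] = some (s₁ ++ s₂ ++ s₃))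
    (hB : run B (s₁ ++ s₂' ++ s₃) = some []) (hK : ∀ x, x ℓ = x ℓ' →
      elems x K = (k (x ℓ)).map (Elem.shift s₁.length))
    (hN : ∀ x, elems x N = n.map (Elem.shift s₁.length))
    (hN' : run N (s₁ ++ s₂ ++ s₃) = some (s₁ ++ s₂' ++ s₃))
    (rk : ∀ v, runE (k v) s₂ = some s₂') (rn : runE n s₂ = some s₂')
    (hl : legs K = [ℓ, ℓ']) (hd : (legs (A ++ K ++ B)).Nodup)
    (hloc : ∀ ψ, EvenOn s₂ ψ → ∀ b : List Bool, b.length = s₂'.sum →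
      exec (k false) s₂ ψ b + exec (k true) s₂ ψ b = 2 * exec n s₂ ψ b) :
    Closed (A ++ N ++ B) ∧
      ∀ x, contract (A ++ K ++ B) ℓ ℓ' x = 2 * eval (A ++ N ++ B) x := by
  refine ⟨closed_of_run hA hN' hB, fun x => ?_⟩
  have hu : ∀ v, ∀ L ∈ [A, B],
      elems (Function.update (Function.update x ℓ v) ℓ' v) L = elems x L := by
    intro v L hL
    refine elems_congr fun j hj => ?_
    rw [legs_append, legs_append, hl] at hd
    -- Labels do not repeat in the diagram, so the layers of `A` and `B` do not see the summation
    -- index.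
    have h1 : j ≠ ℓ ∧ j ≠ ℓ' := by
      simp only [List.mem_cons, List.not_mem_nil, or_false] at hL
      simp only [List.nodup_append, List.mem_append, List.mem_cons, List.not_mem_nil,
        or_false] at hd
      rcases hL with rfl | rfl
      · exact ⟨fun e => hd.1.2.2 j hj ℓ (by simp) e, fun e => hd.1.2.2 j hj ℓ' (by simp) e⟩
      · exact ⟨fun e => hd.2.2 ℓ (by simp) j hj e.symm, fun e => hd.2.2 ℓ' (by simp) j hj e.symm⟩
    rw [Function.update_of_ne h1.2, Function.update_of_ne h1.1]
  have hv : ∀ v, elems (Function.update (Function.update x ℓ v) ℓ' v) K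
      = (k v).map (Elem.shift s₁.length) := by
    intro v
    have h1 : Function.update (Function.update x ℓ v) ℓ' v ℓ = v := by
      by_cases h : ℓ = ℓ' <;> simp [h]
    rw [hK _ (by rw [h1]; simp), h1]
  rw [contract, Fintype.sum_bool, add_comm]
  exact eval_local x _ _ hA hB (hv false) (hv true) (hN x) (rk _) (rk _) rn (hu false) (hu true)
    hloc

theorem contraction : Contraction := by
  intro A B c ℓ ℓ'
  refine ⟨fun h hd => ?_, fun h hd => ?_, fun h hd => ?_⟩ <;>
    obtain ⟨s, s', hA, hK, hB⟩ := closed_append₃ h <;>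
    simp only [run, Option.bind_eq_some_iff, Option.some.injEq, exists_eq_right] at hK <;>
    obtain ⟨t, hK, hK'⟩ := hK
  · obtain ⟨s₁, s₃, hc, rfl, rfl⟩ := step_legOut hK
    obtain ⟨s₁', s₃', hc', e, rfl⟩ := step_legIn hK'
    simp only [List.append_nil] at e
    obtain ⟨rfl, rfl⟩ := List.append_inj e (hc.symm.trans hc')
    have := contract_local (N := []) (fun v => encOut v ++ encIn v) [] hA hB
      (fun x hx => by
        simp [elems_cons, elems_nil, toElems_legIn, toElems_legOut, hc, hx])
      (fun x => rfl) rfl (fun v => by cases v <;> rfl) rfl rfl hd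
      (fun ψ hψ => forall_length_two (exec_encOut_encIn ψ hψ))
    simpa using this
  · obtain ⟨s₁, s₃, hc, rfl, rfl⟩ := step_legOut hK
    obtain ⟨s₁', s₃', hc', e, rfl⟩ := step_legOut hK'
    simp only [List.append_nil, List.append_assoc] at e
    obtain ⟨rfl, rfl⟩ := List.append_inj e (hc.symm.trans hc')
    simp only [List.append_assoc, List.cons_append, List.nil_append] at hA
    exact contract_local (s₂ := [2, 2]) (N := bendBot c) (fun v => encOut v ++ encOut v) bendBotE
      (by simpa using hA) hB
      (fun x hx => by
        simp [elems_cons, elems_nil, toElems_legOut, hc, hx])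
      (fun x => by rw [elems_bendBot, hc])
      (run_of_elems (by rw [bendBot_eq, hc]) rfl) (fun v => by cases v <;> rfl) rfl rfl hd
      (fun ψ hψ b hb => by rw [List.length_eq_zero_iff.1 hb]; exact exec_encOut_encOut ψ hψ)
  · obtain ⟨s₁, s₃, hc, rfl, rfl⟩ := step_legIn hK
    obtain ⟨s₁', s₃', hc', e, rfl⟩ := step_legIn hK'
    simp only [List.append_nil] at e
    obtain ⟨rfl, rfl⟩ := List.append_inj e (by simp [← hc, hc'])
    exact contract_local (s₂' := [2, 2]) (N := bendTop c)
      (fun v => encIn v ++ (encIn v).map (Elem.shift 1)) bendTopE hA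
      (by simpa using hB)
      (fun x hx => by
        simp [elems_cons, elems_nil, toElems_legIn, hc, hx, -List.map_map, map_shift_shift])
      (fun x => by rw [elems_bendTop, hc])
      (run_of_elems (by rw [bendTop_eq, hc]) rfl) (fun v => by cases v <;> rfl) rfl rfl hd
      (fun ψ _ => forall_length_four (exec_encIn_encIn ψ))

theorem elems_shift (x : ℕ → Bool) (L : List Layer) (c : ℕ) :
    elems x (L.map (Layer.shift c)) = (elems x L).map (Elem.shift c) := by
  induction L with
  | nil => rfl
  | cons a L ih =>
    rw [List.map_cons, elems_cons, elems_cons, ih, List.map_append]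
    congr 1
    cases a with
    | ev a => rfl
    | legIn d ℓ => simp only [Layer.shift, toElems_legIn, map_shift_shift]
    | legOut d ℓ => simp only [Layer.shift, toElems_legOut, map_shift_shift]

theorem run_shift {L : List Layer} {s₂ s₂' : Slice} (h : run L s₂ = some s₂') (s₁ s₃ : Slice) :
    run (L.map (Layer.shift s₁.length)) (s₁ ++ s₂ ++ s₃) = some (s₁ ++ s₂' ++ s₃) := by
  induction L generalizing s₂ with
  | nil => simp_all [run]
  | cons a l ih =>
    simp only [run, Option.bind_eq_some_iff] at h
    obtain ⟨t, ht, h⟩ := h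
    have : (a.shift s₁.length).step (s₁ ++ s₂ ++ s₃) = some (s₁ ++ t ++ s₃) := by
      cases a with
      | ev a => exact step_frame a ht s₁ s₃
      | legIn c ℓ =>
        obtain ⟨t₁, t₃, rfl, rfl, rfl⟩ := step_legIn ht
        have := run_legIn (s₁ ++ t₁) (t₃ ++ s₃) (s₁.length + t₁.length) ℓ (by simp)
        simpa [run, Layer.shift] using this
      | legOut c ℓ =>
        obtain ⟨t₁, t₃, rfl, rfl, rfl⟩ := step_legOut ht
        have := run_legOut (s₁ ++ t₁) (t₃ ++ s₃) (s₁.length + t₁.length) ℓ (by simp)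
        simpa [run, Layer.shift] using this
    simp only [List.map_cons, run, this, Option.bind_some]
    exact ih h

/-- The block above `l` is empty, so the state restricted to it is a number. That number is taken
for `ε` and multiplies the vacuum. -/
theorem exec_closed {l : List Elem} {s₁ s₂' s₃ : Slice} (h : runE l [] = some s₂') (Ψ : Amp)
    {b₁ m b₃ : List Bool} (h₁ : b₁.length = s₁.sum) (h₂ : m.length = s₂'.sum) :
    exec (l.map (Elem.shift s₁.length)) (s₁ ++ [] ++ s₃) Ψ (b₁ ++ m ++ b₃)
      = Ψ (b₁ ++ b₃) * exec l [] vac m :=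
  exec_frame h h₁ (fun m hm => by rw [List.length_eq_zero_iff.1 hm]; simp [vac]) _ h₂

theorem merging : Merging := by
  intro A B L s c hAB hA hc hL
  have hB : run B s = some [] := by rw [Closed, run_append, hA] at hAB; exact hAB
  have e1 : s = s.take c ++ [] ++ s.drop c := by simp
  have e2 : (s.take c).length = c := by simp [hc]
  have hK : run (L.map (Layer.shift c)) s = some s := by
    have := run_shift hL (s.take c) (s.drop c)
    rwa [e2, ← e1] at this
  refine ⟨closed_of_run hA hK hB, fun x => ?_⟩
  have rA := runE_elems x hA
  have rB := runE_elems x hB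
  have rK := runE_elems x hK
  have rL := runE_elems x hL
  have rAK : runE (elems x A ++ elems x (L.map (Layer.shift c))) [] = some s := by
    rw [runE_append, rA, Option.bind_some, rK]
  rw [eval_eq, eval_eq, eval_eq, elems_append, elems_append, elems_append,
    evalElems_eq (by rw [runE_append, rAK, Option.bind_some, rB]), exec_append rAK,
    exec_append rA, evalElems_eq (by rw [runE_append, rA, Option.bind_some, rB]),
    exec_append rA, evalElems_eq rL, mul_comm]
  refine exec_congr rB (fun b hb => ?_) rfl
  -- The middle block is empty: it marks the place at which the closed diagram is drawn.
  obtain ⟨b₁, b₂, b₃, rfl, h₁, h₂, h₃⟩ :=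
    exists_bits₃ (n₁ := (s.take c).sum) (n₂ := 0) (n₃ := (s.drop c).sum) (b := b)
      (by rw [hb, add_zero, sum_take_add_drop])
  have := exec_closed (s₃ := s.drop c) rL (exec (elems x A) [] vac) (b₃ := b₃) h₁ h₂
  rw [e2, ← e1] at this
  rw [elems_shift, this, List.length_eq_zero_iff.1 h₂]
  simp [mul_comm]

end Quon

namespace Quon

/-! ### Legs on the lower side and rotation -/

/-- The amplitude of a state on wires that end at legs with the given indices. -/
noncomputable def outVal : List Bool → Amp → ℂ
  | [], ψ => ψ []
  | v :: vs, ψ => outVal vs fun m => ψ (false :: false :: m) + sgn v * ψ (true :: true :: m)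

theorem outVal_congr {vs : List Bool} {ψ φ : Amp}
    (h : ∀ m : List Bool, m.length = 2 * vs.length → ψ m = φ m) : outVal vs ψ = outVal vs φ := by
  induction vs generalizing ψ φ with
  | nil => exact h [] rfl
  | cons v vs ih =>
    refine ih fun m hm => ?_
    rw [h _ (by simp; omega), h _ (by simp; omega)]

theorem outVal_append_singleton (vs : List Bool) (v : Bool) (ψ : Amp) :
    outVal (vs ++ [v]) ψ
      = outVal vs fun m => ψ (m ++ [false, false]) + sgn v * ψ (m ++ [true, true]) := by
  induction vs generalizing ψ with
  | nil => rfl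
  | cons w vs ih => simp only [List.cons_append, outVal, ih]; congr 1; funext m; ring

theorem run_outs (ls : List ℕ) :
    run (ls.map (Layer.legOut 0)) (List.replicate ls.length 2) = some [] := by
  induction ls with
  | nil => rfl
  | cons ℓ ls ih => simpa [run, Layer.step, List.replicate_succ] using ih

/-- All legs end at the component `0`, since the removal of a wire makes its right neighbour the
first one. -/
theorem exec_outs (x : ℕ → Bool) (ls : List ℕ) (ψ : Amp) :
    exec (elems x (ls.map (Layer.legOut 0))) (List.replicate ls.length 2) ψ []
      = outVal (ls.map x) ψ := by
  induction ls generalizing ψ with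
  | nil => rfl
  | cons ℓ ls ih =>
    have h0 : runE ((encOut (x ℓ)).map (Elem.shift 0))
        ([] ++ [2] ++ List.replicate ls.length 2) = some ([] ++ [] ++ List.replicate ls.length 2) :=
      runE_frame (runE_encOut _) [] _
    rw [List.map_cons, List.map_cons, elems_cons, toElems_legOut, List.length_cons,
      List.replicate_succ, show 2 :: List.replicate ls.length 2
        = [] ++ [2] ++ List.replicate ls.length 2 from rfl, exec_append h0, outVal, ← ih,
      List.append_nil, List.nil_append]
    have h1 := exec_congr (runE_elems x (run_outs ls)) (ε := 1)
      (Ψ := exec ((encOut (x ℓ)).map (Elem.shift 0))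
        ([] ++ [2] ++ List.replicate ls.length 2) ψ)
      (ψ := fun m => ψ (false :: false :: m) + sgn (x ℓ) * ψ (true :: true :: m)) (b := [])
      (fun m hm => ?_) rfl
    · simpa using h1
    · have := exec_frame (s₁ := []) (b₁ := []) (b₃ := m) (ε := 1) (s₃ := List.replicate ls.length 2)
        (runE_encOut (x ℓ)) (Ψ := ψ) (ψ := fun k => ψ (k ++ m)) rfl (fun k _ => by simp) [] rfl
      simp only [List.nil_append] at this ⊢
      rw [List.length_nil] at this
      rw [this, exec_encOut]; rfl

theorem shift_one_ev (es : List Elem) (d : ℕ) :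
    (es.map Layer.ev).map (Layer.shift d) = (es.map (Elem.shift d)).map Layer.ev := by
  simp [Layer.shift]

/-- The strip bent over the diagram is a maximally entangled pair. Closing one of its ends with the
first wire teleports the value of this wire to the other end, on the far right, without any scalar
factor. -/
theorem legRotation : LegRotation := by
  intro n es h
  rw [run_ev] at h
  set M := (es.map (Elem.shift 1)) with hM
  have hrep : List.replicate (n + 1) 2 = 2 :: List.replicate n 2 := rfl
  have hrep' : List.replicate (n + 1) 2 = List.replicate n 2 ++ [2] := by
    rw [List.replicate_succ']
  have r1 : runE bendTopE [] = some [2, 2] := rfl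
  have r2 : runE M ([2] ++ [] ++ [2]) = some ([2] ++ List.replicate (n + 1) 2 ++ [2]) :=
    runE_frame h [2] [2]
  have e3 : [2] ++ List.replicate (n + 1) 2 ++ [2]
      = [] ++ [2, 2] ++ (List.replicate n 2 ++ [2]) := by simp [hrep]
  have r3 : runE bendBotE ([2] ++ List.replicate (n + 1) 2 ++ [2])
      = some (List.replicate (n + 1) 2) := by
    have := runE_frame (show runE bendBotE [2, 2] = some [] from rfl) []
      (List.replicate n 2 ++ [2])
    rw [e3, hrep']
    simpa [show bendBotE.map (Elem.shift 0) = bendBotE from rfl] using this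
  have r4 : run (outs (n + 1)) (List.replicate (n + 1) 2) = some [] := by
    simpa [outs] using run_outs (List.range (n + 1))
  have r12 : runE (bendTopE ++ M) [] = some ([2] ++ List.replicate (n + 1) 2 ++ [2]) := by
    rw [runE_append, r1, Option.bind_some, ← r2]; rfl
  have r123 : runE (bendTopE ++ M ++ bendBotE) [] = some (List.replicate (n + 1) 2) := by
    rw [runE_append, r12, Option.bind_some, r3]
  have eL : bendTop 0 ++ (es.map Layer.ev).map (Layer.shift 1) ++ bendBot 0
      = (bendTopE ++ M ++ bendBotE).map Layer.ev := by
    simp only [bendTop_eq, bendBot_eq, shift_one_ev, ← List.map_append]; rfl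
  rw [eL]
  refine ⟨?_, fun x => ?_⟩
  · rw [Closed, run_append, run_ev, r123, Option.bind_some, r4]
  · have r4' := runE_elems x r4
    rw [eval_eq, eval_eq, elems_append, elems_append, elems_ev, elems_ev,
      evalElems_eq (by rw [runE_append, r123, Option.bind_some, r4']),
      evalElems_eq (s' := []) (by
        rw [runE_append, h, Option.bind_some]; exact runE_elems _ r4),
      exec_append r123, exec_append r12, exec_append r1, exec_append h]
    set ψ := exec es [] vac with hψ
    have o1 : ∀ y φ, exec (elems y (outs (n + 1))) (List.replicate (n + 1) 2) φ []
        = outVal ((List.range (n + 1)).map y) φ := fun y φ => by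
      have := exec_outs y (List.range (n + 1)) φ
      rwa [List.length_range] at this
    rw [o1, o1, List.range_succ, List.map_append, List.map_singleton, outVal_append_singleton,
      ← List.range_succ, List.range_succ_eq_map, List.map_cons, List.map_map, outVal]
    have e5 : ((fun i => if i = 0 then x n else x (i - 1)) ∘ Nat.succ) = x := by funext i; simp
    rw [e5]
    refine outVal_congr fun m hm => ?_
    simp only [List.length_map, List.length_range] at hm
    have key : ∀ p, exec bendBotE ([2] ++ List.replicate (n + 1) 2 ++ [2])
        (exec M [2, 2] (exec bendTopE [] vac)) (m ++ [p, p]) = ψ (p :: p :: m) := by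
      intro p
      rw [e3]
      have h1 := exec_frame (l := bendBotE) (s₁ := []) (s₂ := [2, 2]) (s₂' := [])
        (s₃ := List.replicate n 2 ++ [2]) (b₁ := []) (b₃ := m ++ [p, p]) (ε := 1)
        (Ψ := exec M [2, 2] (exec bendTopE [] vac))
        (ψ := fun k => exec M [2, 2] (exec bendTopE [] vac) (k ++ (m ++ [p, p]))) rfl rfl
        (fun k _ => by simp) [] rfl
      refine h1.trans ?_
      rw [one_mul, exec_bendBotE]
      -- The diagram stands between the two ends of the strip, so its state factors off.
      have h2 : ∀ a b c d, exec M [2, 2] (exec bendTopE [] vac) ([a, b, c, d] ++ (m ++ [p, p]))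
          = exec bendTopE [] vac [a, b, p, p] * ψ (c :: d :: m) := by
        intro a b c d
        have := exec_closed (s₁ := [2]) (s₃ := [2]) h (exec bendTopE [] vac) (b₁ := [a, b])
          (m := c :: d :: m) (b₃ := [p, p]) rfl (by simp [hm]; ring)
        simpa using this
      simp only [h2, exec_bendTopE]
      cases p <;> simp [vac]
    rw [key, key]; simp

/-! ### Crossings -/

/-- `i γ_g γ_{g+1}` is `Z` on one bit for even `g` and `X X` on two neighbouring bits for odd `g`.
The constant is quantified in order to keep it opaque in products of braids. -/
theorem braidNegAt_three (φ : Amp) (p q r : Bool) :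
    (∀ c, c = Complex.exp (Complex.I * Real.pi / 8) / (Real.sqrt 2 : ℝ) →
    braidNegAt 0 φ [p, q, r] = c * (φ [p, q, r] - Complex.I * sgn p * φ [p, q, r]) ∧
    braidNegAt 1 φ [p, q, r] = c * (φ [p, q, r] - Complex.I * φ [!p, !q, r]) ∧
    braidNegAt 2 φ [p, q, r] = c * (φ [p, q, r] - Complex.I * sgn q * φ [p, q, r]) ∧
    braidNegAt 3 φ [p, q, r] = c * (φ [p, q, r] - Complex.I * φ [p, !q, !r]) ∧
    braidNegAt 4 φ [p, q, r] = c * (φ [p, q, r] - Complex.I * sgn r * φ [p, q, r])) := by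
  rintro c rfl
  refine ⟨?_, ?_, ?_, ?_, ?_⟩ <;> rw [braidNegAt] <;> congr 2 <;> cases p <;> cases q <;>
    cases r <;> simp [parity, majorana, bit, sgn] <;>
    ring_nf <;> simp only [Complex.I_pow_three] <;> ring

/-- A pair of strings, that is, one fermionic mode, is carried through the two modes of four
strings. Modes are permuted with the sign of exchanging fermions, which is `-1` for every two
occupied modes that cross. -/
theorem cross_three (φ : Amp) (p q r : Bool) :
    braidNegAt 3 (braidNegAt 2 (braidNegAt 1 (braidNegAt 0
      (braidNegAt 4 (braidNegAt 3 (braidNegAt 2 (braidNegAt 1 φ))))))) [p, q, r]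
      = sgn (r && (p ^^ q)) * φ [r, p, q] := by
  obtain ⟨c, hc⟩ : ∃ c, c = Complex.exp (Complex.I * Real.pi / 8) / (Real.sqrt 2 : ℝ) := ⟨_, rfl⟩
  -- Eight braids with the prefactor `e^{iπ/8} / √2`: the phases add up to `e^{iπ}`.
  have hc8 : c ^ 8 = -1 / 16 := by
    rw [hc, div_pow, ← Complex.exp_nat_mul, ← Complex.ofReal_pow,
      show (Real.sqrt 2) ^ 8 = (Real.sqrt 2 ^ 2) ^ 4 by ring, Real.sq_sqrt (by norm_num),
      show ((8 : ℕ) : ℂ) * (Complex.I * Real.pi / 8) = Real.pi * Complex.I by push_cast; ring,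
      Complex.exp_pi_mul_I]
    norm_num
  have k := fun φ p q r => braidNegAt_three φ p q r c hc
  have k0 := fun φ p q r => (k φ p q r).1
  have k1 := fun φ p q r => (k φ p q r).2.1
  have k2 := fun φ p q r => (k φ p q r).2.2.1
  have k3 := fun φ p q r => (k φ p q r).2.2.2.1
  have k4 := fun φ p q r => (k φ p q r).2.2.2.2
  have i3 : Complex.I ^ 3 = -Complex.I := Complex.I_pow_three
  have i5 : Complex.I ^ 5 = Complex.I := by rw [pow_succ, Complex.I_pow_four, one_mul]
  have i6 : Complex.I ^ 6 = -1 := by rw [pow_add Complex.I 4 2, Complex.I_pow_four, one_mul, Complex.I_sq]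
  have i7 : Complex.I ^ 7 = -Complex.I := by rw [pow_add Complex.I 4 3, Complex.I_pow_four, one_mul, i3]
  have i8 : Complex.I ^ 8 = 1 := by rw [pow_add Complex.I 4 4, Complex.I_pow_four, one_mul]
  simp only [k0, k1, k2, k3, k4]
  cases p <;> cases q <;> cases r <;> simp [sgn] <;> ring_nf <;>
    simp only [hc8, Complex.I_sq, i3, Complex.I_pow_four, i5, i6, i7, i8] <;> ring

end Quon

namespace Quon

/-- The events of a crossing. -/
def crossingE : List Elem :=
  [.merge 0]
    ++ (List.range 4).flatMap (fun i => (List.range 4).map fun j => .braidNeg 0 (3 - i + j))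
    ++ [.split 0 2]

theorem crossing_eq (c : ℕ) : crossing c = (crossingE.map (Elem.shift c)).map Layer.ev := rfl

theorem elems_crossing (x : ℕ → Bool) (c : ℕ) :
    elems x (crossing c) = crossingE.map (Elem.shift c) := by rw [crossing_eq, elems_ev]

theorem cross_loc {b₁ b₃ : List Bool} {Ψ ψ : Amp} (h : Loc b₁ b₃ 3 1 Ψ ψ) (k : ℕ)
    (hk : k = 2 * b₁.length) (p q r : Bool) :
    braidNegAt (k + 3) (braidNegAt (k + 2) (braidNegAt (k + 1) (braidNegAt k
      (braidNegAt (k + 4) (braidNegAt (k + 3) (braidNegAt (k + 2) (braidNegAt (k + 1) Ψ)))))))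
      (b₁ ++ [p, q, r] ++ b₃) = sgn (r && (p ^^ q)) * ψ [r, p, q] := by
  have h1 := ((((((((h.braidNegAt (g := 1) (by omega)).braidNegAt (g := 2) (by omega)).braidNegAt
    (g := 3) (by omega)).braidNegAt (g := 4) (by omega)).braidNegAt (g := 0)
    (by omega)).braidNegAt (g := 1) (by omega)).braidNegAt (g := 2) (by omega)).braidNegAt
    (g := 3) (by omega)) [p, q, r] rfl
  rw [cross_three, ← hk, one_mul] at h1
  exact h1

/-- The first eight braids carry the second mode of the left component through the right component,
the other eight carry the first mode. Each fermionic sign contains the parity of the component that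
is crossed, which is even after the projection of the final splitting, so the exchange has no sign.
-/
theorem exec_crossingE (ψ : Amp) (h : EvenOn [2, 2] ψ) (p q r s : Bool) :
    exec crossingE [2, 2] ψ [p, q, r, s] = ψ [r, s, p, q] := by
  set φ := braidNegAt 5 (braidNegAt 4 (braidNegAt 3 (braidNegAt 2
      (braidNegAt 6 (braidNegAt 5 (braidNegAt 4 (braidNegAt 3 ψ))))))) with hφ
  have h1 : ∀ p q r s, φ [p, q, r, s] = sgn (s && (q ^^ r)) * ψ [p, s, q, r] := fun p q r s =>
    cross_loc (b₁ := [p]) (b₃ := []) (Ψ := ψ) (ψ := fun m => ψ (p :: m))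
      (fun m _ => by simp) 2 rfl q r s
  set χ := braidNegAt 3 (braidNegAt 2 (braidNegAt 1 (braidNegAt 0
      (braidNegAt 4 (braidNegAt 3 (braidNegAt 2 (braidNegAt 1 φ))))))) with hχ
  have h2 : ∀ p q r s, χ [p, q, r, s] = sgn (r && (p ^^ q)) * φ [r, p, q, s] := fun p q r s =>
    cross_loc (b₁ := []) (b₃ := [s]) (Ψ := φ) (ψ := fun m => φ (m ++ [s]))
      (fun m _ => by simp) 0 rfl p q r
  have h3 : exec crossingE [2, 2] ψ [p, q, r, s]
      = projectEven 0 2 (projectEven (0 + 2) (4 - 2) χ) [p, q, r, s] := rfl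
  have e1 : r ≠ s → ψ [r, s, p, q] = 0 := fun hn => h _ rfl (by
    cases r <;> cases s <;> simp [EvenAt] at hn ⊢)
  have e2 : p ≠ q → ψ [r, s, p, q] = 0 := fun hn => h _ rfl (by
    cases p <;> cases q <;> simp [EvenAt] at hn ⊢)
  rw [h3]
  by_cases h4 : p = q ∧ r = s
  · obtain ⟨rfl, rfl⟩ := h4
    simp only [projectEven, h2, h1]
    cases p <;> cases r <;> simp [sgn]
  · rw [not_and_or] at h4
    rw [show ψ [r, s, p, q] = 0 by tauto]
    rcases h4 with h4 | h4
    · have : (([p, q, r, s].drop 0).take 2).count true % 2 ≠ 0 := by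
        cases p <;> cases q <;> simp at h4 ⊢
      rw [projectEven, if_neg this]
    · have : (([p, q, r, s].drop 2).take 2).count true % 2 ≠ 0 := by
        cases r <;> cases s <;> simp at h4 ⊢
      rw [projectEven, projectEven, if_neg this, ite_self]

theorem legCrossing : LegCrossing := by
  intro A B c ℓ ℓ' h
  obtain ⟨s, s', hA, hK, hB⟩ := closed_append₃ h
  simp only [run, Option.bind_eq_some_iff, Option.some.injEq, exists_eq_right] at hK
  obtain ⟨t, hK, hK'⟩ := hK
  obtain ⟨s₁, s₃, hc, rfl, rfl⟩ := step_legOut hK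
  obtain ⟨s₁', s₃', hc', e, rfl⟩ := step_legOut hK'
  simp only [List.append_nil, List.append_assoc] at e
  obtain ⟨rfl, rfl⟩ := List.append_inj e (hc.symm.trans hc')
  have r : run (crossing c) (s₁ ++ [2, 2] ++ s₃') = some (s₁ ++ [2, 2] ++ s₃') :=
    run_of_elems (by rw [crossing_eq, hc]) rfl
  have rr : ∀ v w, runE (encOut v ++ encOut w) [2, 2] = some [] := by
    intro v w; cases v <;> cases w <;> rfl
  -- Two legs read off four amplitudes. Exchanging the wires permutes the two mixed ones, which has
  -- the same effect as exchanging the indices.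
  have out : ∀ v w (φ : Amp), EvenOn [2, 2] φ → exec (encOut v ++ encOut w) [2, 2] φ []
      = φ [false, false, false, false] + sgn v * φ [true, true, false, false]
        + sgn w * φ [false, false, true, true] + sgn v * sgn w * φ [true, true, true, true] := by
    intro v w φ hφ
    have r1 : runE (encOut v) [2, 2] = some [2] := by cases v <;> rfl
    have k : ∀ m : List Bool, m.length = 2 → exec (encOut v) [2, 2] φ m
        = φ ([false, false] ++ m) + sgn v * φ ([true, true] ++ m) := by
      intro m hm
      have h0 := exec_frame (s₁ := []) (b₁ := []) (b₃ := m) (ε := 1) (s₃ := [2])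
        (runE_encOut v) (Ψ := φ) (ψ := fun k => φ (k ++ m)) rfl (fun k _ => by simp) [] rfl
      rw [show (encOut v).map (Elem.shift ([] : Slice).length) = encOut v by
        simp [funext Elem.shift_zero], one_mul, exec_encOut] at h0
      exact h0
    rw [exec_append r1, exec_encOut, k _ rfl, k _ rfl]
    simp only [List.cons_append, List.nil_append]; ring
  have h1 := replace_local (K := crossing c ++ [.legOut c ℓ, .legOut c ℓ'])
    (N := [.legOut c ℓ', .legOut c ℓ]) (s₂ := [2, 2]) (s₂' := []) (s₁ := s₁) (s₃ := s₃')
    (fun x => crossingE ++ (encOut (x ℓ) ++ encOut (x ℓ')))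
    (fun x => encOut (x ℓ') ++ encOut (x ℓ)) (by simpa using hA) hB
    (by
      rw [run_append, r, Option.bind_some, ← List.singleton_append, run_append,
        show s₁ ++ [2, 2] ++ s₃' = s₁ ++ [2] ++ (2 :: s₃') by simp,
        run_legOut s₁ _ c ℓ hc, Option.bind_some, List.append_nil]
      simpa using run_legOut s₁ s₃' c ℓ' hc)
    (fun x => by
      simp [elems_append, elems_crossing, elems_cons, elems_nil, toElems_legOut, hc])
    (fun x => by simp [elems_cons, elems_nil, toElems_legOut, hc])
    (fun x => by
      rw [runE_append, show runE crossingE [2, 2] = some [2, 2] from rfl]; exact rr _ _)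
    (fun x => rr _ _)
    (fun x ψ hψ b hb => by
      rw [List.length_eq_zero_iff.1 hb,
        exec_append (show runE crossingE [2, 2] = some [2, 2] from rfl), out _ _ _ hψ,
        out _ _ _ (EvenOn.exec rfl hψ)]
      simp only [exec_crossingE ψ hψ]
      ring)
  simp only [List.append_assoc] at h1 ⊢
  exact h1

/-! ### The generating diagrams -/

section
attribute [local simp] Diagram.tensor eval evalElems Layer.toElems Elem.step Elem.act Slice.offset
  cupAt capAt bit projectEven parity majorana extend

theorem represents_ketZero : Represents ketZeroDiagram 1 ketZero := by
  refine ⟨⟨rfl, by simp [ketZeroDiagram, legs]⟩, funext fun x => ?_⟩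
  have := fourthRootTwo_ne_zero
  cases h0 : x 0 <;> simp [ketZeroDiagram, ketZero, h0, this] <;> field_simp <;> norm_num

theorem represents_id : Represents idDiagram 2 idTensor := by
  refine ⟨⟨rfl, by simp [idDiagram, legs]; decide⟩, funext fun x => ?_⟩
  have := fourthRootTwo_ne_zero
  cases h0 : x 0 <;> cases h1 : x 1 <;> simp [idDiagram, idTensor, h0, h1, this] <;>
    (try field_simp) <;> (try ring_nf)

theorem represents_pauliX : Represents pauliXDiagram 2 pauliX := by
  refine ⟨⟨rfl, by simp [pauliXDiagram, legs]; decide⟩, funext fun x => ?_⟩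
  have := fourthRootTwo_ne_zero
  cases h0 : x 0 <;> cases h1 : x 1 <;> simp [pauliXDiagram, pauliX, h0, h1, this] <;>
    (try field_simp) <;> (try ring_nf)

/-- An element at an odd string acts by `X X` on the two bits of the wire, which is diagonal in the
Hadamard basis of the encoders. The braid at the string `0` is diagonal in the bits and hence
represents a rotation about `X`. -/
theorem represents_rotZ (θ : ℂ) : Represents (rotZDiagram θ) 2 (rotZ θ) := by
  refine ⟨⟨rfl, by simp [rotZDiagram, legs]; decide⟩, funext fun x => ?_⟩
  have := fourthRootTwo_ne_zero
  cases h0 : x 0 <;> cases h1 : x 1 <;> simp [rotZDiagram, rotZ, scatterAt, h0, h1, this] <;>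
    (try field_simp) <;> (try ring_nf) <;> (try simp [Complex.I_sq])

theorem represents_parityTensor : Represents parityTensorDiagram 3 parityTensor := by
  refine ⟨⟨rfl, by simp [parityTensorDiagram, legs]; decide⟩, funext fun x => ?_⟩
  have := fourthRootTwo_ne_zero
  cases h0 : x 0 <;> cases h1 : x 1 <;> cases h2 : x 2 <;>
    simp [parityTensorDiagram, parityTensor, h0, h1, h2, this] <;>
    (try field_simp) <;> (try ring_nf)

theorem sqrt_two_mul_sqrt_two : ((Real.sqrt 2 : ℝ) : ℂ) ^ 2 = 2 := by
  rw [← Complex.ofReal_pow, Real.sq_sqrt (by norm_num)]; norm_num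

theorem represents_rotXPos : Represents rotXPosDiagram 2 (rotX (Real.pi / 4)) := by
  refine ⟨⟨rfl, by simp [rotXPosDiagram, legs]; decide⟩, funext fun x => ?_⟩
  have := fourthRootTwo_ne_zero
  have h2 := sqrt_two_mul_sqrt_two
  have h3 : ((Real.sqrt 2 : ℝ) : ℂ) ≠ 0 := by simp
  have hc : Complex.cos ((Real.pi : ℂ) / 4) = (Real.sqrt 2 : ℝ) / 2 := by
    have := congrArg (fun r : ℝ => (r : ℂ)) Real.cos_pi_div_four
    push_cast at this; exact this
  have hs : Complex.sin ((Real.pi : ℂ) / 4) = (Real.sqrt 2 : ℝ) / 2 := by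
    have := congrArg (fun r : ℝ => (r : ℂ)) Real.sin_pi_div_four
    push_cast at this; exact this
  have he : Complex.exp (Complex.I * (Real.pi / 4)) = Complex.exp (Complex.I * Real.pi / 8) ^ 2 := by
    rw [← Complex.exp_nat_mul]; congr 1; push_cast; ring
  cases h0 : x 0 <;> cases h1 : x 1 <;>
    simp [rotXPosDiagram, rotX, braidNegAt, h0, h1, this, hc, hs, he] <;> field_simp <;>
    (try ring_nf) <;>
    (try simp only [Complex.I_sq, Complex.I_pow_four, Complex.I_pow_three, h2]) <;> (try ring_nf)

theorem represents_rotXNeg : Represents rotXNegDiagram 2 (rotX (-(Real.pi / 4))) := by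
  refine ⟨⟨rfl, by simp [rotXNegDiagram, legs]; decide⟩, funext fun x => ?_⟩
  have := fourthRootTwo_ne_zero
  have h2 := sqrt_two_mul_sqrt_two
  have h3 : ((Real.sqrt 2 : ℝ) : ℂ) ≠ 0 := by simp
  have hc : Complex.cos ((Real.pi : ℂ) / 4) = (Real.sqrt 2 : ℝ) / 2 := by
    have := congrArg (fun r : ℝ => (r : ℂ)) Real.cos_pi_div_four
    push_cast at this; exact this
  have hs : Complex.sin ((Real.pi : ℂ) / 4) = (Real.sqrt 2 : ℝ) / 2 := by
    have := congrArg (fun r : ℝ => (r : ℂ)) Real.sin_pi_div_four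
    push_cast at this; exact this
  have he : Complex.exp (-(Complex.I * (Real.pi / 4)))
      = Complex.exp (-(Complex.I * Real.pi / 8)) ^ 2 := by
    rw [← Complex.exp_nat_mul]; congr 1; push_cast; ring
  cases h0 : x 0 <;> cases h1 : x 1 <;>
    simp [rotXNegDiagram, rotX, braidPosAt, h0, h1, this, hc, hs, he] <;> field_simp <;>
    (try ring_nf) <;>
    (try simp only [Complex.I_sq, Complex.I_pow_four, Complex.I_pow_three, h2]) <;> (try ring_nf)

end

end Quon

namespace Quon

/-! ### Logical wires

A wire is a component with four strings; its value `a` is stored as the pair of bits `a, a`. -/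

/-- Operations on a row of wires. -/
inductive WireOp where
  /-- a new wire at place `c`, in the sum of both values -/
  | plus (c : ℕ)
  /-- wire `c` is summed out -/
  | sum (c : ℕ)
  /-- wire `c` is projected onto the value `0` -/
  | zero (c : ℕ)
  /-- the value `1` of wire `c` gets the weight `z` -/
  | phase (c : ℕ) (z : ℂ)
  /-- the Hadamard transform of wire `c` -/
  | had (c : ℕ)
  /-- wires `c` and `c + 1` are projected onto equal values -/
  | same (c : ℕ)
  /-- wires `c` and `c + 1` are exchanged -/
  | swap (c : ℕ)

/-- The number of wires after an operation, if it fits the number of wires before. -/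
def WireOp.height : WireOp → ℕ → Option ℕ
  | .plus c, H => if c ≤ H then some (H + 1) else none
  | .sum c, H | .zero c, H => if c < H then some (H - 1) else none
  | .phase c _, H => if c < H then some H else none
  | .had c, H => if c < H then some H else none
  | .same c, H | .swap c, H => if c + 1 < H then some H else none

/-- The weights of a phase do not vanish. -/
def WireOp.Nonzero : WireOp → Prop
  | .phase _ z => z ≠ 0
  | _ => True

/-- The effect on an amplitude. -/
noncomputable def WireOp.den : WireOp → Amp → Amp
  | .plus c, φ => fun z => φ (z.take c ++ [] ++ z.drop (c + 1))
  | .sum c, φ => fun z => φ (z.take c ++ [false] ++ z.drop c) + φ (z.take c ++ [true] ++ z.drop c)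
  | .zero c, φ => fun z => fourthRootTwo ^ 2 * φ (z.take c ++ [false] ++ z.drop c)
  | .phase c w, φ => fun z => (if bit z c then w else 1) * φ z
  | .had c, φ => fun z => (1 + Complex.I) / 2 * (φ (z.take c ++ [false] ++ z.drop (c + 1))
      + sgn (bit z c) * φ (z.take c ++ [true] ++ z.drop (c + 1)))
  | .same c, φ => fun z => if bit z c = bit z (c + 1) then φ z else 0
  | .swap c, φ => fun z => φ (z.take c ++ [bit z (c + 1), bit z c] ++ z.drop (c + 2))

/-- The place of an operation. -/
def WireOp.place : WireOp → ℕ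
  | .plus c | .sum c | .zero c | .phase c _ | .had c | .same c | .swap c => c

/-- The angle of the scattering element with a given weight. -/
noncomputable def angle (z : ℂ) : ℂ := Complex.log z / Complex.I

theorem exp_angle {z : ℂ} (hz : z ≠ 0) : Complex.exp (Complex.I * angle z) = z := by
  rw [angle, mul_div_cancel₀ _ Complex.I_ne_zero, Complex.exp_log hz]

/-- The events of an operation at place `0`. -/
noncomputable def WireOp.events : WireOp → List Elem
  | .plus _ => [.birth 0, .cap 0 0, .cap 0 1]
  | .sum _ => [.cup 0 1, .cup 0 0, .death 0]
  | .zero _ => [.cup 0 0, .cup 0 0, .death 0]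
  | .phase _ z => [.scatter (angle z) 0 0]
  | .had _ => [.scatter (angle Complex.I) 0 0,
      .scatter (angle Complex.I) 0 1,
      .scatter (angle Complex.I) 0 0]
  | .same _ => [.merge 0, .cup 0 3, .cup 0 2, .cap 0 2, .cap 0 3, .split 0 2]
  | .swap _ => crossingE

/-- The events of an operation. -/
noncomputable def WireOp.lower (o : WireOp) : List Elem := o.events.map (Elem.shift o.place)

/-- The bits that store the values of the wires. -/
def dbl (z : List Bool) : List Bool := z.flatMap fun a => [a, a]

theorem dbl_append (z w : List Bool) : dbl (z ++ w) = dbl z ++ dbl w := List.flatMap_append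

theorem length_dbl (z : List Bool) : (dbl z).length = 2 * z.length := by
  induction z with
  | nil => rfl
  | cons a z ih => simp [dbl] at ih ⊢; omega

/-- The number of wires that an operation consumes, and the number that it produces. -/
def WireOp.arity : WireOp → ℕ × ℕ
  | .plus _ => (0, 1)
  | .sum _ | .zero _ => (1, 0)
  | .phase _ _ | .had _ => (1, 1)
  | .same _ | .swap _ => (2, 2)

theorem WireOp.runE_events (o : WireOp) :
    runE o.events (List.replicate o.arity.1 2) = some (List.replicate o.arity.2 2) := by
  cases o <;> rfl

section
attribute [local simp] exec Elem.step Elem.act Slice.offset cupAt capAt bit projectEven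
  parity majorana sgn scatterAt

/-- Direct computation on at most four bits. For `had`, the scattering elements with `e^{iθ} = i`
are `diag(1, i)`, the matrix `(1 + i)/2 · (1 - i X)`, and `diag(1, i)` again; their product is `(1 +
i)/2` times the Hadamard matrix. For `same`, the cups and caps replace the two middle bits by an
equal pair, after which the splitting forces all four bits to agree. -/
theorem exec_events (o : WireOp) (hz : o.Nonzero) (ψ : Amp)
    (hψ : EvenOn (List.replicate o.arity.1 2) ψ) (φ : Amp) (y₁ y₃ : List Bool)
    (h : ∀ y : List Bool, y.length = o.arity.1 → ψ (dbl y) = φ (y₁ ++ y ++ y₃))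
    (hp : o.place = y₁.length) (z : List Bool) (hl : z.length = o.arity.2) :
    exec o.events (List.replicate o.arity.1 2) ψ (dbl z) = o.den φ (y₁ ++ z ++ y₃) := by
  have h4 := fourthRootTwo_ne_zero
  have b0 : ∀ a l, bit (y₁ ++ a :: l) y₁.length = a := fun a l => by simp
  have b1 : ∀ a b l, bit (y₁ ++ a :: b :: l) (y₁.length + 1) = b := fun a b l => by
    simp
  cases o with
  | plus c =>
    obtain ⟨a, rfl⟩ := List.length_eq_one_iff.1 hl
    have h0 := h [] rfl
    simp only [WireOp.place] at hp; subst hp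
    simp [dbl] at h0
    cases a <;> simp [WireOp.events, WireOp.den, WireOp.arity, dbl, h4, h0]
  | sum c =>
    obtain rfl := List.length_eq_zero_iff.1 hl
    have h0 := h [false] rfl
    have h1 := h [true] rfl
    simp only [WireOp.place] at hp; subst hp
    simp [dbl] at h0 h1
    simp [WireOp.events, WireOp.den, WireOp.arity, dbl, h4, h0, h1]
  | zero c =>
    obtain rfl := List.length_eq_zero_iff.1 hl
    have h0 := h [false] rfl
    simp only [WireOp.place] at hp; subst hp
    simp [dbl] at h0
    simp [WireOp.events, WireOp.den, WireOp.arity, dbl, h0]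
    ring
  | phase c w =>
    obtain ⟨a, rfl⟩ := List.length_eq_one_iff.1 hl
    have h0 := h [a] rfl
    simp only [WireOp.place] at hp; subst hp
    simp [dbl] at h0
    cases a <;> simp [WireOp.events, WireOp.den, WireOp.arity, dbl, h0,
      exp_angle (show w ≠ 0 from hz)] <;> ring_nf <;> simp [Complex.I_sq] <;> ring
  | had c =>
    obtain ⟨a, rfl⟩ := List.length_eq_one_iff.1 hl
    have h0 := h [false] rfl
    have h1 := h [true] rfl
    simp only [WireOp.place] at hp; subst hp
    simp [dbl] at h0 h1
    cases a <;> simp [WireOp.events, WireOp.den, WireOp.arity, dbl, h0, h1,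
      exp_angle Complex.I_ne_zero] <;> ring_nf <;>
      simp [Complex.I_sq, Complex.I_pow_four, Complex.I_pow_three] <;> ring
  | same c =>
    obtain ⟨a, b, rfl⟩ := List.length_eq_two.1 hl
    have h0 := h [a, b] rfl
    -- The two cups also collect the amplitude in which the inner bits differ from the outer ones;
    -- it is odd on both components.
    have h1 : a ≠ b → ψ [a, b, b, a] = 0 := fun hn => hψ _ rfl (by
      cases a <;> cases b <;> simp [EvenAt, WireOp.arity, List.replicate] at hn ⊢)
    simp only [WireOp.place] at hp; subst hp
    simp [dbl] at h0
    simp only [WireOp.den, List.append_assoc, List.cons_append, b0, b1]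
    cases a <;> cases b <;> simp at h1 <;>
      simp [WireOp.events, WireOp.arity, List.replicate, dbl, h4, h0]
    · have : ψ [false, true, true, false] = 0 := hψ _ rfl (by
        simp [EvenAt, WireOp.arity, List.replicate])
      simp [this]
    · have : ψ [true, false, false, true] = 0 := hψ _ rfl (by
        simp [EvenAt, WireOp.arity, List.replicate])
      simp [this]
  | swap c =>
    obtain ⟨a, b, rfl⟩ := List.length_eq_two.1 hl
    have h0 := h [b, a] rfl
    simp only [WireOp.place] at hp; subst hp
    simp only [WireOp.den, List.append_assoc, List.cons_append, b0, b1]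
    rw [show dbl [a, b] = [a, a, b, b] from rfl]
    refine (exec_crossingE ψ hψ a a b b).trans (h0.trans ?_)
    rw [List.take_left']
    · simp [List.drop_append, List.drop_eq_nil_of_le]
    · rfl

end

/-- The events `es` turn wires with the amplitude `φ` into wires with the amplitude `f φ`. -/
def Realizes (es : List Elem) (H H' : ℕ) (f : Amp → Amp) : Prop :=
  runE es (List.replicate H 2) = some (List.replicate H' 2) ∧
  ∀ ψ φ : Amp, EvenOn (List.replicate H 2) ψ →
    (∀ z : List Bool, z.length = H → ψ (dbl z) = φ z) →
    ∀ z : List Bool, z.length = H' → exec es (List.replicate H 2) ψ (dbl z) = f φ z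

/-- The events of the first part preserve evenness, so that its output qualifies as input of the
second part. -/
theorem Realizes.append {es es' : List Elem} {H H' H'' : ℕ} {f g : Amp → Amp}
    (h : Realizes es H H' f) (h' : Realizes es' H' H'' g) :
    Realizes (es ++ es') H H'' (g ∘ f) := by
  refine ⟨by rw [runE_append, h.1, Option.bind_some, h'.1], fun ψ φ hψ hφ z hz => ?_⟩
  rw [exec_append h.1]
  exact h'.2 _ _ (hψ.exec h.1) (h.2 ψ φ hψ hφ) z hz

theorem WireOp.height_eq {o : WireOp} {H H' : ℕ} (h : o.height H = some H') :
    ∃ r, H = o.place + o.arity.1 + r ∧ H' = o.place + o.arity.2 + r := by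
  refine ⟨H - o.place - o.arity.1, ?_⟩
  cases o <;> simp only [WireOp.height, Option.ite_none_right_eq_some, Option.some.injEq] at h <;>
    simp only [WireOp.place, WireOp.arity] <;> omega

theorem replicate_add₃ (a b c : ℕ) : List.replicate (a + b + c) 2
    = List.replicate a 2 ++ List.replicate b 2 ++ List.replicate c 2 := by
  rw [List.replicate_add, List.replicate_add]

theorem realizes_lower {o : WireOp} {H H' : ℕ} (h : o.height H = some H') (hz : o.Nonzero) :
    Realizes o.lower H H' o.den := by
  obtain ⟨r, rfl, rfl⟩ := WireOp.height_eq h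
  have e : o.lower = o.events.map (Elem.shift (List.replicate o.place 2).length) := by
    rw [List.length_replicate]; rfl
  refine ⟨?_, fun ψ φ hψ hφ z hzl => ?_⟩
  · rw [replicate_add₃, replicate_add₃, e]; exact runE_frame o.runE_events _ _
  · obtain ⟨z₁, z₂, z₃, rfl, h₁, h₂, h₃⟩ := exists_bits₃ hzl
    rw [replicate_add₃] at hψ ⊢
    have l1 : (dbl z₁).length = (List.replicate o.place 2).sum := by
      rw [length_dbl, h₁]; simp [mul_comm]
    have l2 : (dbl z₂).length = (List.replicate o.arity.2 2).sum := by
      rw [length_dbl, h₂]; simp [mul_comm]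
    have l3 : (dbl z₃).length = (List.replicate r 2).sum := by
      rw [length_dbl, h₃]; simp [mul_comm]
    rw [e, dbl_append, dbl_append, exec_frame (ε := 1) o.runE_events l1
      (ψ := fun m => ψ (dbl z₁ ++ m ++ dbl z₃)) (fun m _ => by simp) _ l2, one_mul]
    refine exec_events o hz _ (hψ.frame l1 l3) φ z₁ z₃ (fun y hy => ?_) h₁.symm z₂ h₂
    rw [← dbl_append, ← dbl_append]
    exact hφ _ (by simp; omega)

/-- The number of wires after a list of operations. -/
def heightL : List WireOp → ℕ → Option ℕ
  | [], H => some H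
  | o :: L, H => (o.height H).bind (heightL L)

/-- The effect of a list of operations. -/
noncomputable def denL : List WireOp → Amp → Amp
  | [], φ => φ
  | o :: L, φ => denL L (o.den φ)

theorem realizes_lowerL {L : List WireOp} {H H' : ℕ} (h : heightL L H = some H')
    (hz : ∀ o ∈ L, o.Nonzero) : Realizes (L.flatMap WireOp.lower) H H' (denL L) := by
  induction L generalizing H with
  | nil =>
    simp only [heightL, Option.some.injEq] at h; subst h
    exact ⟨rfl, fun ψ φ _ hφ z hz => hφ z hz⟩
  | cons o L ih =>
    simp only [heightL, Option.bind_eq_some_iff] at h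
    obtain ⟨K, h1, h2⟩ := h
    exact (realizes_lower h1 (hz o (by simp))).append (ih h2 fun o ho => hz o (by simp [ho]))

end Quon

namespace Quon

/-! ### Diagonal operations on wires -/

theorem heightL_append (L L' : List WireOp) (H : ℕ) :
    heightL (L ++ L') H = (heightL L H).bind (heightL L') := by
  induction L generalizing H with
  | nil => rfl
  | cons o L ih =>
    simp only [List.cons_append, heightL, Option.bind_assoc]
    exact congrArg _ (funext fun K => ih K)

theorem denL_append (L L' : List WireOp) (φ : Amp) : denL (L ++ L') φ = denL L' (denL L φ) := by
  induction L generalizing φ with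
  | nil => rfl
  | cons o L ih => exact ih _

theorem WireOp.den_congr {o : WireOp} {H H' : ℕ} (h : o.height H = some H') {φ φ' : Amp}
    (hφ : ∀ z : List Bool, z.length = H → φ z = φ' z) (z : List Bool) (hz : z.length = H') :
    o.den φ z = o.den φ' z := by
  cases o <;> simp only [WireOp.height, Option.ite_none_right_eq_some, Option.some.injEq] at h <;>
    simp only [WireOp.den] <;> (repeat rw [hφ]) <;> (try simp) <;> omega

theorem denL_congr {L : List WireOp} {H H' : ℕ} (h : heightL L H = some H') {φ φ' : Amp}
    (hφ : ∀ z : List Bool, z.length = H → φ z = φ' z) (z : List Bool) (hz : z.length = H') :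
    denL L φ z = denL L φ' z := by
  induction L generalizing H φ φ' with
  | nil => simp only [heightL, Option.some.injEq] at h; exact hφ z (by omega)
  | cons o L ih =>
    simp only [heightL, Option.bind_eq_some_iff] at h
    obtain ⟨K, h1, h2⟩ := h
    exact ih h2 fun w hw => WireOp.den_congr h1 hφ w hw

/-- The operations `L` turn `H` wires with the amplitude `φ` into `H'` wires with `f φ`. -/
structure Maps (L : List WireOp) (H H' : ℕ) (f : Amp → Amp) : Prop where
  height : heightL L H = some H'
  nonzero : ∀ o ∈ L, o.Nonzero
  den : ∀ (φ : Amp) (z : List Bool), z.length = H' → denL L φ z = f φ z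

theorem Maps.nil (H : ℕ) : Maps [] H H id := ⟨rfl, by simp, fun φ z _ => rfl⟩

theorem Maps.append {L L' : List WireOp} {H H' H'' : ℕ} {f g : Amp → Amp} (h : Maps L H H' f)
    (h' : Maps L' H' H'' g) : Maps (L ++ L') H H'' (g ∘ f) := by
  refine ⟨by rw [heightL_append, h.height, Option.bind_some, h'.height], fun o ho => ?_,
    fun φ z hz => ?_⟩
  · rcases List.mem_append.1 ho with ho | ho
    exacts [h.nonzero o ho, h'.nonzero o ho]
  · rw [denL_append, denL_congr h'.height (h.den φ) z hz, h'.den _ z hz]; rfl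

theorem Maps.congr {L : List WireOp} {H H' : ℕ} {f g : Amp → Amp} (h : Maps L H H' f)
    (hfg : ∀ φ z, z.length = H' → f φ z = g φ z) : Maps L H H' g :=
  ⟨h.height, h.nonzero, fun φ z hz => (h.den φ z hz).trans (hfg φ z hz)⟩

theorem Maps.single {o : WireOp} {H H' : ℕ} (h : o.height H = some H') (hz : o.Nonzero) :
    Maps [o] H H' o.den := ⟨by simp [heightL, h], by simpa using hz, fun φ z _ => rfl⟩

/-- The operations `L` multiply the amplitude of `H` wires by `F`. -/
def Mul (L : List WireOp) (H : ℕ) (F : List Bool → ℂ) : Prop :=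
  Maps L H H fun φ z => F z * φ z

theorem Mul.nil (H : ℕ) : Mul [] H fun _ => 1 := (Maps.nil H).congr fun φ z _ => by simp

theorem Mul.congr {L : List WireOp} {H : ℕ} {F G : List Bool → ℂ} (h : Mul L H F)
    (hFG : ∀ z, z.length = H → F z = G z) : Mul L H G :=
  Maps.congr h fun φ z hz => by rw [hFG z hz]

theorem Mul.append {L L' : List WireOp} {H : ℕ} {F G : List Bool → ℂ} (h : Mul L H F)
    (h' : Mul L' H G) : Mul (L ++ L') H fun z => F z * G z :=
  (Maps.append h h').congr fun φ z hz => by simp only [Function.comp]; ring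

theorem Mul.flatMap {α : Type*} {l : List α} {g : α → List WireOp} {H : ℕ}
    {F : α → List Bool → ℂ} (h : ∀ a ∈ l, Mul (g a) H (F a)) :
    Mul (l.flatMap g) H fun z => (l.map fun a => F a z).prod := by
  induction l with
  | nil => exact Mul.nil H
  | cons a l ih =>
    simp only [List.flatMap_cons, List.map_cons, List.prod_cons]
    exact (h a (by simp)).append (ih fun b hb => h b (by simp [hb]))

theorem Mul.ite {p : Prop} [Decidable p] {L : List WireOp} {H : ℕ} {F : List Bool → ℂ}
    (h : Mul L H F) : Mul (if p then L else []) H fun z => if p then F z else 1 := by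
  split_ifs
  exacts [h, Mul.nil H]

/-- A new last wire, summed out in the end. -/
def fresh (H : ℕ) (L : List WireOp) : List WireOp := .plus H :: L ++ [.sum H]

/-- The new wire gets the number `H`, so the numbers of the old wires remain valid inside `L`. -/
theorem Maps.fresh {L : List WireOp} {H : ℕ} {f : Amp → Amp} (h : Maps L (H + 1) (H + 1) f) :
    Maps (fresh H L) H H fun φ z =>
      f (fun w => φ (w.take H)) (z ++ [false]) + f (fun w => φ (w.take H)) (z ++ [true]) := by
  have h1 : Maps [.plus H] H (H + 1) _ := Maps.single (by simp [WireOp.height]) trivial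
  have h2 : Maps [.sum H] (H + 1) H _ := Maps.single (by simp [WireOp.height]) trivial
  refine ((h1.append h).append h2).congr fun φ z hz => ?_
  have e : ∀ w : List Bool, w.length = H + 1 → f ((WireOp.plus H).den φ) w
      = f (fun w => φ (w.take H)) w := fun w hw => by
    rw [← h.den _ w hw, ← h.den _ w hw]
    refine denL_congr h.height (fun v hv => ?_) w hw
    simp [WireOp.den, List.drop_eq_nil_of_le hv.le]
  change f ((WireOp.plus H).den φ) (z.take H ++ [false] ++ z.drop H)
    + f ((WireOp.plus H).den φ) (z.take H ++ [true] ++ z.drop H) = _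
  simp only [List.take_of_length_le hz.le, List.drop_eq_nil_of_le hz.le, List.append_nil]
  rw [e _ (by simp [hz]), e _ (by simp [hz])]

/-- The basic device for all that follows: a factor that is hard to produce directly is written as a
sum, over a hidden bit, of products of simpler factors. -/
theorem Mul.fresh {L : List WireOp} {H : ℕ} {F : List Bool → ℂ} (h : Mul L (H + 1) F) :
    Mul (fresh H L) H fun z => F (z ++ [false]) + F (z ++ [true]) :=
  (Maps.fresh h).congr fun φ z hz => by
    simp only [List.take_left' hz]; ring

theorem bit_append_left {z : List Bool} {i : ℕ} (h : i < z.length) (w : List Bool) :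
    bit (z ++ w) i = bit z i := by
  rw [bit, List.getD_append _ _ _ _ h]; rfl

theorem bit_append_length (z : List Bool) (a : Bool) (w : List Bool) :
    bit (z ++ a :: w) z.length = a := by
  simp [bit]

theorem bit_append_length' {z : List Bool} {H : ℕ} (h : z.length = H) (a : Bool)
    (w : List Bool) : bit (z ++ a :: w) H = a := by
  subst h; exact bit_append_length z a w

theorem Mul.phase {H i : ℕ} (hi : i < H) {w : ℂ} (hw : w ≠ 0) :
    Mul [.phase i w] H fun z => if bit z i then w else 1 :=
  Maps.single (by simp [WireOp.height, hi]) hw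

/-- Multiplication by `s`, beside `H` wires. -/
noncomputable def scal (H : ℕ) (s : ℂ) : List WireOp :=
  if s = 1 then [] else fresh H [.phase H (s - 1)]

/-- The hidden bit contributes `1 + (s - 1)`. The case `s = 1` is separate because a scattering
element cannot have weight `0`. -/
theorem mul_scal (H : ℕ) (s : ℂ) : Mul (scal H s) H fun _ => s := by
  unfold scal
  split_ifs with h
  · subst h; exact Mul.nil H
  · refine (Mul.fresh (Mul.phase (Nat.lt_succ_self H) (sub_ne_zero.2 h))).congr fun z hz => ?_
    rw [bit_append_length' hz, bit_append_length' hz]; simp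

/-! ### Controlled signs -/

/-- The operations on a wire passing by the wire `p`, to mark it with the wires `i` and `j`. -/
noncomputable def pass (i j p : ℕ) : List WireOp :=
  (if p = i then [.same p, .had p] else []) ++ (if p = j then [.same p, .had p] else []) ++ [.swap p]

/-- The sign `(-1)^(zᵢ zⱼ)` on the wires `hs = [0, …, H - 1]`. -/
noncomputable def edge (hs : List ℕ) (i j : ℕ) : List WireOp :=
  (WireOp.plus 0 :: hs.flatMap (pass i j) ++ [.zero hs.length])
    ++ scal hs.length (-(Complex.I * (Real.sqrt 2 : ℝ)))

/-- The amplitude `G` of a wire at place `k` and the other wires. -/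
def busAmp (k : ℕ) (G : Bool → Amp) : Amp := fun z => G (bit z k) (z.eraseIdx k)

theorem exists_bit_split {z : List Bool} {k H : ℕ} (hz : z.length = H) (hk : k < H) :
    ∃ z₁ a z₂, z = z₁ ++ a :: z₂ ∧ z₁.length = k ∧ z₂.length = H - k - 1 :=
  ⟨z.take k, z[k]'(by omega), z.drop (k + 1), by simp, by simp; omega, by
    simp; omega⟩

theorem bit_succ_append (z : List Bool) (a b : Bool) (w : List Bool) :
    bit (z ++ a :: b :: w) (z.length + 1) = b := by
  simp [bit]

theorem eraseIdx_append_length (z : List Bool) (a : Bool) (w : List Bool) :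
    (z ++ a :: w).eraseIdx z.length = z ++ w := by
  rw [List.eraseIdx_append_of_length_le le_rfl]; simp

/-- Comparison gives the bus the value of the wire beside it; the Hadamard transform then makes the
bus free again and records the wire in the sign `(-1)^(w r_k)`. -/
theorem maps_hit {k H : ℕ} (hk : k < H) :
    heightL [.same k, .had k] (H + 1) = some (H + 1) ∧ ∀ (G : Bool → Amp) (z : List Bool),
      z.length = H + 1 → denL [.same k, .had k] (busAmp k G) z
        = busAmp k (fun w r => (1 + Complex.I) / 2 * sgn (w && bit r k) * G (bit r k) r) z := by
  refine ⟨by simp [heightL, WireOp.height, hk]; omega, fun G z hz => ?_⟩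
  obtain ⟨z₁, a, w, rfl, rfl, hw⟩ := exists_bit_split hz (by omega : k < H + 1)
  obtain ⟨b, w, rfl⟩ := List.exists_cons_of_length_pos (l := w) (by omega)
  simp only [denL, WireOp.den, busAmp, bit_append_length, eraseIdx_append_length,
    List.take_left', List.append_assoc, List.cons_append, List.nil_append]
  have : (z₁ ++ a :: b :: w).drop (z₁.length + 1) = b :: w := by
    rw [List.drop_append, List.drop_eq_nil_of_le (by omega)]; simp
  rw [this]
  simp only [bit_succ_append]
  cases a <;> cases b <;> simp [sgn] 

theorem maps_swap {k H : ℕ} (hk : k < H) :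
    heightL [.swap k] (H + 1) = some (H + 1) ∧ ∀ (G : Bool → Amp) (z : List Bool),
      z.length = H + 1 → denL [.swap k] (busAmp k G) z = busAmp (k + 1) G z := by
  refine ⟨by simp [heightL, WireOp.height, hk], fun G z hz => ?_⟩
  obtain ⟨z₁, a, w, rfl, rfl, hw⟩ := exists_bit_split hz (by omega : k < H + 1)
  obtain ⟨b, w, rfl⟩ := List.exists_cons_of_length_pos (l := w) (by omega)
  have e : (z₁ ++ a :: b :: w).eraseIdx (z₁.length + 1) = z₁ ++ a :: w := by
    rw [List.eraseIdx_append_of_length_le (by omega)]; simp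
  have : (z₁ ++ a :: b :: w).drop (z₁.length + 2) = w := by
    rw [List.drop_append, List.drop_eq_nil_of_le (by omega)]; simp
  simp only [denL, WireOp.den, busAmp, bit_append_length, bit_succ_append, e, this,
    List.take_left', List.append_assoc, List.cons_append, List.nil_append, eraseIdx_append_length]

/-- The factor collected by a wire that has passed the first `k` wires. -/
noncomputable def busFactor (i j k : ℕ) (w : Bool) (r : List Bool) : ℂ :=
  if i < k then
    if j < k then ((1 + Complex.I) / 2) ^ 2 * sgn (w && bit r (max i j)) * sgn (bit r i && bit r j)
    else (1 + Complex.I) / 2 * sgn (w && bit r i)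
  else if j < k then (1 + Complex.I) / 2 * sgn (w && bit r j) else 1

/-- The first hit leaves the sign `(-1)^(w zᵢ)`. At the second hit `w` becomes `zⱼ`, which leaves
`(-1)^(zᵢ zⱼ)` and ties the new value of the bus to the wire that was met last, hence the maximum in
`busFactor`. The nine cases are the positions of `k` relative to `i` and `j`; the case `i = j`, with
two hits in a row, is allowed. -/
theorem maps_pass {i j k H : ℕ} (hk : k < H) :
    heightL (pass i j k) (H + 1) = some (H + 1) ∧ ∀ (φ : Amp) (z : List Bool),
      z.length = H + 1 → denL (pass i j k) (busAmp k fun w r => busFactor i j k w r * φ r) z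
        = busAmp (k + 1) (fun w r => busFactor i j (k + 1) w r * φ r) z := by
  have h1 := maps_hit hk
  have h2 := maps_swap hk
  have key : ∀ p : Prop, [Decidable p] → ∀ G : Bool → Amp,
      heightL (if p then [.same k, .had k] else []) (H + 1) = some (H + 1) ∧ ∀ z : List Bool,
      z.length = H + 1 → denL (if p then [.same k, .had k] else []) (busAmp k G) z
        = busAmp k (fun w r => if p then (1 + Complex.I) / 2 * sgn (w && bit r k) * G (bit r k) r
            else G w r) z := fun p _ G => by
    split_ifs
    exacts [⟨h1.1, h1.2 G⟩, ⟨rfl, fun z _ => rfl⟩]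
  refine ⟨?_, fun φ z hz => ?_⟩
  · rw [pass, heightL_append, heightL_append, (key _ (fun _ _ => 0)).1, Option.bind_some,
      (key _ (fun _ _ => 0)).1, Option.bind_some, h2.1]
  · rw [pass, denL_append, denL_append]
    have hh := (key (k = i) (fun _ _ => 0)).1
    rw [denL_congr h2.1 (fun w hw => denL_congr (key (k = j) (fun _ _ => 0)).1
      (fun v hv => (key (k = i) _).2 v hv) w hw) z hz,
      denL_congr h2.1 (fun w hw => (key (k = j) _).2 w hw) z hz, h2.2 _ z hz]
    simp only [busAmp]
    generalize z.eraseIdx (k + 1) = r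
    generalize bit z (k + 1) = w
    rcases lt_trichotomy k i with hi | rfl | hi <;> rcases lt_trichotomy k j with hj | hj | hj
    · have a1 : ¬ k = i := by omega
      have a2 : ¬ k = j := by omega
      have a3 : ¬ i < k := by omega
      have a4 : ¬ j < k := by omega
      have a5 : ¬ i < k + 1 := by omega
      have a6 : ¬ j < k + 1 := by omega
      simp [busFactor, *]
    · subst hj
      have a1 : ¬ k = i := by omega
      have a3 : ¬ i < k := by omega
      have a5 : ¬ i < k + 1 := by omega
      simp [busFactor, *]
    · have a1 : ¬ k = i := by omega
      have a2 : ¬ k = j := by omega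
      have a3 : ¬ i < k := by omega
      have a5 : ¬ i < k + 1 := by omega
      have a6 : j < k + 1 := by omega
      simp [busFactor, *]
    · have a2 : ¬ k = j := by omega
      have a4 : ¬ j < k := by omega
      have a6 : ¬ j < k + 1 := by omega
      simp [busFactor, *]
    · subst hj
      simp [busFactor]; ring
    · have a2 : ¬ k = j := by omega
      have a6 : j < k + 1 := by omega
      have a7 : max k j = k := by omega
      simp [busFactor, *]; ring
    · have a1 : ¬ k = i := by omega
      have a2 : ¬ k = j := by omega
      have a4 : ¬ j < k := by omega
      have a5 : i < k + 1 := by omega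
      have a6 : ¬ j < k + 1 := by omega
      simp [busFactor, *]
    · subst hj
      have a1 : ¬ k = i := by omega
      have a5 : i < k + 1 := by omega
      have a7 : max i k = k := by omega
      simp [busFactor, *, Bool.and_comm]; ring
    · have a1 : ¬ k = i := by omega
      have a2 : ¬ k = j := by omega
      have a5 : i < k + 1 := by omega
      have a6 : j < k + 1 := by omega
      simp [busFactor, *]

theorem pass_nonzero (i j p : ℕ) : ∀ o ∈ pass i j p, o.Nonzero := by
  intro o ho
  simp only [pass, List.mem_append, List.mem_singleton] at ho
  rcases ho with (ho | ho) | rfl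
  · split_ifs at ho <;> simp at ho; rcases ho with rfl | rfl <;> trivial
  · split_ifs at ho <;> simp at ho; rcases ho with rfl | rfl <;> trivial
  · trivial

theorem maps_passes (i j : ℕ) {k H : ℕ} (hk : k ≤ H) :
    heightL ((List.range k).flatMap (pass i j)) (H + 1) = some (H + 1) ∧
      ∀ (φ : Amp) (z : List Bool), z.length = H + 1 →
        denL ((List.range k).flatMap (pass i j)) (busAmp 0 fun _ r => φ r) z
          = busAmp k (fun w r => busFactor i j k w r * φ r) z := by
  induction k with
  | zero => exact ⟨rfl, fun φ z _ => by simp [denL, busAmp, busFactor]⟩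
  | succ k ih =>
    obtain ⟨h1, h2⟩ := ih (by omega)
    obtain ⟨h3, h4⟩ := maps_pass (i := i) (j := j) (H := H) (k := k) (by omega)
    rw [List.range_succ, List.flatMap_append, List.flatMap_singleton]
    refine ⟨by rw [heightL_append, h1, Option.bind_some, h3], fun φ z hz => ?_⟩
    rw [denL_append, denL_congr h3 (h2 φ) z hz, h4 φ z hz]

/-- Projecting the bus onto `0` removes the sign in which it still takes part. The remaining
constant is `√2 · ((1 + i)/2)² = √2 · i/2`, which the scalar `-i √2` cancels. -/
theorem mul_edge {H i j : ℕ} (hi : i < H) (hj : j < H) :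
    Mul (edge (List.range H) i j) H fun z => sgn (bit z i && bit z j) := by
  have hb : Mul (WireOp.plus 0 :: (List.range H).flatMap (pass i j) ++ [.zero H]) H
      fun z => fourthRootTwo ^ 2 * (((1 + Complex.I) / 2) ^ 2 * sgn (bit z i && bit z j)) := by
    obtain ⟨h1, h2⟩ := maps_passes i j (le_refl H)
    have h3 : heightL [.plus 0] H = some (H + 1) := by simp [heightL, WireOp.height]
    have h4 : heightL [.zero H] (H + 1) = some H := by simp [heightL, WireOp.height]
    refine ⟨?_, ?_, fun φ z hz => ?_⟩
    · rw [show WireOp.plus 0 :: (List.range H).flatMap (pass i j)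
        = [.plus 0] ++ (List.range H).flatMap (pass i j) from rfl, heightL_append, heightL_append,
        h3, Option.bind_some, h1, Option.bind_some, h4]
    · simp only [List.cons_append, List.mem_cons, List.mem_append, List.mem_flatMap,
        List.not_mem_nil, or_false]
      rintro o (rfl | ⟨p, -, ho⟩ | rfl)
      · trivial
      · exact pass_nonzero i j p o ho
      · trivial
    · rw [show WireOp.plus 0 :: (List.range H).flatMap (pass i j)
        = [.plus 0] ++ (List.range H).flatMap (pass i j) from rfl, denL_append, denL_append,
        denL_congr h4 (fun v hv => (denL_congr h1 (φ' := busAmp 0 fun _ r => φ r) (fun u hu => ?_)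
          v hv).trans (h2 φ v hv)) z hz]
      · simp only [denL, WireOp.den, busAmp]
        rw [List.take_of_length_le hz.le, List.drop_eq_nil_of_le hz.le, List.append_nil,
          bit_append_length' hz]
        have : (z ++ [false]).eraseIdx H = z := by
          rw [← hz, eraseIdx_append_length, List.append_nil]
        rw [this]
        simp only [busFactor, hi, hj, if_true, Bool.false_and]
        simp [sgn]; ring_nf
      · simp [denL, WireOp.den, busAmp]
  rw [edge, List.length_range]
  refine (hb.append (mul_scal H _)).congr fun z _ => ?_
  rw [fourthRootTwo_sq]
  have h : ((Real.sqrt 2 : ℝ) : ℂ) * ((Real.sqrt 2 : ℝ) : ℂ) = 2 := by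
    rw [← Complex.ofReal_mul, Real.mul_self_sqrt (by norm_num)]; norm_num
  generalize sgn (bit z i && bit z j) = X
  generalize ((Real.sqrt 2 : ℝ) : ℂ) = s at h ⊢
  linear_combination (-(Complex.I * ((1 + Complex.I) / 2) ^ 2 * X)) * h
    + (-X * (1 + Complex.I / 2)) * Complex.I_sq

end Quon

namespace Quon

/-! ### Tables and Clifford tensors as operations on wires -/

/-- One more wire. -/
def grow (hs : List ℕ) : List ℕ := hs ++ [hs.length]

theorem grow_range (H : ℕ) : grow (List.range H) = List.range (H + 1) := by
  simp [grow, List.range_succ]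

/-- The weight `w`, possibly zero, for the value `1` of wire `i`. -/
noncomputable def weight (hs : List ℕ) (i : ℕ) (w : ℂ) : List WireOp :=
  if w = 0 then fresh hs.length (edge (grow hs) hs.length i) ++ scal hs.length (1 / 2)
  else [.phase i w]

/-- For `w = 0` the hidden bit `u` gives `½ ∑_u (-1)^(u zᵢ)`, which vanishes exactly if `zᵢ = 1`. -/
theorem mul_weight {H i : ℕ} (hi : i < H) (w : ℂ) :
    Mul (weight (List.range H) i w) H fun z => if bit z i then w else 1 := by
  unfold weight
  split_ifs with h
  · rw [List.length_range, grow_range]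
    refine ((Mul.fresh (mul_edge (by omega) (by omega))).append (mul_scal H _)).congr
      fun z hz => ?_
    rw [bit_append_length' hz, bit_append_length' hz, bit_append_left (by omega),
      bit_append_left (by omega)]
    cases bit z i <;> simp [sgn, h]; norm_num
  · exact Mul.phase hi h

/-- A square root of `-i`. -/
noncomputable def rootNegI : ℂ := (1 - Complex.I) / (Real.sqrt 2 : ℝ)

theorem rootNegI_sq : rootNegI ^ 2 = -Complex.I := by
  rw [rootNegI, div_pow, sqrt_two_mul_sqrt_two]
  linear_combination Complex.I_sq / 2

theorem rootNegI_ne_zero : rootNegI ≠ 0 := fun h => by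
  have := rootNegI_sq; rw [h] at this; simp at this

theorem rootNegI_ne_one : rootNegI ≠ 1 := fun h => by
  have := rootNegI_sq; rw [h] at this
  have := congrArg Complex.re this; simp at this

theorem rootNegI_ne_neg_one : 1 + rootNegI ≠ 0 := fun h => by
  have := rootNegI_sq; rw [show rootNegI = -1 by linear_combination h] at this
  have := congrArg Complex.re this; simp at this

theorem one_sub_I_ne_zero : 1 - Complex.I ≠ 0 := fun h => by
  have := congrArg Complex.re h; simp at this

/-- The condition that wire `x` has the value `b` if wire `u` has the value `1`. -/
noncomputable def literal (hs : List ℕ) (x u : ℕ) (b : Bool) : List WireOp :=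
  fresh hs.length (fresh (hs.length + 1)
    ([.phase x (if b then Complex.I else -Complex.I), .phase u ((Real.sqrt 2 : ℝ) : ℂ)⁻¹,
        .phase hs.length (if b then -rootNegI else rootNegI),
        .phase (hs.length + 1) ((1 - rootNegI) / (1 + rootNegI))]
      ++ edge (grow (grow hs)) x hs.length
      ++ edge (grow (grow hs)) hs.length (hs.length + 1)
      ++ edge (grow (grow hs)) (hs.length + 1) u))
    ++ scal hs.length ((1 + rootNegI) / (2 * (1 - Complex.I)) * if b then -Complex.I else 1)

/-- Let `β = rootNegI`, so `β² = -i`, and let `p`, `q` be the hidden bits. The weight of `q` is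
chosen such that the sum over `q` is `2/(1 + β) · β^(p ⊕ u)`. Take `b = 0`. For `u = 0` the sum over
`p` is `1 + β² (-1)^x`, which the phase `-i` at `x = 1` turns into `1 - i` for both values of `x`.
For `u = 1` it is `β (1 + (-1)^x)`, which vanishes at `x = 1` and, by the weight `1/√2`, is `√2 β =
1 - i` at `x = 0`. For `b = 1` the sign of `β` at `p` and the phase of `x` are reversed, and the
common value becomes `1 + i = i (1 - i)`. The final scalar normalizes these values to `1`. -/
theorem mul_literal {H x u : ℕ} (hx : x < H) (hu : u < H) (b : Bool) :
    Mul (literal (List.range H) x u b) H fun z => if bit z u = true → bit z x = b then 1 else 0 := by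
  have hb1 := rootNegI_ne_zero
  have hb2 := rootNegI_ne_neg_one
  have hb3 : 1 - rootNegI ≠ 0 := sub_ne_zero.2 rootNegI_ne_one.symm
  have hs2 : ((Real.sqrt 2 : ℝ) : ℂ) ≠ 0 := by simp
  have p1 := Mul.phase (H := H + 1 + 1) (i := x) (by omega)
    (w := if b then Complex.I else -Complex.I) (by cases b <;> simp)
  have p2 := Mul.phase (H := H + 1 + 1) (i := u) (by omega) (inv_ne_zero hs2)
  have p3 := Mul.phase (H := H + 1 + 1) (i := H) (by omega)
    (w := if b then -rootNegI else rootNegI) (by cases b <;> simp [hb1])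
  have p4 := Mul.phase (H := H + 1 + 1) (i := H + 1) (by omega)
    (w := (1 - rootNegI) / (1 + rootNegI)) (by simp [hb2, hb3])
  have e1 := mul_edge (H := H + 1 + 1) (i := x) (j := H) (by omega) (by omega)
  have e2 := mul_edge (H := H + 1 + 1) (i := H) (j := H + 1) (by omega) (by omega)
  have e3 := mul_edge (H := H + 1 + 1) (i := H + 1) (j := u) (by omega) (by omega)
  rw [literal, grow_range, grow_range, List.length_range]
  refine ((Mul.fresh (Mul.fresh (((((p1.append (p2.append (p3.append p4))).append e1).append
    e2).append e3)))).append (mul_scal H _)).congr fun z hz => ?_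
  have b1 : ∀ p q, bit (z ++ [p] ++ [q]) x = bit z x := fun p q => by
    rw [List.append_assoc, bit_append_left (by omega)]
  have b2 : ∀ p q, bit (z ++ [p] ++ [q]) u = bit z u := fun p q => by
    rw [List.append_assoc, bit_append_left (by omega)]
  have b3 : ∀ p q, bit (z ++ [p] ++ [q]) H = p := fun p q => by
    rw [List.append_assoc]; exact bit_append_length' hz _ _
  have b4 : ∀ p q, bit (z ++ [p] ++ [q]) (H + 1) = q := fun p q =>
    bit_append_length' (by simp [hz]) _ _
  simp only [b1, b2, b3, b4]
  have h1 := rootNegI_sq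
  have h2 : ((Real.sqrt 2 : ℝ) : ℂ) * rootNegI = 1 - Complex.I := by
    rw [rootNegI]; field_simp
  have h3 := sqrt_two_mul_sqrt_two
  have h4 := one_sub_I_ne_zero
  have h5 := Complex.I_sq
  generalize ((Real.sqrt 2 : ℝ) : ℂ) = s at *
  generalize rootNegI = β at *
  generalize Complex.I = i at *
  cases bit z x <;> cases bit z u <;> cases b <;> simp [sgn] <;> field_simp <;> grind

/-- The factor `t` if the wires `legs` have the values `bits`. -/
noncomputable def entry (hs legs : List ℕ) (bits : List Bool) (t : ℂ) : List WireOp :=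
  fresh hs.length (weight (grow hs) hs.length (t - 1)
    ++ (legs.zip bits).flatMap fun p => literal (grow hs) p.1 hs.length p.2)

theorem prod_map_ite {α : Type*} (l : List α) (p : α → Prop) [DecidablePred p] :
    (l.map fun a => if p a then (1 : ℂ) else 0).prod = if ∀ a ∈ l, p a then 1 else 0 := by
  induction l with
  | nil => simp
  | cons a l ih =>
    rw [List.map_cons, List.prod_cons, ih]
    by_cases h : p a <;> simp [h]

/-- The hidden bit `u` selects `1` for `u = 0` and `t - 1` times the indicator of a match for `u =
1`; the sum is `t` at the match and `1` elsewhere. Here `t - 1` may vanish, so `weight` is needed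
instead of a phase. -/
theorem mul_entry {H : ℕ} {legs : List ℕ} (hl : ∀ i ∈ legs, i < H) (bits : List Bool) (t : ℂ) :
    Mul (entry (List.range H) legs bits t) H
      fun z => if ∀ p ∈ legs.zip bits, bit z p.1 = p.2 then t else 1 := by
  rw [entry, grow_range, List.length_range]
  have hl' : ∀ p ∈ legs.zip bits, p.1 < H := fun p hp => hl _ (List.of_mem_zip hp).1
  refine (Mul.fresh ((mul_weight (by omega) _).append (Mul.flatMap fun p hp =>
    mul_literal (by have := hl' p hp; omega) (by omega) p.2))).congr fun z hz => ?_
  simp only [bit_append_length' hz, prod_map_ite]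
  have : (∀ a ∈ legs.zip bits, True → bit (z ++ [true]) a.1 = a.2)
      ↔ ∀ p ∈ legs.zip bits, bit z p.1 = p.2 :=
    forall₂_congr fun p hp => by
      rw [bit_append_left (by have := hl' p hp; omega)]; simp
  rw [if_pos (fun a _ h => by simp at h), if_congr this rfl rfl]
  simp only [Bool.false_eq_true, if_false, if_true]
  split_ifs <;> simp

/-- The next number, for binary digits that start with the least significant one, when `c` is
to be added. -/
def incr : Bool → List Bool → List Bool
  | _, [] => []
  | c, b :: l => (b ^^ c) :: incr (c && b) l

theorem incr_false (l : List Bool) : incr false l = l := by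
  induction l with
  | nil => rfl
  | cons b l ih => simp [incr, ih]

theorem range_map_testBit (k j : ℕ) : (List.range (k + 1)).map (Nat.testBit j)
    = Nat.testBit j 0 :: (List.range k).map (Nat.testBit (j / 2)) := by
  rw [List.range_succ_eq_map, List.map_cons, List.map_map]
  simp [Function.comp_def, Nat.testBit_succ]

theorem incr_testBit (k j : ℕ) :
    incr true ((List.range k).map (Nat.testBit j)) = (List.range k).map (Nat.testBit (j + 1)) := by
  induction k generalizing j with
  | zero => rfl
  | succ k ih =>
    rw [range_map_testBit, range_map_testBit, incr]
    simp only [Nat.testBit_zero, Bool.true_and, Bool.xor_true]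
    rcases Nat.mod_two_eq_zero_or_one j with h | h
    · have h1 : (j + 1) % 2 = 1 := by omega
      have h2 : (j + 1) / 2 = j / 2 := by omega
      simp [h, h1, h2, incr_false]
    · have h1 : (j + 1) % 2 = 0 := by omega
      have h2 : (j + 1) / 2 = j / 2 + 1 := by omega
      simp [h, h1, h2, ih]

/-- A tensor given by its components. -/
noncomputable def tableOps (hs legs : List ℕ) (T : List ℂ) : List WireOp :=
  (T.foldl (fun s t => (incr true s.1, s.2 ++ entry hs legs s.1 t))
    (legs.map fun _ => false, [])).2

theorem mul_tableOps_aux {H : ℕ} {legs : List ℕ} (hl : ∀ i ∈ legs, i < H) (T : List ℂ) (j : ℕ)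
    (L : List WireOp) (F : List Bool → ℂ) (hL : Mul L H F) :
    Mul (T.foldl (fun s t => (incr true s.1, s.2 ++ entry (List.range H) legs s.1 t))
      ((List.range legs.length).map (Nat.testBit j), L)).2 H fun z => F z *
        ∏ i : Fin T.length, if ∀ p ∈ legs.zip ((List.range legs.length).map (Nat.testBit (j + i))),
          bit z p.1 = p.2 then T.get i else 1 := by
  induction T generalizing j L F with
  | nil => simpa using hL
  | cons t T ih =>
    rw [List.foldl_cons, incr_testBit]
    refine (ih (j + 1) _ _ (hL.append (mul_entry hl _ t))).congr fun z hz => ?_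
    simp only [List.length_cons]
    rw [Fin.prod_univ_succ, mul_assoc]
    congr 2
    refine Finset.prod_congr rfl fun i _ => ?_
    have e : j + 1 + (i : ℕ) = j + (i.succ : ℕ) := by simp; omega
    rw [e]; rfl

theorem zip_ofFn {α β : Type*} {k : ℕ} (f : Fin k → α) (g : Fin k → β) :
    (List.ofFn f).zip (List.ofFn g) = List.ofFn fun i => (f i, g i) := by
  refine List.ext_getElem (by simp) fun i h1 h2 => by simp

theorem range_map_eq_ofFn {α : Type*} (k : ℕ) (f : ℕ → α) :
    (List.range k).map f = List.ofFn fun i : Fin k => f i :=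
  List.ext_getElem (by simp) fun i h1 h2 => by simp

/-- In the product over all entries only the one whose binary digits are the values of the legs
differs from `1`. Nothing requires the wires `t i` to be distinct, so two legs of a node may lie on
the same edge. -/
theorem mul_tableOps {H k : ℕ} {t : Fin k → ℕ} (ht : ∀ i, t i < H) (T : (Fin k → Bool) → ℂ) :
    Mul (tableOps (List.range H) (List.ofFn t)
      (List.ofFn fun j : Fin (2 ^ k) => T fun i => (j : ℕ).testBit i)) H
      fun z => T fun i => bit z (t i) := by
  have h0 : (List.ofFn t).map (fun _ => false)
      = (List.range (List.ofFn t).length).map (Nat.testBit 0) := by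
    refine List.ext_getElem (by simp) fun i h1 h2 => by simp
  rw [tableOps, h0]
  refine (mul_tableOps_aux (by simpa using ht) _ 0 [] _ (Mul.nil H)).congr fun z hz => ?_
  simp only [one_mul, List.length_ofFn, zero_add, range_map_eq_ofFn, zip_ofFn]
  set w : Fin k → Bool := fun i => bit z (t i)
  have hw : Nat.ofBits w < 2 ^ k := Nat.ofBits_lt_two_pow w
  rw [Finset.prod_eq_single (⟨Nat.ofBits w, by simpa using hw⟩ :
    Fin (List.ofFn fun j : Fin (2 ^ k) => T fun i => (j : ℕ).testBit i).length)]
  · have hb : ∀ i : Fin k, (Nat.ofBits w).testBit i = w i := fun i => by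
      rw [Nat.testBit_ofBits_lt _ _ i.2]
    rw [if_pos]
    · simp [hb, w]
    · intro p hp
      obtain ⟨i, rfl⟩ := List.mem_ofFn.1 hp
      exact (hb i).symm
  · intro j _ hj
    rw [if_neg]
    intro h
    refine hj (Fin.ext ?_)
    refine Nat.eq_of_testBit_eq fun i => ?_
    by_cases hi : i < k
    · rw [Nat.testBit_ofBits_lt _ _ hi]
      exact (h _ (List.mem_ofFn.2 ⟨⟨i, hi⟩, rfl⟩)).symm
    · have hj2 : (j : ℕ) < 2 ^ k := by simpa using j.2
      push Not at hi
      rw [Nat.testBit_lt_two_pow (hj2.trans_le (Nat.pow_le_pow_right (by norm_num) hi)),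
        Nat.testBit_lt_two_pow (hw.trans_le (Nat.pow_le_pow_right (by norm_num) hi))]
  · simp

/-- The condition that the values of the wires `legs` selected by `a` sum up to `b`. -/
noncomputable def rowOps (hs legs : List ℕ) (b : Bool) (a : List Bool) : List WireOp :=
  fresh hs.length (weight (grow hs) hs.length (if b then -1 else 1)
      ++ (legs.zip a).flatMap fun p => if p.2 then edge (grow hs) hs.length p.1 else [])
    ++ scal hs.length (1 / 2)

/-- Fourier inversion over `ZMod 2`: the indicator of the equation is `½ ∑_u (-1)^(u (b + ∑ aᵢ
xᵢ))`. -/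
theorem mul_rowOps {H k : ℕ} {t : Fin k → ℕ} (ht : ∀ i, t i < H) (b : Bool) (a : Fin k → Bool) :
    Mul (rowOps (List.range H) (List.ofFn t) b (List.ofFn a)) H fun z =>
      if (∑ i, if a i && bit z (t i) then 1 else 0 : ZMod 2) = (if b then 1 else 0)
        then 1 else 0 := by
  rw [rowOps, grow_range, List.length_range, zip_ofFn]
  refine ((Mul.fresh ((mul_weight (by omega) _).append (Mul.flatMap
    (F := fun p z => if p.2 then sgn (bit z H && bit z p.1) else 1) fun p hp => Mul.ite
      (mul_edge (by omega) ?_)))).append (mul_scal H _)).congr fun z hz => ?_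
  · obtain ⟨i, rfl⟩ := List.mem_ofFn.1 hp
    have := ht i
    simp; omega
  · simp only [bit_append_length' hz, List.map_ofFn, List.prod_ofFn, Function.comp_def]
    have h1 : ∀ i, bit (z ++ [true]) (t i) = bit z (t i) := fun i =>
      bit_append_left (by have := ht i; omega) _
    simp only [h1]
    -- A product of signs is the nontrivial character of `ZMod 2` at the sum of the exponents.
    have h2 : ∀ s : Finset (Fin k), (∏ i ∈ s, if a i = true then sgn (true && bit z (t i)) else 1)
        = if (∑ i ∈ s, if a i && bit z (t i) then 1 else 0 : ZMod 2) = 0 then 1 else -1 := by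
      intro s
      induction s using Finset.induction_on with
      | empty => simp
      | insert i s hi ih =>
        rw [Finset.prod_insert hi, Finset.sum_insert hi, ih]
        generalize (∑ i ∈ s, if a i && bit z (t i) then 1 else 0 : ZMod 2) = c
        have h3 : ∀ c : ZMod 2, c = 0 ∨ c = 1 := by decide
        rcases h3 c with rfl | rfl <;> cases a i <;> cases bit z (t i) <;> simp [sgn] <;> decide
    have h3 : ∀ c : ZMod 2, c = 0 ∨ c = 1 := by decide
    rw [h2]
    rcases h3 (∑ i, if a i && bit z (t i) then 1 else 0 : ZMod 2) with h | h <;> rw [h] <;>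
      cases b <;> simp [sgn] <;> norm_num

/-- `i ^ l`. -/
noncomputable def iPow (l : ℕ) : ℂ :=
  if l = 0 then 1 else if l = 1 then Complex.I else if l = 2 then -1 else -Complex.I

/-- A Clifford tensor without its support condition. -/
noncomputable def phaseOps (hs legs : List ℕ) (lin : List ℕ) (quad : List (List Bool)) :
    List WireOp :=
  ((legs.zip lin).map fun p => WireOp.phase p.1 (iPow p.2))
    ++ (legs.zip quad).zipIdx.flatMap fun p =>
      ((legs.zip p.1.2).drop (p.2 + 1)).flatMap fun q => if q.2 then edge hs p.1.1 q.1 else []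

/-- A Clifford tensor. -/
noncomputable def cliffordOps (hs legs : List ℕ) (c : ℂ) (rows : List (Bool × List Bool))
    (lin : List ℕ) (quad : List (List Bool)) : List WireOp :=
  scal hs.length c ++ rows.flatMap (fun r => rowOps hs legs r.1 r.2) ++ phaseOps hs legs lin quad

theorem iPow_ne_zero (l : ℕ) : iPow l ≠ 0 := by
  unfold iPow; split_ifs <;> simp

theorem iPow_eq (l : Fin 4) : iPow l = Complex.I ^ (l : ℕ) := by
  fin_cases l <;> simp [iPow, Complex.I_sq, Complex.I_pow_three]

theorem zipIdx_ofFn {α : Type*} {k : ℕ} (f : Fin k → α) :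
    (List.ofFn f).zipIdx = List.ofFn fun i => (f i, (i : ℕ)) := by
  refine List.ext_getElem (by simp) fun i h1 h2 => by simp

theorem prod_drop_ofFn {k : ℕ} (f : Fin k → ℂ) (n : ℕ) :
    ((List.ofFn f).drop n).prod = ∏ i : Fin k, if n ≤ (i : ℕ) then f i else 1 := by
  induction k generalizing n with
  | zero => simp
  | succ k ih =>
    cases n with
    | zero => simp [List.prod_ofFn, Fin.prod_univ_succ]
    | succ n => rw [List.ofFn_succ, List.drop_succ_cons, ih, Fin.prod_univ_succ]; simp

theorem mul_phaseOps {H k : ℕ} {t : Fin k → ℕ} (ht : ∀ i, t i < H) (lin : Fin k → Fin 4)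
    (quad : Fin k → Fin k → Bool) :
    Mul (phaseOps (List.range H) (List.ofFn t) (List.ofFn fun i => (lin i : ℕ))
      (List.ofFn fun i => List.ofFn (quad i))) H fun z =>
        Complex.I ^ (∑ i, if bit z (t i) then (lin i : ℕ) else 0)
          * (-1) ^ (∑ i, ∑ j, if i < j ∧ quad i j ∧ bit z (t i) ∧ bit z (t j) then 1 else 0) := by
  rw [phaseOps]
  simp only [zip_ofFn, zipIdx_ofFn]
  have h1 : Mul ((List.ofFn fun i => (t i, (lin i : ℕ))).map fun p => .phase p.1 (iPow p.2)) H
      fun z => ((List.ofFn fun i => (t i, (lin i : ℕ))).map fun p =>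
        if bit z p.1 then iPow p.2 else 1).prod := by
    rw [List.map_eq_flatMap]
    refine Mul.flatMap fun p hp => Mul.phase ?_ (iPow_ne_zero _)
    obtain ⟨i, rfl⟩ := List.mem_ofFn.1 hp
    exact ht i
  have h2 := Mul.flatMap (H := H)
    (l := List.ofFn fun i => ((t i, List.ofFn (quad i)), (i : ℕ)))
    (g := fun p => (((List.ofFn t).zip p.1.2).drop (p.2 + 1)).flatMap fun q =>
      if q.2 then edge (List.range H) p.1.1 q.1 else [])
    (F := fun p z => ((((List.ofFn t).zip p.1.2).drop (p.2 + 1)).map fun q =>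
      if q.2 then sgn (bit z p.1.1 && bit z q.1) else 1).prod) (by
    intro p hp
    refine Mul.flatMap fun q hq => Mul.ite (mul_edge ?_ ?_)
    · obtain ⟨i, rfl⟩ := List.mem_ofFn.1 hp
      exact ht i
    · obtain ⟨j, hj⟩ := List.mem_ofFn.1 (List.of_mem_zip (List.mem_of_mem_drop hq)).1
      exact hj ▸ ht j)
  refine (h1.append h2).congr fun z _ => ?_
  simp only [List.map_ofFn, List.prod_ofFn, Function.comp_def, zip_ofFn, List.map_drop,
    prod_drop_ofFn]
  congr 1
  · rw [← Finset.prod_pow_eq_pow_sum]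
    refine Finset.prod_congr rfl fun i _ => ?_
    split_ifs <;> simp [iPow_eq]
  · rw [← Finset.prod_pow_eq_pow_sum]
    refine Finset.prod_congr rfl fun i _ => ?_
    rw [← Finset.prod_pow_eq_pow_sum]
    refine Finset.prod_congr rfl fun j _ => ?_
    -- Dropping the first `i + 1` legs leaves the pairs above the diagonal.
    have : (i : ℕ) + 1 ≤ j ↔ i < j := Iff.rfl
    simp only [this]
    by_cases hij : i < j <;> cases quad i j <;> cases bit z (t i) <;> cases bit z (t j) <;>
      simp [hij, sgn]

theorem mul_cliffordOps {H k : ℕ} {t : Fin k → ℕ} (ht : ∀ i, t i < H) (c : ℂ)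
    (rows : List ((Fin k → Bool) × Bool)) (lin : Fin k → Fin 4) (quad : Fin k → Fin k → Bool) :
    Mul (cliffordOps (List.range H) (List.ofFn t) c (rows.map fun r => (r.2, List.ofFn r.1))
      (List.ofFn fun i => (lin i : ℕ)) (List.ofFn fun i => List.ofFn (quad i))) H fun z =>
        (NodeTensor.clifford c rows lin quad).component fun i => bit z (t i) := by
  rw [cliffordOps, List.length_range, List.flatMap_map]
  refine (((mul_scal H c).append (Mul.flatMap fun r _ => mul_rowOps ht r.2 r.1)).append
    (mul_phaseOps ht lin quad)).congr fun z _ => ?_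
  rw [prod_map_ite, NodeTensor.component]
  split_ifs <;> ring

end Quon

namespace Quon

/-! ### Matchgate tensors as operations on wires -/

theorem take_append_drop_eq_set {z : List Bool} {c : ℕ} (h : c < z.length) (b : Bool) :
    z.take c ++ [b] ++ z.drop (c + 1) = z.set c b := by
  rw [List.set_eq_take_append_cons_drop, if_pos h]; simp

theorem bit_set_self {z : List Bool} {c : ℕ} (h : c < z.length) (b : Bool) :
    bit (z.set c b) c = b := by
  simp [bit, h]

theorem bit_set_ne {z : List Bool} {c d : ℕ} (h : c ≠ d) (b : Bool) :
    bit (z.set c b) d = bit z d := by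
  simp [bit, h]

theorem bit_set {z : List Bool} {c : ℕ} (h : c < z.length) (b : Bool) :
    bit (z.set c b) = Function.update (bit z) c b := by
  ext d
  rcases eq_or_ne d c with rfl | hd
  · rw [bit_set_self h, Function.update_self]
  · rw [bit_set_ne hd.symm, Function.update_of_ne hd]

/-- Wire `x` is flipped if wire `t` has the value `1`, up to a factor. -/
noncomputable def flip (hs : List ℕ) (t x : ℕ) : List WireOp :=
  .had x :: edge hs t x ++ [.had x]

/-- A controlled `X` is a controlled `Z` between Hadamard transforms. The two factors `(1 + i)/2`
and the `2` from the sum over the intermediate value make up the factor `i`. -/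
theorem maps_flip {H t x : ℕ} (ht : t < H) (hx : x < H) (htx : x ≠ t) :
    Maps (flip (List.range H) t x) H H fun φ z =>
      Complex.I * φ (z.set x (bit z x ^^ bit z t)) := by
  have h1 : Maps [.had x] H H _ := Maps.single (by simp [WireOp.height, hx]) trivial
  refine ((h1.append (mul_edge ht hx)).append h1).congr fun φ z hz => ?_
  have hx' : x < z.length := by omega
  have e : ∀ b, (z.set x b).take x ++ [true] ++ (z.set x b).drop (x + 1) = z.set x true ∧
      (z.set x b).take x ++ [false] ++ (z.set x b).drop (x + 1) = z.set x false := fun b => by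
    rw [take_append_drop_eq_set (by simpa using hx'), take_append_drop_eq_set (by simpa using hx')]
    simp
  simp only [Function.comp, WireOp.den, take_append_drop_eq_set hx', (e _).1, (e _).2,
    bit_set_self hx', bit_set_ne htx]
  cases bit z t <;> cases bit z x <;> simp [sgn] <;> ring_nf <;> simp [Complex.I_sq]

/-- A flip is not diagonal, but its conjugates of diagonal operations are. The two flips undo each
other because the control `t` is untouched, and they leave `i² = -1`. -/
theorem Mul.conj_flip {L : List WireOp} {H t x : ℕ} {F : List Bool → ℂ} (h : Mul L H F)
    (ht : t < H) (hx : x < H) (htx : x ≠ t) :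
    Mul (flip (List.range H) t x ++ L ++ flip (List.range H) t x) H
      fun z => -F (z.set x (bit z x ^^ bit z t)) := by
  have h1 := maps_flip ht hx htx
  refine ((h1.append h).append h1).congr fun φ z hz => ?_
  have hx' : x < z.length := by omega
  simp only [Function.comp, bit_set_self hx', bit_set_ne htx, List.set_set]
  have : z.set x (bit z x ^^ bit z t ^^ bit z t) = z := by
    rw [Bool.xor_assoc, Bool.xor_self, Bool.xor_false]
    rw [bit, List.getD_eq_getElem _ _ hx']; simp
  rw [this]
  linear_combination -F (z.set x (bit z x ^^ bit z t)) * φ z * (-1) * Complex.I_sq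

/-- A pair of wires, the wires between them, and a weight. -/
abbrev Pairing := ℕ × ℕ × List ℕ × ℂ

/-- The operations before and after those of the remaining pairs. -/
noncomputable def pairTop (hs : List ℕ) (f : Pairing) : List WireOp :=
  .plus hs.length :: weight (grow hs) hs.length f.2.2.2
    ++ literal (grow hs) f.1 hs.length true ++ literal (grow hs) f.2.1 hs.length true
    ++ f.2.2.1.flatMap (edge (grow hs) hs.length)
    ++ flip (grow hs) hs.length f.1 ++ flip (grow hs) hs.length f.2.1

noncomputable def pairBot (hs : List ℕ) (f : Pairing) : List WireOp :=
  flip (grow hs) hs.length f.2.1 ++ flip (grow hs) hs.length f.1 ++ [.sum hs.length]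

/-- The product of the factors `1 + a σᵤ σᵥ` of the pairs, applied to the state with the value
`0` on the wires `ys`. -/
noncomputable def pairOps (ys : List ℕ) : List Pairing → List ℕ → List WireOp
  | [], hs => ys.flatMap fun y => weight hs y 0
  | f :: fs, hs => pairTop hs f ++ pairOps ys fs (grow hs) ++ pairBot hs f

/-- The components of the state described by a list of pairs. -/
noncomputable def pairVal (ys : List ℕ) : List Pairing → (ℕ → Bool) → ℂ
  | [], e => if ∀ y ∈ ys, e y = false then 1 else 0
  | f :: fs, e => pairVal ys fs e + if e f.1 && e f.2.1 then
      f.2.2.2 * (f.2.2.1.map fun i => sgn (e i)).prod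
        * pairVal ys fs (Function.update (Function.update e f.1 false) f.2.1 false) else 0

/-- The wires of a pair lie below `H`. -/
def Pairing.Below (H : ℕ) (f : Pairing) : Prop :=
  f.1 < H ∧ f.2.1 < H ∧ f.1 ≠ f.2.1 ∧ ∀ i ∈ f.2.2.1, i < H

theorem pairVal_congr {ys : List ℕ} {fs : List Pairing} {H : ℕ} (hy : ∀ y ∈ ys, y < H)
    (hf : ∀ f ∈ fs, f.Below H) {e e' : ℕ → Bool} (he : ∀ i < H, e i = e' i) :
    pairVal ys fs e = pairVal ys fs e' := by
  induction fs generalizing e e' with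
  | nil =>
    have : (∀ y ∈ ys, e y = false) ↔ ∀ y ∈ ys, e' y = false :=
      forall₂_congr fun y h => by rw [he y (hy y h)]
    simp only [pairVal, this]
  | cons f fs ih =>
    obtain ⟨h1, h2, -, h3⟩ := hf f (by simp)
    have ih' : ∀ {e e' : ℕ → Bool}, (∀ i < H, e i = e' i) → pairVal ys fs e = pairVal ys fs e' :=
      ih fun g hg => hf g (by simp [hg])
    have h4 : f.2.2.1.map (fun i => sgn (e i)) = f.2.2.1.map fun i => sgn (e' i) :=
      List.map_congr_left fun i hi => by rw [he i (h3 i hi)]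
    rw [pairVal, pairVal, ih' he, he _ h1, he _ h2, h4, ih' (e := Function.update _ _ _)]
    intro i hi
    simp only [Function.update_apply]
    split_ifs <;> simp [he i hi]

/-- The hidden bit of a pair chooses the summand `1` or `a σᵤ σᵥ` of its factor. In the second case
the weight, the two conditions and the signs of the wires in between apply, and the remaining
factors see the values of `u` and `v` flipped to `0`. This is achieved by conjugating them with two
controlled flips, whose signs `-1` cancel each other. Each pair uses one hidden wire, alive while
the later pairs are processed. -/
theorem mul_pairOps {ys : List ℕ} {fs : List Pairing} {H : ℕ} (hy : ∀ y ∈ ys, y < H)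
    (hf : ∀ f ∈ fs, f.Below H) :
    Mul (pairOps ys fs (List.range H)) H fun z => pairVal ys fs (bit z) := by
  induction fs generalizing H with
  | nil =>
    refine (Mul.flatMap fun y h => mul_weight (hy y h) 0).congr fun z _ => ?_
    rw [pairVal, ← prod_map_ite]
    congr 1
    refine List.map_congr_left fun y _ => ?_
    cases bit z y <;> simp
  | cons f fs ih =>
    obtain ⟨h1, h2, h12, h3⟩ := hf f (by simp)
    have hy' : ∀ y ∈ ys, y < H + 1 := fun y h => (hy y h).trans (Nat.lt_succ_self H)
    have hf' : ∀ g ∈ fs, g.Below (H + 1) := fun g hg => by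
      obtain ⟨a, b, c, d⟩ := hf g (by simp [hg])
      exact ⟨by omega, by omega, c, fun i hi => (d i hi).trans (Nat.lt_succ_self H)⟩
    have key := Mul.fresh (((((mul_weight (Nat.lt_succ_self H) f.2.2.2).append
      (mul_literal (x := f.1) (by omega) (Nat.lt_succ_self H) true)).append
      (mul_literal (x := f.2.1) (by omega) (Nat.lt_succ_self H) true)).append
      (Mul.flatMap (l := f.2.2.1) fun i hi =>
        mul_edge (Nat.lt_succ_self H) ((h3 i hi).trans (Nat.lt_succ_self H)))).append
      (((ih hy' hf').conj_flip (t := H) (x := f.2.1) (Nat.lt_succ_self H) (by omega)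
        (by omega)).conj_flip (t := H) (x := f.1) (Nat.lt_succ_self H) (by omega) (by omega)))
    refine Eq.mp ?_ (key.congr (G := fun z => pairVal ys (f :: fs) (bit z)) fun z hz => ?_)
    · congr 1
      rw [pairOps, pairTop, pairBot, grow_range, List.length_range, fresh]
      simp only [List.append_assoc, List.cons_append]
    · have hb : ∀ b, ∀ i < H, bit (z ++ [b]) i = bit z i := fun b i hi =>
        bit_append_left (by omega) _
      have hfs : ∀ g ∈ fs, g.Below H := fun g hg => hf g (by simp [hg])
      have hm : ∀ b : Bool, f.2.2.1.map (fun a => sgn (b && bit (z ++ [b]) a))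
          = f.2.2.1.map fun a => sgn (b && bit z a) := fun b =>
        List.map_congr_left fun i hi => by rw [hb b i (h3 i hi)]
      simp only [bit_append_length' hz, hm]
      have hv : ∀ b : Bool, pairVal ys fs (bit (((z ++ [b]).set f.1 (bit (z ++ [b]) f.1 ^^ b)).set
            f.2.1 (bit ((z ++ [b]).set f.1 (bit (z ++ [b]) f.1 ^^ b)) f.2.1
              ^^ bit ((z ++ [b]).set f.1 (bit (z ++ [b]) f.1 ^^ b)) H)))
          = pairVal ys fs (Function.update (Function.update (bit z) f.1 (bit z f.1 ^^ b)) f.2.1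
              (bit z f.2.1 ^^ b)) := fun b => by
        refine pairVal_congr hy hfs fun i hi => ?_
        have hn : H ≠ f.1 := by omega
        rw [bit_set (by simp [hz]; omega), bit_set (by simp [hz]; omega)]
        simp only [Function.update_apply, bit_append_length' hz, hn, h12.symm, if_false,
          hb _ _ h1, hb _ _ h2, hb _ _ hi]
      rw [pairVal, hv, hv, Bool.xor_false, Bool.xor_false, Function.update_eq_self,
        Function.update_eq_self]
      simp only [hb _ _ h1, hb _ _ h2]
      clear key
      cases h5 : bit z f.1 <;> cases h6 : bit z f.2.1 <;> simp [sgn]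

/-! ### Expansion of the Pfaffian -/

section
variable {k : ℕ} (A : Fin k → Fin k → ℂ)

/-- Only the length of the list matters: each step of the expansion uses one unit of fuel and
removes two elements. -/
theorem pfAux_of_le {f : ℕ} : ∀ {l : List (Fin k)}, l.length ≤ f → pfAux A f l = pf A l := by
  induction f using Nat.strong_induction_on with
  | _ f ih =>
    intro l hl
    cases l with
    | nil => cases f <;> rfl
    | cons i l =>
      cases f with
      | zero => simp at hl
      | succ f =>
        simp only [List.length_cons, Nat.add_le_add_iff_right] at hl
        rw [pf, List.length_cons, pfAux, pfAux]
        refine Finset.sum_congr rfl fun p _ => ?_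
        have h : (l.eraseIdx p).length ≤ l.length := by
          rw [List.length_eraseIdx]; split_ifs <;> omega
        rw [ih f (by omega) (h.trans hl), ih l.length (by omega) h]

theorem pf_cons (i : Fin k) (l : List (Fin k)) :
    pf A (i :: l) = ∑ p : Fin l.length, (-1) ^ (p : ℕ) * A i (l.get p) * pf A (l.eraseIdx p) := by
  rw [pf, List.length_cons, pfAux]
  refine Finset.sum_congr rfl fun p _ => ?_
  rw [pfAux_of_le]
  rw [List.length_eraseIdx]; split_ifs <;> omega

/-- The part of the expansion of the Pfaffian along row `i` that comes from the second list. -/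
noncomputable def rowSum (i : Fin k) : List (Fin k) → List (Fin k) → ℂ
  | _, [] => 0
  | pre, j :: l => (-1) ^ pre.length * A i j * pf A (pre ++ l) + rowSum i (pre ++ [j]) l

theorem rowSum_eq (i : Fin k) (pre l : List (Fin k)) : rowSum A i pre l =
    ∑ p : Fin l.length, (-1) ^ (pre.length + p) * A i (l.get p) * pf A (pre ++ l.eraseIdx p) := by
  induction l generalizing pre with
  | nil => simp [rowSum]
  | cons j l ih =>
    rw [rowSum, ih]
    simp only [List.length_cons]
    rw [Fin.sum_univ_succ]
    simp [add_assoc, add_comm 1]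

theorem pf_cons' (i : Fin k) (l : List (Fin k)) : pf A (i :: l) = rowSum A i [] l := by
  simp [pf_cons, rowSum_eq]

variable (g : Fin k → ℕ)

/-- The pairs of row `i`. -/
def rowPairs (i : Fin k) : List (Fin k) → List (Fin k) → List Pairing
  | _, [] => []
  | pre, j :: l => (g i, g j, pre.map g, A i j) :: rowPairs i (pre ++ [j]) l

/-- The pairs of all rows. -/
def allPairs : List (Fin k) → List Pairing
  | [] => []
  | i :: l => rowPairs A g i [] l ++ allPairs l

variable {g}

/-- A pair of row `i` that is used empties the wire of `i`, so no further pair of this row can be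
used: the product over the row is linear in its entries. If no pair of the row is used while `i` is
occupied, the later rows vanish by `hR`. The induction keeps the processed columns in `pre`, since
they determine the sign. -/
theorem pairVal_rowPairs {ys : List ℕ} {i : Fin k} {rest : List Pairing}
    (hR : ∀ e : ℕ → Bool, e (g i) = true → pairVal ys rest e = 0) (hg : Function.Injective g)
    {suf : List (Fin k)} (hi : i ∉ suf) (hn : suf.Nodup) (e : ℕ → Bool)
    (hrest : ∀ e : ℕ → Bool, pairVal ys rest e = if ∀ j ∉ suf, e (g j) = false
      then pf A (suf.filter fun j => e (g j)) else 0) :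
    ∀ pre l : List (Fin k), pre ++ l = suf → ∀ e : ℕ → Bool,
      pairVal ys (rowPairs A g i pre l ++ rest) e = pairVal ys rest e +
        if e (g i) = true ∧ ∀ j ∉ i :: suf, e (g j) = false then
          rowSum A i (pre.filter fun j => e (g j)) (l.filter fun j => e (g j)) else 0 := by
  intro pre l
  induction l generalizing pre with
  | nil => intro _ e; simp [rowPairs, rowSum]
  | cons j l ih =>
    intro h e
    have ih' := ih (pre ++ [j]) (by simpa using h)
    have hij : g i ≠ g j := fun hh => hi (by rw [hg hh, ← h]; simp)
    rw [rowPairs, List.cons_append, pairVal, ih', ih']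
    have h1 : Function.update (Function.update e (g i) false) (g j) false (g i) = false := by
      simp [hij]
    simp only [h1, Bool.false_eq_true, false_and, if_false, add_zero, add_assoc]
    congr 1
    rcases hei : e (g i) with _ | _
    · simp
    rcases hej : e (g j) with _ | _
    · simp [hej]
    have h2 : (pre.map g).map (fun i => sgn (e i)) = pre.map fun j => sgn (e (g j)) := by simp
    -- The fermionic sign counts the occupied wires between `i` and `j`, which is the position of
    -- `j` in the restricted list and thus the sign of the expansion of the Pfaffian.
    have h3 : ∀ pre : List (Fin k), (pre.map fun j => sgn (e (g j))).prod
        = (-1) ^ (pre.filter fun j => e (g j)).length := fun pre => by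
      induction pre with
      | nil => rfl
      | cons a pre ih3 =>
        rw [List.map_cons, List.prod_cons, ih3]
        cases h4 : e (g a) <;> simp [sgn, h4, pow_succ]
    have h5 : (∀ a ∉ suf, Function.update (Function.update e (g i) false) (g j) false (g a) = false)
        ↔ ∀ a ∉ i :: suf, e (g a) = false := by
      simp only [Function.update_apply, hg.eq_iff, List.mem_cons, not_or]
      refine ⟨fun H a ha => ?_, fun H a ha => ?_⟩
      · have haj : a ≠ j := fun hh => ha.2 (by rw [hh, ← h]; simp)
        simpa [ha.1, haj] using H a ha.2
      · split_ifs with h6 h7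
        · rfl
        · rfl
        · exact H a ⟨h7, ha⟩
    have h6 : (suf.filter fun a => Function.update (Function.update e (g i) false) (g j) false (g a))
        = (pre.filter fun a => e (g a)) ++ l.filter fun a => e (g a) := by
      subst h
      have hn' := List.nodup_append.1 hn
      have hjl := (List.nodup_cons.1 hn'.2.1).1
      have : ∀ a, a ≠ i → a ≠ j →
          Function.update (Function.update e (g i) false) (g j) false (g a) = e (g a) := fun a h7 h8 => by
        simp [hg.eq_iff, h7, h8]
      rw [List.filter_append, List.filter_cons]
      simp only [Function.update_self, Bool.false_eq_true, if_false]
      congr 1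
      · refine List.filter_congr fun a ha => this a ?_ ?_
        · rintro rfl; exact hi (by simp [ha])
        · rintro rfl; exact hn'.2.2 _ ha _ (by simp) rfl
      · refine List.filter_congr fun a ha => this a ?_ ?_
        · rintro rfl; exact hi (by simp [ha])
        · rintro rfl; exact hjl ha
    rw [h2, h3, hrest, if_congr h5 rfl rfl, h6]
    by_cases h7 : ∀ a ∉ i :: suf, e (g a) = false
    · rw [if_pos h7, Bool.and_self, if_pos rfl, if_pos ⟨rfl, h7⟩, if_pos ⟨rfl, h7⟩]
      simp [hej, rowSum]; ring
    · rw [if_neg h7, Bool.and_self, if_pos rfl, if_neg (fun h => h7 h.2), if_neg (fun h => h7 h.2)]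
      simp

/-- Row by row. If the wire of `i` is empty, its row contributes nothing. If it is occupied, every
nonzero term uses exactly one pair of this row, and the sum of these terms is the expansion of the
Pfaffian along its first row. -/
theorem pairVal_allPairs (hg : Function.Injective g) {l : List (Fin k)} (hn : l.Nodup)
    (e : ℕ → Bool) : pairVal (List.ofFn g) (allPairs A g l) e =
      if ∀ j ∉ l, e (g j) = false then pf A (l.filter fun j => e (g j)) else 0 := by
  induction l generalizing e with
  | nil => simp [allPairs, pairVal, pf, pfAux]
  | cons i l ih =>
    have hn' := List.nodup_cons.1 hn
    have ih' := ih hn'.2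
    rw [allPairs, pairVal_rowPairs A (fun e he => ?_) hg hn'.1 hn'.2 e ih' [] l rfl, ih']
    · rcases hei : e (g i) with _ | _
      · have : (∀ j ∉ l, e (g j) = false) ↔ ∀ j ∉ i :: l, e (g j) = false := by
          refine ⟨fun H j hj => H j fun h => hj (by simp [h]), fun H j hj => ?_⟩
          rcases eq_or_ne j i with rfl | hji
          · exact hei
          · exact H j (by simp [hj, hji])
        simp [this, hei]
      · have : ¬ ∀ j ∉ l, e (g j) = false := fun H => by simp [H i hn'.1] at hei
        rw [if_neg this, zero_add, List.filter_cons, if_pos hei, pf_cons']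
        simp
    · rw [ih', if_neg]
      intro H; simp [H i hn'.1] at he

theorem rowPairs_eq (i : Fin k) (pre l : List (Fin k)) : rowPairs A g i pre l =
    (l.zipIdx pre.length).map fun q => (g i, g q.1, ((pre ++ l).take q.2).map g, A i q.1) := by
  induction l generalizing pre with
  | nil => rfl
  | cons j l ih =>
    rw [rowPairs, ih, List.zipIdx_cons, List.map_cons]
    simp

end

/-! ### Matchgate tensors -/

/-- New last wires, summed out in the end. -/
def freshes (ys : List ℕ) (L : List WireOp) : List WireOp :=
  ys.map WireOp.plus ++ L ++ ys.reverse.map WireOp.sum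

/-- The sum over all lists of bits of a given length. -/
def bsum : ℕ → (List Bool → ℂ) → ℂ
  | 0, f => f []
  | k + 1, f => bsum k (fun w => f (false :: w)) + bsum k (fun w => f (true :: w))

theorem bsum_eq (k : ℕ) (f : List Bool → ℂ) :
    bsum k f = ∑ y : Fin k → Bool, f (List.ofFn y) := by
  induction k generalizing f with
  | zero => simp [bsum]
  | succ k ih =>
    rw [bsum, ih, ih, ← (Fin.consEquiv fun _ => Bool).sum_comp, Fintype.sum_prod_type,
      Fintype.sum_bool, add_comm]
    simp [Fin.consEquiv, List.ofFn_succ]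

theorem Mul.freshes {L : List WireOp} {H k : ℕ} {F : List Bool → ℂ} (h : Mul L (H + k) F) :
    Mul (freshes (List.range' H k) L) H fun z => bsum k fun w => F (z ++ w) := by
  induction k generalizing H with
  | zero => simpa [Quon.freshes, bsum] using h
  | succ k ih =>
    have h1 := (ih (H := H + 1) (by rwa [Nat.add_right_comm])).fresh
    refine Eq.mp ?_ (h1.congr (G := fun z => bsum (k + 1) fun w => F (z ++ w)) fun z _ => ?_)
    · congr 1
      simp [Quon.freshes, Quon.fresh, List.range'_succ]
    · simp [bsum]

/-- The pairs of an antisymmetric matrix on the wires `ys`. -/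
def matrixPairs (ys : List ℕ) (A : List (List ℂ)) : List Pairing :=
  (ys.zip A).zipIdx.flatMap fun p => ((ys.zip p.1.2).drop (p.2 + 1)).zipIdx.map fun q =>
    (p.1.1, q.1.1, (ys.drop (p.2 + 1)).take q.2, q.1.2)

/-- A matchgate tensor. -/
noncomputable def matchgateOps (hs legs : List ℕ) (c : ℂ) (ref : List Bool) (A : List (List ℂ)) :
    List WireOp :=
  let ys := legs.zipIdx.map fun p => hs.length + p.2
  scal hs.length c ++ freshes ys
    (((legs.zip ref).zip ys).flatMap (fun p => rowOps (hs ++ ys) [p.1.1, p.2] p.1.2 [true, true])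
      ++ pairOps ys (matrixPairs ys A) (hs ++ ys))

theorem ofFn_eq_finRange_map {α : Type*} {k : ℕ} (f : Fin k → α) :
    List.ofFn f = (List.finRange k).map f := List.ofFn_eq_map

theorem matrixPairs_ofFn {k : ℕ} (g : Fin k → ℕ) (A : Fin k → Fin k → ℂ) :
    matrixPairs (List.ofFn g) (List.ofFn fun i => List.ofFn (A i))
      = allPairs A g (List.finRange k) := by
  have h1 : ∀ i : Fin k, ((((List.ofFn g).zip (List.ofFn (A i))).drop ((i : ℕ) + 1)).zipIdx.map
      fun q => (g i, q.1.1, ((List.ofFn g).drop ((i : ℕ) + 1)).take q.2, q.1.2))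
      = rowPairs A g i [] ((List.finRange k).drop ((i : ℕ) + 1)) := fun i => by
    rw [zip_ofFn, rowPairs_eq, ofFn_eq_finRange_map, ofFn_eq_finRange_map, ← List.map_drop,
      ← List.map_drop, List.zipIdx_map, List.map_map]
    simp [Function.comp_def, List.map_take]
  rw [matrixPairs, zip_ofFn, zipIdx_ofFn,
    ofFn_eq_finRange_map fun i => ((g i, List.ofFn (A i)), (i : ℕ)), List.flatMap_map]
  simp only [h1]
  have h2 : ∀ m n : ℕ, n + m = k → ((List.finRange k).drop n).flatMap
      (fun i => rowPairs A g i [] ((List.finRange k).drop ((i : ℕ) + 1)))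
      = allPairs A g ((List.finRange k).drop n) := by
    intro m
    induction m with
    | zero =>
      intro n hn
      rw [List.drop_eq_nil_of_le (by simp; omega)]; rfl
    | succ m ih =>
      intro n hn
      rw [List.drop_eq_getElem_cons (by simp; omega), List.flatMap_cons, ih (n + 1) (by omega),
        allPairs]
      simp
  simpa using h2 k 0 (by omega)

theorem below_of_mem_allPairs {k : ℕ} {A : Fin k → Fin k → ℂ} {g : Fin k → ℕ} {H : ℕ}
    (hg : Function.Injective g) (hH : ∀ i, g i < H) {l : List (Fin k)} (hl : l.Nodup) :
    ∀ f ∈ allPairs A g l, f.Below H := by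
  induction l with
  | nil => simp [allPairs]
  | cons i l ih =>
    intro f hf
    have hn := List.nodup_cons.1 hl
    rw [allPairs, List.mem_append] at hf
    rcases hf with hf | hf
    · rw [rowPairs_eq] at hf
      obtain ⟨q, hq, rfl⟩ := List.mem_map.1 hf
      have hq' := List.fst_mem_of_mem_zipIdx hq
      refine ⟨hH _, hH _, fun h => hn.1 (hg h ▸ hq'), fun a ha => ?_⟩
      obtain ⟨b, -, rfl⟩ := List.mem_map.1 ha
      exact hH _
    · exact ih hn.2 f hf

/-- The pairs act on new wires `yᵢ = xᵢ ⊕ refᵢ`, set by one affine equation each. The legs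
themselves would not do, because two legs may lie on one wire while the expansion needs distinct
wires, in the order of the legs. -/
theorem mul_matchgateOps {H k : ℕ} {t : Fin k → ℕ} (ht : ∀ i, t i < H) (c : ℂ)
    (ref : Fin k → Bool) (A : Fin k → Fin k → ℂ) :
    Mul (matchgateOps (List.range H) (List.ofFn t) c (List.ofFn ref)
      (List.ofFn fun i => List.ofFn (A i))) H fun z =>
        (NodeTensor.matchgate c ref A).component fun i => bit z (t i) := by
  have hy : ((List.ofFn t).zipIdx.map fun p => H + p.2) = List.ofFn fun i : Fin k => H + (i : ℕ) := by
    rw [zipIdx_ofFn, List.map_ofFn]; rfl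
  have hy' : (List.ofFn fun i : Fin k => H + (i : ℕ)) = List.range' H k := by
    refine List.ext_getElem (by simp) fun i h1 h2 => by simp
  have hr : List.range H ++ List.range' H k = List.range (H + k) := by
    rw [List.range_eq_range', List.range_eq_range', ← List.range'_append]; simp
  have hg : Function.Injective fun i : Fin k => H + (i : ℕ) := fun i j h => by
    simp only [Nat.add_left_cancel_iff] at h; exact Fin.ext h
  have hlt : ∀ i : Fin k, H + (i : ℕ) < H + k := fun i => by omega
  simp only [matchgateOps, List.length_range]
  rw [hy, matrixPairs_ofFn, zip_ofFn, zip_ofFn]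
  have key := (mul_scal H c).append (Mul.freshes (k := k) ((Mul.flatMap
    (l := List.ofFn fun i : Fin k => ((t i, ref i), H + (i : ℕ)))
    (g := fun p => rowOps (List.range (H + k)) [p.1.1, p.2] p.1.2 [true, true])
    (F := fun p z => if bit z p.2 = (bit z p.1.1 ^^ p.1.2) then 1 else 0) (fun p hp => ?_)).append
    (mul_pairOps (ys := List.ofFn fun i : Fin k => H + (i : ℕ))
      (fs := allPairs A (fun i => H + (i : ℕ)) (List.finRange k)) (by
        simp only [List.mem_ofFn]; rintro _ ⟨i, rfl⟩; exact hlt i)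
      (below_of_mem_allPairs hg hlt (List.nodup_finRange k)))))
  · refine Eq.mp ?_ (key.congr (G := fun z => (NodeTensor.matchgate c ref A).component
      fun i => bit z (t i)) fun z hz => ?_)
    · congr 1
      rw [hy', hr]
    · rw [NodeTensor.component, bsum_eq]
      congr 1
      simp only [prod_map_ite, pairVal_allPairs A hg (List.nodup_finRange k), List.mem_finRange,
        not_true_eq_false, false_imp_iff, implies_true, if_true]
      have hb : ∀ (w : List Bool) (i : Fin k), bit (z ++ w) (t i) = bit z (t i) := fun w i =>
        bit_append_left (by have := ht i; omega) _
      have hw : ∀ (w : Fin k → Bool) (i : Fin k), bit (z ++ List.ofFn w) (H + i) = w i :=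
        fun w i => by
          rw [bit, List.getD_append_right _ _ _ _ (by omega)]
          simp [hz]
      -- The equations leave a single term of the sum over the new wires.
      rw [Finset.sum_eq_single fun i => bit z (t i) ^^ ref i]
      · rw [if_pos, one_mul]
        · simp only [hw]
        · intro p hp
          obtain ⟨i, rfl⟩ := List.mem_ofFn.1 hp
          simp only [hw, hb]
      · intro w _ hne
        rw [if_neg, zero_mul]
        intro h
        refine hne (funext fun i => ?_)
        have := h _ (List.mem_ofFn.2 ⟨i, rfl⟩)
        simpa only [hw, hb] using this
      · simp
  · obtain ⟨i, rfl⟩ := List.mem_ofFn.1 hp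
    have := ht i
    have h2 := mul_rowOps (H := H + k) (t := ![t i, H + i]) (by
      intro j; fin_cases j <;> simp; omega) (ref i) ![true, true]
    have e : List.ofFn ![t i, H + (i : ℕ)] = [t i, H + (i : ℕ)] ∧
        List.ofFn ![true, true] = [true, true] := ⟨by simp, by simp⟩
    rw [e.1, e.2] at h2
    refine h2.congr fun z _ => ?_
    simp only [Fin.sum_univ_two]
    simp only [Matrix.cons_val_zero, Matrix.cons_val_one, Bool.true_and]
    cases bit z (t i) <;> cases bit z (H + i) <;> cases ref i <;> simp <;> decide

end Quon

namespace Quon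

/-! ### The diagram of a network -/

/-- The data of a tensor without reference to its number of legs. -/
inductive RawTensor where
  | table (T : List ℂ)
  | clifford (c : ℂ) (rows : List (Bool × List Bool)) (lin : List ℕ) (quad : List (List Bool))
  | matchgate (c : ℂ) (ref : List Bool) (A : List (List ℂ))

/-- The data of a leg end: `0` for an open leg or `1` for an inner edge, and its number. -/
abbrev RawEnd := ℕ × ℕ

/-- The data of a node. -/
abbrev RawNode := List RawEnd × RawTensor

def NodeTensor.raw {k : ℕ} : NodeTensor k → RawTensor
  | .table T => .table (List.ofFn fun j : Fin (2 ^ k) => T fun i => (j : ℕ).testBit i)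
  | .clifford c rows lin quad => .clifford c (rows.map fun r => (r.2, List.ofFn r.1))
      (List.ofFn fun i => (lin i : ℕ)) (List.ofFn fun i => List.ofFn (quad i))
  | .matchgate c ref A => .matchgate c (List.ofFn ref) (List.ofFn fun i => List.ofFn (A i))

def rawEnd {n m : ℕ} : Fin n ⊕ Fin m → RawEnd
  | .inl i => (0, i)
  | .inr j => (1, j)

def Node.raw {n m : ℕ} (v : Node n m) : RawNode :=
  (List.ofFn fun i => rawEnd (v.leg i), v.tensor.raw)

/-- The operations of a tensor on the wires `legs`. -/
noncomputable def RawTensor.ops (hs legs : List ℕ) : RawTensor → List WireOp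
  | .table T => tableOps hs legs T
  | .clifford c rows lin quad => cliffordOps hs legs c rows lin quad
  | .matchgate c ref A => matchgateOps hs legs c ref A

/-- The wire of a leg end, when there are `n` open legs. -/
def wireOf (n : ℕ) (a : RawEnd) : ℕ := if a.1 = 0 then a.2 else n + a.2

noncomputable def nodeOps (n : ℕ) (hs : List ℕ) (v : RawNode) : List WireOp :=
  v.2.ops hs (v.1.map (wireOf n))

/-- The operations of a network on the wires `hs`, of which the first `n` are open. -/
noncomputable def wiresOps (n : ℕ) (hs : List ℕ) (N : List RawNode) : List WireOp :=
  hs.map WireOp.plus ++ N.flatMap (nodeOps n hs) ++ (hs.drop n).map (fun _ => WireOp.sum n)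
    ++ (hs.take n).flatMap (fun _ => scal n (1 / (1 + Complex.I)))
    ++ (hs.take n).reverse.map WireOp.had

/-- The numbers `0, 1, …` for the edges of a network. -/
def wireList (n m : ℕ) (N : List RawNode) : List ℕ :=
  ((N.flatMap Prod.fst).zipIdx.map Prod.snd).take (n + m)

noncomputable def networkOps (n m : ℕ) (N : List RawNode) : List WireOp :=
  wiresOps n (wireList n m N) N

theorem mul_ops {H k : ℕ} {t : Fin k → ℕ} (ht : ∀ i, t i < H) (T : NodeTensor k) :
    Mul (T.raw.ops (List.range H) (List.ofFn t)) H fun z => T.component fun i => bit z (t i) := by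
  cases T with
  | table T => exact mul_tableOps ht T
  | clifford c rows lin quad => exact mul_cliffordOps ht c rows lin quad
  | matchgate c ref A => exact mul_matchgateOps ht c ref A

theorem wireOf_inl {n m : ℕ} (i : Fin n) : wireOf n (rawEnd (.inl i : Fin n ⊕ Fin m)) = i := by
  simp [wireOf, rawEnd]

theorem wireOf_inr {n m : ℕ} (j : Fin m) : wireOf n (rawEnd (.inr j : Fin n ⊕ Fin m)) = n + j := by
  simp [wireOf, rawEnd]

theorem wireOf_lt {n m : ℕ} (a : Fin n ⊕ Fin m) : wireOf n (rawEnd a) < n + m := by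
  rcases a with i | j <;> simp [wireOf, rawEnd]; omega

theorem mul_nodeOps {n m : ℕ} (v : Node n m) :
    Mul (nodeOps n (List.range (n + m)) v.raw) (n + m) fun z =>
      v.tensor.component fun i => bit z (wireOf n (rawEnd (v.leg i))) := by
  have : v.raw.1.map (wireOf n) = List.ofFn fun i => wireOf n (rawEnd (v.leg i)) := by
    simp [Node.raw, Function.comp_def]
  rw [nodeOps, this]
  exact mul_ops (fun i => wireOf_lt _) _

/-- The amplitude of wires that end at legs with the given indices. -/
noncomputable def outWires : List Bool → Amp → ℂ
  | [], φ => φ []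
  | v :: vs, φ => outWires vs fun m => φ (false :: m) + sgn v * φ (true :: m)

theorem outVal_eq {vs : List Bool} {ψ φ : Amp}
    (h : ∀ z : List Bool, z.length = vs.length → ψ (dbl z) = φ z) :
    outVal vs ψ = outWires vs φ := by
  induction vs generalizing ψ φ with
  | nil => exact h [] rfl
  | cons v vs ih =>
    refine ih fun z hz => ?_
    rw [← h (false :: z) (by simp [hz]), ← h (true :: z) (by simp [hz])]; rfl

theorem outWires_congr {vs : List Bool} {φ φ' : Amp}
    (h : ∀ z : List Bool, z.length = vs.length → φ z = φ' z) : outWires vs φ = outWires vs φ' := by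
  induction vs generalizing φ φ' with
  | nil => exact h [] rfl
  | cons v vs ih => exact ih fun z hz => by rw [h _ (by simp [hz]), h _ (by simp [hz])]

theorem outWires_mul (c : ℂ) (vs : List Bool) (φ : Amp) :
    outWires vs (fun z => c * φ z) = c * outWires vs φ := by
  induction vs generalizing φ with
  | nil => rfl
  | cons v vs ih => rw [outWires, outWires, ← ih]; congr 1; funext m; ring

theorem denL_had_succ (l : List ℕ) (φ : Amp) (v : Bool) (z : List Bool) :
    denL (l.map fun i => WireOp.had (i + 1)) φ (v :: z)
      = denL (l.map WireOp.had) (fun z => φ (v :: z)) z := by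
  induction l generalizing φ with
  | nil => rfl
  | cons i l ih => rw [List.map_cons, List.map_cons, denL, denL, ih]; rfl

theorem range_succ_reverse (n : ℕ) : (List.range (n + 1)).reverse.map WireOp.had
    = (List.range n).reverse.map (fun i => WireOp.had (i + 1)) ++ [.had 0] := by
  rw [List.range_succ_eq_map, List.reverse_cons, List.map_append, ← List.map_reverse,
    List.map_map]; rfl

/-- A leg reads its wire in the Hadamard basis. A preceding Hadamard transform turns this into
reading the value itself, with the factor `2 · (1 + i)/2` for each leg. -/
theorem outWires_had (vs : List Bool) (φ : Amp) :
    outWires vs (denL ((List.range vs.length).reverse.map WireOp.had) φ)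
      = (1 + Complex.I) ^ vs.length * φ vs := by
  induction vs generalizing φ with
  | nil => simp [outWires, denL]
  | cons v vs ih =>
    rw [List.length_cons, range_succ_reverse, outWires]
    simp only [denL_append, denL, WireOp.den, List.take_zero, List.nil_append, List.cons_append,
      List.drop_succ_cons, List.drop_zero, zero_add, denL_had_succ]
    rw [outWires_congr (φ' := fun m => (1 + Complex.I)
      * denL ((List.range vs.length).reverse.map WireOp.had) (fun z => φ (v :: z)) m), outWires_mul,
      ih, pow_succ]
    · ring
    · intro z _
      cases v <;> simp [bit, sgn] <;> ring

theorem heightL_had (n : ℕ) (l : List ℕ) (h : ∀ i ∈ l, i < n) :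
    heightL (l.map WireOp.had) n = some n := by
  induction l with
  | nil => rfl
  | cons i l ih =>
    rw [List.map_cons, heightL, WireOp.height, if_pos (h i (by simp)), Option.bind_some,
      ih fun j hj => h j (by simp [hj])]

theorem maps_plus (H k : ℕ) : Maps ((List.range' H k).map WireOp.plus) H (H + k)
    fun φ z => φ (z.take H) := by
  induction k generalizing H with
  | zero => exact (Maps.nil H).congr fun φ z hz => by rw [List.take_of_length_le (by omega)]; rfl
  | succ k ih =>
    have h1 : Maps [.plus H] H (H + 1) _ := Maps.single (by simp [WireOp.height]) trivial
    rw [List.range'_succ, List.map_cons, show H + (k + 1) = H + 1 + k by omega]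
    refine (h1.append (ih (H + 1))).congr fun φ z hz => ?_
    have : (z.take (H + 1)).drop (H + 1) = [] := by
      rw [List.drop_eq_nil_of_le]; simp
    simp [WireOp.den, this, List.take_take]

theorem bsum_add (k : ℕ) (f g : List Bool → ℂ) :
    bsum k (fun w => f w + g w) = bsum k f + bsum k g := by
  simp only [bsum_eq, Finset.sum_add_distrib]

theorem maps_sums (n : ℕ) (l : List ℕ) : Maps (l.map fun _ => WireOp.sum n) (n + l.length) n
    fun φ z => bsum l.length fun w => φ (z ++ w) := by
  induction l with
  | nil => exact (Maps.nil n).congr fun φ z hz => by simp [bsum]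
  | cons a l ih =>
    have h1 : Maps [.sum n] (n + l.length + 1) (n + l.length) _ :=
      Maps.single (by simp [WireOp.height]) trivial
    refine (h1.append ih).congr fun φ z hz => ?_
    simp only [Function.comp, WireOp.den, List.length_cons, bsum, ← bsum_add]
    congr 1; funext w
    rw [List.take_left' hz, List.drop_left' hz]; simp

/-- The final Hadamard transforms are split off, as they are to be evaluated together with the legs
by `outWires_had`. The scalars inserted before them compensate for its factor. -/
theorem maps_wiresOps {n m : ℕ} (N : Network n m) :
    ∃ L, wiresOps n (List.range (n + m)) (N.map Node.raw)
        = L ++ (List.range n).reverse.map WireOp.had ∧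
      Maps L 0 n fun φ z => (1 / (1 + Complex.I)) ^ n * bsum m fun w =>
        (N.map fun v => v.tensor.component fun i =>
          bit (z ++ w) (wireOf n (rawEnd (v.leg i)))).prod * φ [] := by
  have ht : (List.range (n + m)).take n = List.range n := by
    rw [List.take_range]; congr 1; omega
  have hd : ((List.range (n + m)).drop n).length = m := by simp
  refine ⟨_, by rw [wiresOps, ht], ?_⟩
  have h1 := maps_plus 0 (n + m)
  rw [← List.range_eq_range', zero_add] at h1
  have h2 : Mul ((N.map Node.raw).flatMap (nodeOps n (List.range (n + m)))) (n + m) fun z =>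
      (N.map fun v => v.tensor.component fun i => bit z (wireOf n (rawEnd (v.leg i)))).prod := by
    rw [List.flatMap_map]
    exact Mul.flatMap fun v _ => mul_nodeOps v
  have h3 := maps_sums n ((List.range (n + m)).drop n)
  rw [hd] at h3
  have h4 : Mul ((List.range n).flatMap fun _ => scal n (1 / (1 + Complex.I))) n fun _ =>
      ((List.range n).map fun _ => 1 / (1 + Complex.I)).prod := Mul.flatMap fun _ _ => mul_scal n _
  refine ((((h1.append h2).append h3).append h4)).congr fun φ z hz => ?_
  simp [Function.comp]

/-- The diagram of a network. -/
noncomputable def networkDiagram (n m : ℕ) (N : List RawNode) : Diagram :=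
  ⟨1, ((networkOps n m N).flatMap WireOp.lower).map Layer.ev
    ++ ((wireList n m N).take n).map (Layer.legOut 0)⟩

theorem lawfulBEq_ends {n m : ℕ} : LawfulBEq (Fin n ⊕ Fin m) where
  eq_of_beq {a b} h := by
    cases a <;> cases b
    · exact congrArg _ (eq_of_beq h)
    · cases h
    · cases h
    · exact congrArg _ (eq_of_beq h)
  rfl {a} := by cases a <;> exact beq_self_eq_true (α := Fin _) _

theorem length_ends {n m : ℕ} {N : Network n m} (hN : IsNetwork N) :
    (Network.ends N).length = n + 2 * m := by
  have := lawfulBEq_ends (n := n) (m := m)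
  have h : (Network.ends N).length = ∑ a, (Network.ends N).count a := by
    induction Network.ends N with
    | nil => simp
    | cons a l ih => simp [List.count_cons, Finset.sum_add_distrib, ih]
  rw [h, Fintype.sum_sum_type]
  simp [hN.1, hN.2, mul_comm]

/-- The numbers `n` and `m` are atoms of the input, and a program counts along lists only. The list
of all leg ends has length `n + 2 m`, so its positions include all numbers below `n + m`. -/
theorem wireList_eq {n m : ℕ} {N : Network n m} (hN : IsNetwork N) :
    wireList n m (N.map Node.raw) = List.range (n + m) := by
  have h : ((N.map Node.raw).flatMap Prod.fst).length = n + 2 * m := by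
    rw [← length_ends hN, Network.ends, List.flatMap_map, List.length_flatMap, List.length_flatMap]
    simp [Node.raw]
  rw [wireList, List.zipIdx_map_snd, ← List.range_eq_range', List.take_range, h]
  congr 1; omega

theorem networkDiagram_spec {n m : ℕ} {N : Network n m} (hN : IsNetwork N) :
    IsDiagram (networkDiagram n m (N.map Node.raw)) n ∧
      (networkDiagram n m (N.map Node.raw)).HasOrderedLegs n ∧
      (networkDiagram n m (N.map Node.raw)).tensor n = N.value := by
  have ht : (List.range (n + m)).take n = List.range n := by
    rw [List.take_range]; congr 1; omega
  rw [networkDiagram, networkOps, wireList_eq hN, ht]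
  obtain ⟨L, hL, hm⟩ := maps_wiresOps N
  have hh := heightL_had n (List.range n).reverse (by simp)
  have hw : heightL (wiresOps n (List.range (n + m)) (N.map Node.raw)) 0 = some n := by
    rw [hL, heightL_append, hm.height, Option.bind_some, hh]
  have hz : ∀ o ∈ wiresOps n (List.range (n + m)) (N.map Node.raw), o.Nonzero := by
    rw [hL]
    intro o ho
    rcases List.mem_append.1 ho with ho | ho
    · exact hm.nonzero o ho
    · obtain ⟨i, -, rfl⟩ := List.mem_map.1 ho; trivial
  obtain ⟨r1, r2⟩ := realizes_lowerL hw hz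
  set es := (wiresOps n (List.range (n + m)) (N.map Node.raw)).flatMap WireOp.lower
  have ro : run ((List.range n).map (Layer.legOut 0)) (List.replicate n 2) = some [] := by
    simpa using run_outs (List.range n)
  have hrun : run (es.map Layer.ev) [] = some (List.replicate n 2) := by
    rw [run_ev]; exact r1
  have hc : Closed (es.map Layer.ev ++ (List.range n).map (Layer.legOut 0)) := by
    rw [Closed, run_append, hrun, Option.bind_some, ro]
  refine ⟨⟨hc, ?_⟩, ⟨es, rfl⟩, ?_⟩
  · have h1 : ∀ es : List Elem, legs (es.map Layer.ev) = [] := fun es => by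
      induction es with
      | nil => rfl
      | cons e es ih => exact ih
    have h2 : ∀ l : List ℕ, legs (l.map (Layer.legOut 0)) = l := fun l => by
      induction l with
      | nil => rfl
      | cons e es ih => simp [legs, ih]
    rw [legs_append, h1, h2]; rfl
  · funext x
    rw [Diagram.tensor, one_mul, eval_eq]
    have he := runE_elems (extend x) hc
    rw [evalElems_eq he, elems_append, elems_ev, exec_append (show runE es [] = _ from r1)]
    have h3 := exec_outs (extend x) (List.range n) (exec es [] vac)
    rw [List.length_range] at h3
    rw [h3]
    set vs := (List.range n).map (extend x) with hvs
    have hl : vs.length = n := by simp [vs]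
    rw [outVal_eq (vs := vs) (ψ := exec es [] vac) (φ := denL (wiresOps n (List.range (n + m)) (N.map Node.raw)) vac)
      (fun z hzl => r2 vac vac (evenOn_nil _) (fun z hz => by
        rw [List.length_eq_zero_iff.1 hz]; rfl) z (by omega)), hL]
    rw [outWires_congr (φ' := denL ((List.range vs.length).reverse.map WireOp.had)
      fun z => (1 / (1 + Complex.I)) ^ n * bsum m fun w =>
        (N.map fun v => v.tensor.component fun i =>
          bit (z ++ w) (wireOf n (rawEnd (v.leg i)))).prod), outWires_had]
    · have h1 : (1 + Complex.I) ≠ 0 := fun h => by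
        have := congrArg Complex.re h; simp at this
      -- The scalars `1 / (1 + i)` meet the factor of the Hadamard transforms at the legs.
      rw [hl, ← mul_assoc, ← mul_pow, mul_one_div_cancel h1, one_pow, one_mul, bsum_eq,
        Network.value]
      refine Finset.sum_congr rfl fun y _ => ?_
      congr 1
      refine List.map_congr_left fun v _ => ?_
      congr 1; funext i
      have hv : vs = List.ofFn x := by
        rw [hvs, range_map_eq_ofFn]; congr 1; funext i; simp [extend]
      rcases v.leg i with a | b
      · simp only [wireOf_inl, Sum.elim_inl]
        rw [bit_append_left (by omega), hv, bit, List.getD_eq_getElem _ _ (by simp)]; simp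
      · simp only [wireOf_inr, Sum.elim_inr]
        rw [bit, List.getD_append_right _ _ _ _ (by omega), hl]
        simp
    · intro z hzl
      rw [denL_append, hl]
      refine denL_congr hh (fun w hw => ?_) z (by omega)
      rw [hm.den _ w hw]
      simp [vac]

end Quon

namespace Quon

/-! ### Functions computed in polynomial time -/

/-- Types whose elements are written as trees of numbers. -/
class Enc (α : Type) where
  enc : α → Data

open Enc (enc)

instance : Enc ℕ := ⟨Data.nat⟩
instance : Enc Bool := ⟨Data.bool⟩
instance : Enc ℂ := ⟨Data.atom⟩
instance {α β : Type} [Enc α] [Enc β] : Enc (α × β) := ⟨fun x => .cons (enc x.1) (enc x.2)⟩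
instance {α : Type} [Enc α] : Enc (List α) := ⟨fun l => .list (l.map enc)⟩

/-- The size of the tree of an element. -/
def esize {α : Type} [Enc α] (a : α) : ℕ := (enc a).size

section
variable {α β γ σ : Type} [Enc α] [Enc β] [Enc γ] [Enc σ]

theorem enc_mk (a : α) (b : β) : enc (a, b) = .cons (enc a) (enc b) := rfl

theorem enc_nil : enc ([] : List α) = .nil := rfl

theorem enc_cons (a : α) (l : List α) : enc (a :: l) = .cons (enc a) (enc l) := rfl

theorem esize_nat (n : ℕ) : esize n = 1 := rfl
theorem esize_bool (b : Bool) : esize b = 1 := rfl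
theorem esize_mk (a : α) (b : β) : esize (a, b) = esize a + esize b + 1 := rfl
theorem esize_prod (x : α × β) : esize x = esize x.1 + esize x.2 + 1 := rfl
theorem esize_nil : esize ([] : List α) = 1 := rfl
theorem esize_cons (a : α) (l : List α) : esize (a :: l) = esize a + esize l + 1 := rfl

theorem Data.one_le_size (d : Data) : 1 ≤ d.size := by cases d <;> simp [Data.size]

theorem one_le_esize (a : α) : 1 ≤ esize a := Data.one_le_size _

theorem esize_append (l l' : List α) : esize (l ++ l') + 1 = esize l + esize l' := by
  induction l with
  | nil => rw [List.nil_append, esize_nil, add_comm]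
  | cons a l ih => rw [List.cons_append, esize_cons, esize_cons]; omega

theorem length_le_esize (l : List α) : l.length ≤ esize l := by
  induction l with
  | nil => simp
  | cons a l ih => rw [List.length_cons, esize_cons]; omega

theorem esize_le_of_mem {a : α} {l : List α} (h : a ∈ l) : esize a ≤ esize l := by
  induction l with
  | nil => simp at h
  | cons b l ih =>
    rw [esize_cons]
    rcases List.mem_cons.1 h with rfl | h
    · omega
    · have := ih h; omega

theorem eval_mono (q : Polynomial ℕ) {m n : ℕ} (h : m ≤ n) : q.eval m ≤ q.eval n := by
  rw [Polynomial.eval_eq_sum, Polynomial.eval_eq_sum]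
  exact Finset.sum_le_sum fun i _ => Nat.mul_le_mul_left _ (Nat.pow_le_pow_left h i)

theorem size_foldRun_le (F : Data → Data × ℕ) (d s : Data) :
    (foldRun F d s).1.size ≤ (foldRun F d s).2 := by
  induction d generalizing s with
  | nil => exact le_rfl
  | atom z => exact le_rfl
  | cons a l _ ih =>
    have := ih (F (.cons a s)).1
    rw [foldRun]
    dsimp only
    omega

/-- Every instruction costs at least the size of its output. Bounds on time are therefore bounds on
size, and this makes polynomial bounds compose. -/
theorem size_run_le (p : Prog) (d : Data) : (p.run d).1.size ≤ (p.run d).2 := by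
  induction p generalizing d with
  | pair p q _ _ => simp [Prog.run]
  | comp p q _ h => have := h (p.run d).1; simp only [Prog.run]; omega
  | branch t p q _ h1 h2 =>
    have h1 := h1 d
    have h2 := h2 d
    simp only [Prog.run]; split_ifs <;> simp only <;> omega
  | fold p _ =>
    simp only [Prog.run]
    split
    · exact (size_foldRun_le _ _ _).trans (Nat.le_succ _)
    · exact le_rfl
  | id => exact le_rfl
  | nil => exact le_rfl
  | const z => exact le_rfl
  | _ => simp only [Prog.run] <;> split <;> exact le_rfl

/-- The function `f` is computed by a program in polynomial time. -/
@[fun_prop]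
def Poly (f : α → β) : Prop :=
  ∃ (p : Prog) (q : Polynomial ℕ), ∀ a, (p.run (enc a)).1 = enc (f a) ∧
    (p.run (enc a)).2 ≤ q.eval (esize a)

theorem Poly.esize_le {f : α → β} (hf : Poly f) :
    ∃ q : Polynomial ℕ, ∀ a, esize (f a) ≤ q.eval (esize a) := by
  obtain ⟨p, q, h⟩ := hf
  refine ⟨q, fun a => le_trans ?_ (h a).2⟩
  rw [esize, ← (h a).1]; exact size_run_le _ _

@[fun_prop]
theorem Poly.id' : Poly fun a : α => a :=
  ⟨.id, Polynomial.X, fun a => ⟨rfl, by simp [Prog.run, ret, esize]⟩⟩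

theorem exists_const_prog (d : Data) : ∃ (p : Prog) (c : ℕ), ∀ d', p.run d' = (d, c) := by
  induction d with
  | nil => exact ⟨.nil, 1, fun _ => rfl⟩
  | atom z => exact ⟨.const z, 1, fun _ => rfl⟩
  | cons a b h1 h2 =>
    obtain ⟨p, c, hp⟩ := h1
    obtain ⟨q, c', hq⟩ := h2
    exact ⟨.pair p q, c + c' + (Data.cons a b).size, fun d' => by simp [Prog.run, hp, hq]⟩

@[fun_prop]
theorem Poly.const (b : β) : Poly fun _ : α => b := by
  obtain ⟨p, c, h⟩ := exists_const_prog (enc b)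
  exact ⟨p, Polynomial.C c, fun a => by simp [h]⟩

@[fun_prop]
theorem Poly.comp {g : β → γ} {f : α → β} (hg : Poly g) (hf : Poly f) :
    Poly fun a => g (f a) := by
  obtain ⟨p, q, h⟩ := hf
  obtain ⟨p', q', h'⟩ := hg
  refine ⟨.comp p p', q + q'.comp q + 1, fun a => ⟨?_, ?_⟩⟩
  · simp only [Prog.run, (h a).1, (h' (f a)).1]
  · have h1 : esize (f a) ≤ q.eval (esize a) := by
      refine le_trans ?_ (h a).2
      rw [esize, ← (h a).1]; exact size_run_le _ _
    have h2 := (h' (f a)).2.trans (eval_mono q' h1)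
    have h3 := (h a).2
    simp only [Prog.run, (h a).1, Polynomial.eval_add, Polynomial.eval_comp, Polynomial.eval_one]
    omega

@[fun_prop]
theorem Poly.mk {f : α → β} {g : α → γ} (hf : Poly f) (hg : Poly g) :
    Poly fun a => (f a, g a) := by
  obtain ⟨p, q, h⟩ := hf
  obtain ⟨p', q', h'⟩ := hg
  refine ⟨.pair p p', 2 * q + 2 * q' + 1, fun a => ⟨?_, ?_⟩⟩
  · simp only [Prog.run, (h a).1, (h' a).1]; rfl
  · have h1 := size_run_le p (enc a)
    have h2 := size_run_le p' (enc a)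
    have h3 := (h a).2
    have h4 := (h' a).2
    simp only [Prog.run, Polynomial.eval_add, Polynomial.eval_mul, Polynomial.eval_one,
      Polynomial.eval_ofNat, Data.size]
    omega

theorem Poly.fst' : Poly fun x : α × β => x.1 :=
  ⟨.fst, Polynomial.X, fun a => ⟨rfl, by
    simp [Prog.run, ret, esize, enc, Data.size]; omega⟩⟩

theorem Poly.snd' : Poly fun x : α × β => x.2 :=
  ⟨.snd, Polynomial.X, fun a => ⟨rfl, by
    simp [Prog.run, ret, esize, enc, Data.size]; omega⟩⟩

@[fun_prop]
theorem Poly.fst {f : α → β × γ} (hf : Poly f) : Poly fun a => (f a).1 := Poly.fst'.comp hf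

@[fun_prop]
theorem Poly.snd {f : α → β × γ} (hf : Poly f) : Poly fun a => (f a).2 := Poly.snd'.comp hf

theorem Poly.ofRun {f : α → β} (p : Prog) (h : ∀ a, p.run (enc a) = ret (enc (f a)))
    (c : ℕ) (hc : ∀ a, esize (f a) ≤ c) : Poly f :=
  ⟨p, Polynomial.C c, fun a => by rw [h]; simpa [ret, esize] using hc a⟩

@[fun_prop]
theorem Poly.add {f g : α → ℂ} (hf : Poly f) (hg : Poly g) : Poly fun a => f a + g a :=
  Poly.comp (g := fun x : ℂ × ℂ => x.1 + x.2)
    (Poly.ofRun .add (fun _ => rfl) 1 fun _ => le_rfl) (hf.mk hg)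

@[fun_prop]
theorem Poly.mul {f g : α → ℂ} (hf : Poly f) (hg : Poly g) : Poly fun a => f a * g a :=
  Poly.comp (g := fun x : ℂ × ℂ => x.1 * x.2)
    (Poly.ofRun .mul (fun _ => rfl) 1 fun _ => le_rfl) (hf.mk hg)

@[fun_prop]
theorem Poly.neg {f : α → ℂ} (hf : Poly f) : Poly fun a => -f a :=
  Poly.comp (g := fun x : ℂ => -x) (Poly.ofRun .neg (fun _ => rfl) 1 fun _ => le_rfl) hf

@[fun_prop]
theorem Poly.sub {f g : α → ℂ} (hf : Poly f) (hg : Poly g) : Poly fun a => f a - g a := by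
  simp only [sub_eq_add_neg]; fun_prop

@[fun_prop]
theorem Poly.inv {f : α → ℂ} (hf : Poly f) : Poly fun a => (f a)⁻¹ :=
  Poly.comp (g := fun x : ℂ => x⁻¹) (Poly.ofRun .inv (fun _ => rfl) 1 fun _ => le_rfl) hf

@[fun_prop]
theorem Poly.div {f g : α → ℂ} (hf : Poly f) (hg : Poly g) : Poly fun a => f a / g a := by
  simp only [div_eq_mul_inv]; fun_prop

-- A natural number is written as the complex number to which it is cast, so the same program
-- serves. Arithmetic of natural numbers is reduced to that of `ℂ` in this way.
@[fun_prop]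
theorem Poly.natCast {f : α → ℕ} (hf : Poly f) : Poly fun a => (f a : ℂ) := hf

@[fun_prop]
theorem Poly.natAdd {f g : α → ℕ} (hf : Poly f) (hg : Poly g) : Poly fun a => f a + g a := by
  have h : Poly fun a => ((f a : ℂ) + (g a : ℂ)) := by fun_prop
  simp only [← Nat.cast_add] at h
  exact h

theorem Poly.ite_nil {p : α → Prop} [DecidablePred p] {t : α → Data} {g h : α → β}
    (ht : ∃ (r : Prog) (q : Polynomial ℕ), ∀ a, (r.run (enc a)).1 = t a ∧
      (r.run (enc a)).2 ≤ q.eval (esize a)) (hp : ∀ a, t a = .nil ↔ p a)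
    (hg : Poly g) (hh : Poly h) : Poly fun a => if p a then g a else h a := by
  obtain ⟨r, q, hr⟩ := ht
  obtain ⟨r', q', hr'⟩ := hg
  obtain ⟨r'', q'', hr''⟩ := hh
  refine ⟨.branch r r' r'', q + q' + q'' + 1, fun a => ?_⟩
  have h1 := (hr a).2
  have h2 := (hr' a).2
  have h3 := (hr'' a).2
  simp only [Prog.run, (hr a).1, hp a, Polynomial.eval_add, Polynomial.eval_one]
  split_ifs
  · exact ⟨(hr' a).1, by dsimp only; omega⟩
  · exact ⟨(hr'' a).1, by dsimp only; omega⟩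

theorem Poly.ite_zero {f : α → ℂ} [DecidablePred fun a => f a = 0] {g h : α → β} (hf : Poly f)
    (hg : Poly g) (hh : Poly h) : Poly fun a => if f a = 0 then g a else h a := by
  obtain ⟨p, q, hp⟩ := hf
  refine Poly.ite_nil (p := fun a => f a = 0)
    (t := fun a => (Prog.isZero.run (enc (f a))).1) ⟨.comp p .isZero, q + 2, fun a => ?_⟩
    (fun a => ?_) hg hh
  · have := (hp a).2
    refine ⟨congrArg (fun d => (Prog.isZero.run d).1) (hp a).1, ?_⟩
    simp only [Prog.run, (hp a).1, Polynomial.eval_add, Polynomial.eval_ofNat]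
    split_ifs <;> simp only [ret, Data.size] <;> omega
  · simp only [Prog.run, enc, Data.atom.injEq]
    split_ifs with h <;> simp [ret, h]

@[fun_prop]
theorem Poly.ite_complex {f f' : α → ℂ} [DecidablePred fun a => f a = f' a] {g h : α → β}
    (hf : Poly f) (hf' : Poly f') (hg : Poly g) (hh : Poly h) :
    Poly fun a => if f a = f' a then g a else h a := by
  classical
  have : Poly fun a => if f a - f' a = 0 then g a else h a := Poly.ite_zero (by fun_prop) hg hh
  simp only [sub_eq_zero] at this
  convert this

@[fun_prop]
theorem Poly.ite_nat {f f' : α → ℕ} [DecidablePred fun a => f a = f' a] {g h : α → β}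
    (hf : Poly f) (hf' : Poly f') (hg : Poly g) (hh : Poly h) :
    Poly fun a => if f a = f' a then g a else h a := by
  classical
  have : Poly fun a => if (f a : ℂ) = (f' a : ℂ) then g a else h a := by fun_prop
  simp only [Nat.cast_inj] at this
  convert this

/-- Bits as numbers. -/
def bitNum (b : Bool) : ℂ := if b then 1 else 0

@[fun_prop]
theorem Poly.ite_bool {f : α → Bool} [DecidablePred fun a => f a = true] {g h : α → β}
    (hf : Poly f) (hg : Poly g) (hh : Poly h) : Poly fun a => if f a = true then g a else h a := by
  classical
  have h1 : Poly fun a => bitNum (f a) := hf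
  have : Poly fun a => if bitNum (f a) = 1 then g a else h a := by fun_prop
  have e : ∀ a, bitNum (f a) = 1 ↔ f a = true := fun a => by cases f a <;> simp [bitNum]
  simp only [e] at this
  convert this

@[fun_prop]
theorem Poly.cons {f : α → β} {g : α → List β} (hf : Poly f) (hg : Poly g) :
    Poly fun a => f a :: g a := hf.mk hg

/-- The encoding `e` of the state is arbitrary, so that a parameter can travel along with the state.
The bound `C` is required only for the states that really occur. -/
theorem foldRun_list {F : Data → Data × ℕ} {f : σ → β → σ} {e : σ → Data} {C : ℕ} (l : List β)
    (s : σ) (h : ∀ pre b suf, l = pre ++ b :: suf →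
      (F (.cons (enc b) (e (pre.foldl f s)))).1 = e (f (pre.foldl f s) b) ∧
      (Data.cons (enc b) (e (pre.foldl f s))).size + (F (.cons (enc b) (e (pre.foldl f s)))).2 ≤ C)
    (hC : (e (l.foldl f s)).size ≤ C) :
    (foldRun F (enc l) (e s)).1 = e (l.foldl f s) ∧
      (foldRun F (enc l) (e s)).2 ≤ (l.length + 1) * C := by
  induction l generalizing s with
  | nil => exact ⟨rfl, by simpa [enc_nil, foldRun, ret] using hC⟩
  | cons b l ih =>
    obtain ⟨h1, h2⟩ := h [] b l rfl
    simp only [List.foldl_nil] at h1 h2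
    obtain ⟨h3, h4⟩ := ih (f s b) (fun pre b' suf hl => h (b :: pre) b' suf (by rw [hl]; rfl)) hC
    rw [enc_cons, foldRun]
    simp only [h1]
    refine ⟨h3, ?_⟩
    rw [List.length_cons, add_mul _ _ C, one_mul]
    omega

/-- The body of a loop sees the list element and the state but not the input; the loop therefore
runs with the state `(a, s)` and discards `a` in the end. A bound on all intermediate states has to
be assumed, because a loop that doubles its state at each round would be exponential. -/
theorem Poly.foldl {l : α → List β} {s : α → σ} {f : α → σ → β → σ} (hl : Poly l) (hs : Poly s)
    (hf : Poly fun x : α × σ × β => f x.1 x.2.1 x.2.2)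
    (hb : ∃ q : Polynomial ℕ, ∀ a pre suf, l a = pre ++ suf →
      esize (pre.foldl (f a) (s a)) ≤ q.eval (esize a)) :
    Poly fun a => (l a).foldl (f a) (s a) := by
  obtain ⟨pl, ql, hl⟩ := hl
  obtain ⟨ps, qs, hs⟩ := hs
  obtain ⟨qb, hb⟩ := hb
  have hbody : Poly fun y : β × (α × σ) => (y.2.1, f y.2.1 y.2.2 y.1) := by
    have : Poly fun y : β × (α × σ) => f y.2.1 y.2.2 y.1 :=
      Poly.comp (f := fun y : β × (α × σ) => (y.2.1, y.2.2, y.1)) hf (by fun_prop)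
    fun_prop
  obtain ⟨pf, qf, hf⟩ := hbody
  have hll : ∀ a, esize (l a) ≤ ql.eval (esize a) := fun a => by
    refine le_trans ?_ (hl a).2
    rw [esize, ← (hl a).1]; exact size_run_le _ _
  have hss : ∀ a, esize (s a) ≤ qs.eval (esize a) := fun a => by
    refine le_trans ?_ (hs a).2
    rw [esize, ← (hs a).1]; exact size_run_le _ _
  set B : Polynomial ℕ := ql + Polynomial.X + qb + 2 with hB
  set C : Polynomial ℕ := B + qf.comp B with hC
  refine ⟨.comp (.comp (.pair pl (.pair .id ps)) (.fold pf)) .snd,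
    10 * ql + 10 * qs + 10 * Polynomial.X + 20 + (ql + 1) * C + qb, fun a => ?_⟩
  have key := foldRun_list (F := pf.run) (f := f a) (e := fun t => .cons (enc a) (enc t))
    (C := C.eval (esize a)) (l a) (s a) (fun pre b suf h => by
      have h1 := hf (b, a, pre.foldl (f a) (s a))
      refine ⟨h1.1, ?_⟩
      have h2 : esize b ≤ ql.eval (esize a) :=
        (esize_le_of_mem (by rw [h]; simp)).trans (hll a)
      have h3 := hb a pre (b :: suf) h
      have h4 : (Data.cons (enc b) (Data.cons (enc a) (enc (pre.foldl (f a) (s a))))).size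
          ≤ B.eval (esize a) := by
        simp only [hB, Data.size, Polynomial.eval_add, Polynomial.eval_X, Polynomial.eval_ofNat]
        simp only [esize] at h2 h3 ⊢
        omega
      have h5 := h1.2.trans (eval_mono qf (show esize (b, a, pre.foldl (f a) (s a)) ≤ _ from h4))
      rw [hC, Polynomial.eval_add, Polynomial.eval_comp]
      exact add_le_add h4 h5) (by
      have h3 := hb a (l a) [] (by simp)
      simp only [hC, hB, Data.size, Polynomial.eval_add, Polynomial.eval_X, Polynomial.eval_ofNat]
      simp only [esize] at h3 ⊢
      omega)
  have h1 := hl a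
  have h2 := hs a
  have h3 := hll a
  have h4 := hss a
  have h5 := hb a (l a) [] (by simp)
  have e1 : (Prog.comp (.pair pl (.pair .id ps)) (.fold pf)).run (enc a) = ((foldRun pf.run (enc (l a))
      (.cons (enc a) (enc (s a)))).1, ((Prog.pair pl (.pair .id ps)).run (enc a)).2
        + ((foldRun pf.run (enc (l a)) (.cons (enc a) (enc (s a)))).2 + 1) + 1) := by
    simp only [Prog.run, h1.1, h2.1, ret]
  rw [Prog.run, e1]
  simp only
  rw [key.1]
  refine ⟨rfl, ?_⟩
  have h6 : (l a).length + 1 ≤ ql.eval (esize a) + 1 :=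
    Nat.succ_le_succ ((length_le_esize _).trans h3)
  have h7 := key.2.trans (Nat.mul_le_mul_right _ h6)
  simp only [Prog.run, h1.1, h2.1, ret, Data.size, Polynomial.eval_add, Polynomial.eval_mul,
    Polynomial.eval_X, Polynomial.eval_ofNat, Polynomial.eval_one]
  simp only [esize] at h1 h2 h3 h4 h5 h7 ⊢
  have h8 := h1.2
  have h9 := h2.2
  omega

/-- A loop that enlarges its state by amounts that depend only on a part `μ` of the state, which
is itself enlarged by amounts that do not depend on the state. -/
theorem Poly.foldl_add_add {l : α → List β} {s : α → σ} {f : α → σ → β → σ} (hl : Poly l)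
    (hs : Poly s) (hf : Poly fun x : α × σ × β => f x.1 x.2.1 x.2.2) (μ : σ → ℕ)
    (hμ : ∀ t, μ t ≤ esize t)
    (h₁ : ∃ q : Polynomial ℕ, ∀ a t b, μ (f a t b) ≤ μ t + q.eval (esize a + esize b))
    (h₂ : ∃ q : Polynomial ℕ, ∀ a t b,
      esize (f a t b) ≤ esize t + q.eval (esize a + esize b + μ t)) :
    Poly fun a => (l a).foldl (f a) (s a) := by
  obtain ⟨q1, h₁⟩ := h₁
  obtain ⟨q2, h₂⟩ := h₂
  obtain ⟨ql, hll⟩ := hl.esize_le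
  obtain ⟨qs, hss⟩ := hs.esize_le
  -- `M` bounds the part `μ` during the whole loop: its initial value plus one increment for each
  -- element of the list.
  obtain ⟨M, hM⟩ : ∃ M : Polynomial ℕ, M = qs + ql * q1.comp (Polynomial.X + ql) := ⟨_, rfl⟩
  refine hl.foldl hs hf ⟨qs + ql * q2.comp (Polynomial.X + ql + M), fun a pre suf h => ?_⟩
  have hmem : ∀ b ∈ pre, esize b ≤ esize (l a) := fun b hb =>
    esize_le_of_mem (by rw [h]; simp [hb])
  have hlen : pre.length ≤ ql.eval (esize a) := by
    have := (length_le_esize (l a)).trans (hll a)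
    rw [h, List.length_append] at this
    omega
  have key : ∀ (pre : List β) (t : σ), (∀ b ∈ pre, esize b ≤ esize (l a)) →
      μ t + pre.length * q1.eval (esize a + esize (l a)) ≤ M.eval (esize a) →
      esize (pre.foldl (f a) t)
        ≤ esize t + pre.length * q2.eval (esize a + esize (l a) + M.eval (esize a)) := by
    intro pre
    induction pre with
    | nil => intro t _ _; simp
    | cons b pre ih =>
      intro t ht hm
      rw [List.length_cons, add_mul, one_mul] at hm ⊢
      have hb := ht b (by simp)
      have h3 := eval_mono q1 (Nat.add_le_add_left hb (esize a))
      have h4 := h₁ a t b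
      have h1 := ih (f a t b) (fun b' hb' => ht b' (by simp [hb'])) (by omega)
      have h2 := h₂ a t b
      have h5 := eval_mono q2 (show esize a + esize b + μ t
        ≤ esize a + esize (l a) + M.eval (esize a) by omega)
      rw [List.foldl_cons]
      omega
  refine (key pre (s a) hmem ?_).trans ?_
  · rw [hM, Polynomial.eval_add, Polynomial.eval_mul, Polynomial.eval_comp, Polynomial.eval_add,
      Polynomial.eval_X]
    exact add_le_add ((hμ _).trans (hss a)) (Nat.mul_le_mul hlen
      (eval_mono q1 (Nat.add_le_add_left (hll a) _)))
  · rw [Polynomial.eval_add, Polynomial.eval_mul, Polynomial.eval_comp, Polynomial.eval_add,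
      Polynomial.eval_add, Polynomial.eval_X]
    exact add_le_add (hss a) (Nat.mul_le_mul hlen (eval_mono q2
      (Nat.add_le_add_right (Nat.add_le_add_left (hll a) _) _)))

/-- A loop that enlarges its state by amounts that do not depend on it. -/
theorem Poly.foldl_add {l : α → List β} {s : α → σ} {f : α → σ → β → σ} (hl : Poly l)
    (hs : Poly s) (hf : Poly fun x : α × σ × β => f x.1 x.2.1 x.2.2)
    (hb : ∃ q : Polynomial ℕ, ∀ a t b, esize (f a t b) ≤ esize t + q.eval (esize a + esize b)) :
    Poly fun a => (l a).foldl (f a) (s a) :=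
  hl.foldl_add_add hs hf (fun _ => 0) (fun _ => Nat.zero_le _) ⟨0, fun _ _ _ => by simp⟩ hb

/-- Complexity depends on trees only. A structure can thus be built or taken apart through any type
whose elements are written in the same way. -/
theorem Poly.of_enc {f : α → β} {g : α → γ} (hg : Poly g) (h : ∀ a, enc (f a) = enc (g a)) :
    Poly f := by
  obtain ⟨p, q, hp⟩ := hg
  exact ⟨p, q, fun a => by rw [h]; exact hp a⟩

@[fun_prop]
theorem Poly.and {f g : α → Bool} (hf : Poly f) (hg : Poly g) : Poly fun a => f a && g a := by
  have h : Poly fun a => if f a = true then g a else false := by fun_prop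
  convert h using 2 with a
  cases f a <;> rfl

@[fun_prop]
theorem Poly.not {f : α → Bool} (hf : Poly f) : Poly fun a => !f a := by
  have h : Poly fun a => if f a = true then false else true := by fun_prop
  convert h using 2 with a
  cases f a <;> rfl

@[fun_prop]
theorem Poly.xor {f g : α → Bool} (hf : Poly f) (hg : Poly g) : Poly fun a => f a ^^ g a := by
  have h : Poly fun a => if f a = true then !g a else g a := by fun_prop
  convert h using 2 with a
  cases f a <;> simp

end

end Quon

namespace Quon

/-! ### Operations on lists in polynomial time -/

open Enc (enc)

section
variable {α β γ σ : Type} [Enc α] [Enc β] [Enc γ] [Enc σ]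

theorem foldl_cons_eq (l l' : List β) : l.foldl (fun acc b => b :: acc) l' = l.reverse ++ l' := by
  induction l generalizing l' with
  | nil => rfl
  | cons b l ih => rw [List.foldl_cons, ih]; simp

/-- A loop that conses the elements of a list onto an accumulator reverses the list; two such loops
give concatenation. -/
theorem Poly.reverse_append {l l' : α → List β} (hl : Poly l) (hl' : Poly l') :
    Poly fun a => (l a).reverse ++ l' a := by
  simp only [← foldl_cons_eq]
  refine hl.foldl_add hl' (f := fun _ acc b => b :: acc) (by fun_prop) ⟨Polynomial.X + 1, fun a t b => ?_⟩
  rw [esize_cons, Polynomial.eval_add, Polynomial.eval_X, Polynomial.eval_one]; omega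

@[fun_prop]
theorem Poly.reverse {l : α → List β} (hl : Poly l) : Poly fun a => (l a).reverse := by
  simpa using hl.reverse_append (Poly.const [])

@[fun_prop]
theorem Poly.append {l l' : α → List β} (hl : Poly l) (hl' : Poly l') :
    Poly fun a => l a ++ l' a := by
  simpa using hl.reverse.reverse_append hl'

theorem flatMap_eq_foldl (l : List β) (g : β → List γ) (acc : List γ) :
    l.foldl (fun acc b => acc ++ g b) acc = acc ++ l.flatMap g := by
  induction l generalizing acc with
  | nil => simp
  | cons b l ih => rw [List.foldl_cons, ih]; simp

@[fun_prop]
theorem Poly.flatMap {l : α → List β} {g : α → β → List γ} (hl : Poly l)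
    (hg : Poly fun x : α × β => g x.1 x.2) : Poly fun a => (l a).flatMap (g a) := by
  have h : ∀ a, (l a).flatMap (g a) = (l a).foldl (fun acc b => acc ++ g a b) [] := fun a => by
    rw [flatMap_eq_foldl, List.nil_append]
  simp only [h]
  have hg' : Poly fun x : α × List γ × β => g x.1 x.2.2 :=
    Poly.comp (f := fun x : α × List γ × β => (x.1, x.2.2)) hg (by fun_prop)
  refine hl.foldl_add (Poly.const []) (f := fun a acc b => acc ++ g a b) (by fun_prop) ?_
  obtain ⟨q, hq⟩ := hg.esize_le
  refine ⟨q.comp (Polynomial.X + 1), fun a t b => ?_⟩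
  have h1 := hq (a, b)
  have h2 := esize_append t (g a b)
  rw [esize_mk] at h1
  rw [Polynomial.eval_comp, Polynomial.eval_add, Polynomial.eval_X, Polynomial.eval_one]
  simp only at h1
  omega

@[fun_prop]
theorem Poly.map {l : α → List β} {g : α → β → γ} (hl : Poly l)
    (hg : Poly fun x : α × β => g x.1 x.2) : Poly fun a => (l a).map (g a) := by
  have h : ∀ a, (l a).map (g a) = (l a).flatMap fun b => [g a b] := fun a => List.map_eq_flatMap
  simp only [h]
  fun_prop

theorem length_eq_foldl (l : List β) (n : ℕ) : l.foldl (fun n _ => n + 1) n = n + l.length := by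
  induction l generalizing n with
  | nil => rfl
  | cons b l ih => rw [List.foldl_cons, ih, List.length_cons]; omega

@[fun_prop]
theorem Poly.length {l : α → List β} (hl : Poly l) : Poly fun a => (l a).length := by
  have h : ∀ a, (l a).length = (l a).foldl (fun n _ => n + 1) 0 := fun a => by
    rw [length_eq_foldl, zero_add]
  simp only [h]
  refine hl.foldl_add (Poly.const 0) (f := fun _ n _ => n + 1) (by fun_prop) ⟨0, fun a t b => ?_⟩
  rw [esize_nat, esize_nat]; omega

theorem zipIdx_eq_foldl (l : List β) (n : ℕ) (acc : List (β × ℕ)) :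
    l.foldl (fun s b => (s.1 + 1, s.2 ++ [(b, s.1)])) (n, acc)
      = (n + l.length, acc ++ l.zipIdx n) := by
  induction l generalizing n acc with
  | nil => simp
  | cons b l ih => rw [List.foldl_cons, ih]; simp; omega

@[fun_prop]
theorem Poly.zipIdx {l : α → List β} (hl : Poly l) : Poly fun a => (l a).zipIdx := by
  have h : ∀ a, (l a).zipIdx
      = ((l a).foldl (fun s b => (s.1 + 1, s.2 ++ [(b, s.1)])) (0, ([] : List (β × ℕ)))).2 :=
    fun a => by rw [zipIdx_eq_foldl, List.nil_append]
  simp only [h]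
  refine Poly.snd (hl.foldl_add (Poly.const _) (f := fun _ s b => (s.1 + 1, s.2 ++ [(b, s.1)]))
    (by fun_prop) ⟨Polynomial.X + 10, fun a t b => ?_⟩)
  have := esize_append t.2 [(b, t.1)]
  simp only [esize_mk, esize_prod t, esize_nat, esize_cons, esize_nil, Polynomial.eval_add,
    Polynomial.eval_X, Polynomial.eval_ofNat] at this ⊢
  omega

/-- The predecessor of a number, by arithmetic on complex numbers. -/
@[fun_prop]
theorem Poly.pred {f : α → ℕ} (hf : Poly f) : Poly fun a => f a - 1 := by
  have h : Poly fun a => if f a = 0 then (0 : ℂ) else (f a : ℂ) - 1 := by fun_prop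
  have e : ∀ a, (if f a = 0 then (0 : ℂ) else (f a : ℂ) - 1) = ((f a - 1 : ℕ) : ℂ) := fun a => by
    rcases Nat.eq_zero_or_pos (f a) with h | h
    · simp [h]
    · rw [if_neg h.ne', Nat.cast_sub h, Nat.cast_one]
  simp only [e] at h
  exact h

/-- Numbers can be tested for zero but not compared. The counter runs down to `0` and, by truncated
subtraction, stays there. -/
theorem drop_eq_foldl (l : List β) (n : ℕ) (acc : List β) :
    (l.foldl (fun s b => (s.1 - 1, if s.1 = 0 then s.2 ++ [b] else s.2)) (n, acc)).2
      = acc ++ l.drop n := by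
  induction l generalizing n acc with
  | nil => simp
  | cons b l ih =>
    rw [List.foldl_cons, ih]
    cases n <;> simp

theorem take_eq_foldl (l : List β) (n : ℕ) (acc : List β) :
    (l.foldl (fun s b => (s.1 - 1, if s.1 = 0 then s.2 else s.2 ++ [b])) (n, acc)).2
      = acc ++ l.take n := by
  induction l generalizing n acc with
  | nil => simp
  | cons b l ih =>
    rw [List.foldl_cons, ih]
    cases n <;> simp

@[fun_prop]
theorem Poly.drop {n : α → ℕ} {l : α → List β} (hn : Poly n) (hl : Poly l) :
    Poly fun a => (l a).drop (n a) := by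
  have h : ∀ a, (l a).drop (n a) = ((l a).foldl
      (fun s b => (s.1 - 1, if s.1 = 0 then s.2 ++ [b] else s.2)) (n a, ([] : List β))).2 :=
    fun a => by rw [drop_eq_foldl, List.nil_append]
  simp only [h]
  refine Poly.snd (hl.foldl_add (by fun_prop)
    (f := fun _ s b => (s.1 - 1, if s.1 = 0 then s.2 ++ [b] else s.2))
    (by fun_prop) ⟨Polynomial.X + 10, fun a t b => ?_⟩)
  have := esize_append t.2 [b]
  simp only [esize_mk, esize_prod t, esize_nat, esize_cons, esize_nil, Polynomial.eval_add,
    Polynomial.eval_X, Polynomial.eval_ofNat] at this ⊢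
  split_ifs <;> omega

@[fun_prop]
theorem Poly.take {n : α → ℕ} {l : α → List β} (hn : Poly n) (hl : Poly l) :
    Poly fun a => (l a).take (n a) := by
  have h : ∀ a, (l a).take (n a) = ((l a).foldl
      (fun s b => (s.1 - 1, if s.1 = 0 then s.2 else s.2 ++ [b])) (n a, ([] : List β))).2 :=
    fun a => by rw [take_eq_foldl, List.nil_append]
  simp only [h]
  refine Poly.snd (hl.foldl_add (by fun_prop)
    (f := fun _ s b => (s.1 - 1, if s.1 = 0 then s.2 else s.2 ++ [b]))
    (by fun_prop) ⟨Polynomial.X + 10, fun a t b => ?_⟩)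
  have := esize_append t.2 [b]
  simp only [esize_mk, esize_prod t, esize_nat, esize_cons, esize_nil, Polynomial.eval_add,
    Polynomial.eval_X, Polynomial.eval_ofNat] at this ⊢
  split_ifs <;> omega

/-- The head and the tail of a list, when there are a list of heads and a list of tails. -/
theorem Poly.uncons {l : α → List β} {g : α → γ} {h : α → β → List β → γ} (hl : Poly l)
    (hg : Poly g) (hh : Poly fun x : α × β × List β => h x.1 x.2.1 x.2.2) :
    Poly fun a => (match l a with | [] => g a | b :: l => h a b l : γ) := by
  obtain ⟨p, q, hp⟩ := hl
  obtain ⟨p', q', hp'⟩ := hg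
  obtain ⟨p'', q'', hp''⟩ := hh
  refine ⟨.branch p p' (.comp (.pair .id p) p''),
    10 * q + q' + q''.comp (Polynomial.X + q + 1) + 2 * Polynomial.X + 10, fun a => ?_⟩
  have h1 := hp a
  have h2 := hp' a
  have h3 := size_run_le p (enc a)
  have h0 := h1.1
  rw [Prog.run]
  rw [h0] at h3
  rcases hla : l a with _ | ⟨b, t⟩ <;> rw [hla] at h0 h3
  · rw [if_pos (show _ = Data.nil from h0)]
    beta_reduce
    rw [hla]
    refine ⟨h2.1, ?_⟩
    simp only [Polynomial.eval_add, Polynomial.eval_mul, Polynomial.eval_X, Polynomial.eval_ofNat]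
    omega
  · have h4 := hp'' (a, b, t)
    have h5 : esize (a, b, t) ≤ (Polynomial.X + q + 1).eval (esize a) := by
      simp only [Polynomial.eval_add, Polynomial.eval_X, Polynomial.eval_one]
      have : esize (a, b, t) = esize a + (enc (b :: t)).size + 1 := rfl
      omega
    have h6 := h4.2.trans (eval_mono q'' h5)
    rw [if_neg (by rw [h0, enc_cons]; exact fun h => by cases h)]
    simp only [Prog.run, h0, ret, hla]
    refine ⟨h4.1, ?_⟩
    have h7 : (p''.run (.cons (enc a) (enc (b :: t)))).2 ≤ (q''.comp (Polynomial.X + q + 1)).eval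
      (esize a) := by rw [Polynomial.eval_comp]; exact h6
    simp only [Polynomial.eval_add, Polynomial.eval_mul, Polynomial.eval_X, Polynomial.eval_ofNat,
      Data.size] at h7 ⊢
    have h8 : esize a = (enc a).size := rfl
    omega

theorem zip_eq_foldl (l : List β) (l' : List γ) (acc : List (β × γ)) :
    (l.foldl (fun s b => match s.1 with
      | [] => ([], s.2)
      | c :: t => (t, s.2 ++ [(b, c)])) (l', acc)).2 = acc ++ l.zip l' := by
  induction l generalizing l' acc with
  | nil => simp
  | cons b l ih =>
    rw [List.foldl_cons]
    cases l' with
    | nil => rw [ih]; simp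
    | cons c t => rw [ih]; simp

@[fun_prop]
theorem Poly.zip {l : α → List β} {l' : α → List γ} (hl : Poly l) (hl' : Poly l') :
    Poly fun a => (l a).zip (l' a) := by
  have h : ∀ a, (l a).zip (l' a) = ((l a).foldl (fun (s : List γ × List (β × γ)) b => match s.1 with
      | [] => ([], s.2)
      | c :: t => (t, s.2 ++ [(b, c)])) (l' a, ([] : List (β × γ)))).2 :=
    fun a => by rw [zip_eq_foldl, List.nil_append]
  simp only [h]
  refine Poly.snd (hl.foldl_add (by fun_prop) (f := fun _ (s : List γ × List (β × γ)) b => match s.1 with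
      | [] => ([], s.2)
      | c :: t => (t, s.2 ++ [(b, c)])) ?_ ⟨Polynomial.X + 10, fun a t b => ?_⟩)
  · exact Poly.uncons (l := fun x : α × (List γ × List (β × γ)) × β => x.2.1.1)
      (g := fun x => ([], x.2.1.2)) (h := fun x c t => (t, x.2.1.2 ++ [(x.2.2, c)]))
      (by fun_prop) (by fun_prop) (by fun_prop)
  · rcases t with ⟨_ | ⟨c, t⟩, acc⟩
    · simp only; omega
    · have := esize_append acc [(b, c)]
      simp only [esize_mk, esize_cons, esize_nil, Polynomial.eval_add,
        Polynomial.eval_X, Polynomial.eval_ofNat] at this ⊢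
      omega

end

end Quon

namespace Quon

/-! ### The diagram of a network is computed in polynomial time -/

open Enc (enc)

instance : Enc Unit := ⟨fun _ => .nil⟩
noncomputable instance : Enc Elem := ⟨Elem.encode⟩
noncomputable instance : Enc Layer := ⟨Layer.encode⟩
noncomputable instance : Enc Diagram := ⟨Diagram.encode⟩
-- An operation is written as the list of its events, so that the programs for wire operations
-- output events directly.
noncomputable instance : Enc WireOp := ⟨fun o => enc o.lower⟩

/-- The tree of a tensor. -/
def RawTensor.encode : RawTensor → Data
  | .table T => .cons (.nat 0) (enc T)
  | .clifford c rows lin quad => .cons (.nat 1) (enc (c, rows, lin, quad, ()))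
  | .matchgate c ref A => .cons (.nat 2) (enc (c, ref, A, ()))

instance : Enc RawTensor := ⟨RawTensor.encode⟩

section
variable {α β γ σ : Type} [Enc α] [Enc β] [Enc γ] [Enc σ]

@[fun_prop]
theorem Poly.plus {c : α → ℕ} (hc : Poly c) : Poly fun a => WireOp.plus (c a) := by
  have h : Poly fun a => ([[0, (c a : ℂ)], [4, (c a : ℂ), 0], [4, (c a : ℂ), 1]] : List (List ℂ)) := by
    fun_prop
  refine h.of_enc fun a => ?_
  simp [enc, WireOp.lower, WireOp.events, WireOp.place, Elem.shift, Elem.encode, Data.nat, Data.list]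

@[fun_prop]
theorem Poly.sum {c : α → ℕ} (hc : Poly c) : Poly fun a => WireOp.sum (c a) := by
  have h : Poly fun a => ([[5, (c a : ℂ), 1], [5, (c a : ℂ), 0], [1, (c a : ℂ)]] : List (List ℂ)) := by
    fun_prop
  refine h.of_enc fun a => ?_
  simp [enc, WireOp.lower, WireOp.events, WireOp.place, Elem.shift, Elem.encode, Data.nat, Data.list]

@[fun_prop]
theorem Poly.zero {c : α → ℕ} (hc : Poly c) : Poly fun a => WireOp.zero (c a) := by
  have h : Poly fun a => ([[5, (c a : ℂ), 0], [5, (c a : ℂ), 0], [1, (c a : ℂ)]] : List (List ℂ)) := by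
    fun_prop
  refine h.of_enc fun a => ?_
  simp [enc, WireOp.lower, WireOp.events, WireOp.place, Elem.shift, Elem.encode, Data.nat, Data.list]

/-- The value at `0` comes from `Complex.log 0 = 0`. It is needed because the program has to
reproduce the code of a phase for every weight, including the weight `0` that the construction
avoids. -/
theorem exp_angle' (z : ℂ) : Complex.exp (Complex.I * angle z) = if z = 0 then 1 else z := by
  split_ifs with h
  · simp [h, angle]
  · exact exp_angle h

@[fun_prop]
theorem Poly.phase {c : α → ℕ} {z : α → ℂ} (hc : Poly c) (hz : Poly z) :
    Poly fun a => WireOp.phase (c a) (z a) := by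
  have h : Poly fun a => ([[9, (c a : ℂ), 0, if z a = 0 then 1 else z a]] : List (List ℂ)) := by
    fun_prop
  refine h.of_enc fun a => ?_
  simp [enc, WireOp.lower, WireOp.events, WireOp.place, Elem.shift, Elem.encode, Data.nat, Data.list,
    exp_angle']

@[fun_prop]
theorem Poly.had {c : α → ℕ} (hc : Poly c) : Poly fun a => WireOp.had (c a) := by
  have h : Poly fun a => ([[9, (c a : ℂ), 0, Complex.I], [9, (c a : ℂ), 1, Complex.I],
    [9, (c a : ℂ), 0, Complex.I]] : List (List ℂ)) := by
    fun_prop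
  refine h.of_enc fun a => ?_
  simp [enc, WireOp.lower, WireOp.events, WireOp.place, Elem.shift, Elem.encode, Data.nat, Data.list,
    exp_angle']

@[fun_prop]
theorem Poly.same {c : α → ℕ} (hc : Poly c) : Poly fun a => WireOp.same (c a) := by
  have h : Poly fun a => ([[3, (c a : ℂ)], [5, (c a : ℂ), 3], [5, (c a : ℂ), 2],
      [4, (c a : ℂ), 2], [4, (c a : ℂ), 3], [2, (c a : ℂ), 2]] : List (List ℂ)) := by
    fun_prop
  refine h.of_enc fun a => ?_
  simp [enc, WireOp.lower, WireOp.events, WireOp.place, Elem.shift, Elem.encode, Data.nat, Data.list]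

@[fun_prop]
theorem Poly.swap {c : α → ℕ} (hc : Poly c) : Poly fun a => WireOp.swap (c a) := by
  -- The sixteen numbers are the positions `3 - i + j` of the braids in the order of the crossing.
  have h : Poly fun a => ([[3, (c a : ℂ)]] ++ ([3, 4, 5, 6, 2, 3, 4, 5, 1, 2, 3, 4, 0, 1, 2, 3] :
      List ℂ).map (fun i => [8, (c a : ℂ), i]) ++ [[2, (c a : ℂ), 2]] : List (List ℂ)) := by
    fun_prop
  refine h.of_enc fun a => ?_
  simp [enc, WireOp.lower, WireOp.events, WireOp.place, Elem.shift, Elem.encode, Data.nat, Data.list,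
    crossingE, List.range, List.range.loop]

@[fun_prop]
theorem Poly.fresh {H : α → ℕ} {L : α → List WireOp} (hH : Poly H) (hL : Poly L) :
    Poly fun a => fresh (H a) (L a) := by
  unfold Quon.fresh; fun_prop

@[fun_prop]
theorem Poly.grow {hs : α → List ℕ} (h : Poly hs) : Poly fun a => grow (hs a) := by
  unfold Quon.grow; fun_prop

@[fun_prop]
theorem Poly.scal {H : α → ℕ} {s : α → ℂ} (hH : Poly H) (hs : Poly s) :
    Poly fun a => scal (H a) (s a) := by
  unfold Quon.scal; fun_prop

@[fun_prop]
theorem Poly.pass {i j p : α → ℕ} (hi : Poly i) (hj : Poly j) (hp : Poly p) :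
    Poly fun a => pass (i a) (j a) (p a) := by
  unfold Quon.pass; fun_prop

@[fun_prop]
theorem Poly.edge {hs : α → List ℕ} {i j : α → ℕ} (h : Poly hs) (hi : Poly i) (hj : Poly j) :
    Poly fun a => edge (hs a) (i a) (j a) := by
  unfold Quon.edge; fun_prop

@[fun_prop]
theorem Poly.weight {hs : α → List ℕ} {i : α → ℕ} {w : α → ℂ} (h : Poly hs) (hi : Poly i)
    (hw : Poly w) : Poly fun a => weight (hs a) (i a) (w a) := by
  unfold Quon.weight; fun_prop

@[fun_prop]
theorem Poly.literal {hs : α → List ℕ} {x u : α → ℕ} {b : α → Bool} (h : Poly hs) (hx : Poly x)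
    (hu : Poly u) (hb : Poly b) : Poly fun a => literal (hs a) (x a) (u a) (b a) := by
  unfold Quon.literal; fun_prop

@[fun_prop]
theorem Poly.entry {hs legs : α → List ℕ} {bits : α → List Bool} {t : α → ℂ} (h : Poly hs)
    (hl : Poly legs) (hb : Poly bits) (ht : Poly t) :
    Poly fun a => entry (hs a) (legs a) (bits a) (t a) := by
  unfold Quon.entry; fun_prop

theorem incr_eq_foldl (l : List Bool) (c : Bool) (acc : List Bool) :
    (l.foldl (fun s b => (s.1 && b, s.2 ++ [b ^^ s.1])) (c, acc)).2 = acc ++ incr c l := by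
  induction l generalizing c acc with
  | nil => simp [incr]
  | cons b l ih => rw [List.foldl_cons, ih, incr]; simp

@[fun_prop]
theorem Poly.incr {l : α → List Bool} (hl : Poly l) : Poly fun a => incr true (l a) := by
  have h : ∀ a, Quon.incr true (l a) = ((l a).foldl (fun (s : Bool × List Bool) b =>
      (s.1 && b, s.2 ++ [b ^^ s.1])) (true, [])).2 := fun a => by
    rw [incr_eq_foldl, List.nil_append]
  simp only [h]
  refine Poly.snd (hl.foldl_add (Poly.const _)
    (f := fun _ (s : Bool × List Bool) b => (s.1 && b, s.2 ++ [b ^^ s.1]))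
    (by fun_prop) ⟨10, fun a t b => ?_⟩)
  have := esize_append t.2 [b ^^ t.1]
  simp only [esize_mk, esize_prod t, esize_bool, esize_cons, esize_nil,
    Polynomial.eval_ofNat] at this ⊢
  omega

theorem esize_incr (c : Bool) (l : List Bool) : esize (incr c l) = esize l := by
  induction l generalizing c with
  | nil => rfl
  | cons b l ih => rw [incr, esize_cons, esize_cons, ih]; rfl

-- The state consists of the current index and the operations so far. Incrementing does not change
-- the size of the index, and the operations grow by an amount that depends on the index but not on
-- the earlier operations.
@[fun_prop]
theorem Poly.tableOps {hs legs : α → List ℕ} {T : α → List ℂ} (h : Poly hs)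
    (hl : Poly legs) (hT : Poly T) : Poly fun a => tableOps (hs a) (legs a) (T a) := by
  unfold Quon.tableOps
  have h1 : Poly fun x : α × (List Bool × List WireOp) × ℂ =>
      Quon.entry (hs x.1) (legs x.1) x.2.1.1 x.2.2 := by fun_prop
  have h2 : Poly fun x : α × List Bool × ℂ => Quon.entry (hs x.1) (legs x.1) x.2.1 x.2.2 := by
    fun_prop
  obtain ⟨q, hq⟩ := h2.esize_le
  refine Poly.snd (hT.foldl_add_add (s := fun a => ((legs a).map fun _ => false, []))
    (f := fun a (s : List Bool × List WireOp) t =>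
      (Quon.incr true s.1, s.2 ++ Quon.entry (hs a) (legs a) s.1 t)) (by fun_prop) (by fun_prop)
    (fun t => esize t.1) (fun t => by rw [esize_prod t]; omega)
    ⟨0, fun a t b => by rw [esize_incr]; simp⟩
    ⟨q.comp (Polynomial.X + 2), fun a t b => ?_⟩)
  have h3 := hq (a, t.1, b)
  have h4 := esize_append t.2 (Quon.entry (hs a) (legs a) t.1 b)
  simp only [esize_mk] at h3
  rw [esize_mk, esize_prod t, esize_incr, Polynomial.eval_comp, Polynomial.eval_add,
    Polynomial.eval_X, Polynomial.eval_ofNat,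
    show esize a + esize b + esize t.1 + 2 = esize a + (esize t.1 + esize b + 1) + 1 by omega]
  omega

@[fun_prop]
theorem Poly.rowOps {hs legs : α → List ℕ} {b : α → Bool} {r : α → List Bool} (h : Poly hs)
    (hl : Poly legs) (hb : Poly b) (hr : Poly r) :
    Poly fun a => rowOps (hs a) (legs a) (b a) (r a) := by
  unfold Quon.rowOps; fun_prop

@[fun_prop]
theorem Poly.iPow {l : α → ℕ} (hl : Poly l) : Poly fun a => iPow (l a) := by
  unfold Quon.iPow; fun_prop

@[fun_prop]
theorem Poly.cliffordOps {hs legs lin : α → List ℕ} {c : α → ℂ} {rows : α → List (Bool × List Bool)}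
    {quad : α → List (List Bool)} (h : Poly hs) (hl : Poly legs) (hc : Poly c) (hr : Poly rows)
    (hlin : Poly lin) (hq : Poly quad) :
    Poly fun a => cliffordOps (hs a) (legs a) (c a) (rows a) (lin a) (quad a) := by
  unfold Quon.cliffordOps phaseOps; fun_prop

@[fun_prop]
theorem Poly.flip {hs : α → List ℕ} {t x : α → ℕ} (h : Poly hs) (ht : Poly t) (hx : Poly x) :
    Poly fun a => flip (hs a) (t a) (x a) := by
  unfold Quon.flip; fun_prop

@[fun_prop]
theorem Poly.pairTop {hs : α → List ℕ} {f : α → Pairing} (h : Poly hs) (hf : Poly f) :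
    Poly fun a => pairTop (hs a) (f a) := by
  unfold Quon.pairTop; fun_prop

@[fun_prop]
theorem Poly.pairBot {hs : α → List ℕ} {f : α → Pairing} (h : Poly hs) (hf : Poly f) :
    Poly fun a => pairBot (hs a) (f a) := by
  unfold Quon.pairBot; fun_prop

/-- The recursion is nested: the operations of the later pairs stand between those before and those
after them. With one accumulator for the front and one for the back it becomes a plain loop. -/
theorem pairOps_eq_foldl (ys : List ℕ) (fs : List Pairing) (hs : List ℕ) (F B : List WireOp) :
    F ++ pairOps ys fs hs ++ B =
      (fs.foldl (fun s f => (grow s.1, s.2.1 ++ pairTop s.1 f, pairBot s.1 f ++ s.2.2))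
        (hs, F, B)).2.1 ++ ys.flatMap (fun y => weight (fs.foldl (fun s f => (grow s.1,
          s.2.1 ++ pairTop s.1 f, pairBot s.1 f ++ s.2.2)) (hs, F, B)).1 y 0) ++
      (fs.foldl (fun s f => (grow s.1, s.2.1 ++ pairTop s.1 f, pairBot s.1 f ++ s.2.2))
        (hs, F, B)).2.2 := by
  induction fs generalizing hs F B with
  | nil => rfl
  | cons f fs ih => rw [List.foldl_cons, ← ih, pairOps]; simp

@[fun_prop]
theorem Poly.pairOps {ys hs : α → List ℕ} {fs : α → List Pairing} (hy : Poly ys)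
    (hfs : Poly fs) (hh : Poly hs) : Poly fun a => pairOps (ys a) (fs a) (hs a) := by
  have hfold : Poly fun a => (fs a).foldl (fun (s : List ℕ × List WireOp × List WireOp) f =>
      (Quon.grow s.1, s.2.1 ++ Quon.pairTop s.1 f, Quon.pairBot s.1 f ++ s.2.2))
        (hs a, ([] : List WireOp), ([] : List WireOp)) := by
    have h1 : Poly fun x : List ℕ × Pairing => Quon.pairTop x.1 x.2 := by fun_prop
    have h2 : Poly fun x : List ℕ × Pairing => Quon.pairBot x.1 x.2 := by fun_prop
    obtain ⟨q1, hq1⟩ := h1.esize_le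
    obtain ⟨q2, hq2⟩ := h2.esize_le
    have hg : ∀ hs : List ℕ, esize (Quon.grow hs) = esize hs + 2 := fun hs => by
      have := esize_append hs [hs.length]
      rw [esize_cons, esize_nil, esize_nat] at this
      rw [Quon.grow]; omega
    refine hfs.foldl_add_add (f := fun _ (s : List ℕ × List WireOp × List WireOp) f =>
      (Quon.grow s.1, s.2.1 ++ Quon.pairTop s.1 f, Quon.pairBot s.1 f ++ s.2.2)) (by fun_prop)
      (by fun_prop) (fun t => esize t.1) (fun t => by rw [esize_prod t]; omega)
      ⟨2, fun a t b => ?_⟩ ⟨q1 + q2 + 2, fun a t b => ?_⟩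
    · rw [hg]; simp
    · have h3 := hq1 (t.1, b)
      have h4 := hq2 (t.1, b)
      have h5 := esize_append t.2.1 (Quon.pairTop t.1 b)
      have h6 := esize_append (Quon.pairBot t.1 b) t.2.2
      have h7 : esize (t.1, b) ≤ esize a + esize b + esize t.1 := by
        have := one_le_esize a
        rw [esize_mk]; omega
      have h8 := h3.trans (eval_mono q1 h7)
      have h9 := h4.trans (eval_mono q2 h7)
      simp only [esize_mk, hg, esize_prod t, esize_prod t.2, Polynomial.eval_add,
        Polynomial.eval_ofNat] at h8 h9 ⊢
      omega
  have e := fun a => pairOps_eq_foldl (ys a) (fs a) (hs a) [] []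
  simp only [List.nil_append, List.append_nil] at e
  simp only [e]
  refine Poly.append (Poly.append (Poly.fst (Poly.snd hfold)) ?_) (Poly.snd (Poly.snd hfold))
  have h := fun (F : α → List ℕ × List WireOp × List WireOp) (hF : Poly F) =>
    (show Poly fun a => (ys a).flatMap (fun y => Quon.weight (F a).1 y 0) by fun_prop)
  exact h _ hfold

@[fun_prop]
theorem Poly.matrixPairs {ys : α → List ℕ} {A : α → List (List ℂ)} (hy : Poly ys) (hA : Poly A) :
    Poly fun a => matrixPairs (ys a) (A a) := by
  unfold Quon.matrixPairs; fun_prop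

@[fun_prop]
theorem Poly.freshes {ys : α → List ℕ} {L : α → List WireOp} (hy : Poly ys) (hL : Poly L) :
    Poly fun a => freshes (ys a) (L a) := by
  unfold Quon.freshes; fun_prop

@[fun_prop]
theorem Poly.matchgateOps {hs legs : α → List ℕ} {c : α → ℂ} {ref : α → List Bool}
    {A : α → List (List ℂ)} (h : Poly hs) (hl : Poly legs) (hc : Poly c) (hr : Poly ref)
    (hA : Poly A) : Poly fun a => matchgateOps (hs a) (legs a) (c a) (ref a) (A a) := by
  unfold Quon.matchgateOps; fun_prop

open Classical in
theorem Prog.run_branch (t p q : Prog) (d : Data) : (Prog.branch t p q).run d =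
    if (t.run d).1 = .nil then ((p.run d).1, (t.run d).2 + (p.run d).2 + 1)
      else ((q.run d).1, (t.run d).2 + (q.run d).2 + 1) := by
  rw [Prog.run]

/-- The three kinds carry the tags `0`, `1`, `2`, told apart by testing the tag and the tag minus
one for zero. -/
theorem Poly.rawTensor {t : α → RawTensor} {g₁ : α → List ℂ → β}
    {g₂ : α → ℂ × List (Bool × List Bool) × List ℕ × List (List Bool) × Unit → β}
    {g₃ : α → ℂ × List Bool × List (List ℂ) × Unit → β} (ht : Poly t)
    (h₁ : Poly fun x : α × List ℂ => g₁ x.1 x.2) (h₂ : Poly fun x : α × _ => g₂ x.1 x.2)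
    (h₃ : Poly fun x : α × _ => g₃ x.1 x.2) :
    Poly fun a => (match t a with
      | .table T => g₁ a T
      | .clifford c rows lin quad => g₂ a (c, rows, lin, quad, ())
      | .matchgate c ref A => g₃ a (c, ref, A, ()) : β) := by
  obtain ⟨p, q, hp⟩ := ht
  obtain ⟨p₁, q₁, h₁⟩ := h₁
  obtain ⟨p₂, q₂, h₂⟩ := h₂
  obtain ⟨p₃, q₃, h₃⟩ := h₃
  -- `P` removes the tag and hands the remaining data to the branches together with the input.
  set P : Prog := .pair .id (.comp p .snd) with hP
  obtain ⟨E, hE⟩ : ∃ E : Polynomial ℕ, E = Polynomial.X + q + 1 := ⟨_, rfl⟩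
  refine ⟨.branch (.comp (.comp p .fst) .isZero) (.comp P p₁)
    (.branch (.comp (.comp (.pair (.comp p .fst) (.const (-1))) .add) .isZero) (.comp P p₂)
      (.comp P p₃)),
    10 * q + 2 * Polynomial.X + 50 + q₁.comp E + q₂.comp E + q₃.comp E, fun a => ?_⟩
  obtain ⟨k, d, hkd, hk⟩ : ∃ (k : ℕ) (d : Data), enc (t a) = .cons (.nat k) d ∧
      ((∃ T, t a = .table T ∧ k = 0 ∧ d = enc T) ∨
        (∃ c rows lin quad, t a = .clifford c rows lin quad ∧ k = 1 ∧ d = enc (c, rows, lin, quad, ())) ∨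
        (∃ c ref A, t a = .matchgate c ref A ∧ k = 2 ∧ d = enc (c, ref, A, ()))) := by
    rcases t a with T | ⟨c, rows, lin, quad⟩ | ⟨c, ref, A⟩
    · exact ⟨0, _, rfl, Or.inl ⟨T, rfl, rfl, rfl⟩⟩
    · exact ⟨1, _, rfl, Or.inr (Or.inl ⟨c, rows, lin, quad, rfl, rfl, rfl⟩)⟩
    · exact ⟨2, _, rfl, Or.inr (Or.inr ⟨c, ref, A, rfl, rfl, rfl⟩)⟩
  have h0 := (hp a).1
  have hq := (hp a).2
  have hs := size_run_le p (enc a)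
  rw [h0, hkd] at hs
  rw [hkd] at h0
  have hd : (Data.cons (enc a) d).size ≤ E.eval (esize a) := by
    rw [hE, Polynomial.eval_add, Polynomial.eval_add, Polynomial.eval_X, Polynomial.eval_one]
    simp only [Data.size, Data.nat] at hs ⊢
    have h8 : esize a = (enc a).size := rfl
    omega
  have hPr : P.run (enc a) = (.cons (enc a) d,
      (enc a).size + ((p.run (enc a)).2 + d.size + 1) + (Data.cons (enc a) d).size) := by
    simp only [hP, Prog.run, h0, ret]
  have e1 : (Prog.comp (.comp p .fst) .isZero).run (enc a) = ((if k = 0 then .nil else .atom 1 : Data),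
      (p.run (enc a)).2 + 1 + 1 + 1 + 1) := by
    simp only [Prog.run, h0, ret, Data.nat, Data.size, Data.atom.injEq, Nat.cast_eq_zero]
    split_ifs <;> rfl
  have e2 : (Prog.comp (.comp (.pair (.comp p .fst) (.const (-1))) .add) .isZero).run (enc a)
      = ((if k = 1 then .nil else .atom 1 : Data), (p.run (enc a)).2 + 1 + 1 + 1 + 3 + 1 + 1 + 1 + 1) := by
    have : ((k : ℂ) + -1 = 0) ↔ k = 1 := by
      rw [← sub_eq_add_neg, sub_eq_zero]; norm_cast
    simp only [Prog.run, h0, ret, Data.nat, Data.size, Data.atom.injEq, this]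
    split_ifs <;> rfl
  have h8 : esize a = (enc a).size := rfl
  have hds : d.size ≤ (p.run (enc a)).2 := by simp only [Data.size] at hs; omega
  rw [Prog.run_branch, e1, Prog.run_branch, e2]
  simp only [Polynomial.eval_add, Polynomial.eval_mul, Polynomial.eval_X, Polynomial.eval_ofNat,
    Polynomial.eval_comp]
  rcases hk with ⟨T, hT, rfl, rfl⟩ | ⟨c, rows, lin, quad, hT, rfl, rfl⟩ | ⟨c, ref, A, hT, rfl, rfl⟩
  · have h := h₁ (a, T)
    have h' := h.2.trans (eval_mono q₁ hd)
    rw [hT]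
    simp only [if_true, Prog.run, hPr]
    refine ⟨h.1, ?_⟩
    simp only [enc_mk, Data.size] at h' ⊢
    omega
  · have h := h₂ (a, c, rows, lin, quad, ())
    have h' := h.2.trans (eval_mono q₂ hd)
    rw [hT]
    simp only [one_ne_zero, reduceCtorEq, if_true, if_false, Prog.run, hPr]
    refine ⟨h.1, ?_⟩
    have h9 : (p₂.run ((enc a).cons (enc (c, rows, lin, quad, ())))).2
      ≤ q₂.eval (E.eval (esize a)) := h'
    simp only [Data.size] at h9 ⊢
    omega
  · have h := h₃ (a, c, ref, A, ())
    have h' := h.2.trans (eval_mono q₃ hd)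
    rw [hT]
    simp only [OfNat.ofNat_ne_zero, OfNat.ofNat_ne_one, reduceCtorEq, if_false, Prog.run, hPr]
    refine ⟨h.1, ?_⟩
    have h9 : (p₃.run ((enc a).cons (enc (c, ref, A, ())))).2 ≤ q₃.eval (E.eval (esize a)) := h'
    simp only [Data.size] at h9 ⊢
    omega

@[fun_prop]
theorem Poly.ops {hs legs : α → List ℕ} {t : α → RawTensor} (h : Poly hs) (hl : Poly legs)
    (ht : Poly t) : Poly fun a => (t a).ops (hs a) (legs a) := by
  unfold RawTensor.ops
  exact Poly.rawTensor (g₁ := fun a T => Quon.tableOps (hs a) (legs a) T)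
    (g₂ := fun a x => Quon.cliffordOps (hs a) (legs a) x.1 x.2.1 x.2.2.1 x.2.2.2.1)
    (g₃ := fun a x => Quon.matchgateOps (hs a) (legs a) x.1 x.2.1 x.2.2.1) ht
    (by fun_prop) (by fun_prop) (by fun_prop)

@[fun_prop]
theorem Poly.wireOf {n : α → ℕ} {x : α → RawEnd} (hn : Poly n) (hx : Poly x) :
    Poly fun a => wireOf (n a) (x a) := by
  unfold Quon.wireOf; fun_prop

@[fun_prop]
theorem Poly.nodeOps {n : α → ℕ} {hs : α → List ℕ} {v : α → RawNode} (hn : Poly n) (h : Poly hs)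
    (hv : Poly v) : Poly fun a => nodeOps (n a) (hs a) (v a) := by
  unfold Quon.nodeOps; fun_prop

@[fun_prop]
theorem Poly.lower {o : α → WireOp} (ho : Poly o) : Poly fun a => (o a).lower :=
  ho.of_enc fun _ => rfl

@[fun_prop]
theorem Poly.ev {e : α → Elem} (he : Poly e) : Poly fun a => Layer.ev (e a) :=
  he.of_enc fun _ => rfl

@[fun_prop]
theorem Poly.legOut {c ℓ : α → ℕ} (hc : Poly c) (hl : Poly ℓ) :
    Poly fun a => Layer.legOut (c a) (ℓ a) := by
  have h : Poly fun a => [12, (c a : ℂ), (ℓ a : ℂ)] := by fun_prop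
  refine h.of_enc fun a => ?_
  simp [enc, Layer.encode, Data.nat, Data.list]

theorem poly_networkDiagram :
    Poly fun x : ℕ × ℕ × List RawNode => networkDiagram x.1 x.2.1 x.2.2 := by
  have h : Poly fun x : ℕ × ℕ × List RawNode => ((1 : ℂ),
      ((networkOps x.1 x.2.1 x.2.2).flatMap WireOp.lower).map Layer.ev
        ++ ((wireList x.1 x.2.1 x.2.2).take x.1).map (Layer.legOut 0)) := by
    unfold networkOps wiresOps wireList
    fun_prop
  exact h.of_enc fun _ => rfl

end

theorem enc_ofFn {α : Type} [Enc α] {k : ℕ} (f : Fin k → α) :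
    enc (List.ofFn f) = .vec fun i => enc (f i) := by
  simp only [enc, Data.vec, List.map_ofFn]; rfl

theorem encode_tensor {k : ℕ} (T : NodeTensor k) : T.encode = enc T.raw := by
  cases T with
  | table T =>
    exact congrArg (Data.cons (.nat 0)) (enc_ofFn fun j : Fin (2 ^ k) =>
      T fun i => (j : ℕ).testBit i).symm
  | clifford c rows lin quad =>
    simp only [NodeTensor.encode, NodeTensor.raw]
    change _ = Data.cons _ (.cons (enc c) (.cons (enc (List.map _ rows)) (.cons (enc (List.ofFn _))
      (.cons (enc (List.ofFn _)) .nil))))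
    simp only [enc_ofFn, Data.list]
    congr 3
    simp only [enc, List.map_map]
    refine congrArg Data.list (List.map_congr_left fun r _ => ?_)
    exact congrArg (Data.cons _) (enc_ofFn r.1).symm
  | matchgate c ref A =>
    simp only [NodeTensor.encode, NodeTensor.raw]
    change _ = Data.cons _ (.cons (enc c) (.cons (enc (List.ofFn _))
      (.cons (enc (List.ofFn _)) .nil)))
    simp only [enc_ofFn, Data.list]
    rfl

theorem encode_end {n m : ℕ} (a : Fin n ⊕ Fin m) : encodeEnd a = enc (rawEnd a) := by
  rcases a with i | j <;> rfl

theorem encode_network {n m : ℕ} (N : Network n m) :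
    Network.encode N = enc (n, m, N.map Node.raw) := by
  refine congrArg (Data.cons _) (congrArg (Data.cons _) ?_)
  simp only [enc, List.map_map]
  refine congrArg Data.list (List.map_congr_left fun v _ => ?_)
  refine (congrArg₂ Data.cons ?_ (encode_tensor _))
  simp only [encode_end]
  exact (enc_ofFn _).symm

/-- From tensor networks to diagrams. -/
theorem exists_diagram : ∃ (p : Prog) (q : Polynomial ℕ), ∀ (n m : ℕ) (N : Network n m),
    IsNetwork N → ∃ D : Diagram, IsDiagram D n ∧ D.HasOrderedLegs n ∧ D.tensor n = N.value ∧
      Computes p q N.encode D.encode := by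
  obtain ⟨p, q, h⟩ := poly_networkDiagram
  refine ⟨p, q, fun n m N hN => ⟨_, (networkDiagram_spec hN).1, (networkDiagram_spec hN).2.1,
    (networkDiagram_spec hN).2.2, ?_⟩⟩
  rw [encode_network]
  exact h (n, m, N.map Node.raw)

end Quon

namespace Quon

/-! ### Gates and the networks that they make up -/

/-- The number with the given binary digits, from the least significant one. -/
def digits : List Bool → ℕ
  | [] => 0
  | b :: l => b.toNat + 2 * digits l

/-- The component of a table at a list of bits. -/
noncomputable def tabAt (T : List ℂ) (b : List Bool) : ℂ := T.getD (digits b) 0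

/-- A tensor acting on neighbouring bits of a state: `arity` bits at `pos` of the new state
are contracted with it, and one bit for each element of `ins` is taken from the old state. The
legs of the tensor are the open legs `op`, the old bits, and the new bits. -/
structure Gate where
  pos : ℕ
  ins : List Unit
  arity : ℕ
  op : List ℕ
  tab : List ℂ

/-- The action of a gate, when the open leg `ℓ` has the index `x ℓ`. -/
noncomputable def Gate.act (x : ℕ → Bool) (g : Gate) (ψ : Amp) : Amp := fun b =>
  bsum g.ins.length fun a => tabAt g.tab (g.op.map x ++ a ++ (b.drop g.pos).take g.arity)
    * ψ (b.take g.pos ++ a ++ b.drop (g.pos + g.arity))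

/-- The state made by a sequence of gates, of which the last one comes first. -/
noncomputable def actL (x : ℕ → Bool) (G : List Gate) (ψ : Amp) : Amp := G.foldr (Gate.act x) ψ

/-- The number of bits before a sequence of gates, from the number after it. -/
def heightG : List Gate → ℕ → Option ℕ
  | [], h => some h
  | g :: G, h => if g.pos + g.arity ≤ h then heightG G (h - g.arity + g.ins.length) else none

/-- The number of inner edges of the network of a sequence of gates. -/
def edges (G : List Gate) : ℕ := (G.flatMap Gate.ins).length

/-- Fresh names of edges. -/
def freshEdges (g : Gate) (next : ℕ) : List ℕ := g.ins.zipIdx.map fun u => next + u.2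

/-- The edges before a gate. -/
def edgesBefore (g : Gate) (ws : List ℕ) (next : ℕ) : List ℕ :=
  ws.take g.pos ++ freshEdges g next ++ ws.drop (g.pos + g.arity)

/-- The node of a gate. -/
def gateNode (g : Gate) (ws : List ℕ) (next : ℕ) : List RawEnd × List ℂ :=
  (g.op.map (fun l => (0, l)) ++ (freshEdges g next ++ (ws.drop g.pos).take g.arity).map
    (fun j => (1, j)), g.tab)

/-- The nodes of the network of a sequence of gates with the bits `ws` after it, where the edges
from `next` on are free. -/
def nodesOf : List Gate → List ℕ → ℕ → List (List RawEnd × List ℂ)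
  | [], _, _ => []
  | g :: G, ws, next =>
      gateNode g ws next :: nodesOf G (edgesBefore g ws next) (next + g.ins.length)

theorem freshEdges_eq (g : Gate) (next : ℕ) :
    freshEdges g next = List.range' next g.ins.length := by
  refine List.ext_getElem (by simp [freshEdges]) fun i h1 h2 => by simp [freshEdges]

/-- The value of a leg end. -/
def endVal (x y : ℕ → Bool) (a : RawEnd) : Bool := if a.1 = 0 then x a.2 else y a.2

/-- The value of a node. -/
noncomputable def nodeVal (x y : ℕ → Bool) (v : List RawEnd × List ℂ) : ℂ :=
  tabAt v.2 (v.1.map (endVal x y))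

theorem bsum_congr {k : ℕ} {f g : List Bool → ℂ} (h : ∀ w : List Bool, w.length = k → f w = g w) :
    bsum k f = bsum k g := by
  simp only [bsum_eq]
  exact Finset.sum_congr rfl fun y _ => h _ (by simp)

theorem bsum_split (k l : ℕ) (f : List Bool → ℂ) :
    bsum (k + l) f = bsum k fun a => bsum l fun w => f (a ++ w) := by
  induction k generalizing f with
  | zero => simp [bsum]
  | succ k ih => rw [Nat.add_right_comm, bsum, ih, ih]; rfl

theorem mul_bsum (k : ℕ) (c : ℂ) (f : List Bool → ℂ) :
    bsum k (fun w => c * f w) = c * bsum k f := by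
  simp only [bsum_eq, Finset.mul_sum]

theorem edges_cons (g : Gate) (G : List Gate) : edges (g :: G) = g.ins.length + edges G := by
  simp [edges]

theorem map_bit_append {l : List ℕ} {y : List Bool} (h : ∀ j ∈ l, j < y.length) (w : List Bool) :
    l.map (bit (y ++ w)) = l.map (bit y) :=
  List.map_congr_left fun j hj => bit_append_left (h j hj) w

theorem map_bit_range' (y a : List Bool) :
    (List.range' y.length a.length).map (bit (y ++ a)) = a := by
  refine List.ext_getElem (by simp) fun i h1 h2 => ?_
  simp [bit, List.getD, h2]

/-- Induction from the last gate upwards. `y` holds the values of the edges named so far, and `ws`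
names those carrying the present bits. The bits that a gate takes from the old state are new edges
with numbers from `y.length` on, and the sum in the action of the gate is the sum over their values.
-/
theorem bsum_nodesOf (x : ℕ → Bool) (G : List Gate) (ws : List ℕ) (y : List Bool)
    (hw : ∀ j ∈ ws, j < y.length) (hG : heightG G ws.length = some 0) :
    bsum (edges G) (fun w => ((nodesOf G ws y.length).map (nodeVal x (bit (y ++ w)))).prod)
      = actL x G vac (ws.map (bit y)) := by
  induction G generalizing ws y with
  | nil =>
    simp only [heightG, Option.some.injEq] at hG
    simp [edges, bsum, nodesOf, actL, vac, List.length_eq_zero_iff.1 hG]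
  | cons g G ih =>
    simp only [heightG] at hG
    split_ifs at hG with h
    rw [edges_cons, bsum_split]
    change _ = Gate.act x g (actL x G vac) _
    rw [Gate.act]
    refine bsum_congr fun a ha => ?_
    have hb : ∀ j ∈ edgesBefore g ws y.length, j < (y ++ a).length := by
      intro j hj
      simp only [edgesBefore, freshEdges_eq, List.mem_append, List.mem_range'_1] at hj
      rw [List.length_append, ha]
      rcases hj with (hj | hj) | hj
      · exact (hw j (List.mem_of_mem_take hj)).trans_le (by omega)
      · omega
      · exact (hw j (List.mem_of_mem_drop hj)).trans_le (by omega)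
    have hl : (edgesBefore g ws y.length).length = ws.length - g.arity + g.ins.length := by
      simp [edgesBefore, freshEdges_eq]; omega
    have h1 := ih (edgesBefore g ws y.length) (y ++ a) hb (by rw [hl]; exact hG)
    have h2 : (edgesBefore g ws y.length).map (bit (y ++ a))
        = (ws.map (bit y)).take g.pos ++ a ++ (ws.map (bit y)).drop (g.pos + g.arity) := by
      rw [edgesBefore, List.map_append, List.map_append, freshEdges_eq, ← ha, map_bit_range',
        map_bit_append (fun j hj => hw j (List.mem_of_mem_take hj)),
        map_bit_append (fun j hj => hw j (List.mem_of_mem_drop hj)), List.map_take, List.map_drop]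
    rw [← h2, ← h1, ← mul_bsum]
    refine bsum_congr fun w _ => ?_
    rw [nodesOf, List.map_cons, List.prod_cons, List.length_append, ha, ← List.append_assoc y]
    congr 1
    have h3 : ∀ j ∈ (ws.drop g.pos).take g.arity, j < y.length :=
      fun j hj => hw j (List.mem_of_mem_drop (List.mem_of_mem_take hj))
    have h4 : ∀ j ∈ List.range' y.length g.ins.length, j < (y ++ a).length := fun j hj => by
      rw [List.mem_range'_1] at hj; rw [List.length_append]; omega
    have h5 := map_bit_range' y a
    rw [ha] at h5
    rw [nodeVal, gateNode]
    congr 1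
    simp only [List.map_append, List.map_map, Function.comp_def, endVal, if_true,
      one_ne_zero, if_false]
    rw [freshEdges_eq, map_bit_append h4, h5, List.append_assoc y,
      map_bit_append h3, List.map_take, List.map_drop]
    exact (List.append_assoc _ _ _).symm

/-- An edge of number at least `next` is named where a gate takes it from the old state, and it
occurs once more where an earlier gate produces it. The edges in `ws` have their other end outside.
-/
theorem count_flatMap_fst (j : ℕ) (G : List Gate) (ws : List ℕ) (next : ℕ)
    (hG : heightG G ws.length = some 0) :
    ((nodesOf G ws next).flatMap Prod.fst).count (1, j)
      = ws.count j + if next ≤ j ∧ j < next + edges G then 2 else 0 := by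
  induction G generalizing ws next with
  | nil =>
    simp only [heightG, Option.some.injEq] at hG
    simp [nodesOf, List.length_eq_zero_iff.1 hG, edges]
  | cons g G ih =>
    simp only [heightG] at hG
    split_ifs at hG with h
    have hl : (edgesBefore g ws next).length = ws.length - g.arity + g.ins.length := by
      simp [edgesBefore, freshEdges_eq]; omega
    rw [nodesOf, List.flatMap_cons, List.count_append, ih _ _ (by rw [hl]; exact hG), edges_cons]
    have h1 : (gateNode g ws next).1.count (1, j)
        = (List.range' next g.ins.length).count j + ((ws.drop g.pos).take g.arity).count j := by
      have hi : Function.Injective fun j : ℕ => ((1, j) : RawEnd) := fun a b h => by simpa using h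
      rw [gateNode, List.count_append, List.count_eq_zero_of_not_mem (by simp), zero_add,
        ← List.count_append, freshEdges_eq]
      exact List.count_map_of_injective _ _ hi j
    have h2 : ws.count j = (ws.take g.pos).count j + (((ws.drop g.pos).take g.arity).count j
        + (ws.drop (g.pos + g.arity)).count j) := by
      rw [← List.drop_drop, ← List.count_append, List.take_append_drop, ← List.count_append,
        List.take_append_drop]
    have h3 : (List.range' next g.ins.length).count j
        = if next ≤ j ∧ j < next + g.ins.length then 1 else 0 := by
      rw [List.Nodup.count List.nodup_range']; simp [List.mem_range'_1]
    rw [h1, h2, edgesBefore, freshEdges_eq, List.count_append, List.count_append, h3]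
    split_ifs <;> omega

theorem count_flatMap_fst_zero (i : ℕ) (G : List Gate) (ws : List ℕ) (next : ℕ) :
    ((nodesOf G ws next).flatMap Prod.fst).count (0, i) = (G.flatMap Gate.op).count i := by
  induction G generalizing ws next with
  | nil => rfl
  | cons g G ih =>
    have hi : Function.Injective fun j : ℕ => ((0, j) : RawEnd) := fun a b h => by simpa using h
    have h1 : (gateNode g ws next).1.count (0, i) = g.op.count i := by
      rw [gateNode, List.count_append, List.count_eq_zero_of_not_mem (l := List.map _ (_ ++ _))
        (fun h => by obtain ⟨_, _, h⟩ := List.mem_map.1 h; simp at h), add_zero]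
      exact List.count_map_of_injective _ _ hi i
    rw [nodesOf, List.flatMap_cons, List.count_append, ih, List.flatMap_cons, List.count_append, h1]

/-! ### Networks from lists of raw nodes -/

theorem digits_testBit (k j : ℕ) (h : j < 2 ^ k) :
    digits (List.ofFn fun i : Fin k => j.testBit i) = j := by
  induction k generalizing j with
  | zero => simp at h; simp [h, digits]
  | succ k ih =>
    rw [List.ofFn_succ, digits]
    have := ih (j / 2) (by rw [pow_succ] at h; omega)
    simp only [Nat.testBit_div_two] at this
    simp only [Fin.val_succ, this, Fin.val_zero, Nat.testBit_zero]
    rcases Nat.mod_two_eq_zero_or_one j with h | h <;> simp [h] <;> omega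

theorem digits_lt (b : List Bool) : digits b < 2 ^ b.length := by
  induction b with
  | nil => simp [digits]
  | cons a b ih => cases a <;> simp [digits, pow_succ] <;> omega

theorem testBit_digits (b : List Bool) (i : ℕ) : (digits b).testBit i = bit b i := by
  induction b generalizing i with
  | nil => simp [digits, bit]
  | cons a b ih =>
    cases i with
    | zero => cases a <;> simp [digits, bit]
    | succ i =>
      rw [← Nat.testBit_div_two, show digits (a :: b) / 2 = digits b by
        cases a <;> simp [digits] <;> omega, ih]
      rfl

theorem tabAt_ofFn {k : ℕ} (T : (Fin k → Bool) → ℂ) (f : Fin k → Bool) :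
    tabAt (List.ofFn fun j : Fin (2 ^ k) => T fun i => (j : ℕ).testBit i) (List.ofFn f) = T f := by
  have h := digits_lt (List.ofFn f)
  rw [List.length_ofFn] at h
  rw [tabAt, List.getD_eq_getElem _ _ (by simpa using h), List.getElem_ofFn]
  congr 1
  funext i
  simp [testBit_digits, bit]

theorem component_of_raw {n m : ℕ} {v : Node n m} {r : List RawEnd × List ℂ}
    (h : v.raw = (r.1, .table r.2)) (x y : ℕ → Bool) :
    v.tensor.component (fun i => Sum.elim (fun i : Fin n => x i) (fun j : Fin m => y j) (v.leg i))
      = nodeVal x y r := by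
  obtain ⟨k, T, leg⟩ := v
  obtain ⟨e, t⟩ := r
  cases T with
  | clifford c rows lin quad => simp [Node.raw, NodeTensor.raw] at h
  | matchgate c ref A => simp [Node.raw, NodeTensor.raw] at h
  | table T =>
    simp only [Node.raw, NodeTensor.raw, Prod.mk.injEq, RawTensor.table.injEq] at h
    obtain ⟨rfl, rfl⟩ := h
    rw [nodeVal, List.map_ofFn, tabAt_ofFn]
    refine congrArg T (funext fun i => ?_)
    simp only [Function.comp]
    rcases leg i with a | a <;> simp [endVal, rawEnd]

theorem rawEnd_injective {n m : ℕ} : Function.Injective (rawEnd : Fin n ⊕ Fin m → RawEnd) := by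
  rintro (a | a) (b | b) h <;> simp [rawEnd, Fin.ext_iff] at h ⊢ <;> exact h

/-- The network with given raw nodes. -/
theorem exists_network {n m : ℕ} (P : Node n m → Prop) (R : List (List RawEnd × List ℂ))
    (h : ∀ r ∈ R, ∃ v : Node n m, v.raw = (r.1, .table r.2) ∧ P v) :
    ∃ N : Network n m, N.map Node.raw = R.map (fun r => (r.1, RawTensor.table r.2)) ∧
      (∀ v ∈ N, P v) ∧
      (∀ a : Fin n ⊕ Fin m, (Network.ends N).count a = (R.flatMap Prod.fst).count (rawEnd a)) ∧
      ∀ x y : ℕ → Bool, (N.map fun v => v.tensor.component fun i =>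
        Sum.elim (fun i : Fin n => x i) (fun j : Fin m => y j) (v.leg i)).prod
        = (R.map (nodeVal x y)).prod := by
  induction R with
  | nil => exact ⟨[], rfl, by simp, by simp [Network.ends], by simp⟩
  | cons r R ih =>
    obtain ⟨N, h1, h2, h3, h4⟩ := ih fun r hr => h r (List.mem_cons_of_mem _ hr)
    obtain ⟨v, hv, hP⟩ := h r List.mem_cons_self
    refine ⟨v :: N, by simp [h1, hv], ?_, fun a => ?_, fun x y => ?_⟩
    · intro w hw
      rcases List.mem_cons.1 hw with rfl | hw
      · exact hP
      · exact h2 w hw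
    · have h5 : r.1 = (List.ofFn v.leg).map rawEnd := by
        rw [Node.raw, Prod.mk.injEq] at hv
        rw [← hv.1, List.map_ofFn]; rfl
      have h6 := h3 a
      simp only [Network.ends] at h6 ⊢
      rw [List.flatMap_cons, List.flatMap_cons, List.count_append, List.count_append, h6, h5,
        @List.count_map_of_injective _ _ _ lawfulBEq_ends _ _ _ _ rawEnd_injective]
    · rw [List.map_cons, List.map_cons, List.prod_cons, List.prod_cons, h4, component_of_raw hv]

theorem exists_node {n m : ℕ} {r : List RawEnd × List ℂ}
    (h₀ : ∀ i, (0, i) ∈ r.1 → i < n) (h₁ : ∀ j, (1, j) ∈ r.1 → j < m)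
    (h₂ : ∀ a ∈ r.1, a.1 = 0 ∨ a.1 = 1) {k : ℕ} (hk : r.1.length = k) (T : (Fin k → Bool) → ℂ)
    (hT : (List.ofFn fun j : Fin (2 ^ k) => T fun i => (j : ℕ).testBit i) = r.2) :
    ∃ leg, (⟨k, .table T, leg⟩ : Node n m).raw = (r.1, .table r.2) := by
  subst hk
  have h : ∀ a ∈ r.1, ∃ e : Fin n ⊕ Fin m, rawEnd e = a := by
    rintro ⟨t, i⟩ ha
    rcases h₂ _ ha with h | h <;> simp only at h <;> subst h
    · exact ⟨.inl ⟨i, h₀ i ha⟩, rfl⟩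
    · exact ⟨.inr ⟨i, h₁ i ha⟩, rfl⟩
  choose f hf using h
  refine ⟨fun i => f (r.1.get i) (List.get_mem _ _), ?_⟩
  simp only [Node.raw, NodeTensor.raw, hT, Prod.mk.injEq, and_true]
  refine List.ext_getElem (by simp) fun i h1 h2 => ?_
  simp [hf]

/-- The network of a sequence of gates, with a scalar factor. -/
theorem exists_network_of_gates {n : ℕ} (P : ∀ {k}, ((Fin k → Bool) → ℂ) → Prop) (G : List Gate)
    (hG : heightG G 0 = some 0) (hop : (G.flatMap Gate.op).Perm (List.range n))
    (hP : ∀ g ∈ G, ∃ (k : ℕ) (T : (Fin k → Bool) → ℂ),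
      g.op.length + g.ins.length + g.arity = k ∧ P T ∧
      (List.ofFn fun j : Fin (2 ^ k) => T fun i => (j : ℕ).testBit i) = g.tab) :
    ∃ N : Network n (edges G),
      N.map Node.raw = (nodesOf G [] 0).map (fun r => (r.1, RawTensor.table r.2)) ∧
      IsNetwork N ∧ (∀ v ∈ N, ∃ T, v.tensor = .table T ∧ P T) ∧
      ∀ x, N.value x = actL (extend x) G vac [] := by
  have hc1 := fun j => count_flatMap_fst j G [] 0 (by simpa using hG)
  have hc0 := fun i => count_flatMap_fst_zero i G [] 0
  have hnode : ∀ (G : List Gate) (ws : List ℕ) (next h : ℕ), heightG G ws.length = some h →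
      ∀ r ∈ nodesOf G ws next, ∃ g ∈ G, r.2 = g.tab ∧
        r.1.length = g.op.length + g.ins.length + g.arity ∧ ∀ a ∈ r.1, a.1 = 0 ∨ a.1 = 1 := by
    intro G
    induction G with
    | nil => simp [nodesOf]
    | cons g G ih =>
      intro ws next h hh r hr
      simp only [heightG] at hh
      split_ifs at hh with hle
      have hl : (edgesBefore g ws next).length = ws.length - g.arity + g.ins.length := by
        simp [edgesBefore, freshEdges_eq]; omega
      rw [nodesOf, List.mem_cons] at hr
      rcases hr with rfl | hr
      · refine ⟨g, List.mem_cons_self, rfl, ?_, ?_⟩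
        · simp [gateNode, freshEdges_eq]; omega
        · intro a ha
          simp only [gateNode, List.mem_append, List.mem_map] at ha
          rcases ha with ⟨_, _, rfl⟩ | ⟨_, _, rfl⟩ <;> simp
      · obtain ⟨g', hg', h'⟩ := ih _ _ h (by rw [hl]; exact hh) r hr
        exact ⟨g', List.mem_cons_of_mem _ hg', h'⟩
  obtain ⟨N, h1, h2, h3, h4⟩ := exists_network (n := n) (m := edges G)
    (fun v => ∃ T, v.tensor = .table T ∧ P T) (nodesOf G [] 0) fun r hr => by
      obtain ⟨g, hg, ht, hl, ha⟩ := hnode G [] 0 0 (by simpa using hG) r hr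
      obtain ⟨k, T, hk, hPT, hT⟩ := hP g hg
      obtain ⟨leg, hleg⟩ := exists_node (n := n) (m := edges G) (r := r)
        -- An end that occurs in a node has a positive count, so the counts bound its number.
        (fun i hi => by
          have h : 0 < ((nodesOf G [] 0).flatMap Prod.fst).count (0, i) :=
            List.count_pos_iff.2 (List.mem_flatMap.2 ⟨r, hr, hi⟩)
          rw [hc0, List.count_pos_iff] at h
          simpa using hop.mem_iff.1 h)
        (fun j hj => by
          have h : 0 < ((nodesOf G [] 0).flatMap Prod.fst).count (1, j) :=
            List.count_pos_iff.2 (List.mem_flatMap.2 ⟨r, hr, hj⟩)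
          rw [hc1] at h
          by_contra hn
          simp [hn] at h)
        ha (hl.trans hk) T (hT.trans ht.symm)
      exact ⟨_, hleg, T, rfl, hPT⟩
  refine ⟨N, h1, ⟨fun i => ?_, fun j => ?_⟩, h2, fun x => ?_⟩
  · rw [h3, rawEnd, hc0, hop.count_eq, List.Nodup.count List.nodup_range]; simp
  · rw [h3, rawEnd, hc1]; simp
  · have h5 := bsum_nodesOf (extend x) G [] [] (by simp) (by simpa using hG)
    rw [bsum_eq] at h5
    rw [List.map_nil] at h5
    rw [← h5, Network.value]
    refine Finset.sum_congr rfl fun y _ => ?_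
    rw [List.length_nil, List.nil_append, ← h4]
    refine congrArg List.prod (List.map_congr_left fun v _ => congrArg _ (funext fun i => ?_))
    rcases v.leg i with a | a
    · simp [extend]
    · simp [bit]

end Quon

namespace Quon

/-! ### The gates of events and legs -/

/-- The gates have the effect `f` on states, from `h` bits to `h'` bits. -/
structure Lowers (x : ℕ → Bool) (G : List Gate) (h h' : ℕ) (f : Amp → Amp) : Prop where
  height : heightG G h' = some h
  act : ∀ (ψ : Amp) (b : List Bool), b.length = h' → actL x G ψ b = f ψ b

theorem actL_append (x : ℕ → Bool) (G G' : List Gate) (ψ : Amp) :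
    actL x (G ++ G') ψ = actL x G (actL x G' ψ) := List.foldr_append

theorem heightG_append (G G' : List Gate) (h : ℕ) :
    heightG (G ++ G') h = (heightG G h).bind (heightG G') := by
  induction G generalizing h with
  | nil => rfl
  | cons g G ih => simp only [List.cons_append, heightG]; split_ifs <;> simp [ih]

theorem actL_congr {x : ℕ → Bool} {G : List Gate} {h h' : ℕ} (hG : heightG G h' = some h)
    {ψ φ : Amp} (hψ : ∀ b : List Bool, b.length = h → ψ b = φ b) {b : List Bool}
    (hb : b.length = h') : actL x G ψ b = actL x G φ b := by
  induction G generalizing h' b with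
  | nil => simp only [heightG, Option.some.injEq] at hG; exact hψ b (hb.trans hG)
  | cons g G ih =>
    simp only [heightG] at hG
    split_ifs at hG with hle
    refine bsum_congr fun a ha => congrArg _ (ih hG ?_)
    simp [ha]; omega

section
variable {x : ℕ → Bool} {h h' h'' H : ℕ} {f f' : Amp → Amp} {G G' : List Gate}

theorem Lowers.nil (H : ℕ) : Lowers x [] H H id := ⟨rfl, fun _ _ _ => rfl⟩

theorem Lowers.append (hG : Lowers x G h' h'' f) (hG' : Lowers x G' h h' f') :
    Lowers x (G ++ G') h h'' fun ψ => f (f' ψ) := by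
  refine ⟨by rw [heightG_append, hG.height, Option.bind_some, hG'.height], fun ψ b hb => ?_⟩
  rw [actL_append, actL_congr hG.height (hG'.act ψ) hb, hG.act _ _ hb]

theorem Lowers.congr (hG : Lowers x G h h' f)
    (hf : ∀ (ψ : Amp) (b : List Bool), b.length = h' → f ψ b = f' ψ b) : Lowers x G h h' f' :=
  ⟨hG.height, fun ψ b hb => (hG.act ψ b hb).trans (hf ψ b hb)⟩

theorem lowers_single {g : Gate} (hp : g.pos + g.arity ≤ H) (hh : h + g.arity = H + g.ins.length)
    (hf : ∀ (ψ : Amp) (b₁ m b₃ : List Bool), b₁.length = g.pos → m.length = g.arity →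
      bsum g.ins.length (fun a => tabAt g.tab (g.op.map x ++ a ++ m) * ψ (b₁ ++ a ++ b₃))
        = f ψ (b₁ ++ m ++ b₃)) : Lowers x [g] h H f := by
  refine ⟨by simp only [heightG]; rw [if_pos hp]; congr 1; omega, fun ψ b hb => ?_⟩
  obtain ⟨b₁, m, b₃, rfl, h1, h2, -⟩ := exists_bits₃ (n₁ := g.pos) (n₂ := g.arity)
    (n₃ := H - g.pos - g.arity) (hb.trans (by omega))
  rw [← hf ψ b₁ m b₃ h1 h2]
  refine bsum_congr fun a _ => ?_
  have e1 : (b₁ ++ m ++ b₃).take g.pos = b₁ := by rw [← h1]; simp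
  have e2 : ((b₁ ++ m ++ b₃).drop g.pos).take g.arity = m := by rw [← h1, ← h2]; simp
  have e3 : (b₁ ++ m ++ b₃).drop (g.pos + g.arity) = b₃ := by rw [← h1, ← h2]; simp
  rw [e1, e2, e3]; rfl

end

theorem loc_self (b₁ b₃ : List Bool) (n : ℕ) (ψ : Amp) :
    Loc b₁ b₃ n 1 ψ fun m => ψ (b₁ ++ m ++ b₃) := fun _ _ => (one_mul _).symm

section
variable {x : ℕ → Bool} {k h H : ℕ} {f : Amp → Amp} {ins : List Unit} {op : List ℕ} {T : List ℂ}

theorem lowers_zero (hp : k ≤ H) (hh : h = H + ins.length)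
    (hf : ∀ (ψ : Amp) (b₁ b₃ : List Bool), b₁.length = k →
      bsum ins.length (fun a => tabAt T (op.map x ++ a ++ []) * ψ (b₁ ++ a ++ b₃))
        = f ψ (b₁ ++ [] ++ b₃)) : Lowers x [⟨k, ins, 0, op, T⟩] h H f :=
  lowers_single hp hh fun ψ b₁ m b₃ h1 h2 => by
    rw [List.length_eq_zero_iff.1 h2]; exact hf ψ b₁ b₃ h1

theorem lowers_one (hp : k < H) (hh : h + 1 = H + ins.length)
    (hf : ∀ (ψ : Amp) (b₁ b₃ : List Bool) (p : Bool), b₁.length = k →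
      bsum ins.length (fun a => tabAt T (op.map x ++ a ++ [p]) * ψ (b₁ ++ a ++ b₃))
        = f ψ (b₁ ++ [p] ++ b₃)) : Lowers x [⟨k, ins, 1, op, T⟩] h H f :=
  lowers_single hp hh fun ψ b₁ m b₃ h1 h2 => by
    obtain ⟨p, rfl⟩ := List.length_eq_one_iff.1 h2; exact hf ψ b₁ b₃ p h1

theorem lowers_two (hp : k + 1 < H) (hh : h + 2 = H + ins.length)
    (hf : ∀ (ψ : Amp) (b₁ b₃ : List Bool) (p q : Bool), b₁.length = k →
      bsum ins.length (fun a => tabAt T (op.map x ++ a ++ [p, q]) * ψ (b₁ ++ a ++ b₃))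
        = f ψ (b₁ ++ [p, q] ++ b₃)) : Lowers x [⟨k, ins, 2, op, T⟩] h H f :=
  lowers_single hp hh fun ψ b₁ m b₃ h1 h2 => by
    obtain ⟨p, q, rfl⟩ := List.length_eq_two.1 h2; exact hf ψ b₁ b₃ p q h1

end

section
attribute [local simp] bsum tabAt digits bit List.getD

/-- The gate of a cap or a cup. -/
noncomputable def capGate (k : ℕ) (odd : Bool) : Gate :=
  if odd then ⟨k, [()], 2, [], [1, 0, 0, 1, 0, 1, 1, 0].map (· / fourthRootTwo)⟩
  else ⟨k, [], 1, [], [fourthRootTwo, 0]⟩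

noncomputable def cupGate (k : ℕ) (odd : Bool) : Gate :=
  if odd then ⟨k, [(), ()], 1, [], [1, 0, 0, 1, 0, 1, 1, 0].map (· / fourthRootTwo)⟩
  else ⟨k, [()], 0, [], [fourthRootTwo, 0]⟩

/-- The gate of `(u + v) / 2` times the identity plus `(u - v) / 2` times the parity operator of
two neighbouring strings. -/
noncomputable def pairGate (k : ℕ) (odd : Bool) (u v : ℂ) : Gate :=
  if odd then ⟨k, [(), ()], 2, [], [u + v, 0, 0, u - v, 0, u + v, u - v, 0, 0, u - v, u + v, 0,
    u - v, 0, 0, u + v].map (· / 2)⟩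
  else ⟨k, [()], 1, [], [u, 0, 0, v]⟩

variable {x : ℕ → Bool} {k H : ℕ}

theorem lowers_capGate (odd : Bool) (hk : k + odd.toNat < H + 1) :
    Lowers x [capGate k odd] H (H + 1) (capAt (2 * k + odd.toNat)) := by
  cases odd
  · rw [capGate, if_neg Bool.false_ne_true]
    refine lowers_one hk rfl fun ψ b₁ b₃ p h1 => ?_
    subst h1
    rw [Bool.toNat_false, (loc_self b₁ b₃ 0 ψ).capAt (g := 0) (by omega) [p] rfl]
    cases p <;> simp [capAt]
  · rw [capGate, if_pos rfl]
    refine lowers_two hk rfl fun ψ b₁ b₃ p q h1 => ?_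
    subst h1
    rw [Bool.toNat_true, (loc_self b₁ b₃ 1 ψ).capAt (g := 1) (by omega) [p, q] rfl]
    cases p <;> cases q <;> simp [capAt]

theorem lowers_cupGate (odd : Bool) (hk : k + odd.toNat < H + 1) :
    Lowers x [cupGate k odd] (H + 1) H (cupAt (2 * k + odd.toNat)) := by
  cases odd
  · rw [cupGate, if_neg Bool.false_ne_true]
    refine lowers_zero (Nat.le_of_lt_succ hk) rfl fun ψ b₁ b₃ h1 => ?_
    subst h1
    rw [Bool.toNat_false, (loc_self b₁ b₃ 1 ψ).cupAt (g := 0) (n := 0) (by omega) [] rfl]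
    simp [cupAt]
  · rw [cupGate, if_pos rfl]
    refine lowers_one (Nat.lt_of_succ_lt_succ hk) rfl fun ψ b₁ b₃ p h1 => ?_
    subst h1
    rw [Bool.toNat_true, (loc_self b₁ b₃ 2 ψ).cupAt (g := 1) (n := 1) (by omega) [p] rfl]
    cases p <;> simp [cupAt] <;> ring

theorem lowers_pairGate (odd : Bool) (u v : ℂ) (hk : k + odd.toNat < H) :
    Lowers x [pairGate k odd u v] H H fun ψ b => (u + v) / 2 * ψ b
      + (u - v) / 2 * parity (2 * k + odd.toNat) (2 * k + odd.toNat + 1) ψ b := by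
  cases odd
  · rw [pairGate, if_neg Bool.false_ne_true]
    refine lowers_one hk rfl fun ψ b₁ b₃ p h1 => ?_
    subst h1
    rw [Bool.toNat_false, add_assoc,
      (loc_self b₁ b₃ 1 ψ).parity (g := 0) (g' := 1) (by omega) (by omega) [p] rfl]
    cases p <;> simp [parity, majorana, ← mul_assoc] <;> ring
  · rw [pairGate, if_pos rfl]
    refine lowers_two hk rfl fun ψ b₁ b₃ p q h1 => ?_
    subst h1
    rw [Bool.toNat_true, add_assoc,
      (loc_self b₁ b₃ 2 ψ).parity (g := 1) (g' := 2) (by omega) (by omega) [p, q] rfl]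
    cases p <;> cases q <;> simp [parity, majorana, ← mul_assoc] <;> ring

/-- The gate of a scattering element across time, when `z` is the exponential of its angle. -/
noncomputable def scatterHGate (k : ℕ) (odd : Bool) (z : ℂ) : Gate :=
  pairGate k odd ((if odd then 1 / fourthRootTwo ^ 2 else fourthRootTwo ^ 2 / 2) * (1 + z))
    ((if odd then 1 / fourthRootTwo ^ 2 else fourthRootTwo ^ 2 / 2) * (1 - z))

/-- The pair cup–cap is `√2` times the projection onto eigenvalue `1` of the parity operator, and
with dots onto eigenvalue `-1`; hence the gate has the form of `pairGate`. The two expressions for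
the prefactor are both `1/√2`, written so that `fourthRootTwo` may be any nonzero number in the
computation. -/
theorem lowers_scatterHGate (odd : Bool) (θ : ℂ) (hk : k + odd.toNat < H) :
    Lowers x [scatterHGate k odd (Complex.exp (Complex.I * θ))] H H
      (scatterHAt θ (2 * k + odd.toNat)) := by
  have hc := fourthRootTwo_ne_zero
  cases odd
  · rw [scatterHGate, pairGate, if_neg Bool.false_ne_true, if_neg Bool.false_ne_true]
    refine lowers_one hk rfl fun ψ b₁ b₃ p h1 => ?_
    subst h1
    rw [Bool.toNat_false, (loc_self b₁ b₃ 1 ψ).scatterHAt (g := 0) (by omega) θ [p] rfl]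
    cases p <;> simp [scatterHAt, majorana, capAt, cupAt]
    · ring
    · linear_combination (fourthRootTwo ^ 2 * (1 - Complex.exp (Complex.I * θ)) / 2
        * ψ (b₁ ++ true :: b₃)) * Complex.I_sq
  · rw [scatterHGate, pairGate, if_pos rfl, if_pos rfl]
    refine lowers_two hk rfl fun ψ b₁ b₃ p q h1 => ?_
    subst h1
    rw [Bool.toNat_true, (loc_self b₁ b₃ 2 ψ).scatterHAt (g := 1) (by omega) θ [p, q] rfl]
    cases p <;> cases q <;> simp [scatterHAt, majorana, capAt, cupAt] <;> field_simp <;> ring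

theorem bit_mid (b₁ b₃ : List Bool) (p : Bool) : bit (b₁ ++ [p] ++ b₃) b₁.length = p :=
  bit_frame b₁ [p] b₃ (k := 0) (by simp)

theorem set_mid (b₁ b₃ : List Bool) (p v : Bool) :
    (b₁ ++ [p] ++ b₃).set b₁.length v = b₁ ++ [v] ++ b₃ :=
  set_frame b₁ [p] b₃ (k := 0) (by simp) v

/-- The gates of a Majorana operator, with a factor. -/
noncomputable def majGates (R : List ℕ) (k : ℕ) (odd : Bool) (w : ℂ) : List Gate :=
  (R.take k).map (fun j => ⟨j, [()], 1, [], [1, 0, 0, -1]⟩) ++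
    [⟨k, [()], 1, [], if odd then [0, w * Complex.I, -(w * Complex.I), 0] else [0, w, w, 0]⟩]

theorem lowers_signs (hk : k ≤ H) :
    Lowers x ((List.range k).map fun j => (⟨j, [()], 1, [], [1, 0, 0, -1]⟩ : Gate)) H H
      fun ψ b => (-1) ^ (b.take k).count true * ψ b := by
  induction k with
  | zero => exact (Lowers.nil H).congr fun ψ b _ => by simp
  | succ k ih =>
    rw [List.range_succ, List.map_append]
    have h : Lowers x [(⟨k, [()], 1, [], [1, 0, 0, -1]⟩ : Gate)] H H
        fun ψ b => (if bit b k then -1 else 1) * ψ b :=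
      lowers_one hk rfl fun ψ b₁ b₃ p h1 => by
        subst h1
        rw [bit_mid]
        cases p <;> simp
    refine ((ih (by omega)).append h).congr fun ψ b hb => ?_
    have hk' : k < b.length := by omega
    rw [List.take_succ_eq_append_getElem hk', List.count_append]
    have : bit b k = b[k] := by simp [hk']
    simp only [this]
    cases b[k] <;> simp [pow_succ]

/-- The Jordan–Wigner string is a product of one-bit signs, so the operator splits into gates with
two legs although it involves arbitrarily many bits. -/
theorem lowers_majGates {N : ℕ} (odd : Bool) (w : ℂ) (hk : k < H) (hN : k ≤ N) :
    Lowers x (majGates (List.range N) k odd w) H H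
      fun ψ b => w * majorana (2 * k + odd.toNat) ψ b := by
  have e1 : (2 * k + odd.toNat) / 2 = k := by cases odd <;> simp <;> omega
  have e2 : (2 * k + odd.toNat) % 2 = odd.toNat := by cases odd <;> simp
  rw [majGates, List.take_range, min_eq_left hN]
  have h : Lowers x [(⟨k, [()], 1, [], if odd then [0, w * Complex.I, -(w * Complex.I), 0]
      else [0, w, w, 0]⟩ : Gate)] H H fun ψ b => w * (if odd then Complex.I *
        (if bit b k then -1 else 1) else 1) * ψ (b.set k (!bit b k)) :=
    lowers_one hk rfl fun ψ b₁ b₃ p h1 => by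
      subst h1
      rw [bit_mid, set_mid]
      cases p <;> cases odd <;> simp
  refine ((lowers_signs hk.le).append h).congr fun ψ b hb => ?_
  simp only [majorana, e1, e2]
  cases odd <;> simp <;> ring

/-- The gates that project the bits with positions from `p` to `q` onto even parity. -/
noncomputable def parityGates (R : List ℕ) (p q : ℕ) : List Gate :=
  ⟨p, [()], 0, [], [1, 0]⟩ :: ((R.take q).drop p).map (fun k => ⟨k, [(), ()], 2, [],
    [1, 0, 0, 0, 0, 0, 1, 0, 0, 0, 0, 1, 0, 1, 0, 0]⟩) ++ [⟨q, [], 1, [], [1, 0]⟩]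

/-- The parity of many bits is computed by small gates: an auxiliary bit `0` enters to the right of
the bits and travels to the left, adding each bit that it passes. At the place `p` it holds the
parity. Each table is that of the map `(c, a + c) ↦ (a, c)` from old to new bits. -/
theorem lowers_parities (p m : ℕ) (hH : p + m ≤ H) :
    Lowers x ((List.range' p m).map (fun k => (⟨k, [(), ()], 2, [],
      [1, 0, 0, 0, 0, 0, 1, 0, 0, 0, 0, 1, 0, 1, 0, 0]⟩ : Gate)) ++ [⟨p + m, [], 1, [], [1, 0]⟩])
      H (H + 1) fun ψ b => if ((b.drop p).take (m + 1)).count true % 2 = 0 then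
        ψ (b.eraseIdx p) else 0 := by
  induction m generalizing p with
  | zero =>
    refine lowers_one (by omega) rfl fun ψ b₁ b₃ a h1 => ?_
    rw [add_zero] at h1
    subst h1
    rw [List.append_assoc, List.drop_left, List.eraseIdx_append_of_length_le le_rfl]
    cases a <;> simp
  | succ m ih =>
    have h := ih (p + 1) (by omega)
    rw [show p + 1 + m = p + (m + 1) by omega] at h
    rw [List.range'_succ, List.map_cons, List.cons_append, ← List.singleton_append]
    have e (b₁ b₃ : List Bool) (a c : Bool) :
        ((b₁ ++ [a, c] ++ b₃).set b₁.length (bit (b₁ ++ [a, c] ++ b₃) (b₁.length + 1))).set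
          (b₁.length + 1) (bit (b₁ ++ [a, c] ++ b₃) b₁.length ^^
            bit (b₁ ++ [a, c] ++ b₃) (b₁.length + 1)) = b₁ ++ [c, a ^^ c] ++ b₃ := by
      rw [show bit (b₁ ++ [a, c] ++ b₃) b₁.length = a from bit_frame b₁ [a, c] b₃ (k := 0) (by simp),
        bit_frame b₁ [a, c] b₃ (k := 1) (by simp),
        show ∀ v, (b₁ ++ [a, c] ++ b₃).set b₁.length v = b₁ ++ [v, c] ++ b₃ from
          set_frame b₁ [a, c] b₃ (k := 0) (by simp), set_frame b₁ _ b₃ (k := 1) (by simp)]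
      rfl
    have h' : Lowers x [(⟨p, [(), ()], 2, [],
        [1, 0, 0, 0, 0, 0, 1, 0, 0, 0, 0, 1, 0, 1, 0, 0]⟩ : Gate)] (H + 1) (H + 1)
        fun ψ b => ψ ((b.set p (bit b (p + 1))).set (p + 1) (bit b p ^^ bit b (p + 1))) :=
      lowers_two (by omega) rfl fun ψ b₁ b₃ a c h1 => by
        subst h1
        rw [e]
        cases a <;> cases c <;> simp
    refine (h'.append h).congr fun ψ b hb => ?_
    obtain ⟨b₁, w, b₃, rfl, h1, h2, -⟩ := exists_bits₃ (n₁ := p) (n₂ := 2)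
      (n₃ := H + 1 - p - 2) (hb.trans (by omega))
    obtain ⟨a, c, rfl⟩ := List.length_eq_two.1 h2
    subst h1
    simp only [e]
    rw [drop_frame b₁ [c, a ^^ c] b₃ (k := 1) (by simp),
      eraseIdx_frame b₁ [c, a ^^ c] b₃ (k := 1) (by simp),
      show (b₁ ++ [a, c] ++ b₃).eraseIdx b₁.length = b₁ ++ [c] ++ b₃ from
        eraseIdx_frame b₁ [a, c] b₃ (k := 0) (by simp),
      show (b₁ ++ [a, c] ++ b₃).drop b₁.length = [a, c] ++ b₃ from
        drop_frame b₁ [a, c] b₃ (k := 0) (by simp)]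
    have : ∀ n, (n + 1 + 1) % 2 = n % 2 := by omega
    cases a <;> cases c <;> simp [this]

theorem lowers_parityGates {N p q : ℕ} (hpq : p ≤ q) (hq : q ≤ H) (hN : q ≤ N) :
    Lowers x (parityGates (List.range N) p q) H H (projectEven p (q - p)) := by
  have e : ((List.range N).take q).drop p = List.range' p (q - p) := by
    rw [List.take_range, min_eq_left hN, List.range_eq_range', List.drop_range']; simp
  have h := lowers_parities (x := x) (H := H) p (q - p) (by omega)
  rw [parityGates, e, List.cons_append, ← List.singleton_append]
  rw [show p + (q - p) = q by omega] at h
  have h' : Lowers x [(⟨p, [()], 0, [], [1, 0]⟩ : Gate)] (H + 1) H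
      fun ψ b => ψ (b.take p ++ false :: b.drop p) :=
    lowers_zero (by omega) rfl fun ψ b₁ b₃ h1 => by
      subst h1
      simp
  refine (h'.append h).congr fun ψ b hb => ?_
  · have hl : (b.take p).length = p := by simp; omega
    have e1 : (b.take p ++ false :: b.drop p).drop p = false :: b.drop p := by
      conv_lhs => enter [1]; rw [← hl]
      rw [List.drop_left]
    have e2 : (b.take p ++ false :: b.drop p).eraseIdx p = b := by
      rw [List.eraseIdx_append_of_length_le (by rw [hl]), hl, Nat.sub_self]; simp
    simp only [e1, e2, projectEven, List.take_succ_cons, List.count_cons]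
    simp

end

end Quon

namespace Quon

/-! ### The gates of a diagram -/

/-- The half of `i`, rounded down, if it occurs in `R`. -/
def half (R : List ℕ) (i : ℕ) : ℕ :=
  R.foldl (fun s k => if k + k = i then k else if k + k + 1 = i then k else s) 0

/-- Programs have no division and no parity test for numbers. Both are replaced by a search through
the list `R`, whose length must therefore exceed `i / 2`. -/
def isOdd (R : List ℕ) (i : ℕ) : Bool := if half R i + half R i = i then false else true

theorem half_range {N i : ℕ} (h : i / 2 < N) : half (List.range N) i = i / 2 := by
  induction N with
  | zero => simp at h
  | succ N ih =>
    rw [half, List.range_succ, List.foldl_append]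
    change (if N + N = i then N else if N + N + 1 = i then N else half (List.range N) i) = i / 2
    split_ifs
    · omega
    · omega
    · exact ih (by omega)

theorem isOdd_range {N i : ℕ} (h : i / 2 < N) :
    2 * half (List.range N) i + (isOdd (List.range N) i).toNat = i := by
  rw [isOdd, half_range h]
  split_ifs <;> simp <;> omega

/-- The kind of a layer, as in its encoding. -/
def Layer.tag : Layer → ℕ
  | .ev (.birth _) => 0
  | .ev (.death _) => 1
  | .ev (.split _ _) => 2
  | .ev (.merge _) => 3
  | .ev (.cap _ _) => 4
  | .ev (.cup _ _) => 5
  | .ev (.dots _ _ _) => 6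
  | .ev (.braidPos _ _) => 7
  | .ev (.braidNeg _ _) => 8
  | .ev (.scatter _ _ _) => 9
  | .ev (.scatterH _ _ _) => 10
  | .legIn _ _ => 11
  | .legOut _ _ => 12

/-- The component of a layer. -/
def Layer.place : Layer → ℕ
  | .ev (.birth c) | .ev (.death c) | .ev (.split c _) | .ev (.merge c) | .ev (.cap c _)
  | .ev (.cup c _) | .ev (.dots c _ _) | .ev (.braidPos c _) | .ev (.braidNeg c _)
  | .ev (.scatter _ c _) | .ev (.scatterH _ c _) | .legIn c _ | .legOut c _ => c

/-- The first datum of a layer after its component. -/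
def Layer.arg : Layer → ℕ
  | .ev (.birth _) | .ev (.death _) | .ev (.merge _) => 0
  | .ev (.split _ i) | .ev (.cap _ i) | .ev (.cup _ i) | .ev (.dots _ i _)
  | .ev (.braidPos _ i) | .ev (.braidNeg _ i)
  | .ev (.scatter _ _ i) | .ev (.scatterH _ _ i) | .legIn _ i | .legOut _ i => i

/-- The second dotted string. -/
def Layer.dot : Layer → ℕ
  | .ev (.dots _ _ j) => j
  | _ => 0

/-- The exponential of the angle of a scattering element. -/
noncomputable def Layer.factor : Layer → ℂ
  | .ev (.scatter θ _ _) | .ev (.scatterH θ _ _) => Complex.exp (Complex.I * θ)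
  | _ => 0

/-- `e = -1` belongs to the positive braid and `e = 1` to the negative one. -/
noncomputable def braidFactor (e : ℝ) : ℂ :=
  Complex.exp (Complex.I * Real.pi / 8 * e) / (Real.sqrt 2 : ℝ)

/-- The gates of a layer below the slice `s`, when `R` lists the numbers up to a bound. -/
noncomputable def layerGates (R : List ℕ) (s : Slice) (l : Layer) : List Gate :=
  let o := (s.take l.place).sum
  let k := o + half R l.arg
  let odd := isOdd R l.arg
  if l.tag = 2 then
    parityGates R o (o + l.arg) ++ parityGates R (o + l.arg) (o + s.getD l.place 0)
  else if l.tag = 4 then [capGate k odd]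
  else if l.tag = 5 then [cupGate k odd]
  else if l.tag = 6 then
    majGates R k odd Complex.I ++ majGates R (o + half R l.dot) (isOdd R l.dot) 1
  else if l.tag = 7 then
    [pairGate k odd (braidFactor (-1) * (1 + Complex.I)) (braidFactor (-1) * (1 - Complex.I))]
  else if l.tag = 8 then
    [pairGate k odd (braidFactor 1 * (1 - Complex.I)) (braidFactor 1 * (1 + Complex.I))]
  else if l.tag = 9 then [pairGate k odd 1 l.factor]
  else if l.tag = 10 then [scatterHGate k odd l.factor]
  else if l.tag = 11 then [⟨o, [], 2, [l.arg], [1, 1, 0, 0, 0, 0, 1, -1]⟩]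
  else if l.tag = 12 then [⟨o, [(), ()], 0, [l.arg], [1, 1, 0, 0, 0, 0, 1, -1]⟩]
  else []

/-- The slice below a layer. -/
def nextSlice (R : List ℕ) (s : Slice) (l : Layer) : Slice :=
  let e := s.getD l.place 0
  if l.tag = 0 then s.take l.place ++ 0 :: s.drop l.place
  else if l.tag = 1 then s.take l.place ++ s.drop (l.place + 1)
  else if l.tag = 2 then
    s.take l.place ++ l.arg :: ((R.take e).drop l.arg).length :: s.drop (l.place + 1)
  else if l.tag = 3 then s.take l.place ++ (e + s.getD (l.place + 1) 0) :: s.drop (l.place + 2)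
  else if l.tag = 4 then s.take l.place ++ (e + 1) :: s.drop (l.place + 1)
  else if l.tag = 5 then s.take l.place ++ (e - 1) :: s.drop (l.place + 1)
  else if l.tag = 11 then s.take l.place ++ 2 :: s.drop l.place
  else if l.tag = 12 then s.take l.place ++ s.drop (l.place + 1)
  else s

/-- The gate has at most four legs. -/
def Gate.Small (g : Gate) : Prop :=
  g.op.length + g.ins.length + g.arity ≤ 4 ∧
    g.tab.length = 2 ^ (g.op.length + g.ins.length + g.arity)

/-- `nextSlice` and `layerGates` are total functions made for computation; their values are
meaningful only for a layer that fits the slice, and this collects what holds then. -/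
structure LayerSpec (N : ℕ) (l : Layer) (s s' : Slice) : Prop where
  next : nextSlice (List.range N) s l = s'
  lowers : ∀ x, Lowers x (layerGates (List.range N) s l) s.sum s'.sum (exec (l.toElems x) s)
  op : (layerGates (List.range N) s l).flatMap Gate.op = legs [l]
  small : ∀ g ∈ layerGates (List.range N) s l, g.Small

theorem capGate_small (k : ℕ) (odd : Bool) : (capGate k odd).op = [] ∧ (capGate k odd).Small := by
  cases odd <;> simp [capGate, Gate.Small]

theorem cupGate_small (k : ℕ) (odd : Bool) : (cupGate k odd).op = [] ∧ (cupGate k odd).Small := by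
  cases odd <;> simp [cupGate, Gate.Small]

theorem pairGate_small (k : ℕ) (odd : Bool) (u v : ℂ) :
    (pairGate k odd u v).op = [] ∧ (pairGate k odd u v).Small := by
  cases odd <;> simp [pairGate, Gate.Small]

theorem scatterHGate_small (k : ℕ) (odd : Bool) (z : ℂ) :
    (scatterHGate k odd z).op = [] ∧ (scatterHGate k odd z).Small := pairGate_small _ _ _ _

theorem majGates_small (R : List ℕ) (k : ℕ) (odd : Bool) (w : ℂ) :
    ∀ g ∈ majGates R k odd w, g.op = [] ∧ g.Small := by
  intro g hg
  simp only [majGates, List.mem_append, List.mem_map, List.mem_singleton] at hg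
  rcases hg with ⟨_, _, rfl⟩ | rfl
  · simp [Gate.Small]
  · cases odd <;> simp [Gate.Small]

theorem parityGates_small (R : List ℕ) (p q : ℕ) :
    ∀ g ∈ parityGates R p q, g.op = [] ∧ g.Small := by
  intro g hg
  simp only [parityGates, List.mem_append, List.mem_cons, List.mem_map,
    List.not_mem_nil, or_false] at hg
  rcases hg with (rfl | ⟨_, _, rfl⟩) | rfl <;> simp [Gate.Small]

theorem layerSpec_of {N : ℕ} {a : Elem} {s s' : Slice} {G : List Gate}
    (hG : layerGates (List.range N) s (.ev a) = G)
    (hn : nextSlice (List.range N) s (.ev a) = s')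
    (hl : ∀ x, Lowers x G s.sum s'.sum (a.act s)) (hs : ∀ g ∈ G, g.op = [] ∧ g.Small) :
    LayerSpec N (.ev a) s s' :=
  ⟨hn, fun x => by rw [hG]; exact hl x,
    by rw [hG, List.flatMap_eq_nil_iff.2 fun g hg => (hs g hg).1]; rfl,
    fun g hg => (hs g (hG ▸ hg)).2⟩

theorem getD_eq {s : Slice} {c e : ℕ} (h : s[c]? = some e) : s.getD c 0 = e := by
  simp [List.getD, h]

/-- Since the slice has fewer than `N` pairs, `List.range N` is long enough to find the half of
every string position that occurs, including the position of a cap at the right end. -/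
theorem layerSpec {N : ℕ} {l : Layer} {s s' : Slice} (h : l.step s = some s') (hN : s.sum < N) :
    LayerSpec N l s s' := by
  cases l with
  | legIn c ℓ =>
    obtain ⟨s₁, s₃, rfl, rfl, rfl⟩ := step_legIn h
    refine ⟨?_, fun x => ?_, rfl, ?_⟩
    · change List.take _ _ ++ 2 :: List.drop _ _ = _
      simp [Layer.place]
    · rw [toElems_legIn]
      change Lowers x [⟨((s₁ ++ [] ++ s₃).take s₁.length).sum, [], 2, [ℓ], _⟩] _ _ _
      refine lowers_two (by simp; omega) (by simp; omega) fun ψ b₁ b₃ p q h1 => ?_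
      have hs : b₁.length = s₁.sum := by simpa using h1
      rw [exec_frame (s₃ := s₃) (runE_encIn (x ℓ)) hs (loc_self b₁ b₃ _ ψ) [p, q] rfl, exec_encIn]
      cases hx : x ℓ <;> cases p <;> cases q <;> simp [bsum, tabAt, digits, sgn, hx]
    · rintro g hg
      change g ∈ [_] at hg
      rw [List.mem_singleton.1 hg]
      simp [Gate.Small]
  | legOut c ℓ =>
    obtain ⟨s₁, s₃, rfl, rfl, rfl⟩ := step_legOut h
    refine ⟨?_, fun x => ?_, rfl, ?_⟩
    · change List.take _ _ ++ List.drop _ _ = _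
      simp [Layer.place]
    · rw [toElems_legOut]
      change Lowers x [⟨((s₁ ++ [2] ++ s₃).take s₁.length).sum, [(), ()], 0, [ℓ], _⟩] _ _ _
      refine lowers_zero (by simp) (by simp; omega) fun ψ b₁ b₃ h1 => ?_
      have hs : b₁.length = s₁.sum := by simpa using h1
      rw [exec_frame (s₃ := s₃) (runE_encOut (x ℓ)) hs (loc_self b₁ b₃ _ ψ) [] rfl, exec_encOut]
      cases hx : x ℓ <;> simp [bsum, tabAt, digits, sgn, hx]
    · rintro g hg
      change g ∈ [_] at hg
      rw [List.mem_singleton.1 hg]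
      simp [Gate.Small]
  | ev a =>
    simp only [Layer.step] at h
    cases a with
    | birth c =>
      simp only [Elem.step, Option.ite_none_right_eq_some, Option.some.injEq] at h
      obtain ⟨hc, rfl⟩ := h
      refine layerSpec_of rfl rfl (fun x => ?_) (by simp [layerGates, Layer.tag])
      have : (s.take c ++ 0 :: s.drop c).sum = s.sum := by simp
      rw [this]; exact Lowers.nil _
    | death c =>
      simp only [Elem.step, Option.ite_none_right_eq_some, Option.some.injEq] at h
      obtain ⟨hc, rfl⟩ := h
      rw [List.eraseIdx_eq_take_drop_succ]
      refine layerSpec_of rfl rfl (fun x => ?_) (by simp [layerGates, Layer.tag])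
      have : (s.take c ++ s.drop (c + 1)).sum = s.sum := by
        rw [sum_split hc]; simp [Slice.offset]
      rw [this]; exact Lowers.nil _
    | merge c =>
      simp only [Elem.step] at h
      split at h
      · rename_i e e' hc hc'
        obtain rfl := Option.some.inj h
        refine layerSpec_of rfl ?_ (fun x => ?_) (by simp [layerGates, Layer.tag])
        · change s.take c ++ (s.getD c 0 + s.getD (c + 1) 0) :: s.drop (c + 2) = _
          rw [getD_eq hc, getD_eq hc']
        · have : (s.take c ++ (e + e') :: s.drop (c + 2)).sum = s.sum := by
            have h1 := sum_split hc
            have h2 : s.drop (c + 1) = e' :: s.drop (c + 2) := by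
              obtain ⟨h3, rfl⟩ := List.getElem?_eq_some_iff.1 hc'
              exact List.drop_eq_getElem_cons h3
            rw [h1, h2]; simp [Slice.offset]; omega
          rw [this]; exact Lowers.nil _
      · simp at h
    | split c i =>
      simp only [Elem.step] at h
      split at h
      · rename_i e hc
        have hsum := sum_split hc
        simp only [Option.ite_none_right_eq_some, Option.some.injEq] at h
        obtain ⟨hi, rfl⟩ := h
        refine layerSpec_of (G := parityGates (List.range N) (s.offset c) (s.offset c + i) ++
          parityGates (List.range N) (s.offset c + i) (s.offset c + e)) ?_ ?_ (fun x => ?_) ?_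
        · rw [← getD_eq hc]; rfl
        -- The difference `e - i` is obtained as the length of a piece of `List.range N`.
        · change s.take c ++ i :: (((List.range N).take (s.getD c 0)).drop i).length
            :: s.drop (c + 1) = _
          rw [getD_eq hc]
          simp only [List.length_drop, List.length_take, List.length_range]
          rw [min_eq_left (by omega)]
        · have : (s.take c ++ i :: (e - i) :: s.drop (c + 1)).sum = s.sum := by
            rw [hsum]; simp [Slice.offset]; omega
          rw [this]
          have h1 := lowers_parityGates (x := x) (N := N) (H := s.sum)
            (p := s.offset c) (q := s.offset c + i) (by omega) (by omega) (by omega)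
          have h2 := lowers_parityGates (x := x) (N := N) (H := s.sum)
            (p := s.offset c + i) (q := s.offset c + e) (by omega) (by omega) (by omega)
          rw [Nat.add_sub_cancel_left] at h1
          rw [Nat.add_sub_add_left] at h2
          refine (h1.append h2).congr fun ψ b _ => ?_
          simp only [Elem.act, getD_eq hc]
        · intro g hg
          exact (List.mem_append.1 hg).elim (parityGates_small _ _ _ g) (parityGates_small _ _ _ g)
      · simp at h
    | cap c i =>
      simp only [Elem.step] at h
      split at h
      · rename_i e hc
        have hsum := sum_split hc
        simp only [Option.ite_none_right_eq_some, Option.some.injEq] at h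
        obtain ⟨hi, rfl⟩ := h
        have ho := isOdd_range (N := N) (i := i) (by omega)
        have hle := Bool.toNat_le (isOdd (List.range N) i)
        have he : 2 * (s.offset c + half (List.range N) i) + (isOdd (List.range N) i).toNat
          = 2 * s.offset c + i := by omega
        refine layerSpec_of (G := [capGate (s.offset c + half (List.range N) i) (isOdd (List.range N) i)]) rfl ?_ (fun x => ?_)
          (by simpa using capGate_small _ _)
        · change s.take c ++ (s.getD c 0 + 1) :: s.drop (c + 1) = _
          rw [getD_eq hc, List.set_eq_take_append_cons_drop, if_pos (split_at hc).2.2]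
        · rw [show (s.set c (e + 1)).sum = s.sum + 1 by rw [sum_set hc, hsum]; omega]
          change Lowers x _ _ _ (capAt (2 * s.offset c + i))
          rw [← he]
          exact lowers_capGate _ (by omega)
      · simp at h
    | cup c i =>
      simp only [Elem.step] at h
      split at h
      · rename_i e hc
        have hsum := sum_split hc
        simp only [Option.ite_none_right_eq_some, Option.some.injEq] at h
        obtain ⟨hi, rfl⟩ := h
        have ho := isOdd_range (N := N) (i := i) (by omega)
        have hle := Bool.toNat_le (isOdd (List.range N) i)
        have he : 2 * (s.offset c + half (List.range N) i) + (isOdd (List.range N) i).toNat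
          = 2 * s.offset c + i := by omega
        refine layerSpec_of (G := [cupGate (s.offset c + half (List.range N) i) (isOdd (List.range N) i)]) rfl ?_ (fun x => ?_)
          (by simpa using cupGate_small _ _)
        · change s.take c ++ (s.getD c 0 - 1) :: s.drop (c + 1) = _
          rw [getD_eq hc, List.set_eq_take_append_cons_drop, if_pos (split_at hc).2.2]
        · have hs : s.sum = (s.set c (e - 1)).sum + 1 := by rw [sum_set hc, hsum]; omega
          change Lowers x _ _ _ (cupAt (2 * s.offset c + i))
          rw [← he, hs]
          exact lowers_cupGate _ (by omega)
      · simp at h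
    | dots c i j =>
      simp only [Elem.step] at h
      split at h
      · rename_i e hc
        have hsum := sum_split hc
        simp only [Option.ite_none_right_eq_some, Option.some.injEq] at h
        obtain ⟨hi, rfl⟩ := h
        have ho := isOdd_range (N := N) (i := i) (by omega)
        have hle := Bool.toNat_le (isOdd (List.range N) i)
        have he : 2 * (s.offset c + half (List.range N) i) + (isOdd (List.range N) i).toNat
          = 2 * s.offset c + i := by omega
        have ho' := isOdd_range (N := N) (i := j) (by omega)
        have he' : 2 * (s.offset c + half (List.range N) j) + (isOdd (List.range N) j).toNat
          = 2 * s.offset c + j := by omega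
        refine layerSpec_of (G := majGates (List.range N) (s.offset c + half (List.range N) i) (isOdd (List.range N) i) Complex.I ++
          majGates (List.range N) (s.offset c + half (List.range N) j) (isOdd (List.range N) j) 1)
          rfl rfl (fun x => ?_) ?_
        · have h1 := (lowers_majGates (x := x) (H := s.sum) (N := N) (isOdd (List.range N) i)
            Complex.I (k := s.offset c + half (List.range N) i) (by omega) (by omega)).append
            (lowers_majGates (N := N) (isOdd (List.range N) j) 1
              (k := s.offset c + half (List.range N) j) (by omega) (by omega))
          rw [he, he'] at h1
          refine h1.congr fun ψ b _ => ?_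
          simp only [one_mul]; rfl
        · intro g hg
          exact (List.mem_append.1 hg).elim (majGates_small _ _ _ _ g) (majGates_small _ _ _ _ g)
      · simp at h
    | braidPos c i =>
      simp only [Elem.step] at h
      split at h
      · rename_i e hc
        have hsum := sum_split hc
        simp only [Option.ite_none_right_eq_some, Option.some.injEq] at h
        obtain ⟨hi, rfl⟩ := h
        have ho := isOdd_range (N := N) (i := i) (by omega)
        have hle := Bool.toNat_le (isOdd (List.range N) i)
        have he : 2 * (s.offset c + half (List.range N) i) + (isOdd (List.range N) i).toNat
          = 2 * s.offset c + i := by omega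
        refine layerSpec_of (G := [pairGate (s.offset c + half (List.range N) i) (isOdd (List.range N) i) (braidFactor (-1) * (1 + Complex.I))
          (braidFactor (-1) * (1 - Complex.I))]) rfl rfl (fun x => ?_)
          (by simpa using pairGate_small _ _ _ _)
        refine (lowers_pairGate _ _ _ (by omega)).congr fun ψ b _ => ?_
        rw [he]
        simp only [Elem.act, braidPosAt, braidFactor]
        push_cast
        ring_nf
      · simp at h
    | braidNeg c i =>
      simp only [Elem.step] at h
      split at h
      · rename_i e hc
        have hsum := sum_split hc
        simp only [Option.ite_none_right_eq_some, Option.some.injEq] at h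
        obtain ⟨hi, rfl⟩ := h
        have ho := isOdd_range (N := N) (i := i) (by omega)
        have hle := Bool.toNat_le (isOdd (List.range N) i)
        have he : 2 * (s.offset c + half (List.range N) i) + (isOdd (List.range N) i).toNat
          = 2 * s.offset c + i := by omega
        refine layerSpec_of (G := [pairGate (s.offset c + half (List.range N) i) (isOdd (List.range N) i) (braidFactor 1 * (1 - Complex.I))
          (braidFactor 1 * (1 + Complex.I))]) rfl rfl (fun x => ?_)
          (by simpa using pairGate_small _ _ _ _)
        refine (lowers_pairGate _ _ _ (by omega)).congr fun ψ b _ => ?_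
        rw [he]
        simp only [Elem.act, braidNegAt, braidFactor]
        push_cast
        ring_nf
      · simp at h
    | scatter θ c i =>
      simp only [Elem.step] at h
      split at h
      · rename_i e hc
        have hsum := sum_split hc
        simp only [Option.ite_none_right_eq_some, Option.some.injEq] at h
        obtain ⟨hi, rfl⟩ := h
        have ho := isOdd_range (N := N) (i := i) (by omega)
        have hle := Bool.toNat_le (isOdd (List.range N) i)
        have he : 2 * (s.offset c + half (List.range N) i) + (isOdd (List.range N) i).toNat
          = 2 * s.offset c + i := by omega
        refine layerSpec_of (G := [pairGate (s.offset c + half (List.range N) i) (isOdd (List.range N) i) 1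
          (Complex.exp (Complex.I * θ))]) rfl rfl (fun x => ?_)
          (by simpa using pairGate_small _ _ _ _)
        refine (lowers_pairGate _ _ _ (by omega)).congr fun ψ b _ => ?_
        rw [he]
        simp only [Elem.act, scatterAt]
      · simp at h
    | scatterH θ c i =>
      simp only [Elem.step] at h
      split at h
      · rename_i e hc
        have hsum := sum_split hc
        simp only [Option.ite_none_right_eq_some, Option.some.injEq] at h
        obtain ⟨hi, rfl⟩ := h
        have ho := isOdd_range (N := N) (i := i) (by omega)
        have hle := Bool.toNat_le (isOdd (List.range N) i)
        have he : 2 * (s.offset c + half (List.range N) i) + (isOdd (List.range N) i).toNat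
          = 2 * s.offset c + i := by omega
        refine layerSpec_of (G := [scatterHGate (s.offset c + half (List.range N) i) (isOdd (List.range N) i)
          (Complex.exp (Complex.I * θ))]) rfl rfl (fun x => ?_)
          (by simpa using scatterHGate_small _ _ _)
        change Lowers x _ _ _ (scatterHAt θ (2 * s.offset c + i))
        rw [← he]
        exact lowers_scatterHGate _ _ (by omega)
      · simp at h

/-- The extreme case is a leg pointing up, which brings two pairs of strings. Twice the number of
layers therefore bounds all slices. -/
theorem sum_step_le {l : Layer} {s s' : Slice} (h : l.step s = some s') : s'.sum ≤ s.sum + 2 := by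
  cases l with
  | legIn c ℓ =>
    obtain ⟨s₁, s₃, rfl, rfl, rfl⟩ := step_legIn h
    simp; omega
  | legOut c ℓ =>
    obtain ⟨s₁, s₃, rfl, rfl, rfl⟩ := step_legOut h
    simp; omega
  | ev a =>
    simp only [Layer.step] at h
    cases a with
    | birth c =>
      simp only [Elem.step, Option.ite_none_right_eq_some, Option.some.injEq] at h
      rw [← h.2, List.sum_append, List.sum_cons, zero_add, sum_take_add_drop]
      omega
    | death c =>
      simp only [Elem.step, Option.ite_none_right_eq_some, Option.some.injEq] at h
      rw [← h.2, List.eraseIdx_eq_take_drop_succ, sum_split h.1, List.sum_append, Slice.offset]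
      omega
    | merge c =>
      simp only [Elem.step] at h
      split at h
      · rename_i e e' hc hc'
        have h2 : s.drop (c + 1) = e' :: s.drop (c + 2) := by
          obtain ⟨h3, rfl⟩ := List.getElem?_eq_some_iff.1 hc'
          exact List.drop_eq_getElem_cons h3
        rw [← Option.some.inj h, sum_split hc, h2, List.sum_append, List.sum_cons, List.sum_cons,
          Slice.offset]
        omega
      · simp at h
    | _ =>
      simp only [Elem.step] at h
      split at h
      · rename_i e hc
        simp only [Option.ite_none_right_eq_some, Option.some.injEq] at h
        rw [← h.2, sum_split hc]
        first
          | rw [sum_set hc]; omega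
          | rw [← sum_split hc]; omega
          | rw [List.sum_append, List.sum_cons, List.sum_cons, Slice.offset]; omega
      · simp at h

/-- The slice and the gates below a sequence of layers. -/
noncomputable def sweep (R : List ℕ) (L : List Layer) (t : Slice × List Gate) : Slice × List Gate :=
  L.foldl (fun t l => (nextSlice R t.1 l, layerGates R t.1 l ++ t.2)) t

/-- The gates of a later layer are put in front, as sequences of gates list the last one first. The
state `φ` is kept general for the induction, and it matters only on bits of the right length. -/
theorem sweep_spec {N : ℕ} {L : List Layer} {s s' : Slice} (h : run L s = some s')
    (hN : s.sum + 2 * L.length < N) {G : List Gate} (hG : heightG G s.sum = some 0)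
    (hs : ∀ g ∈ G, g.Small) :
    ∃ G', sweep (List.range N) L (s, G) = (s', G') ∧ heightG G' s'.sum = some 0 ∧
      (∀ x φ, (∀ b : List Bool, b.length = s.sum → actL x G vac b = φ b) →
        ∀ b : List Bool, b.length = s'.sum → actL x G' vac b = exec (elems x L) s φ b) ∧
      (G'.flatMap Gate.op).Perm (legs L ++ G.flatMap Gate.op) ∧ ∀ g ∈ G', g.Small := by
  induction L generalizing s G with
  | nil =>
    obtain rfl := Option.some.inj h
    exact ⟨G, rfl, hG, fun x φ hφ b hb => hφ b hb, List.Perm.refl _, hs⟩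
  | cons l L ih =>
    simp only [run, Option.bind_eq_some_iff] at h
    obtain ⟨t, ht, h⟩ := h
    rw [List.length_cons] at hN
    have hl := layerSpec ht (N := N) (by omega)
    have hle := sum_step_le ht
    obtain ⟨G', h1, h2, h3, h4, h5⟩ := ih h (by omega)
      (G := layerGates (List.range N) s l ++ G)
      (by rw [heightG_append, (hl.lowers fun _ => false).height]; exact hG)
      (fun g hg => (List.mem_append.1 hg).elim (hl.small g) (hs g))
    refine ⟨G', ?_, h2, fun x φ hφ b hb => ?_, ?_, h5⟩
    · rw [← h1, ← hl.next]; rfl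
    · rw [elems_cons, exec_append (runE_toElems x ht)]
      refine h3 x _ (fun b hb => ?_) b hb
      rw [actL_append, actL_congr (hl.lowers x).height hφ hb, (hl.lowers x).act _ _ hb]
    · refine h4.trans ?_
      rw [List.flatMap_append, hl.op]
      cases l with
      | ev a => exact List.Perm.refl _
      | legIn c ℓ => exact List.perm_middle
      | legOut c ℓ => exact List.perm_middle

/-- The gates of a diagram. -/
noncomputable def diagramGates (D : Diagram) : List Gate :=
  ⟨0, [], 0, [], [D.coeff]⟩ ::
    (sweep ((() :: D.layers.flatMap fun _ => [(), ()]).zipIdx.map Prod.snd) D.layers ([], [])).2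

theorem diagramGates_spec {D : Diagram} {n : ℕ} (hD : IsDiagram D n) :
    heightG (diagramGates D) 0 = some 0 ∧
      ((diagramGates D).flatMap Gate.op).Perm (List.range n) ∧
      (∀ g ∈ diagramGates D, g.Small) ∧
      ∀ x, actL (extend x) (diagramGates D) vac [] = D.tensor n x := by
  -- Two positions for each layer and one more give a list of numbers longer than any slice needs,
  -- obtained by numbering a list as long as the input allows.
  have hR : (() :: D.layers.flatMap fun _ => [(), ()]).zipIdx.map Prod.snd
      = List.range (2 * D.layers.length + 1) := by
    rw [List.zipIdx_map_snd, ← List.range_eq_range']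
    congr 1
    simp [List.length_flatMap, mul_comm]
  obtain ⟨G, h1, h2, h3, h4, h5⟩ := sweep_spec hD.1 (N := 2 * D.layers.length + 1) (G := [])
    (by simp) rfl (by simp)
  rw [diagramGates, hR, h1]
  refine ⟨?_, ?_, ?_, fun x => ?_⟩
  · simpa [heightG] using h2
  · simpa using h4.trans (by simpa using hD.2)
  · intro g hg
    rcases List.mem_cons.1 hg with rfl | hg
    · simp [Gate.Small]
    · exact h5 g hg
  · change Gate.act _ _ (actL _ G vac) _ = _
    rw [Diagram.tensor, eval_eq, evalElems_eq (runE_elems _ hD.1),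
      ← h3 (extend x) vac (fun b _ => rfl) [] rfl]
    simp [Gate.act, bsum, tabAt, digits]

end Quon

namespace Quon

/-! ### The network of a diagram is computed in polynomial time -/

open Enc (enc)

noncomputable instance : Enc Gate := ⟨fun g => enc (g.pos, g.ins, g.arity, g.op, g.tab)⟩

/-- The encoding of a layer as a list of numbers. -/
noncomputable def Layer.code : Layer → List ℂ
  | .ev (.birth c) => [0, c]
  | .ev (.death c) => [1, c]
  | .ev (.split c m) => [2, c, m]
  | .ev (.merge c) => [3, c]
  | .ev (.cap c i) => [4, c, i]
  | .ev (.cup c i) => [5, c, i]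
  | .ev (.dots c i j) => [6, c, i, j]
  | .ev (.braidPos c i) => [7, c, i]
  | .ev (.braidNeg c i) => [8, c, i]
  | .ev (.scatter θ c i) => [9, c, i, Complex.exp (Complex.I * θ)]
  | .ev (.scatterH θ c i) => [10, c, i, Complex.exp (Complex.I * θ)]
  | .legIn c ℓ => [11, c, ℓ]
  | .legOut c ℓ => [12, c, ℓ]

section
variable {α β γ σ : Type} [Enc α] [Enc β] [Enc γ] [Enc σ]

@[fun_prop]
theorem Poly.gate {pos arity : α → ℕ} {ins : α → List Unit} {op : α → List ℕ} {tab : α → List ℂ}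
    (h₁ : Poly pos) (h₂ : Poly ins) (h₃ : Poly arity) (h₄ : Poly op) (h₅ : Poly tab) :
    Poly fun a => (⟨pos a, ins a, arity a, op a, tab a⟩ : Gate) := by
  have h : Poly fun a => (pos a, ins a, arity a, op a, tab a) := by fun_prop
  exact h.of_enc fun _ => rfl

theorem Poly.gate_fields {g : α → Gate} (hg : Poly g) :
    Poly fun a => ((g a).pos, (g a).ins, (g a).arity, (g a).op, (g a).tab) :=
  hg.of_enc fun _ => rfl

@[fun_prop]
theorem Poly.pos {g : α → Gate} (hg : Poly g) : Poly fun a => (g a).pos := hg.gate_fields.fst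

@[fun_prop]
theorem Poly.ins {g : α → Gate} (hg : Poly g) : Poly fun a => (g a).ins := hg.gate_fields.snd.fst

@[fun_prop]
theorem Poly.arity {g : α → Gate} (hg : Poly g) : Poly fun a => (g a).arity :=
  hg.gate_fields.snd.snd.fst

@[fun_prop]
theorem Poly.op {g : α → Gate} (hg : Poly g) : Poly fun a => (g a).op :=
  hg.gate_fields.snd.snd.snd.fst

@[fun_prop]
theorem Poly.tab {g : α → Gate} (hg : Poly g) : Poly fun a => (g a).tab :=
  hg.gate_fields.snd.snd.snd.snd

@[fun_prop]
theorem Poly.getD {l : α → List β} {k : α → ℕ} {d : α → β} (hl : Poly l) (hk : Poly k)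
    (hd : Poly d) : Poly fun a => (l a).getD (k a) (d a) := by
  have h : Poly fun a => (match (l a).drop (k a) with | [] => d a | b :: _ => b : β) :=
    Poly.uncons (h := fun _ b _ => b) (hk.drop hl) hd (by fun_prop)
  convert h using 2 with a
  rw [List.getD, ← Nat.add_zero (k a), ← List.getElem?_drop]
  rcases (l a).drop (k a + 0) with _ | ⟨b, l'⟩ <;> rfl

-- A layer and its code are written as the same tree. The fields of a layer can thus be read off by
-- position in a list of numbers.
@[fun_prop]
theorem Poly.code {l : α → Layer} (hl : Poly l) : Poly fun a => (l a).code := by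
  refine hl.of_enc fun a => ?_
  rcases l a with (_ | _ | _ | _ | _ | _ | _ | _ | _ | _ | _) | _ | _ <;>
    simp [enc, Layer.encode, Elem.encode, Layer.code, Data.nat, Data.list]

@[fun_prop]
theorem Poly.tag {l : α → Layer} (hl : Poly l) : Poly fun a => (l a).tag := by
  have h : Poly fun a => (l a).code.getD 0 0 := by fun_prop
  refine h.of_enc fun a => congrArg Data.atom ?_
  rcases l a with (_ | _ | _ | _ | _ | _ | _ | _ | _ | _ | _) | _ | _ <;>
    simp [Layer.code, Layer.tag]

@[fun_prop]
theorem Poly.place {l : α → Layer} (hl : Poly l) : Poly fun a => (l a).place := by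
  have h : Poly fun a => (l a).code.getD 1 0 := by fun_prop
  refine h.of_enc fun a => congrArg Data.atom ?_
  rcases l a with (_ | _ | _ | _ | _ | _ | _ | _ | _ | _ | _) | _ | _ <;>
    simp [Layer.code, Layer.place]

@[fun_prop]
theorem Poly.arg {l : α → Layer} (hl : Poly l) : Poly fun a => (l a).arg := by
  have h : Poly fun a => (l a).code.getD 2 0 := by fun_prop
  refine h.of_enc fun a => congrArg Data.atom ?_
  rcases l a with (_ | _ | _ | _ | _ | _ | _ | _ | _ | _ | _) | _ | _ <;>
    simp [Layer.code, Layer.arg]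

@[fun_prop]
theorem Poly.dot {l : α → Layer} (hl : Poly l) : Poly fun a => (l a).dot := by
  have h : Poly fun a => if (l a).tag = 6 then (l a).code.getD 3 0 else 0 := by fun_prop
  refine h.of_enc fun a => congrArg Data.atom ?_
  rcases l a with (_ | _ | _ | _ | _ | _ | _ | _ | _ | _ | _) | _ | _ <;>
    simp [Layer.code, Layer.dot, Layer.tag]

@[fun_prop]
theorem Poly.factor {l : α → Layer} (hl : Poly l) : Poly fun a => (l a).factor := by
  -- For a pair of dots the fourth entry is a string; for all other layers without a factor it is
  -- absent and the default `0` is correct.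
  have h : Poly fun a => if (l a).tag = 6 then 0 else (l a).code.getD 3 0 := by fun_prop
  refine h.of_enc fun a => congrArg Data.atom ?_
  rcases l a with (_ | _ | _ | _ | _ | _ | _ | _ | _ | _ | _) | _ | _ <;>
    simp [Layer.code, Layer.factor, Layer.tag]

@[fun_prop]
theorem Poly.half {R : α → List ℕ} {i : α → ℕ} (hR : Poly R) (hi : Poly i) :
    Poly fun a => half (R a) (i a) :=
  hR.foldl_add (Poly.const 0)
    (f := fun a s k => if k + k = i a then k else if k + k + 1 = i a then k else s) (by fun_prop)
    ⟨0, fun a t b => by simp [esize_nat]⟩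

@[fun_prop]
theorem Poly.isOdd {R : α → List ℕ} {i : α → ℕ} (hR : Poly R) (hi : Poly i) :
    Poly fun a => isOdd (R a) (i a) := by
  unfold Quon.isOdd; fun_prop

@[fun_prop]
theorem Poly.listSum {l : α → List ℕ} (hl : Poly l) : Poly fun a => (l a).sum := by
  have h : ∀ a, (l a).sum = (l a).foldl (fun s k => s + k) 0 := fun a => List.sum_eq_foldl
  simp only [h]
  exact hl.foldl_add (Poly.const 0) (f := fun a s k => s + k) (by fun_prop)
    ⟨0, fun a t b => by simp [esize_nat]⟩

@[fun_prop]
theorem Poly.capGate {k : α → ℕ} {odd : α → Bool} (hk : Poly k) (ho : Poly odd) :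
    Poly fun a => capGate (k a) (odd a) := by
  unfold Quon.capGate; fun_prop

@[fun_prop]
theorem Poly.cupGate {k : α → ℕ} {odd : α → Bool} (hk : Poly k) (ho : Poly odd) :
    Poly fun a => cupGate (k a) (odd a) := by
  unfold Quon.cupGate; fun_prop

@[fun_prop]
theorem Poly.pairGate {k : α → ℕ} {odd : α → Bool} {u v : α → ℂ} (hk : Poly k) (ho : Poly odd)
    (hu : Poly u) (hv : Poly v) : Poly fun a => pairGate (k a) (odd a) (u a) (v a) := by
  unfold Quon.pairGate; fun_prop

@[fun_prop]
theorem Poly.scatterHGate {k : α → ℕ} {odd : α → Bool} {z : α → ℂ} (hk : Poly k) (ho : Poly odd)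
    (hz : Poly z) : Poly fun a => scatterHGate (k a) (odd a) (z a) := by
  unfold Quon.scatterHGate; fun_prop

@[fun_prop]
theorem Poly.majGates {R : α → List ℕ} {k : α → ℕ} {odd : α → Bool} {w : α → ℂ} (hR : Poly R)
    (hk : Poly k) (ho : Poly odd) (hw : Poly w) :
    Poly fun a => majGates (R a) (k a) (odd a) (w a) := by
  unfold Quon.majGates; fun_prop

@[fun_prop]
theorem Poly.parityGates {R : α → List ℕ} {p q : α → ℕ} (hR : Poly R)
    (hp : Poly p) (hq : Poly q) : Poly fun a => parityGates (R a) (p a) (q a) := by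
  unfold Quon.parityGates; fun_prop

@[fun_prop]
theorem Poly.layerGates {R : α → List ℕ} {s : α → Slice} {l : α → Layer} (hR : Poly R)
    (hs : Poly s) (hl : Poly l) : Poly fun a => layerGates (R a) (s a) (l a) := by
  unfold Quon.layerGates; fun_prop

@[fun_prop]
theorem Poly.nextSlice {R : α → List ℕ} {s : α → Slice} {l : α → Layer} (hR : Poly R)
    (hs : Poly s) (hl : Poly l) : Poly fun a => nextSlice (R a) (s a) (l a) := by
  unfold Quon.nextSlice; fun_prop

theorem esize_list_nat (l : List ℕ) : esize l = 2 * l.length + 1 := by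
  induction l with
  | nil => rfl
  | cons a l ih => rw [esize_cons, ih, esize_nat, List.length_cons]; ring

theorem length_nextSlice (R : List ℕ) (s : Slice) (l : Layer) :
    (nextSlice R s l).length ≤ s.length + 2 := by
  unfold nextSlice
  dsimp only
  split_ifs <;> simp <;> omega

-- A slice grows by at most two entries per layer, and the gates of a layer depend on the slice but
-- not on the gates collected before.
@[fun_prop]
theorem Poly.sweep {R : α → List ℕ} {L : α → List Layer} {t : α → Slice × List Gate} (hR : Poly R)
    (hL : Poly L) (ht : Poly t) : Poly fun a => sweep (R a) (L a) (t a) := by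
  have h : Poly fun x : α × Slice × Layer => Quon.layerGates (R x.1) x.2.1 x.2.2 := by fun_prop
  obtain ⟨q, hq⟩ := h.esize_le
  refine hL.foldl_add_add ht (f := fun a t l => (Quon.nextSlice (R a) t.1 l,
    Quon.layerGates (R a) t.1 l ++ t.2)) (by fun_prop) (fun t => esize t.1)
    (fun t => by rw [esize_prod t]; omega) ⟨4, fun a t l => ?_⟩
    ⟨q.comp (Polynomial.X + 2) + 4, fun a t l => ?_⟩
  · have := length_nextSlice (R a) t.1 l
    simp only [esize_list_nat, Polynomial.eval_ofNat]
    omega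
  · have h1 := length_nextSlice (R a) t.1 l
    have h2 := hq (a, t.1, l)
    have h3 := esize_append (Quon.layerGates (R a) t.1 l) t.2
    simp only [esize_mk] at h2
    rw [esize_mk, esize_prod t, Polynomial.eval_add, Polynomial.eval_ofNat, Polynomial.eval_comp,
      Polynomial.eval_add, Polynomial.eval_X, Polynomial.eval_ofNat,
      show esize a + esize l + esize t.1 + 2 = esize a + (esize t.1 + esize l + 1) + 1 by omega]
    have h4 := esize_list_nat (Quon.nextSlice (R a) t.1 l)
    have h5 := esize_list_nat t.1
    omega

@[fun_prop]
theorem Poly.edgesBefore {g : α → Gate} {ws : α → List ℕ} {next : α → ℕ} (hg : Poly g)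
    (hw : Poly ws) (hn : Poly next) : Poly fun a => edgesBefore (g a) (ws a) (next a) := by
  unfold Quon.edgesBefore freshEdges; fun_prop

@[fun_prop]
theorem Poly.gateNode {g : α → Gate} {ws : α → List ℕ} {next : α → ℕ} (hg : Poly g)
    (hw : Poly ws) (hn : Poly next) : Poly fun a => gateNode (g a) (ws a) (next a) := by
  unfold Quon.gateNode freshEdges; fun_prop

theorem nodesOf_eq_foldl (G : List Gate) (ws : List ℕ) (next : ℕ)
    (acc : List (List RawEnd × List ℂ)) :
    (G.foldl (fun (t : List ℕ × ℕ × List (List RawEnd × List ℂ)) g =>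
      (edgesBefore g t.1 t.2.1, t.2.1 + g.ins.length, t.2.2 ++ [gateNode g t.1 t.2.1]))
        (ws, next, acc)).2.2 = acc ++ nodesOf G ws next := by
  induction G generalizing ws next acc with
  | nil => simp [nodesOf]
  | cons g G ih => rw [List.foldl_cons, ih, nodesOf]; simp

@[fun_prop]
theorem Poly.nodesOf {G : α → List Gate} {ws : α → List ℕ} {next : α → ℕ} (hG : Poly G)
    (hw : Poly ws) (hn : Poly next) : Poly fun a => nodesOf (G a) (ws a) (next a) := by
  have e := fun a => nodesOf_eq_foldl (G a) (ws a) (next a) []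
  simp only [List.nil_append] at e
  simp only [← e]
  have h : Poly fun x : Gate × List ℕ × ℕ => Quon.gateNode x.1 x.2.1 x.2.2 := by fun_prop
  obtain ⟨q, hq⟩ := h.esize_le
  refine Poly.snd (Poly.snd (hG.foldl_add_add
    (s := fun a => (ws a, next a, ([] : List (List RawEnd × List ℂ))))
    (f := fun _ (t : List ℕ × ℕ × List (List RawEnd × List ℂ)) g =>
      (Quon.edgesBefore g t.1 t.2.1, t.2.1 + g.ins.length, t.2.2 ++ [Quon.gateNode g t.1 t.2.1]))
    (by fun_prop) (by fun_prop) (fun t => esize t.1) (fun t => by rw [esize_prod t]; omega)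
    ⟨2 * Polynomial.X, fun a t g => ?_⟩ ⟨q.comp (Polynomial.X + 3) + 2 * Polynomial.X + 4,
      fun a t g => ?_⟩))
  all_goals
    have h1 : (Quon.edgesBefore g t.1 t.2.1).length ≤ t.1.length + g.ins.length := by
      simp [Quon.edgesBefore, freshEdges]; omega
    have h2 : g.ins.length ≤ esize g := (length_le_esize g.ins).trans (by
      change _ ≤ esize (g.pos, g.ins, g.arity, g.op, g.tab)
      simp only [esize_mk]; omega)
    have h4 := esize_list_nat (Quon.edgesBefore g t.1 t.2.1)
    have h5 := esize_list_nat t.1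
  · simp only [Polynomial.eval_mul, Polynomial.eval_ofNat, Polynomial.eval_X]
    omega
  · have h3 := hq (g, t.1, t.2.1)
    have h6 := esize_append t.2.2 [Quon.gateNode g t.1 t.2.1]
    simp only [esize_mk, esize_nat, esize_cons, esize_nil] at h3 h6
    have h7 := eval_mono q (show esize g + (esize t.1 + 1 + 1) + 1
      ≤ esize a + esize g + esize t.1 + 3 by omega)
    rw [esize_mk, esize_mk, esize_prod t, esize_prod t.2, esize_nat, esize_nat,
      Polynomial.eval_add, Polynomial.eval_add, Polynomial.eval_ofNat, Polynomial.eval_comp,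
      Polynomial.eval_add, Polynomial.eval_X, Polynomial.eval_ofNat, Polynomial.eval_mul,
      Polynomial.eval_X, Polynomial.eval_ofNat]
    omega

@[fun_prop]
theorem Poly.coeff {D : α → Diagram} (hD : Poly D) : Poly fun a => (D a).coeff :=
  Poly.fst (f := fun a => ((D a).coeff, (D a).layers)) (hD.of_enc fun _ => rfl)

@[fun_prop]
theorem Poly.layers {D : α → Diagram} (hD : Poly D) : Poly fun a => (D a).layers :=
  Poly.snd (f := fun a => ((D a).coeff, (D a).layers)) (hD.of_enc fun _ => rfl)

@[fun_prop]
theorem Poly.diagramGates {D : α → Diagram} (hD : Poly D) : Poly fun a => diagramGates (D a) := by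
  unfold Quon.diagramGates; fun_prop

@[fun_prop]
theorem Poly.table {T : α → List ℂ} (hT : Poly T) : Poly fun a => RawTensor.table (T a) := by
  have h : Poly fun a => (0, T a) := by fun_prop
  exact h.of_enc fun _ => rfl

@[fun_prop]
theorem Poly.edges {G : α → List Gate} (hG : Poly G) : Poly fun a => edges (G a) := by
  unfold Quon.edges; fun_prop

end

/-- From diagrams to tensor networks. -/
theorem exists_network_of_diagram : ∃ (p : Prog) (q : Polynomial ℕ), ∀ (n : ℕ) (D : Diagram),
    IsDiagram D n → ∃ (m : ℕ) (N : Network n m), IsNetwork N ∧ (∀ v ∈ N, v.IsSmall) ∧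
      N.value = D.tensor n ∧ Computes p q D.encode N.encode := by
  -- The number `n` is not part of the encoded diagram; it is recovered as the number of open legs
  -- of the gates.
  have h : Poly fun D : Diagram => (((diagramGates D).flatMap Gate.op).length,
      edges (diagramGates D), (nodesOf (diagramGates D) [] 0).map fun r =>
        (r.1, RawTensor.table r.2)) := by fun_prop
  obtain ⟨p, q, h⟩ := h
  refine ⟨p, q, fun n D hD => ?_⟩
  obtain ⟨h1, h2, h3, h4⟩ := diagramGates_spec hD
  obtain ⟨N, hN, h5, h6, h7⟩ := exists_network_of_gates (n := n) (fun {k} _ => k ≤ 4)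
    (diagramGates D) h1 h2 fun g hg => by
      refine ⟨_, fun x => tabAt g.tab (List.ofFn x), rfl, (h3 g hg).1, ?_⟩
      refine List.ext_getElem (by simp [(h3 g hg).2]) fun i hi hi' => ?_
      simp only [List.length_ofFn] at hi
      simp [digits_testBit _ i hi, tabAt, List.getD, hi']
  refine ⟨_, N, h5, fun v hv => ?_, funext fun x => (h7 x).trans (h4 x), ?_⟩
  · obtain ⟨T, hT, hk⟩ := h6 v hv
    exact ⟨hk, T, hT⟩
  · rw [encode_network, hN]
    have := h D
    beta_reduce at this
    rw [h2.length_eq, List.length_range] at this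
    exact this

end Quon

namespace Quon

/-! ### Every tensor is generated -/

/-- The table of a tensor. -/
noncomputable def tableOf {k : ℕ} (T : (Fin k → Bool) → ℂ) : List ℂ :=
  List.ofFn fun j : Fin (2 ^ k) => T fun i => (j : ℕ).testBit i

/-- The gate is one of the generating tensors. -/
def Gate.IsGen (g : Gate) : Prop :=
  ∃ (k : ℕ) (T : (Fin k → Bool) → ℂ),
    g.op.length + g.ins.length + g.arity = k ∧ IsGenerator k T ∧ tableOf T = g.tab

/-- Some gates without open legs, all of them generating tensors, contract `r` neighbouring bits
of a state with the kernel `K` and leave `i` bits. -/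
def Generated (i r : ℕ) (K : List Bool → List Bool → ℂ) : Prop :=
  ∀ H k, k + r ≤ H → ∃ G : List Gate, (∀ g ∈ G, g.op = [] ∧ g.IsGen) ∧
    ∀ x, Lowers x G (H - r + i) H fun ψ b =>
      bsum i fun a => K a ((b.drop k).take r) * ψ (b.take k ++ a ++ b.drop (k + r))

theorem Generated.lowers {i r h H k : ℕ} {K : List Bool → List Bool → ℂ} (hK : Generated i r K)
    (hk : k + r ≤ H) (hh : h + r = H + i) {f : Amp → Amp}
    (hf : ∀ (ψ : Amp) (b₁ m b₃ : List Bool), b₁.length = k → m.length = r →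
      k + r + b₃.length = H → bsum i (fun a => K a m * ψ (b₁ ++ a ++ b₃)) = f ψ (b₁ ++ m ++ b₃)) :
    ∃ G : List Gate, (∀ g ∈ G, g.op = [] ∧ g.IsGen) ∧ ∀ x, Lowers x G h H f := by
  obtain ⟨G, h1, h2⟩ := hK H k hk
  refine ⟨G, h1, fun x => ?_⟩
  rw [show h = H - r + i by omega]
  refine (h2 x).congr fun ψ b hb => ?_
  obtain ⟨b₁, m, b₃, rfl, e1, e2, e3⟩ := exists_bits₃ (n₁ := k) (n₂ := r) (n₃ := H - k - r)
    (hb.trans (by omega))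
  rw [← hf ψ b₁ m b₃ e1 e2 (by omega)]
  clear e3
  subst e1 e2
  simp

theorem Generated.congr {i r : ℕ} {K K' : List Bool → List Bool → ℂ} (hK : Generated i r K)
    (h : ∀ a m : List Bool, a.length = i → m.length = r → K a m = K' a m) : Generated i r K' := by
  intro H k hk
  refine hK.lowers hk (by omega) fun ψ b₁ m b₃ h1 h2 _ => ?_
  subst h1 h2
  simp only [List.append_assoc, List.drop_left, List.take_left, ← List.drop_drop]
  exact bsum_congr fun a ha => by rw [h a m ha rfl]

theorem Generated.comp {i j r : ℕ} {K K' : List Bool → List Bool → ℂ} (hK : Generated j r K)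
    (hK' : Generated i j K') : Generated i r fun a m => bsum j fun c => K c m * K' a c := by
  intro H k hk
  obtain ⟨G, h1, h2⟩ := hK H k hk
  obtain ⟨G', h1', h2'⟩ := hK' (H - r + j) k (by omega)
  rw [show H - r + j - j + i = H - r + i by omega] at h2'
  refine ⟨G ++ G', fun g hg => (List.mem_append.1 hg).elim (h1 g) (h1' g), fun x =>
    ((h2 x).append (h2' x)).congr fun ψ b hb => ?_⟩
  have h3 : ∀ c : List Bool, c.length = j →
      ((b.take k ++ c ++ b.drop (k + r)).drop k).take j = c ∧
      (b.take k ++ c ++ b.drop (k + r)).take k = b.take k ∧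
      (b.take k ++ c ++ b.drop (k + r)).drop (k + j) = b.drop (k + r) := by
    intro c hc
    have hl : (b.take k).length = k := by simp; omega
    refine ⟨?_, ?_, ?_⟩
    · rw [List.append_assoc, List.drop_left' hl, List.take_left' hc]
    · rw [List.append_assoc, List.take_left' hl]
    · exact List.drop_left' (by simp [hc]; omega)
  calc _ = bsum j fun c => bsum i fun a => K c ((b.drop k).take r) * K' a c
          * ψ (b.take k ++ a ++ b.drop (k + r)) := bsum_congr fun c hc => by
        obtain ⟨e1, e2, e3⟩ := h3 c hc
        beta_reduce
        rw [e1, e2, e3, ← mul_bsum]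
        exact bsum_congr fun a _ => by ring
    _ = _ := by
        simp only [bsum_eq, Finset.sum_mul]
        exact Finset.sum_comm

theorem Generated.smul {i r : ℕ} {K : List Bool → List Bool → ℂ} {s : ℂ}
    (hs : Generated 0 0 fun _ _ => s) (hK : Generated i r K) :
    Generated i r fun a m => s * K a m := by
  intro H k hk
  obtain ⟨G, h1, h2⟩ := hs H 0 (by omega)
  obtain ⟨G', h1', h2'⟩ := hK H k hk
  refine ⟨G ++ G', fun g hg => (List.mem_append.1 hg).elim (h1 g) (h1' g), fun x =>
    ((h2 x).append (h2' x)).congr fun ψ b hb => ?_⟩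
  simp [bsum, ← mul_bsum, mul_assoc]

/-- Kernels are generated at every place of every state, so an idle wire needs no gate: it suffices
to move the place by one. -/
theorem Generated.left {i r : ℕ} {K : List Bool → List Bool → ℂ} (hK : Generated i r K) :
    Generated (i + 1) (r + 1) fun a m =>
      if bit a 0 = bit m 0 then K a.tail m.tail else 0 := by
  intro H k hk
  obtain ⟨G, h1, h2⟩ := hK.lowers (h := H - (r + 1) + (i + 1)) (H := H) (k := k + 1)
    (f := fun ψ b => bsum (i + 1) fun a => (if bit a 0 = bit ((b.drop k).take (r + 1)) 0 then
      K a.tail ((b.drop k).take (r + 1)).tail else 0) * ψ (b.take k ++ a ++ b.drop (k + (r + 1))))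
    (by omega) (by omega) fun ψ b₁ m b₃ h1 h2 h3 => by
      -- The idle wire is the last bit before the gates.
      obtain ⟨l, y, rfl⟩ : ∃ l y, b₁ = l ++ [y] := ⟨_, _, (List.dropLast_append_getLast
        (List.ne_nil_of_length_eq_add_one h1)).symm⟩
      rw [List.length_append, List.length_singleton, Nat.add_right_cancel_iff] at h1
      subst h1 h2
      have e1 : (l ++ [y] ++ m ++ b₃).drop l.length = y :: (m ++ b₃) := by simp
      have e2 : (l ++ [y] ++ m ++ b₃).take l.length = l := by simp
      have e3 : (l ++ [y] ++ m ++ b₃).drop (l.length + (m.length + 1)) = b₃ := by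
        rw [← List.drop_drop, e1]; simp
      rw [e1, e2, e3]
      cases y <;> simp [bsum, bsum_eq, bit]
  exact ⟨G, h1, h2⟩

theorem bsum_succ' (k : ℕ) (f : List Bool → ℂ) :
    bsum (k + 1) f = bsum k fun w => f (w ++ [false]) + f (w ++ [true]) := by
  rw [bsum_split]
  simp [bsum]

theorem Generated.right {i r : ℕ} {K : List Bool → List Bool → ℂ} (hK : Generated i r K) :
    Generated (i + 1) (r + 1) fun a m =>
      if bit a i = bit m r then K (a.take i) (m.take r) else 0 := by
  intro H k hk
  obtain ⟨G, h1, h2⟩ := hK.lowers (h := H - (r + 1) + (i + 1)) (H := H) (k := k)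
    (f := fun ψ b => bsum (i + 1) fun a => (if bit a i = bit ((b.drop k).take (r + 1)) r then
      K (a.take i) (((b.drop k).take (r + 1)).take r) else 0)
        * ψ (b.take k ++ a ++ b.drop (k + (r + 1))))
    (by omega) (by omega) fun ψ b₁ m b₃ h1 h2 h3 => by
      obtain ⟨y, l, rfl⟩ := List.exists_cons_of_length_pos (l := b₃) (by omega)
      clear h3
      subst h1 h2
      have e1 : (b₁ ++ m ++ y :: l).drop b₁.length = m ++ y :: l := by simp
      have e2 : (b₁ ++ m ++ y :: l).take b₁.length = b₁ := by simp
      have e3 : (b₁ ++ m ++ y :: l).drop (b₁.length + (m.length + 1)) = l := by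
        rw [← List.drop_drop, e1, ← List.drop_drop]; simp
      have e4 : (m ++ y :: l).take (m.length + 1) = m ++ [y] := by
        rw [List.append_cons, List.take_left' (by simp)]
      rw [e1, e2, e3, e4, bsum_succ']
      refine bsum_congr fun a ha => ?_
      subst ha
      cases y <;> simp [bit]
  exact ⟨G, h1, h2⟩

/-- The legs of a tensor may be distributed over old and new bits in any way, so that one generator
acts as a state, an operator or a functional. -/
theorem generated_of_isGenerator {i r k : ℕ} {T : (Fin k → Bool) → ℂ} (hT : IsGenerator k T)
    (hk : i + r = k) : Generated i r fun a m => T fun j => bit (a ++ m) j := by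
  intro H p hp
  refine ⟨[⟨p, List.replicate i (), r, [], tableOf T⟩], fun g hg => ?_, fun x =>
    lowers_single hp (by simp; omega) fun ψ b₁ m b₃ h1 h2 => ?_⟩
  · rw [List.mem_singleton.1 hg]
    exact ⟨rfl, k, T, by simp [hk], hT, rfl⟩
  · simp only at h1 h2
    subst h1 h2
    simp only [List.length_replicate, List.append_assoc, List.drop_left, List.take_left,
      ← List.drop_drop, List.map_nil, List.nil_append]
    refine bsum_congr fun a ha => ?_
    congr 1
    have e : a ++ m = List.ofFn fun j : Fin k => bit (a ++ m) j := by
      refine List.ext_getElem (by simp [ha, hk]) fun j h1 h2 => ?_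
      rw [List.getElem_ofFn, bit, List.getD_eq_getElem _ _ h1]
    conv_lhs => rw [e]
    exact tabAt_ofFn T _

end Quon

/-! ### Kernels made of generators -/

namespace Quon

section
attribute [local simp] bit sgn bsum ketZero pauliX rotX rotZ parityTensor

theorem generated_ket : Generated 0 1 fun _ m => if bit m 0 then 0 else 1 :=
  (generated_of_isGenerator .ketZero rfl).congr fun a m ha hm => by
    obtain rfl := List.length_eq_zero_iff.1 ha
    simp

theorem generated_bra : Generated 1 0 fun a _ => if bit a 0 then 0 else 1 :=
  (generated_of_isGenerator .ketZero rfl).congr fun a m ha hm => by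
    obtain ⟨a, rfl⟩ := List.length_eq_one_iff.1 ha
    simp

theorem generated_pauliX : Generated 1 1 fun a m => if bit a 0 = bit m 0 then 0 else 1 :=
  (generated_of_isGenerator .pauliX rfl).congr fun a m ha hm => by
    obtain ⟨a, rfl⟩ := List.length_eq_one_iff.1 ha
    simp

/-- Here `e^{iπ/4} cos(π/4) = (1 + i)/2`, and the sine equals the cosine. -/
theorem generated_rotX : Generated 1 1 fun a m =>
    (1 + Complex.I) / 2 * if bit a 0 = bit m 0 then 1 else -Complex.I :=
  (generated_of_isGenerator .rotXPos rfl).congr fun a m ha hm => by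
    obtain ⟨a, rfl⟩ := List.length_eq_one_iff.1 ha
    have h : (((√2 : ℝ) : ℂ)) * ((√2 : ℝ) : ℂ) = 2 := by
      rw [← Complex.ofReal_mul, Real.mul_self_sqrt (by norm_num)]; norm_num
    have hc : Complex.cos (Real.pi / 4) = ((√2 / 2 : ℝ) : ℂ) := by
      rw [← Real.cos_pi_div_four]; push_cast; rfl
    have hs : Complex.sin (Real.pi / 4) = ((√2 / 2 : ℝ) : ℂ) := by
      rw [← Real.sin_pi_div_four]; push_cast; rfl
    have he : Complex.exp (Complex.I * (Real.pi / 4))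
        = ((√2 / 2 : ℝ) : ℂ) * (1 + Complex.I) := by
      rw [mul_comm, Complex.exp_mul_I, hc, hs]; ring
    simp only [rotX]
    push_cast
    rw [he, hc, hs]
    push_cast
    simp only [bit, List.singleton_append, Fin.isValue, Fin.val_zero, Fin.val_one,
      List.getD_cons_zero, List.getD_cons_succ]
    split_ifs
    · linear_combination (1 / 4 : ℂ) * (1 + Complex.I) * h
    · linear_combination (-Complex.I / 4 : ℂ) * (1 + Complex.I) * h

/-- The argument of `u` lies in `(-π, π]`; adding `2π` to negative values brings it into the range
of angles of the generators. -/
theorem generated_unit {u : ℂ} (hu : ‖u‖ = 1) : Generated 1 1 fun a m =>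
    if bit a 0 = bit m 0 then (if bit a 0 then u else 1) else 0 := by
  obtain ⟨θ, h₀, h₁, rfl⟩ : ∃ θ : ℝ, 0 ≤ θ ∧ θ < 2 * Real.pi ∧
      Complex.exp (Complex.I * θ) = u := by
    have h := Complex.norm_mul_exp_arg_mul_I u
    rw [hu, Complex.ofReal_one, one_mul, mul_comm] at h
    have := Complex.neg_pi_lt_arg u
    have := Complex.arg_le_pi u
    have := Real.pi_pos
    rcases le_or_gt 0 u.arg with h' | h'
    · exact ⟨u.arg, h', by linarith, h⟩
    · refine ⟨u.arg + 2 * Real.pi, by linarith, by linarith, ?_⟩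
      refine Eq.trans ?_ ((Complex.exp_periodic (Complex.I * u.arg)).trans h)
      congr 1
      push_cast
      ring
  refine (generated_of_isGenerator (.rotZ θ h₀ h₁) rfl).congr fun a m ha hm => ?_
  obtain ⟨a, rfl⟩ := List.length_eq_one_iff.1 ha
  simp

theorem generated_parity : Generated 1 2 fun a m =>
    if bit a 0 ^^ bit m 0 ^^ bit m 1 then 0 else 1 :=
  (generated_of_isGenerator .parityTensor rfl).congr fun a m ha hm => by
    obtain ⟨a, rfl⟩ := List.length_eq_one_iff.1 ha
    simp

theorem generated_parity' : Generated 2 1 fun a m =>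
    if bit a 0 ^^ bit a 1 ^^ bit m 0 then 0 else 1 :=
  (generated_of_isGenerator .parityTensor rfl).congr fun a m ha hm => by
    obtain ⟨a, b, rfl⟩ := List.length_eq_two.1 ha
    simp

/-! ### Scalars -/

/-- This is `⟨1| diag(1, u) |1⟩`, with `|1⟩ = X|0⟩`. -/
theorem generated_scalar_unit {u : ℂ} (hu : ‖u‖ = 1) : Generated 0 0 fun _ _ => u :=
  ((generated_bra.comp generated_pauliX).comp (generated_unit hu)).comp
    (generated_pauliX.comp generated_ket) |>.congr fun a m ha hm => by simp

/-- The kets fix one leg of either parity tensor to `0`; the other two legs agree, and joining them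
gives a closed loop. -/
theorem generated_scalar_two : Generated 0 0 fun _ _ => 2 :=
  (generated_bra.comp generated_parity').comp (generated_parity.comp generated_ket) |>.congr
    fun a m ha hm => by simp; norm_num

/-- The product `diag(1, i) · (1 + i)/2 (1 - i X) · diag(1, i)`, as for the Hadamard transform of a
wire. -/
theorem generated_hadamard' : Generated 1 1 fun a m =>
    (1 + Complex.I) / 2 * sgn (bit a 0 && bit m 0) :=
  ((generated_unit Complex.norm_I).comp generated_rotX).comp (generated_unit Complex.norm_I)
    |>.congr fun a m ha hm => by
      obtain ⟨a, rfl⟩ := List.length_eq_one_iff.1 ha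
      obtain ⟨m, rfl⟩ := List.length_eq_one_iff.1 hm
      cases a <;> cases m <;> simp <;> ring_nf <;> simp <;> ring

theorem generated_scalar_mul {s t : ℂ} (hs : Generated 0 0 fun _ _ => s)
    (ht : Generated 0 0 fun _ _ => t) : Generated 0 0 fun _ _ => s * t :=
  hs.smul ht

/-- Interference gives moduli below `1`: for a unit number `v = c + i d`, the amplitude `⟨0| H
diag(1, v²) H |0⟩` is proportional to `1 + v²`, and the phase `-i v̄` makes it `(v + v̄)/2 = c`.
Powers of `2` and a phase then give every complex number. -/
theorem generated_scalar (s : ℂ) : Generated 0 0 fun _ _ => s := by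
  have h1 : ∀ c : ℝ, 0 ≤ c → c ≤ 1 → Generated 0 0 fun _ _ => (c : ℂ) := by
    intro c h₀ h₁
    obtain ⟨d, hd⟩ : ∃ d : ℝ, c ^ 2 + d ^ 2 = 1 :=
      ⟨√(1 - c ^ 2), by rw [Real.sq_sqrt (by nlinarith)]; ring⟩
    have hd' : (c : ℂ) ^ 2 + (d : ℂ) ^ 2 = 1 := by exact_mod_cast hd
    have hv : ‖(c + d * Complex.I : ℂ)‖ = 1 := by
      rw [Complex.norm_add_mul_I, hd, Real.sqrt_one]
    have hw : ‖-Complex.I * (c + ((-d : ℝ) : ℂ) * Complex.I : ℂ)‖ = 1 := by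
      rw [norm_mul, norm_neg, Complex.norm_I, one_mul, Complex.norm_add_mul_I, neg_sq, hd,
        Real.sqrt_one]
    refine generated_scalar_mul (generated_scalar_unit hw)
      (((generated_bra.comp generated_hadamard').comp (generated_unit
        (u := (c + d * Complex.I) ^ 2) (by rw [norm_pow, hv, one_pow]))).comp
        (generated_hadamard'.comp generated_ket)) |>.congr fun a m ha hm => ?_
    simp
    linear_combination (-(Complex.I * (c - d * Complex.I)
      * (1 + (c + d * Complex.I) ^ 2) / 4) - (c - d * Complex.I)
      * (1 + (c + d * Complex.I) ^ 2) / 2) * Complex.I_sq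
      + (c + d * Complex.I) / 2 * (hd' - d ^ 2 * Complex.I_sq)
  have h2 : ∀ n : ℕ, Generated 0 0 fun _ _ => (2 : ℂ) ^ n := by
    intro n
    induction n with
    | zero => simpa using h1 1 zero_le_one le_rfl
    | succ n ih => simpa only [pow_succ] using generated_scalar_mul ih generated_scalar_two
  rcases eq_or_ne s 0 with rfl | hs
  · simpa using h1 0 le_rfl zero_le_one
  obtain ⟨n, hn⟩ := pow_unbounded_of_one_lt ‖s‖ (one_lt_two (α := ℝ))
  have hs' : (‖s‖ : ℂ) ≠ 0 := by simpa using hs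
  refine (generated_scalar_mul (generated_scalar_mul (h2 n) (h1 (‖s‖ / 2 ^ n) (by positivity)
    ((div_le_one (by positivity)).2 hn.le))) (generated_scalar_unit (u := s / ‖s‖)
      (by simp [hs]))).congr fun _ _ _ _ => ?_
  push_cast
  field_simp

theorem Generated.of_mul {i r : ℕ} {s : ℂ} {K : List Bool → List Bool → ℂ} (hs : s ≠ 0)
    (hK : Generated i r fun a m => s * K a m) : Generated i r K :=
  ((generated_scalar s⁻¹).smul hK).congr fun _ _ _ _ => by rw [inv_mul_cancel_left₀ hs]

theorem generated_hadamard : Generated 1 1 fun a m => sgn (bit a 0 && bit m 0) :=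
  generated_hadamard'.of_mul (by
    intro h
    have := congrArg Complex.re h
    simp at this)

/-! ### Copies, weights and permutations -/

/-- The Hadamard transform of the parity tensor on all three legs: the character sum over the even
triples is `4` if the three dual bits agree and `0` otherwise. -/
theorem generated_copy : Generated 1 2 fun a m =>
    if bit a 0 = bit m 0 ∧ bit a 0 = bit m 1 then 1 else 0 :=
  .of_mul (s := 4) (by norm_num) <|
    ((generated_hadamard.left.comp generated_hadamard.right).comp generated_parity).comp
      generated_hadamard |>.congr fun a m ha hm => by
        obtain ⟨a, rfl⟩ := List.length_eq_one_iff.1 ha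
        obtain ⟨b, c, rfl⟩ := List.length_eq_two.1 hm
        cases a <;> cases b <;> cases c <;> simp <;> norm_num

theorem generated_copy' : Generated 2 1 fun a m =>
    if bit m 0 = bit a 0 ∧ bit m 0 = bit a 1 then 1 else 0 :=
  .of_mul (s := 4) (by norm_num) <|
    (generated_hadamard.comp generated_parity').comp
      (generated_hadamard.left.comp generated_hadamard.right) |>.congr fun a m ha hm => by
        obtain ⟨a, rfl⟩ := List.length_eq_one_iff.1 hm
        obtain ⟨b, c, rfl⟩ := List.length_eq_two.1 ha
        cases a <;> cases b <;> cases c <;> simp <;> norm_num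

/-- The weights are copied into the wire from an auxiliary state proportional to `(1, w)`. The state
`diag(1, v) H diag(1, u) H |0⟩` is `(1 + u, v (1 - u))`, and the Cayley transform `u = (1 + i r)/(1
- i r)` with `r = ‖w‖` makes the ratio `-i r v`; a unit number `v` adjusts the phase. The weight `0`
is included. -/
theorem generated_weight (w : ℂ) : Generated 1 1 fun a m =>
    if bit a 0 = bit m 0 then (if bit a 0 then w else 1) else 0 := by
  have hr : (1 - ‖w‖ * Complex.I : ℂ) ≠ 0 := fun h => by simpa using congrArg Complex.re h
  have hu : ‖((1 + ‖w‖ * Complex.I) / (1 - ‖w‖ * Complex.I) : ℂ)‖ = 1 := by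
    rw [norm_div, div_eq_one_iff_eq (norm_ne_zero_iff.2 hr), ← Complex.norm_conj]
    congr 1
    simp [sub_eq_add_neg]
  obtain ⟨v, hv, hw⟩ : ∃ v : ℂ, ‖v‖ = 1 ∧ v * (-(‖w‖ * Complex.I)) = w := by
    rcases eq_or_ne w 0 with rfl | h0
    · exact ⟨1, by simp⟩
    · have h0' : (‖w‖ : ℂ) ≠ 0 := by simpa using h0
      refine ⟨Complex.I * (w / ‖w‖), by simp [h0], ?_⟩
      field_simp
      simp
  refine .of_mul (s := 2 / (1 - ‖w‖ * Complex.I)) (div_ne_zero two_ne_zero hr) <|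
    (generated_copy'.comp ((generated_unit hv).comp (generated_hadamard.comp ((generated_unit
      hu).comp (generated_hadamard.comp generated_ket)))).left).congr fun a m ha hm => ?_
  obtain ⟨a, rfl⟩ := List.length_eq_one_iff.1 ha
  obtain ⟨m, rfl⟩ := List.length_eq_one_iff.1 hm
  cases a <;> cases m <;> simp
  · field_simp
    ring
  · generalize ‖w‖ = r at hr hw ⊢
    rw [← hw]
    field_simp
    ring

theorem generated_same : Generated 2 2 fun a m =>
    if bit a 0 = bit a 1 ∧ a = m then 1 else 0 :=
  generated_copy.comp generated_copy' |>.congr fun a m ha hm => by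
    obtain ⟨a, b, rfl⟩ := List.length_eq_two.1 ha
    obtain ⟨c, d, rfl⟩ := List.length_eq_two.1 hm
    cases a <;> cases b <;> cases c <;> cases d <;> simp

theorem generated_xor_snd : Generated 2 2 fun a m =>
    if bit m 0 = bit a 0 ∧ bit m 1 = (bit a 0 ^^ bit a 1) then 1 else 0 :=
  generated_parity'.left.comp generated_copy.right |>.congr fun a m ha hm => by
    obtain ⟨a, b, rfl⟩ := List.length_eq_two.1 ha
    obtain ⟨c, d, rfl⟩ := List.length_eq_two.1 hm
    cases a <;> cases b <;> cases c <;> cases d <;> simp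

theorem generated_xor_fst : Generated 2 2 fun a m =>
    if bit m 0 = (bit a 0 ^^ bit a 1) ∧ bit m 1 = bit a 1 then 1 else 0 :=
  generated_parity'.right.comp generated_copy.left |>.congr fun a m ha hm => by
    obtain ⟨a, b, rfl⟩ := List.length_eq_two.1 ha
    obtain ⟨c, d, rfl⟩ := List.length_eq_two.1 hm
    cases a <;> cases b <;> cases c <;> cases d <;> simp

/-- Three controlled negations, in alternating directions. Networks are not required to be planar,
but gates act on neighbouring bits. -/
theorem generated_swap : Generated 2 2 fun a m =>
    if bit m 0 = bit a 1 ∧ bit m 1 = bit a 0 then 1 else 0 :=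
  (generated_xor_snd.comp generated_xor_fst).comp generated_xor_snd |>.congr fun a m ha hm => by
    obtain ⟨a, b, rfl⟩ := List.length_eq_two.1 ha
    obtain ⟨c, d, rfl⟩ := List.length_eq_two.1 hm
    cases a <;> cases b <;> cases c <;> cases d <;> simp

end

end Quon

/-! ### Every tensor is the value of a network of generators -/

namespace Quon

section
attribute [local simp] bit bsum WireOp.den

/-- This transfers the constructions on wires to generators: the sum of both values is `H|0⟩`,
summing out is its adjoint, and the other operations are kernels obtained above. -/
theorem WireOp.exists_gates {o : WireOp} {H H' : ℕ} (h : o.height H = some H') :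
    ∃ G : List Gate, (∀ g ∈ G, g.op = [] ∧ g.IsGen) ∧ ∀ x, Lowers x G H H' o.den := by
  have b0 : ∀ y₁ a l, bit (y₁ ++ a :: l) y₁.length = a := fun y₁ a l => by simp
  have b1 : ∀ y₁ a b l, bit (y₁ ++ a :: b :: l) (y₁.length + 1) = b := fun y₁ a b l => by
    simp
  cases o <;> simp only [WireOp.height, Option.ite_none_right_eq_some, Option.some.injEq] at h <;>
    obtain ⟨h, rfl⟩ := h
  case plus c =>
    refine (generated_hadamard.comp generated_ket).lowers (k := c) (by omega) (by omega)
      fun ψ b₁ m b₃ h1 h2 _ => ?_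
    obtain ⟨a, rfl⟩ := List.length_eq_one_iff.1 h2
    subst h1
    cases a <;> simp [sgn]
  case sum c =>
    refine (generated_bra.comp generated_hadamard).lowers (k := c) (by omega) (by omega)
      fun ψ b₁ m b₃ h1 h2 _ => ?_
    obtain rfl := List.length_eq_zero_iff.1 h2
    subst h1
    simp [sgn]
  case zero c =>
    refine ((generated_scalar (fourthRootTwo ^ 2)).smul generated_bra).lowers (k := c) (by omega)
      (by omega) fun ψ b₁ m b₃ h1 h2 _ => ?_
    obtain rfl := List.length_eq_zero_iff.1 h2
    subst h1
    simp
  case phase c w =>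
    refine (generated_weight w).lowers (k := c) (by omega) (by omega)
      fun ψ b₁ m b₃ h1 h2 _ => ?_
    obtain ⟨a, rfl⟩ := List.length_eq_one_iff.1 h2
    subst h1
    cases a <;> simp
  case had c =>
    refine generated_hadamard'.lowers (k := c) (by omega) (by omega)
      fun ψ b₁ m b₃ h1 h2 _ => ?_
    obtain ⟨a, rfl⟩ := List.length_eq_one_iff.1 h2
    subst h1
    cases a <;> simp [sgn] <;> ring
  case same c =>
    refine generated_same.lowers (k := c) (by omega) (by omega)
      fun ψ b₁ m b₃ h1 h2 _ => ?_
    obtain ⟨a, b, rfl⟩ := List.length_eq_two.1 h2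
    subst h1
    cases a <;> cases b <;> simp
  case swap c =>
    refine generated_swap.lowers (k := c) (by omega) (by omega)
      fun ψ b₁ m b₃ h1 h2 _ => ?_
    obtain ⟨a, b, rfl⟩ := List.length_eq_two.1 h2
    subst h1
    cases a <;> cases b <;> simp

end

theorem exists_gates_of_heightL {L : List WireOp} {H H' : ℕ} (h : heightL L H = some H') :
    ∃ G : List Gate, (∀ g ∈ G, g.op = [] ∧ g.IsGen) ∧ ∀ x, Lowers x G H H' (denL L) := by
  induction L generalizing H with
  | nil =>
    simp only [heightL, Option.some.injEq] at h
    subst h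
    exact ⟨[], by simp, fun x => Lowers.nil H⟩
  | cons o L ih =>
    simp only [heightL, Option.bind_eq_some_iff] at h
    obtain ⟨K, h1, h2⟩ := h
    obtain ⟨G, hG, hG'⟩ := ih h2
    obtain ⟨G₁, hG₁, hG₁'⟩ := WireOp.exists_gates h1
    exact ⟨G ++ G₁, fun g hg => (List.mem_append.1 hg).elim (hG g) (hG₁ g), fun x =>
      (hG' x).append (hG₁' x)⟩

/-- The gate that turns a bit into an open leg. -/
noncomputable def legGate (i : ℕ) : Gate := ⟨i, [()], 0, [i], tableOf idTensor⟩

/-- The identity tensor turns the last bit into an open leg, so that the ends of the network belong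
to generators as well. The leg `0` comes first in the list and thus acts last. -/
theorem lowers_legGate (x : ℕ → Bool) (n : ℕ) :
    Lowers x ((List.range n).map legGate) n 0 fun ψ _ => ψ ((List.range n).map x) := by
  induction n with
  | zero => exact (Lowers.nil 0).congr fun ψ b hb => by rw [List.length_eq_zero_iff.1 hb]; rfl
  | succ n ih =>
    have h : Lowers x [legGate n] (n + 1) n fun ψ b => ψ (b.take n ++ [x n] ++ b.drop n) :=
      lowers_zero le_rfl rfl fun ψ b₁ b₃ h1 => by
        have ht : ∀ p q : Bool, tabAt (tableOf idTensor) [p, q] = if p = q then 1 else 0 :=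
          fun p q => by
            have := tabAt_ofFn idTensor ![p, q]

            exact this
        subst h1
        cases hx : x b₁.length <;> simp [bsum, ht, hx]
    rw [List.range_succ, List.map_append, List.map_append]
    refine (ih.append h).congr fun ψ b hb => ?_
    have hl : ((List.range n).map x).length = n := by simp
    beta_reduce
    rw [List.take_of_length_le hl.le, List.drop_of_length_le hl.le, List.append_nil]
    rfl

/-- New wires in the sum of both values have the constant amplitude `1`; the operations for the
table of `T` multiply it by `T`, and the wires then become the open legs. -/
theorem exists_network_isGen (n : ℕ) (T : (Fin n → Bool) → ℂ) : ∃ (m : ℕ) (N : Network n m),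
    IsNetwork N ∧ (∀ v ∈ N, v.IsGen) ∧ N.value = T := by
  have hM := (maps_plus 0 n).append (mul_tableOps (H := 0 + n) (t := fun i : Fin n => (i : ℕ))
    (fun i => by simp) T)
  obtain ⟨G, hG, hG'⟩ := exists_gates_of_heightL hM.height
  have hl := fun x => (lowers_legGate x (0 + n)).append (hG' x)
  rw [zero_add] at hM hl
  obtain ⟨N, -, h1, h2, h3⟩ := exists_network_of_gates (n := n) (fun {k} T => IsGenerator k T)
    ((List.range n).map legGate ++ G) (hl fun _ => false).height (by
      rw [List.flatMap_append, List.flatMap_eq_nil_iff.2 fun g hg => (hG g hg).1, List.append_nil,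
        List.flatMap_map]
      simp [legGate]) fun g hg => by
      rcases List.mem_append.1 hg with hg | hg
      · obtain ⟨i, -, rfl⟩ := List.mem_map.1 hg
        exact ⟨2, idTensor, rfl, .idTensor, rfl⟩
      · exact (hG g hg).2
  refine ⟨_, N, h1, h2, funext fun x => ?_⟩
  rw [h3, (hl _).act _ _ rfl, hM.den _ _ (by simp)]
  simp only [Function.comp_apply, vac, List.take_zero, if_true, mul_one]
  exact congrArg T (funext fun i => by simp [bit, extend])

end Quon

theorem mainTheorem5 :
    -- the diagrams of the generating tensors
    (Quon.Represents Quon.ketZeroDiagram 1 Quon.ketZero ∧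
      Quon.Represents Quon.idDiagram 2 Quon.idTensor ∧
      Quon.Represents Quon.pauliXDiagram 2 Quon.pauliX ∧
      Quon.Represents Quon.rotXPosDiagram 2 (Quon.rotX (Real.pi / 4)) ∧
      Quon.Represents Quon.rotXNegDiagram 2 (Quon.rotX (-(Real.pi / 4))) ∧
      (∀ θ : ℂ, Quon.Represents (Quon.rotZDiagram θ) 2 (Quon.rotZ θ)) ∧
      Quon.Represents Quon.parityTensorDiagram 3 Quon.parityTensor) ∧
    -- they generate all tensors
    (∀ (n : ℕ) (T : (Fin n → Bool) → ℂ), ∃ (m : ℕ) (N : Quon.Network n m),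
      Quon.IsNetwork N ∧ (∀ v ∈ N, v.IsGen) ∧ N.value = T) ∧
    -- tensor operations are gluings of diagrams
    (Quon.LegRotation ∧ Quon.LegBending ∧ Quon.LegCrossing ∧ Quon.Merging ∧
      Quon.Contraction) ∧
    -- from tensor networks to diagrams, in polynomial time
    (∃ (p : Quon.Prog) (q : Polynomial ℕ), ∀ (n m : ℕ) (N : Quon.Network n m),
      Quon.IsNetwork N →
      ∃ D : Quon.Diagram, Quon.IsDiagram D n ∧ D.HasOrderedLegs n ∧
        D.tensor n = N.value ∧ Quon.Computes p q N.encode D.encode) ∧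
    -- from diagrams to tensor networks, in polynomial time
    (∃ (p : Quon.Prog) (q : Polynomial ℕ), ∀ (n : ℕ) (D : Quon.Diagram),
      Quon.IsDiagram D n →
      ∃ (m : ℕ) (N : Quon.Network n m), Quon.IsNetwork N ∧ (∀ v ∈ N, v.IsSmall) ∧
        N.value = D.tensor n ∧ Quon.Computes p q D.encode N.encode) :=
  ⟨⟨Quon.represents_ketZero, Quon.represents_id, Quon.represents_pauliX, Quon.represents_rotXPos,
      Quon.represents_rotXNeg, Quon.represents_rotZ, Quon.represents_parityTensor⟩,
    Quon.exists_network_isGen,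
    ⟨Quon.legRotation, Quon.legBending, Quon.legCrossing, Quon.merging, Quon.contraction⟩,
    Quon.exists_diagram, Quon.exists_network_of_diagram⟩
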